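/- **Setting.** Let $n\in\mathbb N$, $\tfrac13<\alpha<\beta<\tfrac12$, and let $f:\mathbb R^n\to\mathbb R^n$, $g:\mathbb R^n\to\mathbb R^{n\times n}$ be $C^\infty$. For $\gamma\in(0,1)$ write $\|h\|_{C^\gamma}=\sup_{x\ne y}\frac{|h(x)-h(y)|}{|x-y|^\gamma}+\sup_x|h(x)|$ for functions $h$ on $[0,2\pi]$, and $\|A\|_{2\alpha}=\sup_{x\neq y}\frac{|A_{x,y}|}{|x-y|^{2\alpha}}$ for functions $A$ on $[0,2\pi]^2$. Let $\mathcal D^\alpha$ be the set of rough paths $\Psi=(\psi,\boldsymbol\Psi)$ on $[0,2\pi]$, i.e. $\psi\in C^\alpha([0,2\pi],\mathbb R^n)$ and $\boldsymbol\Psi:[0,2\pi]^2\to\mathbb R^{n\times n}$ (the area process) continuous with $\boldsymbol\Psi_{x,x}=0$, $\boldsymbol\Psi^{ij}_{x,z}-\boldsymbol\Psi^{ij}_{y,z}-\boldsymbol\Psi^{ij}_{x,y}=(\psi^i(y)-\psi^i(x))(\psi^j(z)-\psi^j(y))$ and $\|\boldsymbol\Psi\|_{2\alpha}<\infty$; its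 distance is $\|\psi-\bar\psi\|_{C^\alpha}+\|\boldsymbol\Psi-\bar{\boldsymbol\Psi}\|_{2\alpha}$. *Data* are pairs $(u_0,\Psi)$ with $u_0\in C^\beta([0,2\pi],\mathbb R^n)$ and $\Psi\in C(\mathbb R_+,\mathcal D^\alpha)$, $\psi\in C(\mathbb R_+,C^\beta)$, where $u_0$ and all $\psi_t$ are periodic: $u_0(0)=u_0(2\pi)$, $\psi_t(0)=\psi_t(2\pi)$. Let $p_t$ be the kernel of the semigroup $S_t=e^{t(\partial_x^2-1)}$ on $[0,2\pi]$ with periodic boundary conditions. A function $u$ is a *mild solution on $[0,T]$* with data $(u_0,\Psi)$ if $u$ starts from $u_0$ at time $0$, is bounded in $C^\beta$ on $[0,T]$ and continuous in $C^\beta$ on $(0,T]$, if $v_t=u_t-\psi_t$ belongs to $C([0,T],C)\cap L^1([0,T],C^1)$, and if for all $t\in(0,T]$, $x\in[0,2\pi]$ $$v_t(x)=S_t(u_0-\psi_0)(x)+\int_0^tS_{t-s}\bigl(g(u_s)\,\partial_xv_s+f(u_s)+u_s\bigr)(x)\,ds+\int_0^t\int_0^{2\pi}p_{t-s}(x-y)\,g(u_s(y))\,d\Psi_s(y)\,ds,$$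 where both integrands are integrable in $s\in[0,t]$. For a.e. $s$ the inner integral of the last term is the rough integral: the limit, as the mesh of the partition tends to $0$, of the sums over the intervals $[y,y']$ of a partition of $[0,2\pi]$ of $p_{t-s}(x-y)\bigl(g(u_s(y))(\psi_s(y')-\psi_s(y))+\sum_{i,j}\partial_ig_{\cdot j}(u_s(y))\,(\boldsymbol\Psi_s)^{ij}_{y,y'}\bigr)$. A *local solution with blow-up time* $\tau\in(0,\infty]$ is a function $u$ that is a mild solution on $[0,T]$ for every $0\le T<\tau$, with $\lim_{t\uparrow\tau}\|u_t\|_{C^\beta}=\infty$ if $\tau<\infty$. **Statement.** For all data $(u_0,\Psi)$ a local solution exists. Let $u$ be a local solution with data $(u_0,\Psi)$ and blow-up time $\tau$. For every $0\le T<\tau$ and $\varepsilon>0$ there is $\delta>0$ such that, for all data $(\bar u_0,\bar\Psi)$ with $$\|u_0-\bar u_0\|_{C^\beta}+\sup_{t\le T}\|\psi_t-\bar\psi_t\|_{C^\beta}+\sup_{t\le T}\|\boldsymbol\Psi_t-\bar{\boldsymbol\Psi}_t\|_{2\alpha}\le\delta,$$ every local solution $\bar u$ with these data and with blow-up time $\bar\tau$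 satisfies $$\bar\tau>T\qquad\text{and}\qquad\sup_{t\le T}\|u_t-\bar u_t\|_{C^\beta}\le\varepsilon .$$ (In particular, taking equal data, the local solution and its blow-up time are unique.) -/

import Mathlib

open Set Filter Topology MeasureTheory
open scoped NNReal ENNReal ContDiff

namespace RoughBurgers

/-- `ℝⁿ` with its Euclidean norm. -/
abbrev Vec (n : ℕ) : Type := EuclideanSpace ℝ (Fin n)

/-- The spatial interval `[0, 2π]`. -/
def box : Set ℝ := Icc 0 (2 * Real.pi)

section Norms

variable {F : Type*} [NormedAddCommGroup F]

/-- Supremum norm over `[0, 2π]`. -/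
noncomputable def supNorm (h : ℝ → F) : ℝ≥0∞ := ⨆ x ∈ box, ‖h x‖ₑ

/-- The norm of `C^γ([0, 2π])`: Hölder seminorm plus supremum norm, with the value `∞` for functions
that are not `γ`-Hölder continuous on `[0, 2π]`. -/
noncomputable def holderNorm (γ : ℝ≥0) (h : ℝ → F) : ℝ≥0∞ :=
  eHolderNorm γ (box.domRestrict h) + supNorm h

/-- For a function `A` of two variables, `sup_{x ≠ y ∈ [0, 2π]} |A x y| / |y - x| ^ γ`. -/
noncomputable def twoParamNorm (γ : ℝ≥0) (A : ℝ → ℝ → F) : ℝ≥0∞ :=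
  ⨆ x ∈ box, ⨆ y ∈ box, ⨆ _ : x ≠ y, ‖A x y‖ₑ / ENNReal.ofReal (|y - x| ^ (γ : ℝ))

end Norms

/-- The space `𝒟^α([0, 2π], ℝⁿ)` of rough paths: a path `X` and an area process `A`, where
`A x y i j` stands for `∫_x^y (X^i_r - X^i_x) dX^j_r`. Only values on `[0, 2π]` matter. -/
structure RoughPath (n : ℕ) (α : ℝ≥0) where
  path : ℝ → Vec n
  area : ℝ → ℝ → Fin n → Fin n → ℝ
  path_holder : holderNorm α path < ⊤
  area_continuous : ContinuousOn (fun p : ℝ × ℝ => area p.1 p.2) (box ×ˢ box)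
  area_self : ∀ x ∈ box, area x x = 0
  chen : ∀ x ∈ box, ∀ y ∈ box, ∀ z ∈ box, ∀ i j,
    area x z i j - area y z i j - area x y i j
      = (path y i - path x i) * (path z j - path y j)
  area_holder : twoParamNorm (2 * α) area < ⊤

/-- The distance on `𝒟^α`. -/
noncomputable def RoughPath.distance {n : ℕ} {α : ℝ≥0} (X Y : RoughPath n α) : ℝ≥0∞ :=
  holderNorm α (X.path - Y.path) + twoParamNorm (2 * α) (X.area - Y.area)

/-- The second order term `Y' 𝐗` for the "matrix" `M = 𝐗_{x,y}`:
`∑_{i,j} M^{ij} (Y' e_i) e_j`. -/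
noncomputable def contract {n : ℕ} (Y' : Vec n →L[ℝ] Vec n →L[ℝ] Vec n)
    (M : Fin n → Fin n → ℝ) : Vec n :=
  ∑ i, ∑ j, M i j • Y' (EuclideanSpace.single i 1) (EuclideanSpace.single j 1)

/-- `I` is the rough integral `∫_0^{2π} Y dX` of the matrix valued path `Y` with derivative
process `Y'`: the limit, as the mesh of the partition `0 = q 0 ≤ ⋯ ≤ q m = 2π` tends to zero, of the
sums of `Y_x (X_y - X_x) + Y'_x 𝐗_{x,y}` over the intervals `[x, y]` of the partition. -/
def HasRoughIntegral {n : ℕ} {α : ℝ≥0} (X : RoughPath n α) (Y : ℝ → Vec n →L[ℝ] Vec n)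
    (Y' : ℝ → Vec n →L[ℝ] Vec n →L[ℝ] Vec n) (I : Vec n) : Prop :=
  ∀ ε : ℝ, 0 < ε → ∃ δ : ℝ, 0 < δ ∧ ∀ (m : ℕ) (q : ℕ → ℝ), q 0 = 0 → q m = 2 * Real.pi →
    (∀ k < m, q k ≤ q (k + 1) ∧ q (k + 1) - q k ≤ δ) →
    ‖(∑ k ∈ Finset.range m, (Y (q k) (X.path (q (k + 1)) - X.path (q k))
        + contract (Y' (q k)) (X.area (q k) (q (k + 1))))) - I‖ ≤ ε

/-- The heat kernel on the circle `ℝ / 2πℤ`, generated by `∂_x²`, for `t > 0`. -/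
noncomputable def heatKernel (t x : ℝ) : ℝ :=
  ∑' k : ℤ, (Real.sqrt (4 * Real.pi * t))⁻¹
    * Real.exp (-(x - 2 * Real.pi * k) ^ 2 / (4 * t))

/-- The kernel `e^{-t} p_t` of the semigroup generated by `∂_x² - 1` with periodic boundary
conditions. -/
noncomputable def kernel (t x : ℝ) : ℝ := Real.exp (-t) * heatKernel t x

/-- The semigroup generated by `∂_x² - 1` with periodic boundary conditions, for `t > 0`. -/
noncomputable def semigroup {n : ℕ} (t : ℝ) (h : ℝ → Vec n) (x : ℝ) : Vec n :=
  ∫ y in (0 : ℝ)..(2 * Real.pi), kernel t (x - y) • h y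

/-- Initial data: periodic elements of `C^β`. -/
def IsInitialDatum {n : ℕ} (β : ℝ≥0) (u₀ : ℝ → Vec n) : Prop :=
  holderNorm β u₀ < ⊤ ∧ u₀ 0 = u₀ (2 * Real.pi)

/-- Driving paths: `Ψ ∈ C(ℝ₊, 𝒟^α) ∩ C(ℝ₊, C^β)`, periodic in space. -/
structure IsDriver {n : ℕ} {α : ℝ≥0} (β : ℝ≥0) (Ψ : ℝ → RoughPath n α) : Prop where
  periodic : ∀ t, 0 ≤ t → (Ψ t).path 0 = (Ψ t).path (2 * Real.pi)
  holder : ∀ t, 0 ≤ t → holderNorm β (Ψ t).path < ⊤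
  continuous_rough : ∀ t₀, 0 ≤ t₀ →
    Tendsto (fun t => (Ψ t).distance (Ψ t₀)) (𝓝[Ici 0] t₀) (𝓝 0)
  continuous_holder : ∀ t₀, 0 ≤ t₀ →
    Tendsto (fun t => holderNorm β ((Ψ t).path - (Ψ t₀).path)) (𝓝[Ici 0] t₀) (𝓝 0)

/-- The function `g(u) ∂_x v + f(u) + u` of the spatial variable. -/
noncomputable def drift {n : ℕ} (f : Vec n → Vec n) (g : Vec n → Vec n →L[ℝ] Vec n)
    (u v : ℝ → Vec n) (x : ℝ) : Vec n :=
  g (u x) (derivWithin v box x) + (f (u x) + u x)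

/-- `u` is, on `[0, T]`, a mild solution with values in `C^β` of
`∂_t u = ∂_x² u + f(u) + g(u) ∂_x u + ξ` with `u_0 = u₀`, where the noise `ξ` enters through the
rough path valued function `Ψ`, whose path component `ψ` stands for the solution of
`∂_t ψ = (∂_x² - 1) ψ + ξ`. The function `v` of the definition is `v_t = u_t - ψ_t`. -/
structure IsMildSolution {n : ℕ} {α : ℝ≥0} (f : Vec n → Vec n) (g : Vec n → Vec n →L[ℝ] Vec n)
    (β : ℝ≥0) (u₀ : ℝ → Vec n) (Ψ : ℝ → RoughPath n α) (T : ℝ) (u : ℝ → ℝ → Vec n) : Prop where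
  initial : ∀ x ∈ box, u 0 x = u₀ x
  holder_bounded : (⨆ t ∈ Icc 0 T, holderNorm β (u t)) < ⊤
  holder_continuous : ∀ t₀ ∈ Ioc 0 T,
    Tendsto (fun t => holderNorm β (u t - u t₀)) (𝓝[Ioc 0 T] t₀) (𝓝 0)
  /-- `v ∈ C([0, T], C)` -/
  sup_continuous : ∀ t₀ ∈ Icc 0 T,
    Tendsto (fun t => supNorm ((u t - (Ψ t).path) - (u t₀ - (Ψ t₀).path))) (𝓝[Icc 0 T] t₀) (𝓝 0)
  /-- `v ∈ L¹([0, T], C¹)` -/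
  contDiff : ∀ᵐ s ∂volume.restrict (Icc 0 T), ContDiffOn ℝ 1 (u s - (Ψ s).path) box
  integrable : (∫⁻ s in Icc 0 T, (supNorm (u s - (Ψ s).path)
    + supNorm (derivWithin (u s - (Ψ s).path) box))) < ⊤
  /-- The mild formulation; `J s = ∫_0^{2π} p_{t-s}(x - y) g(u_s(y)) dΨ_s(y)` is a rough integral. -/
  mild : ∀ t ∈ Ioc 0 T, ∀ x ∈ box, ∃ J : ℝ → Vec n,
    (∀ᵐ s ∂volume.restrict (Ioo 0 t), HasRoughIntegral (Ψ s)
      (fun y => kernel (t - s) (x - y) • g (u s y))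
      (fun y => kernel (t - s) (x - y) • fderiv ℝ g (u s y)) (J s)) ∧
    IntervalIntegrable J volume 0 t ∧
    IntervalIntegrable (fun s => semigroup (t - s) (drift f g (u s) (u s - (Ψ s).path)) x)
      volume 0 t ∧
    u t x - (Ψ t).path x = semigroup t (u₀ - (Ψ 0).path) x
      + (∫ s in (0 : ℝ)..t, semigroup (t - s) (drift f g (u s) (u s - (Ψ s).path)) x)
      + ∫ s in (0 : ℝ)..t, J s

/-- `u` is the local solution and `τ ∈ (0, ∞]` its blow-up time. -/
structure IsLocalSolution {n : ℕ} {α : ℝ≥0} (f : Vec n → Vec n) (g : Vec n → Vec n →L[ℝ] Vec n)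
    (β : ℝ≥0) (u₀ : ℝ → Vec n) (Ψ : ℝ → RoughPath n α) (u : ℝ → ℝ → Vec n) (τ : EReal) :
    Prop where
  pos : 0 < τ
  solution : ∀ T : ℝ, 0 ≤ T → (T : EReal) < τ → IsMildSolution f g β u₀ Ψ T u
  blowup : ∀ b : ℝ, τ = (b : EReal) → Tendsto (fun t => holderNorm β (u t)) (𝓝[<] b) (𝓝 ⊤)

/-- The distance `Δ` between two sets of data on the time interval `[0, T]`. -/
noncomputable def dataDistance {n : ℕ} {α : ℝ≥0} (β : ℝ≥0) (T : ℝ) (u₀ u₀' : ℝ → Vec n)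
    (Ψ Ψ' : ℝ → RoughPath n α) : ℝ≥0∞ :=
  holderNorm β (u₀ - u₀') + (⨆ t ∈ Icc 0 T, holderNorm β ((Ψ t).path - (Ψ' t).path))
    + ⨆ t ∈ Icc 0 T, twoParamNorm (2 * α) ((Ψ t).area - (Ψ' t).area)

end RoughBurgers

/-!
Subtracting the driving path, the remainder `v = u - ψ` of a solution is Lipschitz in space at
positive times, with a constant of order `t ^ (-(1 - β) / 2)`, although `u` itself is only Hölder.
At a fixed time the increments of the controlled path `g(u)` against `ψ` are therefore
`g(u) δψ + Dg(u) 𝚿` up to an error of order `3α > 1`. Adding `g(u) δv` and the rest of the drift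
gives a `germ`, which the sewing lemma (`norm_sew_sub_le`) turns into a function `H` on `[0, 2π]`
that is `α`-Hölder with a bound linear in the Lipschitz constant of `v` (`isPrimitive_sew_germ`) and
depends on the data in a locally Lipschitz way (`isPrimitive_sew_germ_sub`). `H` is the primitive in
space of the whole right hand side of the equation. With `duhamel τ H` for the semigroup at time `τ`
applied to the derivative of `H`, the equation becomes the Volterra equation `IsSol`
`v t = heat t v₀ + ∫₀ᵗ duhamel (t - s) (H s) ds` for periodic functions on the line, where `heat`
and its derivatives are Gaussian expectations.

This equation has integrable singular kernels, and in norms with a weight `e^{-λ t}` its right hand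
side gains a factor `λ ^ (-α / 4)` (`WBound.of_isPrimitive`). This yields linear growth, hence a
priori bounds on the Lipschitz constants in terms of the `C^β` norm (`exists_apriori`), Lipschitz
dependence on the data among solutions bounded in `C^β` (`exists_stability`), and local solutions by
Picard iteration with an existence time that only depends on the size of the data
(`exists_local_solution`). Solutions can be restarted and glued (`IsSol.shift`, `IsSol.glue`), so
that a maximal solution exists and its `C^β` norm tends to infinity at a finite maximal time.

Mild solutions and solutions of the Volterra equation correspond to each other. Integration by parts
against the `C¹` heat kernel identifies the rough integral plus the drift with `duhamel`
(`hasRoughIntegral_slice`), and rough integrals are unique as limits. A mild solution is only known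
to have a remainder in `L¹([0, T], C¹)`; its Lipschitz constant satisfies a singular integral
inequality, and iterating this inequality upgrades integrability to the bound of order
`t ^ (-(1 - β) / 2)` (`exists_singular_bound`, `IsMildSolution.isSol`). Conversely, solutions of the
Volterra equation are `C¹` in space and continuous in `C^β` at positive times
(`IsSol.isMildSolution`).

For the continuous dependence only the given solution is bounded a priori. As long as the other one
stays within distance `1` of it in `C^β`, stability gives a distance of the order of the distance of
the data, so the condition propagates by continuity in time (`exists_stability_of_bound`) up to `T`
or the blow-up time of the second solution; but a solution that stays close to a bounded one does
not blow up (`IsLocalSolution.lt_of_holderNorm_sub_le`).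
-/

namespace RoughBurgers

/-! ### Gaussian averages -/

section Gaussian

set_option linter.unusedSectionVars false

variable {E : Type*} [NormedAddCommGroup E] [NormedSpace ℝ E] [CompleteSpace E]

/-- The standard Gaussian measure on `ℝ`. -/
noncomputable abbrev stdGauss : Measure ℝ := ProbabilityTheory.gaussianReal 0 1

/-- The expectation of `w ξ • h (x + σ ξ)` for a standard Gaussian `ξ`. -/
noncomputable def gaussMean (w : ℝ → ℝ) (σ : ℝ) (h : ℝ → E) (x : ℝ) : E :=
  ∫ ξ, w ξ • h (x + σ * ξ) ∂stdGauss

/-- A constant dominating every Gaussian moment that is needed. -/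
noncomputable def gaussConst : ℝ := ∫ ξ, (|ξ| + 2) ^ 4 ∂stdGauss

lemma gauss_pdf_std (x : ℝ) : ProbabilityTheory.gaussianPDFReal 0 1 x
    = (Real.sqrt (2 * Real.pi))⁻¹ * Real.exp (-x ^ 2 / 2) := by
  simp [ProbabilityTheory.gaussianPDFReal]

lemma integrable_poly_gauss (k : ℕ) : Integrable (fun ξ : ℝ => (|ξ| + 2) ^ k) stdGauss := by
  have h1 : MemLp (fun ξ : ℝ => |ξ| + 2) (k : ℝ≥0∞) stdGauss := by
    have h2 : MemLp (id : ℝ → ℝ) ((k : ℝ≥0) : ℝ≥0∞) stdGauss :=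
      ProbabilityTheory.memLp_id_gaussianReal (k : ℝ≥0)
    have h2' : MemLp (id : ℝ → ℝ) (k : ℝ≥0∞) stdGauss := by simpa using h2
    exact h2'.norm.add (memLp_const 2)
  have h3 := h1.integrable_norm_pow' (f := fun ξ : ℝ => |ξ| + 2)
  refine h3.congr (ae_of_all _ fun ξ => ?_)
  have : (0:ℝ) ≤ |ξ| + 2 := by positivity
  simp [abs_of_nonneg this]

lemma one_le_gaussConst : 1 ≤ gaussConst := by
  have : ∫ _ξ : ℝ, (1:ℝ) ∂stdGauss ≤ gaussConst := by
    refine integral_mono (integrable_const _) (integrable_poly_gauss 4) fun ξ => ?_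
    have : 1 ≤ |ξ| + 2 := by linarith [abs_nonneg ξ]
    exact one_le_pow₀ this
  simpa using this

lemma gaussConst_pos : 0 < gaussConst := lt_of_lt_of_le one_pos one_le_gaussConst

lemma integral_std_id : ∫ ξ : ℝ, ξ ∂stdGauss = 0 := ProbabilityTheory.integral_id_gaussianReal

lemma integrable_of_poly {F : ℝ → E} (hF : AEStronglyMeasurable F stdGauss) {K : ℝ} (k : ℕ)
    (hb : ∀ ξ, ‖F ξ‖ ≤ K * (|ξ| + 2) ^ k) : Integrable F stdGauss :=
  ((integrable_poly_gauss k).const_mul K).mono' hF (ae_of_all _ hb)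

lemma integral_std_sq : ∫ ξ : ℝ, (ξ ^ 2 - 1) ∂stdGauss = 0 := by
  have h1 : ∫ ξ : ℝ, ξ ^ 2 ∂stdGauss = 1 := by
    have := ProbabilityTheory.variance_id_gaussianReal (μ := 0) (v := 1)
    rw [ProbabilityTheory.variance_of_integral_eq_zero (by fun_prop) (by simp)] at this
    simpa using this
  have h2 : Integrable (fun ξ : ℝ => ξ ^ 2) stdGauss := by
    refine integrable_of_poly (by fun_prop) (K := 1) 2 fun ξ => ?_
    rw [Real.norm_of_nonneg (by positivity), one_mul, ← sq_abs]
    gcongr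
    linarith
  rw [integral_sub h2 (integrable_const _), h1]
  simp

lemma gaussMean_integrable {w : ℝ → ℝ} (hw : Continuous w) (hw2 : ∀ ξ, |w ξ| ≤ (|ξ| + 2) ^ 2)
    {h : ℝ → E} (hh : Continuous h) {B : ℝ} (hB : ∀ x, ‖h x‖ ≤ B) (σ x : ℝ) :
    Integrable (fun ξ => w ξ • h (x + σ * ξ)) stdGauss := by
  refine integrable_of_poly (by fun_prop) (K := B) 2 fun ξ => ?_
  rw [norm_smul, mul_comm]
  exact mul_le_mul (hB _) (hw2 ξ) (norm_nonneg _) (le_trans (norm_nonneg _) (hB 0))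

lemma gaussMean_eq_integral (w : ℝ → ℝ) {σ : ℝ} (hσ : 0 < σ) (h : ℝ → E) (x : ℝ) :
    gaussMean w σ h x
      = σ⁻¹ • ∫ y, (ProbabilityTheory.gaussianPDFReal 0 1 ((y - x) / σ) * w ((y - x) / σ)) • h y := by
  unfold gaussMean
  rw [ProbabilityTheory.integral_gaussianReal_eq_integral_smul (by norm_num)]
  set F : ℝ → E := fun y =>
    (ProbabilityTheory.gaussianPDFReal 0 1 ((y - x) / σ) * w ((y - x) / σ)) • h y with hF
  have h1 : ∀ ξ, ProbabilityTheory.gaussianPDFReal 0 1 ξ • w ξ • h (x + σ * ξ) = F (x + σ * ξ) := by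
    intro ξ
    simp [hF, smul_smul, hσ.ne']
  simp_rw [h1]
  rw [Measure.integral_comp_mul_left (fun z => F (x + z)) σ, integral_add_left_eq_self F x,
    abs_of_pos (inv_pos.2 hσ)]

lemma integrable_dominating : Integrable (fun v : ℝ => (|v| + 3) ^ 2 * Real.exp (-v ^ 2 / 4)) := by
  have h0 : Integrable (fun v : ℝ => Real.exp (-(1/4) * v ^ 2)) :=
    integrable_exp_neg_mul_sq (by norm_num)
  have h2 : Integrable (fun v : ℝ => v ^ (2:ℝ) * Real.exp (-(1/4) * v ^ 2)) :=
    integrable_rpow_mul_exp_neg_mul_sq (by norm_num) (by norm_num)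
  refine ((h2.const_mul 2).add (h0.const_mul 18)).mono' (by fun_prop) (ae_of_all _ fun v => ?_)
  rw [Real.norm_of_nonneg (by positivity)]
  have e : Real.exp (-v ^ 2 / 4) = Real.exp (-(1/4) * v ^ 2) := by ring_nf
  have e2 : v ^ (2:ℝ) = v ^ 2 := by norm_cast
  simp only [Pi.add_apply, e, e2]
  have : (|v| + 3) ^ 2 ≤ 2 * v ^ 2 + 18 := by
    rw [← sq_abs v]; nlinarith [sq_nonneg (|v| - 3)]
  nlinarith [Real.exp_pos (-(1/4) * v ^ 2)]

/-- Differentiation under the integral: if `(w φ)' = -w₁ φ` for the Gaussian density `φ`, then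
`∂ₓ E[w ξ h (x + σ ξ)] = σ⁻¹ E[w₁ ξ h (x + σ ξ)]`, without any smoothness of `h`. -/
lemma hasDerivAt_gaussMean {w w₁ : ℝ → ℝ} (hw : Continuous w) (hw1 : Continuous w₁)
    (hw2 : ∀ ξ, |w ξ| ≤ (|ξ| + 2) ^ 2) (hw12 : ∀ ξ, |w₁ ξ| ≤ (|ξ| + 2) ^ 2)
    (hd : ∀ z, HasDerivAt w (w z * z - w₁ z) z)
    {σ : ℝ} (hσ : 0 < σ) {h : ℝ → E} (hh : Continuous h) {B : ℝ} (hB : ∀ x, ‖h x‖ ≤ B) (x : ℝ) :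
    HasDerivAt (gaussMean w σ h) (σ⁻¹ • gaussMean w₁ σ h x) x := by
  set φ := ProbabilityTheory.gaussianPDFReal 0 1 with hφ
  have hB0 : 0 ≤ B := le_trans (norm_nonneg _) (hB 0)
  have hφd : ∀ z, HasDerivAt φ (-z * φ z) z := by
    intro z
    have h1 : HasDerivAt (fun z : ℝ => -z ^ 2 / 2) (-z) z := by
      have := ((hasDerivAt_id z).pow 2).neg.div_const 2
      refine this.congr_deriv ?_
      simp only [Nat.cast_ofNat, id_eq, Nat.add_one_sub_one, pow_one, mul_one]
      ring
    have := (h1.exp).const_mul (Real.sqrt (2 * Real.pi))⁻¹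
    have e : φ = fun z => (Real.sqrt (2 * Real.pi))⁻¹ * Real.exp (-z ^ 2 / 2) :=
      funext gauss_pdf_std
    rw [e]
    refine this.congr_deriv ?_
    ring
  have hφc : Continuous φ := continuous_iff_continuousAt.2 fun z => (hφd z).continuousAt
  have hkd : ∀ z, HasDerivAt (fun z => φ z * w z) (-(φ z * w₁ z)) z := by
    intro z
    refine ((hφd z).mul (hd z)).congr_deriv ?_
    ring
  have hdom : ∀ v v' : ℝ, |v - v'| ≤ 1 → ∀ u : ℝ → ℝ, (∀ ξ, |u ξ| ≤ (|ξ| + 2) ^ 2) →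
      |φ v' * u v'| ≤ Real.exp (1/2) * ((|v| + 3) ^ 2 * Real.exp (-v ^ 2 / 4)) := by
    intro v v' hv u hu
    have h1 : |φ v'| ≤ Real.exp (1/2) * Real.exp (-v ^ 2 / 4) := by
      rw [hφ, gauss_pdf_std, abs_of_nonneg (by positivity), ← Real.exp_add]
      have h2 : (Real.sqrt (2 * Real.pi))⁻¹ ≤ 1 := by
        apply inv_le_one_of_one_le₀
        rw [Real.one_le_sqrt]
        linarith [Real.pi_gt_three]
      -- moving the centre by at most `σ` costs a constant and half of the Gaussian exponent
      have h3 : -v' ^ 2 / 2 ≤ 1/2 + -v ^ 2 / 4 := by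
        have : (v - v') ^ 2 ≤ 1 := by rw [← sq_abs]; nlinarith [abs_nonneg (v - v')]
        nlinarith [sq_nonneg (v - 2 * v')]
      calc _ ≤ 1 * Real.exp (-v' ^ 2 / 2) := by gcongr
        _ ≤ _ := by rw [one_mul]; exact Real.exp_le_exp.2 h3
    have h4 : |u v'| ≤ (|v| + 3) ^ 2 := by
      refine (hu v').trans ?_
      have : |v'| ≤ |v| + 1 := by
        have := abs_sub_abs_le_abs_sub v' v
        rw [abs_sub_comm] at this; linarith
      gcongr ?_ ^ 2
      linarith
    rw [abs_mul]
    calc _ ≤ (Real.exp (1/2) * Real.exp (-v ^ 2 / 4)) * (|v| + 3) ^ 2 := by gcongr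
      _ = _ := by ring
  have hfun : gaussMean w σ h
      = fun x => σ⁻¹ • ∫ y, (φ ((y - x) / σ) * w ((y - x) / σ)) • h y :=
    funext fun x => gaussMean_eq_integral w hσ h x
  rw [hfun, gaussMean_eq_integral w₁ hσ h x, ← hφ]
  refine HasDerivAt.const_smul σ⁻¹ ?_
  have hbi : Integrable (fun y : ℝ => Real.exp (1/2) * ((|(y - x) / σ| + 3) ^ 2
      * Real.exp (-((y - x) / σ) ^ 2 / 4))) := by
    refine Integrable.const_mul ?_ _
    have := (integrable_dominating.comp_div hσ.ne').comp_sub_right x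
    exact this
  have key := hasDerivAt_integral_of_dominated_loc_of_deriv_le (μ := volume) (𝕜 := ℝ)
    (F := fun x y => (φ ((y - x) / σ) * w ((y - x) / σ)) • h y)
    (F' := fun x y => (σ⁻¹ * (φ ((y - x) / σ) * w₁ ((y - x) / σ))) • h y)
    (x₀ := x) (s := Metric.ball x σ)
    (bound := fun y => σ⁻¹ * (Real.exp (1/2) * ((|(y - x) / σ| + 3) ^ 2
      * Real.exp (-((y - x) / σ) ^ 2 / 4))) * B)
    (Metric.ball_mem_nhds x hσ)
    (Eventually.of_forall fun x' => by
      refine Continuous.aestronglyMeasurable ?_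
      fun_prop)
    ?_ (by refine Continuous.aestronglyMeasurable ?_; fun_prop) ?_ ?_ ?_
  · refine key.2.congr_deriv ?_
    simp_rw [mul_smul]
    rw [integral_smul]
  · refine (hbi.mul_const B).mono' (by refine Continuous.aestronglyMeasurable ?_; fun_prop)
      (ae_of_all _ fun y => ?_)
    rw [norm_smul, Real.norm_eq_abs]
    exact mul_le_mul (hdom _ _ (by simp) w hw2) (hB y) (norm_nonneg _) (by positivity)
  · refine ae_of_all _ fun y x' hx' => ?_
    rw [norm_smul, Real.norm_eq_abs, abs_mul, abs_of_pos (inv_pos.2 hσ)]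
    have hv : |(y - x) / σ - (y - x') / σ| ≤ 1 := by
      rw [← sub_div, abs_div, abs_of_pos hσ, div_le_one hσ]
      rw [Metric.mem_ball, Real.dist_eq] at hx'
      have : y - x - (y - x') = x' - x := by ring
      rw [this]; exact hx'.le
    have := hdom _ _ hv w₁ hw12
    exact mul_le_mul (mul_le_mul_of_nonneg_left this (by positivity)) (hB y) (norm_nonneg _)
      (by positivity)
  · exact (hbi.const_mul σ⁻¹).mul_const B
  · refine ae_of_all _ fun y x' _ => ?_
    have h1 : HasDerivAt (fun x' : ℝ => (y - x') / σ) (-σ⁻¹) x' := by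
      have := ((hasDerivAt_id x').const_sub y).div_const σ
      refine this.congr_deriv ?_
      simp [neg_div]
    have h2 := (hkd ((y - x') / σ)).comp x' h1
    refine (HasDerivAt.smul_const h2 (h y)).congr_deriv ?_
    congr 1
    ring

lemma norm_gaussMean_le {w : ℝ → ℝ} (hw2 : ∀ ξ, |w ξ| ≤ (|ξ| + 2) ^ 2)
    {h : ℝ → E} {B : ℝ} (hB : ∀ x, ‖h x‖ ≤ B) (σ x : ℝ) :
    ‖gaussMean w σ h x‖ ≤ gaussConst * B := by
  have hB0 : 0 ≤ B := le_trans (norm_nonneg _) (hB 0)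
  unfold gaussMean gaussConst
  rw [← integral_mul_const]
  refine norm_integral_le_of_norm_le ((integrable_poly_gauss 4).mul_const B) (ae_of_all _ fun ξ => ?_)
  rw [norm_smul, Real.norm_eq_abs]
  have h1 : |w ξ| ≤ (|ξ| + 2) ^ 4 := (hw2 ξ).trans
    (pow_le_pow_right₀ (by linarith [abs_nonneg ξ]) (by norm_num))
  exact mul_le_mul h1 (hB _) (norm_nonneg _) (by positivity)

/-- If the weight has mean zero then `E[w ξ h (x + σ ξ)]` only sees increments of `h`. -/
lemma norm_gaussMean_le_of_holder {w : ℝ → ℝ} (hw : Continuous w)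
    (hw2 : ∀ ξ, |w ξ| ≤ (|ξ| + 2) ^ 2) (hw0 : ∫ ξ, w ξ ∂stdGauss = 0)
    {h : ℝ → E} (hh : Continuous h) {B : ℝ} (hB : ∀ x, ‖h x‖ ≤ B) {K γ : ℝ} (hK : 0 ≤ K)
    (hγ : 0 ≤ γ) (hγ1 : γ ≤ 1)
    (hol : ∀ x y, ‖h x - h y‖ ≤ K * |x - y| ^ γ) {σ : ℝ} (hσ : 0 ≤ σ) (x : ℝ) :
    ‖gaussMean w σ h x‖ ≤ gaussConst * (K * σ ^ γ) := by
  have h1 : gaussMean w σ h x = ∫ ξ, w ξ • (h (x + σ * ξ) - h x) ∂stdGauss := by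
    unfold gaussMean
    simp_rw [smul_sub]
    have hwi : Integrable w stdGauss :=
      integrable_of_poly hw.aestronglyMeasurable (K := 1) 2 (by simpa using hw2)
    rw [integral_sub (gaussMean_integrable hw hw2 hh hB σ x) (hwi.smul_const _)]
    rw [integral_smul_const, hw0]
    simp
  rw [h1]
  unfold gaussConst
  rw [← integral_mul_const]
  refine norm_integral_le_of_norm_le ((integrable_poly_gauss 4).mul_const _) (ae_of_all _ fun ξ => ?_)
  rw [norm_smul, Real.norm_eq_abs]
  have h2 : ‖h (x + σ * ξ) - h x‖ ≤ K * (σ ^ γ * (|ξ| + 2)) := by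
    refine (hol _ _).trans ?_
    rw [add_sub_cancel_left, abs_mul, abs_of_nonneg hσ, Real.mul_rpow hσ (abs_nonneg _)]
    gcongr
    calc |ξ| ^ γ ≤ (|ξ| + 2) ^ γ := by gcongr; linarith
      _ ≤ (|ξ| + 2) ^ (1:ℝ) := Real.rpow_le_rpow_of_exponent_le (by linarith [abs_nonneg ξ]) hγ1
      _ = _ := by simp
  calc |w ξ| * ‖h (x + σ * ξ) - h x‖ ≤ (|ξ| + 2) ^ 2 * (K * (σ ^ γ * (|ξ| + 2))) := by
        gcongr; exact hw2 ξ
    _ = (|ξ| + 2) ^ 3 * (K * σ ^ γ) := by ring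
    _ ≤ (|ξ| + 2) ^ 4 * (K * σ ^ γ) := by
        gcongr ?_ * _
        exact pow_le_pow_right₀ (by linarith [abs_nonneg ξ]) (by norm_num)

lemma norm_gaussMean_one_le {h : ℝ → E} {B : ℝ} (hB : ∀ x, ‖h x‖ ≤ B) (σ x : ℝ) :
    ‖gaussMean (fun _ => 1) σ h x‖ ≤ B := by
  unfold gaussMean
  have := norm_integral_le_of_norm_le_const (μ := stdGauss) (f := fun ξ => (1:ℝ) • h (x + σ * ξ))
    (C := B) (ae_of_all _ fun ξ => by simpa using hB _)
  simpa using this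

lemma gaussMean_sub {w : ℝ → ℝ} (hw : Continuous w) (hw2 : ∀ ξ, |w ξ| ≤ (|ξ| + 2) ^ 2)
    {h k : ℝ → E} (hh : Continuous h) {B : ℝ} (hB : ∀ x, ‖h x‖ ≤ B)
    (hk : Continuous k) {B' : ℝ} (hB' : ∀ x, ‖k x‖ ≤ B') (σ x : ℝ) :
    gaussMean w σ (fun y => h y - k y) x = gaussMean w σ h x - gaussMean w σ k x := by
  unfold gaussMean
  simp_rw [smul_sub]
  rw [integral_sub (gaussMean_integrable hw hw2 hh hB σ x) (gaussMean_integrable hw hw2 hk hB' σ x)]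

lemma continuous_gaussMean {w : ℝ → ℝ} (hw : Continuous w) (hw2 : ∀ ξ, |w ξ| ≤ (|ξ| + 2) ^ 2)
    {h : ℝ → E} (hh : Continuous h) {B : ℝ} (hB : ∀ x, ‖h x‖ ≤ B) (σ : ℝ) :
    Continuous (gaussMean w σ h) := by
  unfold gaussMean
  refine continuous_of_dominated (bound := fun ξ => (|ξ| + 2) ^ 2 * B) (fun x => ?_) (fun x => ?_)
    ((integrable_poly_gauss 2).mul_const B) (ae_of_all _ fun ξ => by fun_prop)
  · exact Continuous.aestronglyMeasurable (by fun_prop)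
  · refine ae_of_all _ fun ξ => ?_
    rw [norm_smul]
    exact mul_le_mul (hw2 ξ) (hB _) (norm_nonneg _) (by positivity)

end Gaussian

/-! ### The heat semigroup on the line -/

section Heat

set_option linter.unusedSectionVars false

variable {E : Type*} [NormedAddCommGroup E] [NormedSpace ℝ E] [CompleteSpace E]

/-- The semigroup of `∂ₓ² - 1` on the line, written as a Gaussian expectation. -/
noncomputable def heat (t : ℝ) (h : ℝ → E) (x : ℝ) : E :=
  Real.exp (-t) • gaussMean (fun _ => 1) (Real.sqrt (2 * t)) h x

/-- The spatial derivative of `heat t h`. -/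
noncomputable def dheat (t : ℝ) (h : ℝ → E) (x : ℝ) : E :=
  Real.exp (-t) • (Real.sqrt (2 * t))⁻¹ • gaussMean (fun ξ => ξ) (Real.sqrt (2 * t)) h x

/-- The second spatial derivative of `heat t h`. -/
noncomputable def ddheat (t : ℝ) (h : ℝ → E) (x : ℝ) : E :=
  Real.exp (-t) • (Real.sqrt (2 * t))⁻¹ • (Real.sqrt (2 * t))⁻¹ •
    gaussMean (fun ξ => ξ ^ 2 - 1) (Real.sqrt (2 * t)) h x

lemma weight_one (ξ : ℝ) : |(1:ℝ)| ≤ (|ξ| + 2) ^ 2 := by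
  rw [abs_one]; nlinarith [abs_nonneg ξ]

lemma weight_id (ξ : ℝ) : |ξ| ≤ (|ξ| + 2) ^ 2 := by nlinarith [abs_nonneg ξ]

lemma weight_sq (ξ : ℝ) : |ξ ^ 2 - 1| ≤ (|ξ| + 2) ^ 2 := by
  have h := sq_abs ξ
  rw [abs_le]; constructor <;> nlinarith [abs_nonneg ξ]

lemma sqrt_two_mul_pos {t : ℝ} (ht : 0 < t) : 0 < Real.sqrt (2 * t) := Real.sqrt_pos.2 (by linarith)

variable {h k : ℝ → E} {B B' : ℝ}

lemma hasDerivAt_heat (hh : Continuous h) (hB : ∀ x, ‖h x‖ ≤ B) {t : ℝ} (ht : 0 < t) (x : ℝ) :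
    HasDerivAt (heat t h) (dheat t h x) x := by
  have := hasDerivAt_gaussMean (w := fun _ => 1) (w₁ := fun ξ => ξ) continuous_const continuous_id
    weight_one weight_id (fun z => by simpa using hasDerivAt_const z (1:ℝ))
    (sqrt_two_mul_pos ht) hh hB x
  exact this.const_smul (Real.exp (-t))

lemma hasDerivAt_dheat (hh : Continuous h) (hB : ∀ x, ‖h x‖ ≤ B) {t : ℝ} (ht : 0 < t) (x : ℝ) :
    HasDerivAt (dheat t h) (ddheat t h x) x := by
  have := hasDerivAt_gaussMean (w := fun ξ => ξ) (w₁ := fun ξ => ξ ^ 2 - 1) continuous_id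
    (by fun_prop) weight_id weight_sq
    (fun z => (hasDerivAt_id z).congr_deriv (by ring))
    (sqrt_two_mul_pos ht) hh hB x
  exact (this.const_smul (Real.sqrt (2 * t))⁻¹).const_smul (Real.exp (-t))

lemma continuous_heat (hh : Continuous h) (hB : ∀ x, ‖h x‖ ≤ B) (t : ℝ) : Continuous (heat t h) :=
  (continuous_gaussMean continuous_const weight_one hh hB _).const_smul _

lemma continuous_dheat (hh : Continuous h) (hB : ∀ x, ‖h x‖ ≤ B) (t : ℝ) : Continuous (dheat t h) :=
  ((continuous_gaussMean continuous_id weight_id hh hB _).const_smul _).const_smul _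

lemma continuous_ddheat (hh : Continuous h) (hB : ∀ x, ‖h x‖ ≤ B) (t : ℝ) :
    Continuous (ddheat t h) :=
  (((continuous_gaussMean (by fun_prop) weight_sq hh hB _).const_smul _).const_smul _).const_smul _

lemma norm_exp_neg_smul_le {t : ℝ} (ht : 0 ≤ t) (v : E) : ‖Real.exp (-t) • v‖ ≤ ‖v‖ := by
  rw [norm_smul, Real.norm_of_nonneg (Real.exp_pos _).le]
  have : Real.exp (-t) ≤ 1 := Real.exp_le_one_iff.2 (by linarith)
  exact mul_le_of_le_one_left (norm_nonneg _) this

lemma norm_heat_le (hB : ∀ x, ‖h x‖ ≤ B) {t : ℝ} (ht : 0 ≤ t) (x : ℝ) : ‖heat t h x‖ ≤ B :=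
  (norm_exp_neg_smul_le ht _).trans (norm_gaussMean_one_le hB _ _)

lemma heat_sub_apply (hh : Continuous h) (hB : ∀ x, ‖h x‖ ≤ B) (hk : Continuous k)
    (hB' : ∀ x, ‖k x‖ ≤ B') (t x : ℝ) :
    heat t (fun y => h y - k y) x = heat t h x - heat t k x := by
  unfold heat
  rw [gaussMean_sub continuous_const weight_one hh hB hk hB', smul_sub]

lemma dheat_sub_apply (hh : Continuous h) (hB : ∀ x, ‖h x‖ ≤ B) (hk : Continuous k)
    (hB' : ∀ x, ‖k x‖ ≤ B') (t x : ℝ) :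
    dheat t (fun y => h y - k y) x = dheat t h x - dheat t k x := by
  unfold dheat
  rw [gaussMean_sub (w := fun ξ => ξ) continuous_id weight_id hh hB hk hB', smul_sub, smul_sub]

lemma heat_add_arg (t : ℝ) (h : ℝ → E) (x c : ℝ) :
    heat t (fun y => h (y + c)) x = heat t h (x + c) := by
  unfold heat gaussMean
  congr 2; ext ξ; beta_reduce; rw [add_right_comm]

lemma dheat_add_arg (t : ℝ) (h : ℝ → E) (x c : ℝ) :
    dheat t (fun y => h (y + c)) x = dheat t h (x + c) := by
  unfold dheat gaussMean
  congr 3; ext ξ; beta_reduce; rw [add_right_comm]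

lemma heat_periodic {L : ℝ} (hp : Function.Periodic h L) (t : ℝ) :
    Function.Periodic (heat t h) L := by
  intro x
  rw [← heat_add_arg]
  congr 1; exact funext hp

lemma dheat_periodic {L : ℝ} (hp : Function.Periodic h L) (t : ℝ) :
    Function.Periodic (dheat t h) L := by
  intro x
  rw [← dheat_add_arg]
  congr 1; exact funext hp

lemma heat_const (t : ℝ) (c : E) (x : ℝ) : heat t (fun _ => c) x = Real.exp (-t) • c := by
  simp [heat, gaussMean]

/-- The semigroup does not increase moduli of continuity. -/
lemma norm_heat_sub_le (hh : Continuous h) (hB : ∀ x, ‖h x‖ ≤ B) {t : ℝ} (ht : 0 ≤ t) {x y D : ℝ}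
    (hD : ∀ z, ‖h (x + z) - h (y + z)‖ ≤ D) : ‖heat t h x - heat t h y‖ ≤ D := by
  have e1 : heat t h x = heat t (fun z => h (z + x)) 0 := by rw [heat_add_arg, zero_add]
  have e2 : heat t h y = heat t (fun z => h (z + y)) 0 := by rw [heat_add_arg, zero_add]
  rw [e1, e2, ← heat_sub_apply (B := B) (B' := B) (by fun_prop) (fun z => hB _) (by fun_prop)
    (fun z => hB _)]
  exact norm_heat_le (fun z => by simpa [add_comm] using hD z) ht 0

lemma sqrt_rpow_bound {t γ : ℝ} (ht : 0 < t) (hγ1 : γ ≤ 1) :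
    (Real.sqrt (2 * t))⁻¹ * (Real.sqrt (2 * t)) ^ γ ≤ t ^ ((γ - 1) / 2) := by
  have h2 : (0:ℝ) < 2 * t := by linarith
  rw [← Real.rpow_neg_one, ← Real.rpow_add (sqrt_two_mul_pos ht), Real.sqrt_eq_rpow,
    ← Real.rpow_mul h2.le]
  rw [show (1 / 2 * (-1 + γ) : ℝ) = (γ - 1) / 2 by ring]
  exact Real.rpow_le_rpow_of_nonpos ht (by linarith) (by linarith)

lemma sqrt_rpow_bound_two {t γ : ℝ} (ht : 0 < t) (hγ1 : γ ≤ 1) :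
    (Real.sqrt (2 * t))⁻¹ * ((Real.sqrt (2 * t))⁻¹ * (Real.sqrt (2 * t)) ^ γ)
      ≤ t ^ (γ / 2 - 1) := by
  have h2 : (0:ℝ) < 2 * t := by linarith
  rw [← Real.rpow_neg_one, ← Real.rpow_add (sqrt_two_mul_pos ht),
    ← Real.rpow_add (sqrt_two_mul_pos ht), Real.sqrt_eq_rpow,
    ← Real.rpow_mul h2.le]
  rw [show (1 / 2 * (-1 + (-1 + γ)) : ℝ) = γ / 2 - 1 by ring]
  exact Real.rpow_le_rpow_of_nonpos ht (by linarith) (by linarith)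

/-- Smoothing on `γ`-Hölder functions. The weight `ξ` has mean zero, so only increments of `h` over
the distance `√(2t)` enter. -/
lemma norm_dheat_le (hh : Continuous h) (hB : ∀ x, ‖h x‖ ≤ B) {K γ : ℝ} (hK : 0 ≤ K)
    (hγ : 0 ≤ γ) (hγ1 : γ ≤ 1) (hol : ∀ x y, ‖h x - h y‖ ≤ K * |x - y| ^ γ) {t : ℝ} (ht : 0 < t)
    (x : ℝ) : ‖dheat t h x‖ ≤ gaussConst * K * t ^ ((γ - 1) / 2) := by
  refine (norm_exp_neg_smul_le ht.le _).trans ?_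
  have hs := sqrt_two_mul_pos ht
  have := norm_gaussMean_le_of_holder continuous_id weight_id integral_std_id hh hB hK hγ hγ1 hol
    hs.le x
  rw [norm_smul, Real.norm_of_nonneg (inv_pos.2 hs).le]
  calc _ ≤ (Real.sqrt (2 * t))⁻¹ * (gaussConst * (K * (Real.sqrt (2 * t)) ^ γ)) := by gcongr; exact this
    _ = gaussConst * K * ((Real.sqrt (2 * t))⁻¹ * (Real.sqrt (2 * t)) ^ γ) := by ring
    _ ≤ _ := by
      have := gaussConst_pos
      gcongr; exact sqrt_rpow_bound ht hγ1

/-- Smoothing for the second derivative; the weight `ξ² - 1` has mean zero as well. -/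
lemma norm_ddheat_le (hh : Continuous h) (hB : ∀ x, ‖h x‖ ≤ B) {K γ : ℝ} (hK : 0 ≤ K)
    (hγ : 0 ≤ γ) (hγ1 : γ ≤ 1) (hol : ∀ x y, ‖h x - h y‖ ≤ K * |x - y| ^ γ) {t : ℝ} (ht : 0 < t)
    (x : ℝ) : ‖ddheat t h x‖ ≤ gaussConst * K * t ^ (γ / 2 - 1) := by
  refine (norm_exp_neg_smul_le ht.le _).trans ?_
  have hs := sqrt_two_mul_pos ht
  have := norm_gaussMean_le_of_holder (w := fun ξ => ξ ^ 2 - 1) (by fun_prop) weight_sq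
    integral_std_sq hh hB hK hγ hγ1 hol hs.le x
  rw [norm_smul, norm_smul, Real.norm_of_nonneg (inv_pos.2 hs).le]
  calc _ ≤ (Real.sqrt (2 * t))⁻¹ * ((Real.sqrt (2 * t))⁻¹
        * (gaussConst * (K * (Real.sqrt (2 * t)) ^ γ))) := by gcongr
    _ = gaussConst * K * ((Real.sqrt (2 * t))⁻¹ * ((Real.sqrt (2 * t))⁻¹
        * (Real.sqrt (2 * t)) ^ γ)) := by ring
    _ ≤ _ := by
      have := gaussConst_pos
      gcongr; exact sqrt_rpow_bound_two ht hγ1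

/-- Continuity of the semigroup at time zero, with a rate. -/
lemma norm_heat_sub_self_le (hh : Continuous h) (hB : ∀ x, ‖h x‖ ≤ B) {K γ : ℝ} (hK : 0 ≤ K)
    (hγ : 0 ≤ γ) (hγ1 : γ ≤ 1) (hol : ∀ x y, ‖h x - h y‖ ≤ K * |x - y| ^ γ) {t : ℝ} (ht : 0 ≤ t)
    (x : ℝ) : ‖heat t h x - h x‖ ≤ t * B + gaussConst * K * (Real.sqrt (2 * t)) ^ γ := by
  set σ := Real.sqrt (2 * t) with hσ
  have hσ0 : 0 ≤ σ := Real.sqrt_nonneg _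
  have h1 : gaussMean (fun _ => 1) σ h x - h x = ∫ ξ, (h (x + σ * ξ) - h x) ∂stdGauss := by
    unfold gaussMean
    rw [integral_sub]
    · simp
    · simpa using gaussMean_integrable continuous_const weight_one hh hB σ x
    · exact integrable_const _
  have h2 : ‖gaussMean (fun _ => 1) σ h x - h x‖ ≤ gaussConst * K * σ ^ γ := by
    rw [h1, mul_assoc]
    unfold gaussConst
    rw [← integral_mul_const]
    refine norm_integral_le_of_norm_le ((integrable_poly_gauss 4).mul_const _)
      (ae_of_all _ fun ξ => ?_)
    refine (hol _ _).trans ?_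
    rw [add_sub_cancel_left, abs_mul, abs_of_nonneg hσ0, Real.mul_rpow hσ0 (abs_nonneg _)]
    have : |ξ| ^ γ ≤ (|ξ| + 2) ^ 4 := by
      calc |ξ| ^ γ ≤ (|ξ| + 2) ^ γ := by gcongr; linarith
        _ ≤ (|ξ| + 2) ^ (4:ℝ) :=
          Real.rpow_le_rpow_of_exponent_le (by linarith [abs_nonneg ξ]) (by linarith)
        _ = _ := by norm_cast
    calc K * (σ ^ γ * |ξ| ^ γ) = |ξ| ^ γ * (K * σ ^ γ) := by ring
      _ ≤ _ := by gcongr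
  have h3 : heat t h x - h x = (Real.exp (-t) - 1) • h x
      + Real.exp (-t) • (gaussMean (fun _ => 1) σ h x - h x) := by
    unfold heat; module
  rw [h3]
  refine (norm_add_le _ _).trans (add_le_add ?_ ((norm_exp_neg_smul_le ht _).trans h2))
  rw [norm_smul]
  have h4 : Real.exp (-t) ≤ 1 := Real.exp_le_one_iff.2 (by linarith)
  have h5 : 1 - t ≤ Real.exp (-t) := by linarith [Real.add_one_le_exp (-t)]
  have : ‖Real.exp (-t) - 1‖ ≤ t := by rw [Real.norm_eq_abs, abs_le]; constructor <;> linarith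
  exact mul_le_mul this (hB x) (norm_nonneg _) ht

lemma heat_eq_integral_gaussian {t : ℝ} (ht : 0 ≤ t) (h : ℝ → E) (hh : Continuous h) (x : ℝ) :
    heat t h x = Real.exp (-t) •
      ∫ z, h (x + z) ∂(ProbabilityTheory.gaussianReal 0 (2 * Real.toNNReal t)) := by
  unfold heat gaussMean
  congr 1
  have h1 := ProbabilityTheory.gaussianReal_map_const_mul (μ := 0) (v := 1) (Real.sqrt (2 * t))
  have h2 : (NNReal.mk (Real.sqrt (2 * t) ^ 2) (sq_nonneg _)) * 1 = 2 * Real.toNNReal t := by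
    ext
    rw [mul_one, NNReal.coe_mul, Real.coe_toNNReal t ht]
    exact Real.sq_sqrt (by linarith)
  rw [h2, mul_zero] at h1
  rw [← h1, integral_map (by fun_prop)
    (by exact Continuous.aestronglyMeasurable (by fun_prop))]
  simp

/-- The semigroup property: a convolution of Gaussians is Gaussian. -/
lemma heat_heat (hh : Continuous h) (hB : ∀ x, ‖h x‖ ≤ B) {s t : ℝ} (hs : 0 ≤ s) (ht : 0 ≤ t)
    (x : ℝ) : heat t (heat s h) x = heat (t + s) h x := by
  have hc := continuous_heat hh hB s
  rw [heat_eq_integral_gaussian ht _ hc, heat_eq_integral_gaussian (add_nonneg ht hs) _ hh]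
  simp_rw [heat_eq_integral_gaussian hs _ hh]
  rw [integral_smul, smul_smul, ← Real.exp_add, neg_add]
  congr 1
  have h1 := ProbabilityTheory.gaussianReal_conv_gaussianReal (m₁ := 0) (m₂ := 0)
    (v₁ := 2 * Real.toNNReal t) (v₂ := 2 * Real.toNNReal s)
  rw [add_zero, ← mul_add, ← Real.toNNReal_add ht hs] at h1
  rw [← h1, Measure.conv, integral_map (by fun_prop)
    (by exact Continuous.aestronglyMeasurable (by fun_prop)), integral_prod]
  · simp_rw [add_assoc]
  · exact Integrable.mono' (integrable_const B)
      (Continuous.aestronglyMeasurable (by fun_prop)) (ae_of_all _ fun _ => hB _)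

/-- The semigroup commutes with the derivative. -/
lemma heat_dheat (hh : Continuous h) (hB : ∀ x, ‖h x‖ ≤ B) {s t : ℝ} (hs : 0 < s) (ht : 0 ≤ t)
    (x : ℝ) : heat t (dheat s h) x = dheat (t + s) h x := by
  have hc := continuous_heat hh hB s
  have hd := continuous_dheat hh hB s
  have hdB : ∀ x, ‖dheat s h x‖ ≤ (Real.sqrt (2 * s))⁻¹ * (gaussConst * B) := by
    intro x
    refine (norm_exp_neg_smul_le hs.le _).trans ?_
    rw [norm_smul, Real.norm_of_nonneg (inv_nonneg.2 (Real.sqrt_nonneg _))]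
    gcongr
    exact norm_gaussMean_le weight_id hB _ _
  have h1 : HasDerivAt (heat t (heat s h)) (heat t (dheat s h) x) x := by
    refine HasDerivAt.const_smul _ ?_
    refine (hasDerivAt_integral_of_dominated_loc_of_deriv_le (μ := stdGauss) (𝕜 := ℝ)
      (F := fun x ξ => (1:ℝ) • heat s h (x + Real.sqrt (2 * t) * ξ))
      (F' := fun x ξ => (1:ℝ) • dheat s h (x + Real.sqrt (2 * t) * ξ))
      (bound := fun _ => (Real.sqrt (2 * s))⁻¹ * (gaussConst * B))
      (s := univ) univ_mem (Eventually.of_forall fun x' => ?_) ?_ ?_ ?_ (integrable_const _) ?_).2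
    · exact Continuous.aestronglyMeasurable (by fun_prop)
    · exact gaussMean_integrable continuous_const weight_one hc (norm_heat_le hB hs.le) _ x
    · exact Continuous.aestronglyMeasurable (by fun_prop)
    · exact ae_of_all _ fun ξ x' _ => by simpa using hdB _
    · refine ae_of_all _ fun ξ x' _ => ?_
      simp only [one_smul]
      exact (hasDerivAt_heat hh hB hs (x' + Real.sqrt (2 * t) * ξ)).comp_add_const x'
        (Real.sqrt (2 * t) * ξ)
  have h2 : HasDerivAt (heat t (heat s h)) (dheat (t + s) h x) x := by
    have e : heat t (heat s h) = heat (t + s) h := funext fun x => heat_heat hh hB hs.le ht x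
    rw [e]
    exact hasDerivAt_heat hh hB (by linarith) x
  exact h1.unique h2

end Heat

/-! ### Primitives and the Duhamel operator -/

section Periodic

set_option linter.unusedSectionVars false

variable {E : Type*} [NormedAddCommGroup E] [NormedSpace ℝ E] [CompleteSpace E]

lemma two_pi_pos' : (0:ℝ) < 2 * Real.pi := Real.two_pi_pos

lemma two_pi_le_seven : 2 * Real.pi ≤ 7 := by linarith [Real.pi_lt_d2]

lemma one_le_two_pi : 1 ≤ 2 * Real.pi := by linarith [Real.pi_gt_three]

lemma zero_mem_box : (0:ℝ) ∈ box := ⟨le_rfl, two_pi_pos'.le⟩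

lemma two_pi_mem_box : 2 * Real.pi ∈ box := ⟨two_pi_pos'.le, le_rfl⟩

lemma abs_sub_le_of_mem_box {x y : ℝ} (hx : x ∈ box) (hy : y ∈ box) : |x - y| ≤ 2 * Real.pi := by
  rw [abs_le]; constructor <;> linarith [hx.1, hx.2, hy.1, hy.2]

/-- The `2π`-periodic function that agrees with `h` on `[0, 2π)`. -/
noncomputable def perExt (h : ℝ → E) (x : ℝ) : E := h (toIcoMod two_pi_pos' 0 x)

lemma perExt_periodic (h : ℝ → E) : Function.Periodic (perExt h) (2 * Real.pi) := by
  intro x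
  simp [perExt, toIcoMod_add_right]

lemma perExt_eq {h : ℝ → E} (hp : h 0 = h (2 * Real.pi)) {x : ℝ} (hx : x ∈ box) :
    perExt h x = h x := by
  unfold perExt
  rcases eq_or_lt_of_le hx.2 with h1 | h1
  · subst h1
    have : toIcoMod two_pi_pos' 0 (2 * Real.pi) = 0 := by
      simpa using toIcoMod_add_right two_pi_pos' 0 0
    rw [this, hp]
  · rw [(toIcoMod_eq_self two_pi_pos').2 ⟨hx.1, by simpa using h1⟩]

lemma toIcoMod_mem_box (x : ℝ) : toIcoMod two_pi_pos' 0 x ∈ box := by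
  have := toIcoMod_mem_Ico two_pi_pos' 0 x
  exact ⟨this.1, by simpa using this.2.le⟩

lemma norm_perExt_le {h : ℝ → E} {B : ℝ} (hB : ∀ x ∈ box, ‖h x‖ ≤ B) (x : ℝ) :
    ‖perExt h x‖ ≤ B := hB _ (toIcoMod_mem_box x)

/-- A periodic function that is Hölder on one period is Hölder on the line. -/
lemma perExt_holder {h : ℝ → E} (hp : h 0 = h (2 * Real.pi)) {K γ : ℝ} (hK : 0 ≤ K) (hγ : 0 ≤ γ)
    (hol : ∀ x ∈ box, ∀ y ∈ box, ‖h x - h y‖ ≤ K * |x - y| ^ γ) (x y : ℝ) :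
    ‖perExt h x - perExt h y‖ ≤ 2 * K * |x - y| ^ γ := by
  wlog hxy : x ≤ y generalizing x y
  · rw [norm_sub_rev, abs_sub_comm]
    exact this y x (le_of_not_ge hxy)
  set x' := toIcoMod two_pi_pos' 0 x with hx'
  set y' := toIcoMod two_pi_pos' 0 y with hy'
  set k := toIcoDiv two_pi_pos' 0 x with hk
  set l := toIcoDiv two_pi_pos' 0 y with hl
  have ex : x' + k * (2 * Real.pi) = x := by
    have := toIcoMod_add_toIcoDiv_zsmul two_pi_pos' 0 x
    rwa [zsmul_eq_mul] at this
  have ey : y' + l * (2 * Real.pi) = y := by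
    have := toIcoMod_add_toIcoDiv_zsmul two_pi_pos' 0 y
    rwa [zsmul_eq_mul] at this
  have hxm := toIcoMod_mem_box x
  have hym := toIcoMod_mem_box y
  have hylt : y' < 2 * Real.pi := by simpa using (toIcoMod_mem_Ico two_pi_pos' 0 y).2
  have hxlt : x' < 2 * Real.pi := by simpa using (toIcoMod_mem_Ico two_pi_pos' 0 x).2
  rw [← hx'] at hxm; rw [← hy'] at hym
  have hpi := two_pi_pos'
  change ‖h x' - h y'‖ ≤ _
  have hr : 0 ≤ |x - y| ^ γ := by positivity
  rcases lt_trichotomy k l with hkl | hkl | hkl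
  · have h1 : (k:ℝ) + 1 ≤ l := by exact_mod_cast hkl
    have h2 : (2 * Real.pi) * (k + 1) ≤ (2 * Real.pi) * l := by gcongr
    have e : h x' - h y' = (h x' - h (2 * Real.pi)) + (h 0 - h y') := by rw [hp]; abel
    rw [e]
    have a1 : ‖h x' - h (2 * Real.pi)‖ ≤ K * |x - y| ^ γ := by
      refine (hol _ hxm _ two_pi_mem_box).trans ?_
      gcongr K * ?_ ^ γ
      rw [abs_sub_comm, abs_sub_comm x y, abs_of_nonneg (by linarith), abs_of_nonneg (by linarith)]
      linarith [hym.1]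
    have a2 : ‖h 0 - h y'‖ ≤ K * |x - y| ^ γ := by
      refine (hol _ zero_mem_box _ hym).trans ?_
      gcongr K * ?_ ^ γ
      rw [abs_sub_comm, abs_sub_comm x y, abs_of_nonneg (by linarith [hym.1]),
        abs_of_nonneg (by linarith)]
      linarith
    refine (norm_add_le _ _).trans ?_
    linarith
  · have : |x' - y'| = |x - y| := by rw [← ex, ← ey, hkl]; ring_nf
    refine (hol _ hxm _ hym).trans ?_
    rw [this]; nlinarith
  · exfalso
    have h1 : (l:ℝ) + 1 ≤ k := by exact_mod_cast hkl
    have h2 : (2 * Real.pi) * (l + 1) ≤ (2 * Real.pi) * k := by gcongr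
    linarith [hxm.1]

lemma continuous_of_holder {h : ℝ → E} {K γ : ℝ} (hγ : 0 < γ)
    (hol : ∀ x y, ‖h x - h y‖ ≤ K * |x - y| ^ γ) : Continuous h := by
  rw [continuous_iff_continuousAt]
  intro x
  rw [ContinuousAt, tendsto_iff_norm_sub_tendsto_zero]
  refine squeeze_zero (fun _ => norm_nonneg _) (fun y => hol y x) ?_
  have : Continuous fun y : ℝ => K * |y - x| ^ γ := by
    refine continuous_const.mul (Continuous.rpow_const (by fun_prop) fun _ => Or.inr hγ.le)
  simpa [hγ.ne'] using this.tendsto x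

lemma rpow_le_two_pi {γ r : ℝ} (hγ : 0 ≤ γ) (hγ1 : γ ≤ 1) (hr : 0 ≤ r) (hr2 : r ≤ 2 * Real.pi) :
    r ^ γ ≤ 7 := by
  calc r ^ γ ≤ (2 * Real.pi) ^ γ := by gcongr
    _ ≤ (2 * Real.pi) ^ (1:ℝ) := Real.rpow_le_rpow_of_exponent_le one_le_two_pi hγ1
    _ ≤ 7 := by simpa using two_pi_le_seven

/-- On `[0, 2π]`, a larger Hölder exponent controls a smaller one. -/
lemma rpow_exponent_le {γ δ r : ℝ} (hγδ : γ ≤ δ) (hδ : δ ≤ γ + 1) (hr : 0 ≤ r)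
    (hr2 : r ≤ 2 * Real.pi) (hγ0 : 0 < δ) : r ^ δ ≤ 7 * r ^ γ := by
  rcases hr.eq_or_lt with rfl | hr0
  · rw [Real.zero_rpow hγ0.ne']; positivity
  · have : r ^ δ = r ^ (δ - γ) * r ^ γ := by rw [← Real.rpow_add hr0]; ring_nf
    rw [this]
    gcongr
    exact rpow_le_two_pi (by linarith) (by linarith) hr hr2

/-- `H` vanishes at `0` and is `α`-Hölder on `[0, 2π]` with constant `K`. Such an `H` stands for its
distributional derivative on the circle, which has regularity `α - 1`; a jump `H (2π) ≠ 0` is the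
total mass of this distribution. -/
def IsPrimitive (α K : ℝ) (H : ℝ → E) : Prop :=
  H 0 = 0 ∧ ∀ x ∈ box, ∀ y ∈ box, ‖H x - H y‖ ≤ K * |x - y| ^ α

/-- `H` minus its linear interpolation between `0` and `2π`, which makes it periodic. -/
noncomputable def bridge (H : ℝ → E) (y : ℝ) : E := H y - (y / (2 * Real.pi)) • H (2 * Real.pi)

/-- `duhamel τ H` is the derivative of the semigroup at time `τ` applied to the (not periodic)
primitive `H`, i.e. the semigroup applied to the distributional derivative of `H` on the circle.
The linear part of `H` contributes a constant. -/
noncomputable def duhamel (τ : ℝ) (H : ℝ → E) (x : ℝ) : E :=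
  dheat τ (perExt (bridge H)) x + (Real.exp (-τ) / (2 * Real.pi)) • H (2 * Real.pi)

/-- The spatial derivative of `duhamel τ H`. -/
noncomputable def dduhamel (τ : ℝ) (H : ℝ → E) (x : ℝ) : E := ddheat τ (perExt (bridge H)) x

variable {α K : ℝ} {H : ℝ → E}

lemma bridge_zero (h0 : H 0 = 0) : bridge H 0 = bridge H (2 * Real.pi) := by
  simp [bridge, h0]

lemma IsPrimitive.nonneg (hH : IsPrimitive α K H) : 0 ≤ K := by
  have h1 := (norm_nonneg _).trans (hH.2 _ zero_mem_box _ two_pi_mem_box)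
  have h2 : 0 < |0 - 2 * Real.pi| ^ α := by
    apply Real.rpow_pos_of_pos; rw [zero_sub, abs_neg]; exact abs_pos.2 two_pi_pos'.ne'
  exact nonneg_of_mul_nonneg_left h1 h2

lemma IsPrimitive.norm_end_le (hH : IsPrimitive α K H) :
    ‖H (2 * Real.pi)‖ ≤ K * (2 * Real.pi) ^ α := by
  have := hH.2 _ two_pi_mem_box _ zero_mem_box
  rwa [hH.1, sub_zero, sub_zero, abs_of_pos two_pi_pos'] at this

lemma IsPrimitive.bridge_holder (hH : IsPrimitive α K H) (hα1 : α ≤ 1) (x : ℝ)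
    (hx : x ∈ box) (y : ℝ) (hy : y ∈ box) :
    ‖bridge H x - bridge H y‖ ≤ (2 * K) * |x - y| ^ α := by
  have e : bridge H x - bridge H y
      = (H x - H y) - ((x - y) / (2 * Real.pi)) • H (2 * Real.pi) := by
    unfold bridge; module
  rw [e]
  have h1 := hH.2 x hx y hy
  have hK := hH.nonneg
  have h2 : ‖((x - y) / (2 * Real.pi)) • H (2 * Real.pi)‖ ≤ K * |x - y| ^ α := by
    rw [norm_smul, norm_div, Real.norm_eq_abs, Real.norm_of_nonneg two_pi_pos'.le]
    have h3 : |x - y| / (2 * Real.pi) ≤ (|x - y| / (2 * Real.pi)) ^ α := by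
      have h4 : |x - y| / (2 * Real.pi) ≤ 1 := by
        rw [div_le_one two_pi_pos']; exact abs_sub_le_of_mem_box hx hy
      calc |x - y| / (2 * Real.pi) = (|x - y| / (2 * Real.pi)) ^ (1:ℝ) := by simp
        _ ≤ _ := Real.rpow_le_rpow_of_exponent_ge_of_imp (by positivity) h4 hα1
            (fun _ h => absurd h one_ne_zero)
    calc _ ≤ (|x - y| / (2 * Real.pi)) ^ α * (K * (2 * Real.pi) ^ α) := by
          gcongr; exact hH.norm_end_le
      _ = K * |x - y| ^ α := by
          rw [Real.div_rpow (abs_nonneg _) two_pi_pos'.le]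
          have : (2 * Real.pi) ^ α ≠ 0 := (Real.rpow_pos_of_pos two_pi_pos' _).ne'
          field_simp
  refine (norm_sub_le _ _).trans ?_
  linarith

lemma IsPrimitive.perExt_holder (hH : IsPrimitive α K H) (hα : 0 < α) (hα1 : α ≤ 1) (x y : ℝ) :
    ‖perExt (bridge H) x - perExt (bridge H) y‖ ≤ (4 * K) * |x - y| ^ α := by
  have := RoughBurgers.perExt_holder (bridge_zero hH.1) (by linarith [hH.nonneg]) hα.le
    (hH.bridge_holder hα1) x y
  linarith

lemma IsPrimitive.continuous_perExt (hH : IsPrimitive α K H) (hα : 0 < α) (hα1 : α ≤ 1) :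
    Continuous (perExt (bridge H)) := continuous_of_holder hα (hH.perExt_holder hα hα1)

lemma IsPrimitive.norm_perExt_le (hH : IsPrimitive α K H) (hα : 0 < α) (hα1 : α ≤ 1) (x : ℝ) :
    ‖perExt (bridge H) x‖ ≤ 14 * K := by
  refine RoughBurgers.norm_perExt_le (fun x hx => ?_) x
  have h1 := hH.bridge_holder hα1 x hx 0 zero_mem_box
  have h2 : bridge H 0 = 0 := by simp [bridge, hH.1]
  rw [h2, sub_zero, sub_zero] at h1
  have h3 : |x| ^ α ≤ 7 := rpow_le_two_pi hα.le hα1 (abs_nonneg _)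
    (by simpa using abs_sub_le_of_mem_box hx zero_mem_box)
  nlinarith [hH.nonneg]

lemma hasDerivAt_duhamel (hH : IsPrimitive α K H) (hα : 0 < α) (hα1 : α ≤ 1) {τ : ℝ} (hτ : 0 < τ)
    (x : ℝ) : HasDerivAt (duhamel τ H) (dduhamel τ H x) x :=
  (hasDerivAt_dheat (hH.continuous_perExt hα hα1) (hH.norm_perExt_le hα hα1) hτ x).add_const _

lemma continuous_dduhamel (hH : IsPrimitive α K H) (hα : 0 < α) (hα1 : α ≤ 1) (τ : ℝ) :
    Continuous (dduhamel τ H) :=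
  continuous_ddheat (hH.continuous_perExt hα hα1) (hH.norm_perExt_le hα hα1) τ

lemma duhamel_periodic (τ : ℝ) (H : ℝ → E) : Function.Periodic (duhamel τ H) (2 * Real.pi) := by
  intro x
  unfold duhamel
  rw [dheat_periodic (perExt_periodic _)]

lemma exp_neg_le_rpow {τ γ : ℝ} (hτ : 0 < τ) (hγ : 0 ≤ γ) (hγ1 : γ ≤ 1) :
    Real.exp (-τ) ≤ τ ^ (-γ) := by
  have h1 : τ ^ γ ≤ Real.exp τ := by
    rcases le_total τ 1 with h | h
    · exact (Real.rpow_le_one hτ.le h hγ).trans (Real.one_le_exp hτ.le)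
    · calc τ ^ γ ≤ τ ^ (1:ℝ) := Real.rpow_le_rpow_of_exponent_le h hγ1
        _ ≤ Real.exp τ := by rw [Real.rpow_one]; linarith [Real.add_one_le_exp τ]
  rw [Real.exp_neg, Real.rpow_neg hτ.le]
  exact inv_anti₀ (Real.rpow_pos_of_pos hτ _) h1

/-- Gain of regularity: `duhamel τ` maps `α`-Hölder primitives to bounded functions. -/
lemma norm_duhamel_le (hH : IsPrimitive α K H) (hα : 0 < α) (hα1 : α ≤ 1) {τ : ℝ} (hτ : 0 < τ)
    (x : ℝ) : ‖duhamel τ H x‖ ≤ 5 * gaussConst * K * τ ^ ((α - 1) / 2) := by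
  have hK := hH.nonneg
  have h1 := norm_dheat_le (hH.continuous_perExt hα hα1) (hH.norm_perExt_le hα hα1)
    (by linarith) hα.le hα1 (hH.perExt_holder hα hα1) hτ x
  have h2 : ‖(Real.exp (-τ) / (2 * Real.pi)) • H (2 * Real.pi)‖ ≤ K * τ ^ ((α - 1) / 2) := by
    rw [norm_smul, norm_div, Real.norm_of_nonneg (Real.exp_pos _).le,
      Real.norm_of_nonneg two_pi_pos'.le]
    have h3 := exp_neg_le_rpow hτ (γ := (1 - α) / 2) (by linarith) (by linarith)
    rw [show -((1 - α) / 2) = (α - 1) / 2 by ring] at h3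
    have h4 : (2 * Real.pi) ^ α ≤ 2 * Real.pi := by
      simpa using Real.rpow_le_rpow_of_exponent_le one_le_two_pi hα1
    calc _ ≤ Real.exp (-τ) / (2 * Real.pi) * (K * (2 * Real.pi)) := by
          gcongr
          exact hH.norm_end_le.trans (by gcongr)
      _ = K * Real.exp (-τ) := by field_simp
      _ ≤ _ := by gcongr
  have h5 : K * τ ^ ((α - 1) / 2) ≤ gaussConst * K * τ ^ ((α - 1) / 2) := by
    gcongr; nlinarith [one_le_gaussConst]
  unfold duhamel
  refine (norm_add_le _ _).trans ?_
  nlinarith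

lemma norm_dduhamel_le (hH : IsPrimitive α K H) (hα : 0 < α) (hα1 : α ≤ 1) {τ : ℝ} (hτ : 0 < τ)
    (x : ℝ) : ‖dduhamel τ H x‖ ≤ 4 * gaussConst * K * τ ^ (α / 2 - 1) := by
  have hK := hH.nonneg
  have h1 := norm_ddheat_le (hH.continuous_perExt hα hα1) (hH.norm_perExt_le hα hα1)
    (by linarith) hα.le hα1 (hH.perExt_holder hα hα1) hτ x
  unfold dduhamel
  linarith

lemma norm_sub_le_of_deriv_le {F F' : ℝ → E} (hd : ∀ x, HasDerivAt F (F' x) x) {C : ℝ}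
    (hC : ∀ x, ‖F' x‖ ≤ C) (x y : ℝ) : ‖F x - F y‖ ≤ C * |x - y| := by
  have := Convex.norm_image_sub_le_of_norm_hasDerivWithin_le (s := univ)
    (fun x _ => (hd x).hasDerivWithinAt) (fun x _ => hC x) convex_univ (mem_univ y) (mem_univ x)
  simpa using this

/-- `duhamel τ` maps `α`-Hölder primitives to Lipschitz functions. -/
lemma norm_duhamel_sub_le (hH : IsPrimitive α K H) (hα : 0 < α) (hα1 : α ≤ 1) {τ : ℝ} (hτ : 0 < τ)
    (x y : ℝ) : ‖duhamel τ H x - duhamel τ H y‖ ≤ 4 * gaussConst * K * τ ^ (α / 2 - 1) * |x - y| :=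
  norm_sub_le_of_deriv_le (hasDerivAt_duhamel hH hα hα1 hτ) (norm_dduhamel_le hH hα hα1 hτ) x y

lemma le_interpolate {z a b γ : ℝ} (hz : 0 ≤ z) (ha : z ≤ a) (hb : z ≤ b) (hγ : 0 ≤ γ)
    (hγ1 : γ ≤ 1) : z ≤ a ^ (1 - γ) * b ^ γ := by
  have ha0 := hz.trans ha
  have hb0 := hz.trans hb
  rcases hz.eq_or_lt with rfl | h
  · positivity
  calc z = z ^ (1 - γ) * z ^ γ := by rw [← Real.rpow_add h]; simp
    _ ≤ _ := by gcongr

/-- Interpolation between the uniform and the Lipschitz bound. -/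
lemma norm_duhamel_sub_le_holder (hH : IsPrimitive α K H) (hα : 0 < α) (hα1 : α ≤ 1) {β : ℝ}
    (hβ : 0 ≤ β) (hβ1 : β ≤ 1) {τ : ℝ} (hτ : 0 < τ) (x y : ℝ) :
    ‖duhamel τ H x - duhamel τ H y‖
      ≤ 10 * gaussConst * K * τ ^ ((α - 1 - β) / 2) * |x - y| ^ β := by
  have hK := hH.nonneg
  have hG := gaussConst_pos
  have h1 : ‖duhamel τ H x - duhamel τ H y‖ ≤ (10 * gaussConst * K) * τ ^ ((α - 1) / 2) := by
    refine (norm_sub_le _ _).trans ?_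
    have := norm_duhamel_le hH hα hα1 hτ x
    have := norm_duhamel_le hH hα hα1 hτ y
    linarith
  have h2 : ‖duhamel τ H x - duhamel τ H y‖
      ≤ (10 * gaussConst * K) * (τ ^ (α / 2 - 1) * |x - y|) := by
    refine (norm_duhamel_sub_le hH hα hα1 hτ x y).trans ?_
    rw [mul_assoc]
    gcongr; norm_num
  refine (le_interpolate (norm_nonneg _) h1 h2 hβ hβ1).trans (le_of_eq ?_)
  have hc : 0 ≤ 10 * gaussConst * K := by positivity
  generalize 10 * gaussConst * K = c at hc
  rw [Real.mul_rpow hc (by positivity), Real.mul_rpow hc (by positivity),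
    Real.mul_rpow (by positivity) (by positivity), ← Real.rpow_mul hτ.le, ← Real.rpow_mul hτ.le]
  have e1 : c = c ^ (1 - β) * c ^ β := by
    rcases hc.eq_or_lt with h | h
    · rw [← h]
      by_cases hb : β = 0
      · simp [hb]
      · simp [Real.zero_rpow hb]
    · rw [← Real.rpow_add h]; simp
  have e2 : τ ^ ((α - 1 - β) / 2) = τ ^ ((α - 1) / 2 * (1 - β)) * τ ^ ((α / 2 - 1) * β) := by
    rw [← Real.rpow_add hτ]; ring_nf
  rw [e2]
  nth_rewrite 3 [e1]
  ring

lemma perExt_sub (h k : ℝ → E) : perExt (fun y => h y - k y) = fun y => perExt h y - perExt k y :=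
  rfl

lemma duhamel_sub {K' : ℝ} {H' : ℝ → E} (hH : IsPrimitive α K H) (hH' : IsPrimitive α K' H')
    (hα : 0 < α) (hα1 : α ≤ 1) (τ x : ℝ) :
    duhamel τ (fun y => H y - H' y) x = duhamel τ H x - duhamel τ H' x := by
  have e : bridge (fun y => H y - H' y) = fun y => bridge H y - bridge H' y := by
    funext y; unfold bridge; module
  unfold duhamel
  rw [e, perExt_sub, dheat_sub_apply (hH.continuous_perExt hα hα1) (hH.norm_perExt_le hα hα1)
    (hH'.continuous_perExt hα hα1) (hH'.norm_perExt_le hα hα1)]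
  module

lemma heat_add_const {h : ℝ → E} {B : ℝ} (hh : Continuous h) (hB : ∀ x, ‖h x‖ ≤ B) (t : ℝ) (c : E)
    (x : ℝ) : heat t (fun y => h y + c) x = heat t h x + Real.exp (-t) • c := by
  have := heat_sub_apply hh hB (continuous_const (y := -c)) (fun _ => le_rfl) t x
  simp only [sub_neg_eq_add] at this
  rw [this, heat_const]
  simp

/-- The semigroup property for `duhamel`, the basis for restarting the integral equation. -/
lemma heat_duhamel (hH : IsPrimitive α K H) (hα : 0 < α) (hα1 : α ≤ 1) {r τ : ℝ} (hr : 0 ≤ r)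
    (hτ : 0 < τ) (x : ℝ) : heat r (duhamel τ H) x = duhamel (r + τ) H x := by
  have h1 : ∀ x, ‖dheat τ (perExt (bridge H)) x‖ ≤ gaussConst * (4 * K) * τ ^ ((α - 1) / 2) :=
    norm_dheat_le (hH.continuous_perExt hα hα1) (hH.norm_perExt_le hα hα1)
      (by linarith [hH.nonneg]) hα.le hα1 (hH.perExt_holder hα hα1) hτ
  unfold duhamel
  rw [heat_add_const (continuous_dheat (hH.continuous_perExt hα hα1)
    (hH.norm_perExt_le hα hα1) τ) h1,
    heat_dheat (hH.continuous_perExt hα hα1) (hH.norm_perExt_le hα hα1) hτ hr, smul_smul,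
    neg_add, Real.exp_add, mul_div_assoc]

lemma IsPrimitive.mono {K' : ℝ} (hH : IsPrimitive α K H) (hK : K ≤ K') : IsPrimitive α K' H :=
  ⟨hH.1, fun x hx y hy => (hH.2 x hx y hy).trans (by gcongr)⟩

end Periodic

/-! ### The sewing lemma -/

section Sewing

set_option linter.unusedSectionVars false

variable {E : Type*} [NormedAddCommGroup E] [NormedSpace ℝ E] [CompleteSpace E]

/-- `Ξ` is almost additive on `[0, 2π]`, with defect of order `p`. -/
def IsGerm (p K : ℝ) (Ξ : ℝ → ℝ → E) : Prop :=
  ∀ x y z, 0 ≤ x → x ≤ y → y ≤ z → z ≤ 2 * Real.pi → ‖Ξ x z - Ξ x y - Ξ y z‖ ≤ K * (z - x) ^ p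

/-- The dyadic points of level `N` of `[0, 2π]`. -/
noncomputable def dyadic (N i : ℕ) : ℝ := 2 * Real.pi * i / 2 ^ N

/-- Truncation to `[a, b]`. -/
noncomputable def trunc (a b z : ℝ) : ℝ := max a (min z b)

/-- The Riemann sum of `Ξ` over the dyadic partition of level `N` of `[0, 2π]`, truncated to
`[a, b]`. -/
noncomputable def sewSum (Ξ : ℝ → ℝ → E) (N : ℕ) (a b : ℝ) : E :=
  ∑ i ∈ Finset.range (2 ^ N), Ξ (trunc a b (dyadic N i)) (trunc a b (dyadic N (i + 1)))

/-- The additive function with increments close to `Ξ`. The limit exists for germs of order `p > 1`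
(`tendsto_sew`); otherwise the value is arbitrary. -/
noncomputable def sew (Ξ : ℝ → ℝ → E) (x : ℝ) : E := limUnder atTop fun N => sewSum Ξ N 0 x

/-- The constant of the sewing lemma. -/
noncomputable def sewConst (p : ℝ) : ℝ :=
  (2 * Real.pi) ^ ((p - 1) / 2) / (1 - (1 / 2) ^ ((p - 1) / 2))

lemma dyadic_zero (N : ℕ) : dyadic N 0 = 0 := by simp [dyadic]

lemma dyadic_last (N : ℕ) : dyadic N (2 ^ N) = 2 * Real.pi := by
  simp [dyadic]

lemma dyadic_succ_even (N i : ℕ) : dyadic (N + 1) (2 * i) = dyadic N i := by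
  unfold dyadic; push_cast; rw [pow_succ]; field_simp

lemma dyadic_step (N i : ℕ) : dyadic N (i + 1) - dyadic N i = 2 * Real.pi / 2 ^ N := by
  unfold dyadic; push_cast; field_simp; ring

lemma dyadic_nonneg (N i : ℕ) : 0 ≤ dyadic N i := by
  unfold dyadic; have := two_pi_pos'; positivity

lemma dyadic_mono (N : ℕ) : Monotone (dyadic N) := by
  intro i j hij
  unfold dyadic
  have := two_pi_pos'
  gcongr

lemma dyadic_le (N : ℕ) {i : ℕ} (hi : i ≤ 2 ^ N) : dyadic N i ≤ 2 * Real.pi :=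
  dyadic_last N ▸ dyadic_mono N hi

lemma trunc_mono (a b : ℝ) : Monotone (trunc a b) := fun x y h => by
  unfold trunc; gcongr

lemma trunc_ge (a b z : ℝ) : a ≤ trunc a b z := le_max_left _ _

lemma trunc_le {a b : ℝ} (h : a ≤ b) (z : ℝ) : trunc a b z ≤ b := max_le h (min_le_right _ _)

lemma trunc_sub_le (a b : ℝ) {x y : ℝ} (h : x ≤ y) : trunc a b y - trunc a b x ≤ y - x := by
  unfold trunc
  rcases le_total y b with h1 | h1 <;> rcases le_total x b with h2 | h2 <;>
  rcases le_total a y with h3 | h3 <;> rcases le_total a x with h4 | h4 <;>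
  rcases le_total a b with h5 | h5 <;> simp [*] <;> linarith

lemma sum_range_two_mul (f : ℕ → E) (n : ℕ) :
    ∑ i ∈ Finset.range (2 * n), f i = ∑ i ∈ Finset.range n, (f (2 * i) + f (2 * i + 1)) := by
  induction n with
  | zero => simp
  | succ n ih =>
    rw [show 2 * (n + 1) = 2 * n + 1 + 1 by ring, Finset.sum_range_succ, Finset.sum_range_succ, ih,
      Finset.sum_range_succ]
    abel

variable {p K : ℝ} {Ξ : ℝ → ℝ → E}

lemma IsGerm.self (h : IsGerm p K Ξ) (hp : 1 < p) {x : ℝ} (hx : x ∈ box) : Ξ x x = 0 := by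
  have := h x x x hx.1 le_rfl le_rfl hx.2
  rw [sub_self, sub_self, Real.zero_rpow (by linarith), mul_zero, zero_sub, norm_neg] at this
  exact norm_le_zero_iff.1 this

lemma IsGerm.nonneg (h : IsGerm p K Ξ) : 0 ≤ K := by
  have h1 := (norm_nonneg _).trans (h 0 0 (2 * Real.pi) le_rfl le_rfl two_pi_pos'.le le_rfl)
  exact nonneg_of_mul_nonneg_left h1 (Real.rpow_pos_of_pos (by linarith [two_pi_pos']) _)

lemma sewSum_zero {a b : ℝ} (ha : 0 ≤ a) (hab : a ≤ b) (hb : b ≤ 2 * Real.pi) :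
    sewSum Ξ 0 a b = Ξ a b := by
  have h1 : dyadic 0 1 = 2 * Real.pi := by simp [dyadic]
  simp [sewSum, dyadic_zero, h1, trunc, hb, hab, ha, ha.trans hab]

/-- Passing from level `N` to level `N + 1` halves every dyadic interval. For an interval of length
`ℓ`, the defect `ℓ ^ p` is split as `ℓ ^ ((p-1)/2) * ℓ ^ ((p-1)/2) * ℓ`: the first factor decays in
the level, the second is bounded by the length of `[a, b]`, and the last sums to this length. -/
lemma norm_sewSum_sub_le (h : IsGerm p K Ξ) (hp : 1 < p) {a b : ℝ} (ha : 0 ≤ a) (hab : a ≤ b)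
    (hb : b ≤ 2 * Real.pi) (N : ℕ) :
    ‖sewSum Ξ N a b - sewSum Ξ (N + 1) a b‖
      ≤ K * (2 * Real.pi / 2 ^ N) ^ ((p - 1) / 2) * (b - a) ^ ((1 + p) / 2) := by
  have hK := h.nonneg
  set t := trunc a b
  have htm : ∀ N, Monotone fun i => t (dyadic N i) := fun N => (trunc_mono a b).comp (dyadic_mono N)
  unfold sewSum
  rw [pow_succ, mul_comm (2 ^ N) 2, sum_range_two_mul, ← Finset.sum_sub_distrib]
  have key : ∀ i ∈ Finset.range (2 ^ N),
      ‖Ξ (t (dyadic N i)) (t (dyadic N (i + 1)))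
        - (Ξ (t (dyadic (N + 1) (2 * i))) (t (dyadic (N + 1) (2 * i + 1)))
          + Ξ (t (dyadic (N + 1) (2 * i + 1))) (t (dyadic (N + 1) (2 * i + 1 + 1))))‖
      ≤ K * (2 * Real.pi / 2 ^ N) ^ ((p - 1) / 2) * (b - a) ^ ((p - 1) / 2)
        * (t (dyadic N (i + 1)) - t (dyadic N i)) := by
    intro i _
    have e1 := dyadic_succ_even N i
    have e2 : dyadic (N + 1) (2 * i + 1 + 1) = dyadic N (i + 1) := by
      rw [← dyadic_succ_even N (i + 1)]; ring_nf
    have m1 := htm (N + 1) (Nat.le_succ (2 * i))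
    have m2 := htm (N + 1) (Nat.le_succ (2 * i + 1))
    simp only [Nat.succ_eq_add_one] at m1 m2
    rw [e1] at m1 ⊢
    rw [e2] at m2 ⊢
    rw [← sub_sub]
    refine (h _ _ _ (ha.trans (trunc_ge _ _ _)) m1 m2 ((trunc_le hab _).trans hb)).trans ?_
    set ℓ := t (dyadic N (i + 1)) - t (dyadic N i) with hℓ
    have hℓ0 : 0 ≤ ℓ := by linarith
    have h1 : ℓ ≤ 2 * Real.pi / 2 ^ N := by
      rw [← dyadic_step N i]; exact trunc_sub_le _ _ (dyadic_mono N (Nat.le_succ i))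
    have h2 : ℓ ≤ b - a := by
      have := trunc_ge a b (dyadic N i)
      have := trunc_le hab (dyadic N (i + 1))
      linarith
    rcases hℓ0.eq_or_lt with h0 | h0
    · rw [← h0, Real.zero_rpow (by linarith)]; simp
    · have e : ℓ ^ p = ℓ ^ ((p - 1) / 2) * ℓ ^ ((p - 1) / 2) * ℓ := by
        nth_rewrite 4 [← Real.rpow_one ℓ]
        rw [← Real.rpow_add h0, ← Real.rpow_add h0]; ring_nf
      rw [e]
      have hq : 0 ≤ (p - 1) / 2 := by linarith
      calc K * (ℓ ^ ((p - 1) / 2) * ℓ ^ ((p - 1) / 2) * ℓ)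
          ≤ K * ((2 * Real.pi / 2 ^ N) ^ ((p - 1) / 2) * (b - a) ^ ((p - 1) / 2) * ℓ) := by gcongr
        _ = _ := by ring
  refine (norm_sum_le_of_le _ key).trans (le_of_eq ?_)
  rw [← Finset.mul_sum, Finset.sum_range_sub (fun i => t (dyadic N i)), dyadic_zero, dyadic_last]
  have e1 : t 0 = a := by simp [t, trunc, ha, ha.trans hab]
  have e2 : t (2 * Real.pi) = b := by simp [t, trunc, hb, hab]
  rw [e1, e2, mul_assoc]
  congr 1
  rcases hab.eq_or_lt with h0 | h0
  · rw [h0, sub_self, mul_zero, Real.zero_rpow (by linarith)]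
  · nth_rewrite 2 [← Real.rpow_one (b - a)]
    rw [← Real.rpow_add (by linarith)]; ring_nf

lemma half_rpow_lt_one (hp : 1 < p) : ((1:ℝ) / 2) ^ ((p - 1) / 2) < 1 :=
  Real.rpow_lt_one (by norm_num) (by norm_num) (by linarith)

lemma sewConst_pos (hp : 1 < p) : 0 < sewConst p :=
  div_pos (Real.rpow_pos_of_pos two_pi_pos' _) (by linarith [half_rpow_lt_one hp])

lemma dist_sewSum_le (h : IsGerm p K Ξ) (hp : 1 < p) {a b : ℝ} (ha : 0 ≤ a) (hab : a ≤ b)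
    (hb : b ≤ 2 * Real.pi) (N : ℕ) :
    dist (sewSum Ξ N a b) (sewSum Ξ (N + 1) a b)
      ≤ K * (2 * Real.pi) ^ ((p - 1) / 2) * (b - a) ^ ((1 + p) / 2)
        * (((1:ℝ) / 2) ^ ((p - 1) / 2)) ^ N := by
  rw [dist_eq_norm]
  refine (norm_sewSum_sub_le h hp ha hab hb N).trans (le_of_eq ?_)
  have : (2 * Real.pi / 2 ^ N) = 2 * Real.pi * ((1:ℝ) / 2) ^ N := by
    rw [one_div, inv_pow, div_eq_mul_inv]
  rw [this, Real.mul_rpow two_pi_pos'.le (by positivity), ← Real.rpow_natCast,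
    ← Real.rpow_natCast, ← Real.rpow_mul (by norm_num), ← Real.rpow_mul (by norm_num),
    mul_comm (N:ℝ)]
  ring

lemma sewSum_cauchy (h : IsGerm p K Ξ) (hp : 1 < p) {a b : ℝ} (ha : 0 ≤ a) (hab : a ≤ b)
    (hb : b ≤ 2 * Real.pi) : CauchySeq fun N => sewSum Ξ N a b :=
  cauchySeq_of_le_geometric _ _ (half_rpow_lt_one hp) (dist_sewSum_le h hp ha hab hb)

lemma norm_limit_sub_le (h : IsGerm p K Ξ) (hp : 1 < p) {a b : ℝ} (ha : 0 ≤ a) (hab : a ≤ b)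
    (hb : b ≤ 2 * Real.pi) {l : E} (hl : Tendsto (fun N => sewSum Ξ N a b) atTop (𝓝 l)) :
    ‖l - Ξ a b‖ ≤ sewConst p * K * (b - a) ^ ((1 + p) / 2) := by
  have := dist_le_of_le_geometric_of_tendsto₀ _ _ (half_rpow_lt_one hp)
    (dist_sewSum_le h hp ha hab hb) hl
  rw [sewSum_zero ha hab hb, dist_comm, dist_eq_norm] at this
  refine this.trans (le_of_eq ?_)
  unfold sewConst; ring

lemma tendsto_sew (h : IsGerm p K Ξ) (hp : 1 < p) {x : ℝ} (hx : x ∈ box) :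
    Tendsto (fun N => sewSum Ξ N 0 x) atTop (𝓝 (sew Ξ x)) :=
  (sewSum_cauchy h hp le_rfl hx.1 hx.2).tendsto_limUnder

/-- The sums are additive in the limit: only the dyadic interval that contains `x` contributes to the
defect. -/
lemma norm_sewSum_split_le (h : IsGerm p K Ξ) (hp : 1 < p) {x y : ℝ} (hx : 0 ≤ x) (hxy : x ≤ y)
    (hy : y ≤ 2 * Real.pi) (N : ℕ) :
    ‖sewSum Ξ N 0 y - sewSum Ξ N 0 x - sewSum Ξ N x y‖
      ≤ K * (2 * Real.pi) ^ p * (((1:ℝ) / 2) ^ (p - 1)) ^ N := by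
  have hK := h.nonneg
  have hpi := two_pi_pos'
  unfold sewSum
  rw [← Finset.sum_sub_distrib, ← Finset.sum_sub_distrib]
  have key : ∀ i ∈ Finset.range (2 ^ N),
      ‖Ξ (trunc 0 y (dyadic N i)) (trunc 0 y (dyadic N (i + 1)))
        - Ξ (trunc 0 x (dyadic N i)) (trunc 0 x (dyadic N (i + 1)))
        - Ξ (trunc x y (dyadic N i)) (trunc x y (dyadic N (i + 1)))‖
      ≤ K * (2 * Real.pi / 2 ^ N) ^ p := by
    intro i hi
    have hi' : i + 1 ≤ 2 ^ N := Finset.mem_range.1 hi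
    have ha := dyadic_nonneg N i
    have hb := dyadic_le N hi'
    have hst := dyadic_step N i
    have hab := dyadic_mono N (Nat.le_succ i)
    simp only [Nat.succ_eq_add_one] at hab
    generalize dyadic N i = a at *
    generalize dyadic N (i + 1) = b at *
    have hx' : Ξ x x = 0 := h.self hp ⟨hx, hxy.trans hy⟩
    have hr : 0 ≤ K * (2 * Real.pi / 2 ^ N) ^ p := by positivity
    unfold trunc
    rcases le_total b x with h1 | h1
    · have h2 : a ≤ x := hab.trans h1
      rw [min_eq_left (h2.trans hxy), min_eq_left (h1.trans hxy), min_eq_left h2, min_eq_left h1,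
        max_eq_left h2, max_eq_left h1, hx']
      simpa using hr
    rcases le_total x a with h2 | h2
    · have hx0 : max 0 x = x := max_eq_right hx
      have m1 : 0 ≤ min a y := le_min ha (hx.trans hxy)
      have m2 : 0 ≤ min b y := le_min (ha.trans hab) (hx.trans hxy)
      rw [min_eq_right h2, min_eq_right h1, hx0, hx', max_eq_right m1, max_eq_right m2,
        max_eq_right (le_min h2 hxy), max_eq_right (le_min h1 hxy)]
      simpa using hr
    · have m2 : x ≤ min b y := le_min h1 hxy
      rw [min_eq_left (h2.trans hxy), max_eq_right ha, max_eq_right (hx.trans m2), min_eq_left h2,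
        max_eq_right ha, min_eq_right h1, max_eq_right hx, max_eq_left h2, max_eq_right m2]
      refine (h a x (min b y) ha h2 m2 ((min_le_right _ _).trans hy)).trans ?_
      have h3 : min b y - a ≤ 2 * Real.pi / 2 ^ N := by
        rw [← hst]; linarith [min_le_left b y]
      have h4 : 0 ≤ min b y - a := by linarith
      gcongr
  refine (norm_sum_le_of_le _ key).trans (le_of_eq ?_)
  rw [Finset.sum_const, Finset.card_range, nsmul_eq_mul]
  have e : (2 * Real.pi / 2 ^ N) = 2 * Real.pi * ((1:ℝ) / 2) ^ N := by
    rw [one_div, inv_pow, div_eq_mul_inv]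
  have e2 : (((1:ℝ) / 2) ^ N) ^ p = (((1:ℝ) / 2) ^ (p - 1)) ^ N * (1 / 2) ^ N := by
    rw [← Real.rpow_natCast, ← Real.rpow_natCast, ← Real.rpow_mul (by norm_num),
      ← Real.rpow_mul (by norm_num), ← Real.rpow_add (by norm_num)]
    ring_nf
  rw [e, Real.mul_rpow hpi.le (by positivity), e2]
  push_cast
  have : (2:ℝ) ^ N * (1 / 2) ^ N = 1 := by rw [← mul_pow]; norm_num
  linear_combination (K * (2 * Real.pi) ^ p * (((1:ℝ) / 2) ^ (p - 1)) ^ N) * this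

lemma sew_zero (h : IsGerm p K Ξ) (hp : 1 < p) : sew Ξ 0 = 0 := by
  have h1 := tendsto_sew h hp zero_mem_box
  have h2 : (fun N => sewSum Ξ N 0 0) = fun _ => 0 := by
    funext N
    unfold sewSum
    refine Finset.sum_eq_zero fun i _ => ?_
    have : ∀ i, trunc 0 0 (dyadic N i) = 0 := fun i => by simp [trunc]
    rw [this, this, h.self hp zero_mem_box]
  rw [h2] at h1
  exact tendsto_nhds_unique h1 tendsto_const_nhds

/-- The sewing lemma. The loss from `p` to `(1 + p) / 2` in the exponent lets the plain telescoping
sum over dyadic levels converge. -/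
lemma norm_sew_sub_le (h : IsGerm p K Ξ) (hp : 1 < p) {x y : ℝ} (hx : 0 ≤ x) (hxy : x ≤ y)
    (hy : y ≤ 2 * Real.pi) :
    ‖sew Ξ y - sew Ξ x - Ξ x y‖ ≤ sewConst p * K * (y - x) ^ ((1 + p) / 2) := by
  have h1 := tendsto_sew h hp (x := x) ⟨hx, hxy.trans hy⟩
  have h2 := tendsto_sew h hp (x := y) ⟨hx.trans hxy, hy⟩
  refine norm_limit_sub_le h hp hx hxy hy ?_
  have h3 : Tendsto (fun N => sewSum Ξ N 0 y - sewSum Ξ N 0 x - sewSum Ξ N x y) atTop (𝓝 0) := by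
    rw [tendsto_zero_iff_norm_tendsto_zero]
    refine squeeze_zero (fun _ => norm_nonneg _) (norm_sewSum_split_le h hp hx hxy hy) ?_
    have := (tendsto_pow_atTop_nhds_zero_of_lt_one (r := ((1:ℝ) / 2) ^ (p - 1)) (by positivity)
      (Real.rpow_lt_one (by norm_num) (by norm_num) (by linarith))).const_mul
      (K * (2 * Real.pi) ^ p)
    simpa using this
  have := (h2.sub h1).sub h3
  simpa using this

lemma sew_sub {K' : ℝ} {Ξ' : ℝ → ℝ → E} (h : IsGerm p K Ξ) (h' : IsGerm p K' Ξ') (hp : 1 < p)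
    {x : ℝ} (hx : x ∈ box) : sew (fun a b => Ξ a b - Ξ' a b) x = sew Ξ x - sew Ξ' x := by
  have h1 := (tendsto_sew h hp hx).sub (tendsto_sew h' hp hx)
  have h2 : (fun N => sewSum Ξ N 0 x - sewSum Ξ' N 0 x)
      = fun N => sewSum (fun a b => Ξ a b - Ξ' a b) N 0 x := by
    funext N; simp [sewSum]
  rw [h2] at h1
  exact h1.limUnder_eq

end Sewing

/-! ### Smooth coefficients on balls -/

section Nonlinear

/-- On the ball of radius `R`, `h` and its derivative are bounded by `C`, and the derivative is
`C`-Lipschitz. -/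
def LocalBound {V W : Type*} [NormedAddCommGroup V] [NormedSpace ℝ V] [NormedAddCommGroup W]
    [NormedSpace ℝ W] (h : V → W) (R C : ℝ) : Prop :=
  Differentiable ℝ h ∧ (∀ a, ‖a‖ ≤ R → ‖h a‖ ≤ C) ∧ (∀ a, ‖a‖ ≤ R → ‖fderiv ℝ h a‖ ≤ C) ∧
    ∀ a b, ‖a‖ ≤ R → ‖b‖ ≤ R → ‖fderiv ℝ h a - fderiv ℝ h b‖ ≤ C * ‖a - b‖

section

variable {V W : Type*} [NormedAddCommGroup V] [NormedSpace ℝ V] [NormedAddCommGroup W]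
    [NormedSpace ℝ W] {h : V → W} {R C : ℝ}

lemma exists_localBound [FiniteDimensional ℝ V] (hh : ContDiff ℝ ∞ h) (R : ℝ) :
    ∃ C, ∀ C' ≥ C, LocalBound h R C' := by
  have hproper : ProperSpace V := FiniteDimensional.proper ℝ V
  have hd : ContDiff ℝ ∞ (fderiv ℝ h) := hh.fderiv_right (by simp)
  have hdd : ContDiff ℝ ∞ (fderiv ℝ (fderiv ℝ h)) := hd.fderiv_right (by simp)
  have hK := isCompact_closedBall (0:V) R
  obtain ⟨C0, h0⟩ := hK.exists_bound_of_continuousOn hh.continuous.continuousOn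
  obtain ⟨C1, h1⟩ := hK.exists_bound_of_continuousOn hd.continuous.continuousOn
  obtain ⟨C2, h2⟩ := hK.exists_bound_of_continuousOn (f := fderiv ℝ (fderiv ℝ h))
    hdd.continuous.continuousOn
  refine ⟨max C0 (max C1 C2), fun C' hC => ⟨hh.differentiable (by simp), ?_, ?_, ?_⟩⟩
  · intro a ha
    exact (h0 a (by simpa using ha)).trans ((le_max_left _ _).trans hC)
  · intro a ha
    exact (h1 a (by simpa using ha)).trans
      ((le_max_left _ _).trans ((le_max_right _ _).trans hC))
  · intro a b ha hb
    refine Convex.norm_image_sub_le_of_norm_fderiv_le (𝕜 := ℝ) (s := Metric.closedBall (0:V) R)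
      (fun x _ => hd.differentiable (by simp) x) (fun x hx => ?_) (convex_closedBall _ _)
      (by simpa using hb) (by simpa using ha)
    exact (h2 x hx).trans ((le_max_right _ _).trans ((le_max_right _ _).trans hC))

lemma norm_segment_le {a b : V} (ha : ‖a‖ ≤ R) (hb : ‖b‖ ≤ R) {θ : ℝ} (hθ : θ ∈ Icc (0:ℝ) 1) :
    ‖a + θ • (b - a)‖ ≤ R := by
  have := (convex_closedBall (0:V) R).add_smul_sub_mem (by simpa using ha) (by simpa using hb) hθ
  simpa using this

lemma norm_segment_sub_le {a b a' b' : V} {D : ℝ} (ha : ‖a - a'‖ ≤ D) (hb : ‖b - b'‖ ≤ D) {θ : ℝ}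
    (hθ : θ ∈ Icc (0:ℝ) 1) : ‖(a + θ • (b - a)) - (a' + θ • (b' - a'))‖ ≤ D := by
  have e : (a + θ • (b - a)) - (a' + θ • (b' - a'))
      = (a - a') + θ • ((b - b') - (a - a')) := by module
  rw [e]
  exact norm_segment_le ha hb hθ

lemma LocalBound.nonneg (hb : LocalBound h R C) (hR : 0 ≤ R) : 0 ≤ C :=
  (norm_nonneg _).trans (hb.2.1 0 (by simpa using hR))

lemma LocalBound.lipschitz (hb : LocalBound h R C) {a b : V} (ha : ‖a‖ ≤ R) (hb' : ‖b‖ ≤ R) :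
    ‖h b - h a‖ ≤ C * ‖b - a‖ :=
  Convex.norm_image_sub_le_of_norm_fderiv_le (𝕜 := ℝ) (s := Metric.closedBall (0:V) R)
      (fun x _ => hb.1 x) (fun x hx => hb.2.2.1 x (by simpa using hx)) (convex_closedBall _ _)
      (by simpa using ha) (by simpa using hb')

lemma hasDerivAt_segment (hh : Differentiable ℝ h) (a b : V) (θ : ℝ) :
    HasDerivAt (fun θ : ℝ => h (a + θ • (b - a))) (fderiv ℝ h (a + θ • (b - a)) (b - a)) θ := by
  have h1 : HasDerivAt (fun θ : ℝ => a + θ • (b - a)) (b - a) θ := by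
    have := ((hasDerivAt_id θ).smul_const (b - a)).const_add a
    simpa using this
  exact (hh _).hasFDerivAt.comp_hasDerivAt θ h1

lemma norm_sub_le_of_hasDerivAt_unit {φ φ' : ℝ → W} (hd : ∀ θ, HasDerivAt φ (φ' θ) θ) {M : ℝ}
    (hM : ∀ θ ∈ Icc (0:ℝ) 1, ‖φ' θ‖ ≤ M) : ‖φ 1 - φ 0‖ ≤ M := by
  have := Convex.norm_image_sub_le_of_norm_hasDerivWithin_le (s := Icc (0:ℝ) 1) (f := φ)
    (fun x _ => (hd x).hasDerivWithinAt) hM (convex_Icc 0 1) (x := 0) (y := 1) (by simp) (by simp)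
  simpa using this

lemma norm_apply_sub_le (S S' : V →L[ℝ] W) (x x' : V) :
    ‖S x - S' x'‖ ≤ ‖S - S'‖ * ‖x‖ + ‖S'‖ * ‖x - x'‖ := by
  have e : S x - S' x' = (S - S') x + S' (x - x') := by simp
  rw [e]
  exact (norm_add_le _ _).trans (add_le_add ((S - S').le_opNorm x) (S'.le_opNorm _))

/-- Second differences of a `C²` function. -/
lemma LocalBound.second_difference (hb : LocalBound h R C) {a b a' b' : V} (ha : ‖a‖ ≤ R)
    (hb1 : ‖b‖ ≤ R) (ha' : ‖a'‖ ≤ R) (hb' : ‖b'‖ ≤ R) {D : ℝ} (hD : ‖a - a'‖ ≤ D)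
    (hD' : ‖b - b'‖ ≤ D) :
    ‖(h b - h a) - (h b' - h a')‖ ≤ C * D * ‖b - a‖ + C * ‖(b - a) - (b' - a')‖ := by
  have hC : 0 ≤ C := hb.nonneg ((norm_nonneg _).trans ha)
  have key := norm_sub_le_of_hasDerivAt_unit
    (fun θ => (hasDerivAt_segment hb.1 a b θ).sub (hasDerivAt_segment hb.1 a' b' θ))
    (M := C * D * ‖b - a‖ + C * ‖(b - a) - (b' - a')‖) (fun θ hθ => ?_)
  · convert key using 2
    simp only [Pi.sub_apply, one_smul, zero_smul, add_sub_cancel, add_zero]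
    abel
  · refine (norm_apply_sub_le _ _ _ _).trans ?_
    have h1 := hb.2.2.2 _ _ (norm_segment_le ha hb1 hθ) (norm_segment_le ha' hb' hθ)
    have h2 := norm_segment_sub_le hD hD' hθ
    have h3 := hb.2.2.1 _ (norm_segment_le ha' hb' hθ)
    gcongr
    exact h1.trans (by gcongr)

/-- Taylor remainder of first order. -/
noncomputable def taylorRem (h : V → W) (a b : V) : W := h b - h a - fderiv ℝ h a (b - a)

lemma LocalBound.norm_taylorRem_le (hb : LocalBound h R C) {a b : V} (ha : ‖a‖ ≤ R)
    (hb1 : ‖b‖ ≤ R) : ‖taylorRem h a b‖ ≤ C * ‖b - a‖ ^ 2 := by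
  have hC : 0 ≤ C := hb.nonneg ((norm_nonneg _).trans ha)
  have key := norm_sub_le_of_hasDerivAt_unit
    (fun θ => (hasDerivAt_segment hb.1 a b θ).sub
      ((hasDerivAt_id θ).smul_const (fderiv ℝ h a (b - a))))
    (M := C * ‖b - a‖ ^ 2) (fun θ hθ => ?_)
  · convert key using 2
    simp only [taylorRem, Pi.sub_apply, one_smul, zero_smul, add_sub_cancel, add_zero, id]
    abel
  · rw [one_smul, ← _root_.sub_apply]
    refine (ContinuousLinearMap.le_opNorm _ _).trans ?_
    have h1 := hb.2.2.2 _ _ (norm_segment_le ha hb1 hθ) ha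
    rw [add_sub_cancel_left, norm_smul, Real.norm_of_nonneg hθ.1] at h1
    have : ‖fderiv ℝ h (a + θ • (b - a)) - fderiv ℝ h a‖ ≤ C * ‖b - a‖ := by
      refine h1.trans ?_
      gcongr
      exact mul_le_of_le_one_left (norm_nonneg _) hθ.2
    calc _ ≤ C * ‖b - a‖ * ‖b - a‖ := by gcongr
      _ = _ := by ring

/-- Differences of Taylor remainders of a `C³` function. -/
lemma LocalBound.norm_taylorRem_sub_le (hb : LocalBound h R C)
    (hb2 : LocalBound (fderiv ℝ h) R C) {a b a' b' : V} (ha : ‖a‖ ≤ R)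
    (hb1 : ‖b‖ ≤ R) (ha' : ‖a'‖ ≤ R) (hb' : ‖b'‖ ≤ R) {D : ℝ} (hD : ‖a - a'‖ ≤ D)
    (hD' : ‖b - b'‖ ≤ D) :
    ‖taylorRem h a b - taylorRem h a' b'‖
      ≤ (C * D * ‖b - a‖ + C * ‖(b - a) - (b' - a')‖) * ‖b - a‖
        + C * ‖b' - a'‖ * ‖(b - a) - (b' - a')‖ := by
  have hC : 0 ≤ C := hb.nonneg ((norm_nonneg _).trans ha)
  have hD0 : 0 ≤ D := (norm_nonneg _).trans hD
  have key := norm_sub_le_of_hasDerivAt_unit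
    (fun θ => ((hasDerivAt_segment hb.1 a b θ).sub
      ((hasDerivAt_id θ).smul_const (fderiv ℝ h a (b - a)))).sub
      ((hasDerivAt_segment hb.1 a' b' θ).sub
      ((hasDerivAt_id θ).smul_const (fderiv ℝ h a' (b' - a')))))
    (M := (C * D * ‖b - a‖ + C * ‖(b - a) - (b' - a')‖) * ‖b - a‖
        + C * ‖b' - a'‖ * ‖(b - a) - (b' - a')‖) (fun θ hθ => ?_)
  · convert key using 2
    simp only [taylorRem, Pi.sub_apply, one_smul, zero_smul, add_sub_cancel, add_zero, id]
    abel
  · rw [one_smul, one_smul, ← _root_.sub_apply, ← _root_.sub_apply]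
    refine (norm_apply_sub_le _ _ _ _).trans ?_
    have n1 := norm_segment_le ha hb1 hθ
    have n2 := norm_segment_le ha' hb' hθ
    have h1 := hb2.second_difference ha n1 ha' n2 hD (norm_segment_sub_le hD hD' hθ)
    rw [add_sub_cancel_left, add_sub_cancel_left, ← smul_sub, norm_smul, norm_smul,
      Real.norm_of_nonneg hθ.1] at h1
    have h2 := hb.2.2.2 _ _ n2 ha'
    rw [add_sub_cancel_left, norm_smul, Real.norm_of_nonneg hθ.1] at h2
    have m : ∀ r : ℝ, 0 ≤ r → θ * r ≤ r := fun r hr => mul_le_of_le_one_left hr hθ.2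
    gcongr
    · refine h1.trans ?_
      gcongr
      · exact m _ (norm_nonneg _)
      · exact m _ (norm_nonneg _)
    · refine h2.trans ?_
      gcongr
      exact m _ (norm_nonneg _)

end

section Contract

variable {n : ℕ}

lemma norm_contract_le (Y : Vec n →L[ℝ] Vec n →L[ℝ] Vec n) (M : Fin n → Fin n → ℝ) :
    ‖contract Y M‖ ≤ (n:ℝ) ^ 2 * (‖Y‖ * ‖M‖) := by
  unfold contract
  have : ∀ i ∈ Finset.univ, ‖∑ j, M i j • Y (EuclideanSpace.single i 1) (EuclideanSpace.single j 1)‖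
      ≤ n * (‖Y‖ * ‖M‖) := by
    intro i _
    have h2 : ∀ j ∈ Finset.univ,
        ‖M i j • Y (EuclideanSpace.single i 1) (EuclideanSpace.single j 1)‖ ≤ ‖Y‖ * ‖M‖ := by
      intro j _
      rw [norm_smul, mul_comm]
      have h3 : ‖M i j‖ ≤ ‖M‖ := (norm_le_pi_norm (M i) j).trans (norm_le_pi_norm M i)
      have h4 := Y.le_opNorm₂ (EuclideanSpace.single i 1) (EuclideanSpace.single j 1)
      simp only [PiLp.norm_single, norm_one, mul_one] at h4
      gcongr
    refine (norm_sum_le_of_le _ h2).trans (le_of_eq ?_)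
    simp
  refine (norm_sum_le_of_le _ this).trans (le_of_eq ?_)
  simp; ring

lemma contract_sub_left (Y Y' : Vec n →L[ℝ] Vec n →L[ℝ] Vec n) (M : Fin n → Fin n → ℝ) :
    contract (Y - Y') M = contract Y M - contract Y' M := by
  simp [contract, smul_sub, Finset.sum_sub_distrib]

lemma contract_sub_right (Y : Vec n →L[ℝ] Vec n →L[ℝ] Vec n) (M M' : Fin n → Fin n → ℝ) :
    contract Y (M - M') = contract Y M - contract Y M' := by
  simp [contract, sub_smul, Finset.sum_sub_distrib]

lemma contract_smul_left (c : ℝ) (Y : Vec n →L[ℝ] Vec n →L[ℝ] Vec n) (M : Fin n → Fin n → ℝ) :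
    contract (c • Y) M = c • contract Y M := by
  simp [contract, Finset.smul_sum, smul_comm c]

/-- On products of increments the contraction is the evaluation of the bilinear map. -/
lemma contract_outer (Y : Vec n →L[ℝ] Vec n →L[ℝ] Vec n) (a b : Vec n) :
    contract Y (fun i j => a i * b j) = Y a b := by
  have ha : a = ∑ i, a i • EuclideanSpace.single i (1:ℝ) := by
    simpa using ((EuclideanSpace.basisFun (Fin n) ℝ).sum_repr a).symm
  have hb : b = ∑ i, b i • EuclideanSpace.single i (1:ℝ) := by
    simpa using ((EuclideanSpace.basisFun (Fin n) ℝ).sum_repr b).symm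
  conv_rhs => rw [ha, hb]
  unfold contract
  simp only [map_sum, map_smul, _root_.sum_apply, _root_.smul_apply,
    Finset.smul_sum, smul_smul]
  rw [Finset.sum_comm]
  refine Finset.sum_congr rfl fun i _ => Finset.sum_congr rfl fun j _ => ?_
  rw [mul_comm]

lemma norm_contract_sub_le (Y Y' : Vec n →L[ℝ] Vec n →L[ℝ] Vec n) (M M' : Fin n → Fin n → ℝ) :
    ‖contract Y M - contract Y' M'‖
      ≤ (n:ℝ) ^ 2 * (‖Y - Y'‖ * ‖M‖) + (n:ℝ) ^ 2 * (‖Y'‖ * ‖M - M'‖) := by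
  have e : contract Y M - contract Y' M' = contract (Y - Y') M + contract Y' (M - M') := by
    rw [contract_sub_left, contract_sub_right]; abel
  rw [e]
  exact (norm_add_le _ _).trans (add_le_add (norm_contract_le _ _) (norm_contract_le _ _))

end Contract

end Nonlinear

/-! ### The germ of the right hand side -/

section Germ

variable {n : ℕ}

/-- The local approximation of `∫ g(u) du + (f(u) + u) dx` over `[x, y]`, where `u = v + ψ` and the
iterated integrals of `ψ` are given by `A`. -/
noncomputable def germ (f : Vec n → Vec n) (g : Vec n → Vec n →L[ℝ] Vec n) (ψ : ℝ → Vec n)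
    (A : ℝ → ℝ → Fin n → Fin n → ℝ) (v : ℝ → Vec n) (x y : ℝ) : Vec n :=
  g (v x + ψ x) ((v y + ψ y) - (v x + ψ x)) + contract (fderiv ℝ g (v x + ψ x)) (A x y)
    + (y - x) • (f (v x + ψ x) + (v x + ψ x))

/-- Bounds on the coefficients `f` and `g` over the ball of radius `R`. -/
structure CoeffBound (f : Vec n → Vec n) (g : Vec n → Vec n →L[ℝ] Vec n) (R C : ℝ) : Prop where
  bound_f : LocalBound (fun u => f u + u) R C
  bound_g : LocalBound g R C
  bound_dg : LocalBound (fderiv ℝ g) R C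

lemma exists_coeffBound {f : Vec n → Vec n} {g : Vec n → Vec n →L[ℝ] Vec n}
    (hf : ContDiff ℝ ∞ f) (hg : ContDiff ℝ ∞ g) (R : ℝ) :
    ∃ C, 1 ≤ C ∧ CoeffBound f g R C := by
  obtain ⟨C1, h1⟩ := exists_localBound (hf.add contDiff_id) R
  obtain ⟨C2, h2⟩ := exists_localBound hg R
  obtain ⟨C3, h3⟩ := exists_localBound (hg.fderiv_right (m := ∞) (by simp)) R
  refine ⟨max 1 (max C1 (max C2 C3)), le_max_left _ _, h1 _ ?_, h2 _ ?_, h3 _ ?_⟩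
  · exact (le_max_left _ _).trans (le_max_right _ _)
  · exact (le_max_left _ _).trans ((le_max_right _ _).trans (le_max_right _ _))
  · exact (le_max_right _ _).trans ((le_max_right _ _).trans (le_max_right _ _))

/-- At a fixed time: `u = v + ψ` is bounded by `R` in `C^α([0, 2π])`, `(ψ, A)` is a rough path
bounded by `R` and `v` is Lipschitz with constant `a`. -/
structure SliceBound (α R a : ℝ) (ψ : ℝ → Vec n) (A : ℝ → ℝ → Fin n → Fin n → ℝ)
    (v : ℝ → Vec n) : Prop where
  u_le : ∀ x ∈ box, ‖v x + ψ x‖ ≤ R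
  u_hol : ∀ x ∈ box, ∀ y ∈ box, ‖(v y + ψ y) - (v x + ψ x)‖ ≤ R * |y - x| ^ α
  path_hol : ∀ x ∈ box, ∀ y ∈ box, ‖ψ y - ψ x‖ ≤ R * |y - x| ^ α
  area_hol : ∀ x ∈ box, ∀ y ∈ box, ‖A x y‖ ≤ R * |y - x| ^ (2 * α)
  v_lip : ∀ x ∈ box, ∀ y ∈ box, ‖v y - v x‖ ≤ a * |y - x|
  chen : ∀ x ∈ box, ∀ y ∈ box, ∀ z ∈ box, ∀ i j,
    A x z i j - A y z i j - A x y i j = (ψ y i - ψ x i) * (ψ z j - ψ y j)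

/-- The difference of two sets of data at a fixed time: `d` bounds the differences of `u = v + ψ`, `ψ`
and `A`, and `e` is a Lipschitz constant of `v - v'`. The constants are kept apart because `e`, unlike
`d`, blows up at time zero. -/
structure SliceDiff (α d e : ℝ) (ψ ψ' : ℝ → Vec n) (A A' : ℝ → ℝ → Fin n → Fin n → ℝ)
    (v v' : ℝ → Vec n) : Prop where
  u_le : ∀ x ∈ box, ‖(v x + ψ x) - (v' x + ψ' x)‖ ≤ d
  u_hol : ∀ x ∈ box, ∀ y ∈ box,
    ‖((v y + ψ y) - (v x + ψ x)) - ((v' y + ψ' y) - (v' x + ψ' x))‖ ≤ d * |y - x| ^ α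
  path_hol : ∀ x ∈ box, ∀ y ∈ box, ‖(ψ y - ψ x) - (ψ' y - ψ' x)‖ ≤ d * |y - x| ^ α
  area_hol : ∀ x ∈ box, ∀ y ∈ box, ‖A x y - A' x y‖ ≤ d * |y - x| ^ (2 * α)
  v_lip : ∀ x ∈ box, ∀ y ∈ box, ‖(v y - v x) - (v' y - v' x)‖ ≤ e * |y - x|

variable {f : Vec n → Vec n} {g : Vec n → Vec n →L[ℝ] Vec n} {ψ ψ' : ℝ → Vec n}
  {A A' : ℝ → ℝ → Fin n → Fin n → ℝ} {v v' : ℝ → Vec n}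

/-- The defect of additivity of the germ; every term is a product of increments. -/
lemma germ_defect (hchen : ∀ x ∈ box, ∀ y ∈ box, ∀ z ∈ box, ∀ i j,
    A x z i j - A y z i j - A x y i j = (ψ y i - ψ x i) * (ψ z j - ψ y j))
    {x y z : ℝ} (hx : x ∈ box) (hy : y ∈ box) (hz : z ∈ box) :
    germ f g ψ A v x y + germ f g ψ A v y z - germ f g ψ A v x z
      = taylorRem g (v x + ψ x) (v y + ψ y) (ψ z - ψ y)
        + fderiv ℝ g (v x + ψ x) (v y - v x) (ψ z - ψ y)
        + (g (v y + ψ y) - g (v x + ψ x)) (v z - v y)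
        + contract (fderiv ℝ g (v y + ψ y) - fderiv ℝ g (v x + ψ x)) (A y z)
        + (z - y) • ((f (v y + ψ y) + (v y + ψ y)) - (f (v x + ψ x) + (v x + ψ x))) := by
  have h1 : A x z = A x y + A y z + fun i j => (ψ y - ψ x) i * (ψ z - ψ y) j := by
    funext i j
    simp only [Pi.add_apply, PiLp.sub_apply]
    linarith [hchen x hx y hy z hz i j]
  have h2 : contract (fderiv ℝ g (v x + ψ x)) (A x z)
      = contract (fderiv ℝ g (v x + ψ x)) (A x y) + contract (fderiv ℝ g (v x + ψ x)) (A y z)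
        + fderiv ℝ g (v x + ψ x) (ψ y - ψ x) (ψ z - ψ y) := by
    rw [← contract_outer, h1]
    simp [contract, add_smul, Finset.sum_add_distrib]
  unfold germ
  rw [h2, contract_sub_left]
  simp only [taylorRem, _root_.sub_apply, map_sub, map_add, _root_.add_apply]
  module

/-- The constant in the estimates on germs. -/
noncomputable def germConst (n : ℕ) (C R : ℝ) : ℝ := 40 * (1 + (n:ℝ) ^ 2) * C * R ^ 3

lemma term_le {a b c d A B C D : ℝ} (h1 : a ≤ A) (h2 : b ≤ B) (h3 : c ≤ C) (h4 : d ≤ D)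
    (hb : 0 ≤ b) (hA : 0 ≤ A) (hd : 0 ≤ d) (hC : 0 ≤ C) : a * b + c * d ≤ A * B + C * D :=
  add_le_add (mul_le_mul h1 h2 hb hA) (mul_le_mul h3 h4 hd hC)

set_option maxHeartbeats 1600000 in
/-- The defect of additivity depends on the data in a locally Lipschitz way; the Lipschitz constants
`a` and `e` of `v` and `v - v'` enter linearly. -/
lemma norm_germ_defect_sub_le {α R a d e C : ℝ} (hα : 0 < α) (hα2 : α < 1 / 2) (hR : 1 ≤ R)
    (ha : 0 ≤ a) (hd : 0 ≤ d) (he : 0 ≤ e) (hC : 1 ≤ C) (hc : CoeffBound f g R C)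
    (h : SliceBound α R a ψ A v) (h' : SliceBound α R a ψ' A' v')
    (hdiff : SliceDiff α d e ψ ψ' A A' v v') {x y z : ℝ} (hx : 0 ≤ x) (hxy : x ≤ y) (hyz : y ≤ z)
    (hz : z ≤ 2 * Real.pi) :
    ‖(germ f g ψ A v x y + germ f g ψ A v y z - germ f g ψ A v x z)
      - (germ f g ψ' A' v' x y + germ f g ψ' A' v' y z - germ f g ψ' A' v' x z)‖
      ≤ germConst n C R * ((1 + a) * d + e) * (z - x) ^ (3 * α) := by
  have bx : x ∈ box := ⟨hx, (hxy.trans hyz).trans hz⟩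
  have byy : y ∈ box := ⟨hx.trans hxy, hyz.trans hz⟩
  have bz : z ∈ box := ⟨hx.trans (hxy.trans hyz), hz⟩
  rw [germ_defect h.chen bx byy bz, germ_defect h'.chen bx byy bz]
  set ρ := (z - x) ^ α with hρ
  have hzx : 0 ≤ z - x := by linarith
  have hρ0 : 0 ≤ ρ := by positivity
  have hρ3 : (z - x) ^ (3 * α) = ρ ^ 3 := by
    rw [hρ, ← Real.rpow_natCast, ← Real.rpow_mul hzx]; congr 1; push_cast; ring
  have hρ2 : (z - x) ^ (2 * α) = ρ ^ 2 := by
    rw [hρ, ← Real.rpow_natCast, ← Real.rpow_mul hzx]; congr 1; push_cast; ring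
  -- `7` bounds `2π`, and `2α < 1`: a Lipschitz increment is at least as good as one of order `2α`
  have hlin : z - x ≤ 7 * ρ ^ 2 := by
    rw [← hρ2]
    have := rpow_exponent_le (γ := 2 * α) (δ := 1) (r := z - x) (by linarith) (by linarith) hzx
      (by linarith) one_pos
    simpa using this
  have rxy : |y - x| ^ α ≤ ρ := by
    rw [abs_of_nonneg (by linarith)]; exact Real.rpow_le_rpow (by linarith) (by linarith) hα.le
  have ryz : |z - y| ^ α ≤ ρ := by
    rw [abs_of_nonneg (by linarith)]; exact Real.rpow_le_rpow (by linarith) (by linarith) hα.le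
  have ryz2 : |z - y| ^ (2 * α) ≤ ρ ^ 2 := by
    rw [abs_of_nonneg (by linarith), ← hρ2]
    exact Real.rpow_le_rpow (by linarith) (by linarith) (by linarith)
  have lxy : |y - x| ≤ 7 * ρ ^ 2 := by rw [abs_of_nonneg (by linarith)]; linarith
  have lyz : |z - y| ≤ 7 * ρ ^ 2 := by rw [abs_of_nonneg (by linarith)]; linarith
  have lyz' : |z - y| ≤ 7 * ρ ^ 2 := lyz
  rw [hρ3]
  have hR0 : 0 ≤ R := by linarith
  have hC0 : 0 ≤ C := by linarith
  -- the increments of the two sets of data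
  have k1 := (h.u_hol x bx y byy).trans (mul_le_mul_of_nonneg_left rxy hR0)
  have k1' := (h'.u_hol x bx y byy).trans (mul_le_mul_of_nonneg_left rxy hR0)
  have kd := (hdiff.u_hol x bx y byy).trans (mul_le_mul_of_nonneg_left rxy hd)
  have p1 := (h.path_hol y byy z bz).trans (mul_le_mul_of_nonneg_left ryz hR0)
  have pd := (hdiff.path_hol y byy z bz).trans (mul_le_mul_of_nonneg_left ryz hd)
  have A1 := (h.area_hol y byy z bz).trans (mul_le_mul_of_nonneg_left ryz2 hR0)
  have Ad := (hdiff.area_hol y byy z bz).trans (mul_le_mul_of_nonneg_left ryz2 hd)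
  have v1 := (h.v_lip x bx y byy).trans (mul_le_mul_of_nonneg_left lxy ha)
  have v1' := (h'.v_lip x bx y byy).trans (mul_le_mul_of_nonneg_left lxy ha)
  have vd := (hdiff.v_lip x bx y byy).trans (mul_le_mul_of_nonneg_left lxy he)
  have w1 := (h.v_lip y byy z bz).trans (mul_le_mul_of_nonneg_left lyz ha)
  have wd := (hdiff.v_lip y byy z bz).trans (mul_le_mul_of_nonneg_left lyz he)
  have ux := h.u_le x bx
  have uy := h.u_le y byy
  have ux' := h'.u_le x bx
  have uy' := h'.u_le y byy
  have dx := hdiff.u_le x bx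
  have dy := hdiff.u_le y byy
  generalize v x + ψ x = X at *
  generalize v y + ψ y = Y at *
  generalize v' x + ψ' x = X' at *
  generalize v' y + ψ' y = Y' at *
  generalize ψ z - ψ y = P at *
  generalize ψ' z - ψ' y = P' at *
  generalize v y - v x = V at *
  generalize v' y - v' x = V' at *
  generalize v z - v y = W at *
  generalize v' z - v' y = W' at *
  generalize A y z = M at *
  generalize A' y z = M' at *
  have hlast : ‖z - y‖ ≤ 7 * ρ ^ 2 := lyz'
  -- second differences of the coefficients
  have sd : ∀ {W : Type} [NormedAddCommGroup W] [NormedSpace ℝ W] {k : Vec n → W},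
      LocalBound k R C → ‖(k Y - k X) - (k Y' - k X')‖ ≤ 2 * (C * R * d * ρ) := by
    intro W _ _ k hk
    refine (hk.second_difference ux uy ux' uy' dx dy).trans ?_
    have e1 : C * d * ‖Y - X‖ ≤ C * d * (R * ρ) := by gcongr
    have e2 : C * ‖(Y - X) - (Y' - X')‖ ≤ C * (R * (d * ρ)) := by
      gcongr
      exact kd.trans (le_mul_of_one_le_left (by positivity) hR)
    linarith
  have fd : ∀ {W : Type} [NormedAddCommGroup W] [NormedSpace ℝ W] {k : Vec n → W},
      LocalBound k R C → ‖k Y' - k X'‖ ≤ C * (R * ρ) := by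
    intro W _ _ k hk
    exact (hk.lipschitz ux' uy').trans (by gcongr)
  have hTd : ‖taylorRem g X Y - taylorRem g X' Y'‖ ≤ 3 * (C * R ^ 2 * d * ρ ^ 2) := by
    refine (hc.bound_g.norm_taylorRem_sub_le hc.bound_dg ux uy ux' uy' dx dy).trans ?_
    calc _ ≤ (C * d * (R * ρ) + C * (R * (d * ρ))) * (R * ρ) + C * (R * ρ) * (R * (d * ρ)) := by
          have kd2 : ‖(Y - X) - (Y' - X')‖ ≤ R * (d * ρ) :=
            kd.trans (le_mul_of_one_le_left (by positivity) hR)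
          gcongr
      _ = _ := by ring
  have hT : ‖taylorRem g X' Y'‖ ≤ C * (R * ρ) ^ 2 :=
    (hc.bound_g.norm_taylorRem_le ux' uy').trans (by gcongr)
  -- one bound for each of the five terms in `germ_defect`
  have t1 : ‖taylorRem g X Y P - taylorRem g X' Y' P'‖ ≤ 4 * (C * R ^ 3 * (d * ρ ^ 3)) := by
    refine (norm_apply_sub_le _ _ _ _).trans ?_
    refine (term_le hTd p1 hT pd (norm_nonneg _) (by positivity) (norm_nonneg _)
      (by positivity)).trans ?_
    have : R ^ 2 ≤ R ^ 3 := pow_le_pow_right₀ hR (by norm_num)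
    have : C * R ^ 2 * (d * ρ ^ 3) ≤ C * R ^ 3 * (d * ρ ^ 3) := by gcongr
    nlinarith
  have hG : ‖fderiv ℝ g X - fderiv ℝ g X'‖ ≤ C * d :=
    (hc.bound_g.2.2.2 X X' ux ux').trans (by gcongr)
  have hG' : ‖fderiv ℝ g X'‖ ≤ C := hc.bound_g.2.2.1 X' ux'
  have t2a : ‖fderiv ℝ g X V - fderiv ℝ g X' V'‖ ≤ 7 * (C * (a * d + e) * ρ ^ 2) := by
    refine (norm_apply_sub_le _ _ _ _).trans ?_
    refine (term_le hG v1 hG' vd (norm_nonneg _) (by positivity) (norm_nonneg _)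
      (by positivity)).trans (le_of_eq (by ring))
  have t2b : ‖fderiv ℝ g X' V'‖ ≤ C * (a * (7 * ρ ^ 2)) :=
    ((fderiv ℝ g X').le_opNorm V').trans (by gcongr)
  have hRR : R ≤ R ^ 3 := le_self_pow₀ hR (by norm_num)
  have h1R : 1 ≤ R ^ 3 := one_le_pow₀ hR
  have had : 0 ≤ a * d := by positivity
  have t2 : ‖fderiv ℝ g X V P - fderiv ℝ g X' V' P'‖ ≤ 14 * (C * R ^ 3 * ((a * d + e) * ρ ^ 3)) := by
    refine (norm_apply_sub_le _ _ _ _).trans ?_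
    refine (term_le t2a p1 t2b pd (norm_nonneg _) (by positivity) (norm_nonneg _)
      (by positivity)).trans ?_
    have e1 : C * R * ((a * d + e) * ρ ^ 3) ≤ C * R ^ 3 * ((a * d + e) * ρ ^ 3) := by gcongr
    have e2 : C * 1 * (a * d * ρ ^ 3) ≤ C * R ^ 3 * ((a * d + e) * ρ ^ 3) := by
      gcongr; linarith
    linarith
  have t3 : ‖(g Y - g X) W - (g Y' - g X') W'‖ ≤ 14 * (C * R ^ 3 * ((a * d + e) * ρ ^ 3)) := by
    refine (norm_apply_sub_le _ _ _ _).trans ?_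
    refine (term_le (sd hc.bound_g) w1 (fd hc.bound_g) wd (norm_nonneg _) (by positivity)
      (norm_nonneg _) (by positivity)).trans ?_
    have e1 : C * R * ((a * d + e) * ρ ^ 3) ≤ C * R ^ 3 * ((a * d + e) * ρ ^ 3) := by gcongr
    have e2 : 0 ≤ C * R * (e * ρ ^ 3) := by positivity
    linarith
  have t4 : ‖contract (fderiv ℝ g Y - fderiv ℝ g X) M
      - contract (fderiv ℝ g Y' - fderiv ℝ g X') M'‖ ≤ 3 * ((n:ℝ) ^ 2 * (C * R ^ 3 * (d * ρ ^ 3))) := by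
    refine (norm_contract_sub_le _ _ _ _).trans ?_
    rw [← mul_add]
    have e0 := term_le (sd hc.bound_dg) A1 (fd hc.bound_dg) Ad (norm_nonneg _) (by positivity)
      (norm_nonneg _) (by positivity)
    have e1 : C * R * (d * ρ ^ 3) ≤ C * R ^ 3 * (d * ρ ^ 3) := by gcongr
    have e2 : C * R ^ 2 * (d * ρ ^ 3) ≤ C * R ^ 3 * (d * ρ ^ 3) := by
      gcongr
      norm_num
    have e3 : 2 * (C * R * d * ρ) * (R * ρ ^ 2) + C * (R * ρ) * (d * ρ ^ 2)
        ≤ 3 * (C * R ^ 3 * (d * ρ ^ 3)) := by linarith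
    calc _ ≤ (n:ℝ) ^ 2 * (3 * (C * R ^ 3 * (d * ρ ^ 3))) := by
          gcongr
          exact e0.trans e3
      _ = _ := by ring
  have t5 : ‖(z - y) • ((f Y + Y) - (f X + X)) - (z - y) • ((f Y' + Y') - (f X' + X'))‖
      ≤ 14 * (C * R ^ 3 * (d * ρ ^ 3)) := by
    rw [← smul_sub, norm_smul]
    have e0 := mul_le_mul hlast (sd hc.bound_f) (norm_nonneg _) (by positivity)
    have e1 : C * R * (d * ρ ^ 3) ≤ C * R ^ 3 * (d * ρ ^ 3) := by gcongr
    refine e0.trans ?_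
    linarith
  have split : ∀ a b c d e a' b' c' d' e' : Vec n,
      ‖(a + b + c + d + e) - (a' + b' + c' + d' + e')‖
        ≤ ‖a - a'‖ + ‖b - b'‖ + ‖c - c'‖ + ‖d - d'‖ + ‖e - e'‖ := by
    intro a b c d e a' b' c' d' e'
    have : (a + b + c + d + e) - (a' + b' + c' + d' + e')
        = (a - a') + (b - b') + (c - c') + (d - d') + (e - e') := by abel
    rw [this]
    exact (norm_add_le _ _).trans (add_le_add_left ((norm_add_le _ _).trans (add_le_add_left
      ((norm_add_le _ _).trans (add_le_add_left (norm_add_le _ _) _)) _)) _)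
  refine (split _ _ _ _ _ _ _ _ _ _).trans ?_
  have hn : 0 ≤ (n:ℝ) ^ 2 := by positivity
  have q1 : 0 ≤ C * R ^ 3 * (d * ρ ^ 3) := by positivity
  have q2 : 0 ≤ C * R ^ 3 * ((a * d + e) * ρ ^ 3) := by positivity
  have q3 : 0 ≤ (n:ℝ) ^ 2 * (C * R ^ 3 * (d * ρ ^ 3)) := by positivity
  have q4 : 0 ≤ (n:ℝ) ^ 2 * (C * R ^ 3 * ((a * d + e) * ρ ^ 3)) := by positivity
  unfold germConst
  calc _ ≤ 4 * (C * R ^ 3 * (d * ρ ^ 3)) + 14 * (C * R ^ 3 * ((a * d + e) * ρ ^ 3))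
        + 14 * (C * R ^ 3 * ((a * d + e) * ρ ^ 3)) + 3 * ((n:ℝ) ^ 2 * (C * R ^ 3 * (d * ρ ^ 3)))
        + 14 * (C * R ^ 3 * (d * ρ ^ 3)) := by gcongr
    _ ≤ 40 * (C * R ^ 3 * (d * ρ ^ 3)) + 40 * (C * R ^ 3 * ((a * d + e) * ρ ^ 3))
        + 40 * ((n:ℝ) ^ 2 * (C * R ^ 3 * (d * ρ ^ 3)))
        + 40 * ((n:ℝ) ^ 2 * (C * R ^ 3 * ((a * d + e) * ρ ^ 3))) := by linarith
    _ = _ := by ring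

end Germ

/-! ### Hölder bounds for the primitive of the right hand side -/

section Primitive

variable {n : ℕ} {f : Vec n → Vec n} {g : Vec n → Vec n →L[ℝ] Vec n} {ψ ψ' : ℝ → Vec n}
  {A A' : ℝ → ℝ → Fin n → Fin n → ℝ} {v v' : ℝ → Vec n} {α R a d e C : ℝ}

/-- The difference of two germs is a germ of order `3α > 1`. -/
lemma isGerm_germ_sub (hα : 0 < α) (hα2 : α < 1 / 2) (hR : 1 ≤ R)
    (ha : 0 ≤ a) (hd : 0 ≤ d) (he : 0 ≤ e) (hC : 1 ≤ C) (hc : CoeffBound f g R C)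
    (h : SliceBound α R a ψ A v) (h' : SliceBound α R a ψ' A' v')
    (hdiff : SliceDiff α d e ψ ψ' A A' v v') :
    IsGerm (3 * α) (germConst n C R * ((1 + a) * d + e))
      (fun x y => germ f g ψ A v x y - germ f g ψ' A' v' x y) := by
  intro x y z hx hxy hyz hz
  have := norm_germ_defect_sub_le hα hα2 hR ha hd he hC hc h h' hdiff hx hxy hyz hz
  rw [← norm_neg] at this
  refine le_trans (le_of_eq ?_) this
  congr 1
  beta_reduce
  abel

lemma germConst_nonneg (hC : 1 ≤ C) (hR : 1 ≤ R) : 0 ≤ germConst n C R := by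
  unfold germConst
  have : 0 ≤ R := by linarith
  positivity

/-- Size of the difference of two germs. -/
lemma norm_germ_sub_le (hα : 0 < α) (hα2 : α < 1 / 2) (hR : 1 ≤ R)
    (hd : 0 ≤ d) (hC : 1 ≤ C) (hc : CoeffBound f g R C)
    (h : SliceBound α R a ψ A v) (h' : SliceBound α R a ψ' A' v')
    (hdiff : SliceDiff α d e ψ ψ' A A' v v') {x y : ℝ} (hx : x ∈ box) (hy : y ∈ box) :
    ‖germ f g ψ A v x y - germ f g ψ' A' v' x y‖ ≤ germConst n C R * d * |y - x| ^ α := by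
  set ρ := |y - x| ^ α with hρ
  have hρ0 : 0 ≤ ρ := by positivity
  have hr : |y - x| ≤ 2 * Real.pi := abs_sub_le_of_mem_box hy hx
  have hρ7 : |y - x| ^ (2 * α) ≤ 7 * ρ :=
    rpow_exponent_le (by linarith) (by linarith) (abs_nonneg _) hr (by linarith)
  have hlin : |y - x| ≤ 7 * ρ := by
    have := rpow_exponent_le (γ := α) (δ := 1) (r := |y - x|) (by linarith) (by linarith)
      (abs_nonneg _) hr one_pos
    simpa using this
  have hR0 : 0 ≤ R := by linarith
  have k1 := h.u_hol x hx y hy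
  have kd := hdiff.u_hol x hx y hy
  have A1 := (h.area_hol x hx y hy).trans (mul_le_mul_of_nonneg_left hρ7 hR0)
  have Ad := (hdiff.area_hol x hx y hy).trans (mul_le_mul_of_nonneg_left hρ7 hd)
  have ux := h.u_le x hx
  have ux' := h'.u_le x hx
  have dx := hdiff.u_le x hx
  rw [← hρ] at k1 kd
  unfold germ
  have hlast : ‖y - x‖ ≤ 7 * ρ := hlin
  generalize v x + ψ x = X at *
  generalize v' x + ψ' x = X' at *
  generalize v y + ψ y = Y at *
  generalize v' y + ψ' y = Y' at *
  generalize A x y = M at *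
  generalize A' x y = M' at *
  have L : ∀ {W : Type} [NormedAddCommGroup W] [NormedSpace ℝ W] {k : Vec n → W},
      LocalBound k R C → ‖k X - k X'‖ ≤ C * d := by
    intro W _ _ k hk
    exact (hk.lipschitz ux' ux).trans (by gcongr)
  have t1 : ‖g X (Y - X) - g X' (Y' - X')‖ ≤ C * d * (R * ρ) + C * (d * ρ) :=
    (norm_apply_sub_le _ _ _ _).trans (term_le (L hc.bound_g) k1 (hc.bound_g.2.1 _ ux') kd
      (norm_nonneg _) (by positivity) (norm_nonneg _) (by positivity))
  have t2 : ‖contract (fderiv ℝ g X) M - contract (fderiv ℝ g X') M'‖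
      ≤ (n:ℝ) ^ 2 * (C * d * (R * (7 * ρ)) + C * (d * (7 * ρ))) := by
    refine (norm_contract_sub_le _ _ _ _).trans ?_
    rw [← mul_add]
    gcongr ?_ * ?_
    exact term_le (L hc.bound_dg) A1 (hc.bound_dg.2.1 _ ux') Ad
      (norm_nonneg _) (by positivity) (norm_nonneg _) (by positivity)
  have t3 : ‖(y - x) • (f X + X) - (y - x) • (f X' + X')‖ ≤ 7 * ρ * (C * d) := by
    rw [← smul_sub, norm_smul]
    exact mul_le_mul hlast (L hc.bound_f) (norm_nonneg _) (by positivity)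
  have split : ∀ a b c a' b' c' : Vec n,
      ‖(a + b + c) - (a' + b' + c')‖ ≤ ‖a - a'‖ + ‖b - b'‖ + ‖c - c'‖ := by
    intro a b c a' b' c'
    have : (a + b + c) - (a' + b' + c') = (a - a') + (b - b') + (c - c') := by abel
    rw [this]
    exact norm_add₃_le
  refine (split _ _ _ _ _ _).trans ((add_le_add (add_le_add t1 t2) t3).trans ?_)
  unfold germConst
  have hRR : R ≤ R ^ 3 := le_self_pow₀ hR (by norm_num)
  have h1R : 1 ≤ R ^ 3 := one_le_pow₀ hR
  have q1 : C * R * (d * ρ) ≤ C * R ^ 3 * (d * ρ) := by gcongr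
  have q2 : C * 1 * (d * ρ) ≤ C * R ^ 3 * (d * ρ) := by gcongr
  have q3 : (n:ℝ) ^ 2 * (C * R * (d * ρ)) ≤ (n:ℝ) ^ 2 * (C * R ^ 3 * (d * ρ)) := by gcongr
  have q4 : (n:ℝ) ^ 2 * (C * 1 * (d * ρ)) ≤ (n:ℝ) ^ 2 * (C * R ^ 3 * (d * ρ)) := by gcongr
  have q5 : 0 ≤ C * R ^ 3 * (d * ρ) := by positivity
  have q6 : 0 ≤ (n:ℝ) ^ 2 * (C * R ^ 3 * (d * ρ)) := by positivity
  calc _ ≤ 9 * (C * R ^ 3 * (d * ρ)) + 14 * ((n:ℝ) ^ 2 * (C * R ^ 3 * (d * ρ))) := by linarith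
    _ ≤ 40 * (C * R ^ 3 * (d * ρ)) + 40 * ((n:ℝ) ^ 2 * (C * R ^ 3 * (d * ρ))) := by linarith
    _ = _ := by ring

/-- A germ of size `K |y - x|^α` sews to an `α`-Hölder primitive. -/
lemma isPrimitive_sew {E : Type*} [NormedAddCommGroup E] [NormedSpace ℝ E] [CompleteSpace E]
    {Ξ : ℝ → ℝ → E} {K K' p : ℝ} (hα2 : α ≤ 1) (hp : 1 < p) (hp1 : p ≤ 2 * α + 1)
    (hΞ : IsGerm p K Ξ) (hb : ∀ x ∈ box, ∀ y ∈ box, x ≤ y → ‖Ξ x y‖ ≤ K' * |y - x| ^ α) :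
    IsPrimitive α (K' + 7 * sewConst p * K) (sew Ξ) := by
  refine ⟨sew_zero hΞ hp, ?_⟩
  intro x hx y hy
  wlog hxy : x ≤ y generalizing x y
  · rw [norm_sub_rev, abs_sub_comm]
    exact this y hy x hx (le_of_not_ge hxy)
  have h1 := norm_sew_sub_le hΞ hp hx.1 hxy hy.2
  have h2 := hb x hx y hy hxy
  have hK := hΞ.nonneg
  have hS := sewConst_pos hp
  have h3 : (y - x) ^ ((1 + p) / 2) ≤ 7 * |y - x| ^ α := by
    rw [abs_of_nonneg (by linarith)]
    refine rpow_exponent_le (by linarith) (by linarith) (by linarith) ?_ (by linarith)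
    linarith [hx.1, hy.2]
  rw [norm_sub_rev, abs_sub_comm]
  have e : sew Ξ y - sew Ξ x = (sew Ξ y - sew Ξ x - Ξ x y) + Ξ x y := by abel
  rw [e]
  refine (norm_add_le _ _).trans ?_
  have h4 : sewConst p * K * (y - x) ^ ((1 + p) / 2) ≤ sewConst p * K * (7 * |y - x| ^ α) := by
    gcongr
  linarith

/-- The constant in the estimates on primitives. -/
noncomputable def primConst (n : ℕ) (α C R : ℝ) : ℝ :=
  (1 + 7 * sewConst (3 * α)) * germConst n C R

lemma primConst_nonneg (hα3 : 1 / 3 < α) (hC : 1 ≤ C) (hR : 1 ≤ R) : 0 ≤ primConst n α C R := by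
  have := sewConst_pos (p := 3 * α) (by linarith)
  have := germConst_nonneg (n := n) hC hR
  unfold primConst; positivity

/-- The primitive of the right hand side is locally Lipschitz in the data at a fixed time. -/
lemma isPrimitive_sew_germ_sub (hα3 : 1 / 3 < α) (hα2 : α < 1 / 2) (hR : 1 ≤ R)
    (ha : 0 ≤ a) (hd : 0 ≤ d) (he : 0 ≤ e) (hC : 1 ≤ C) (hc : CoeffBound f g R C)
    (h : SliceBound α R a ψ A v) (h' : SliceBound α R a ψ' A' v')
    (hdiff : SliceDiff α d e ψ ψ' A A' v v') :
    IsPrimitive α (primConst n α C R * ((1 + a) * d + e))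
      (sew (fun x y => germ f g ψ A v x y - germ f g ψ' A' v' x y)) := by
  have hg := germConst_nonneg (n := n) hC hR
  refine (isPrimitive_sew (by linarith) (by linarith) (by linarith)
    (isGerm_germ_sub (by linarith) hα2 hR ha hd he hC hc h h' hdiff)
    (fun x hx y hy _ => norm_germ_sub_le (by linarith) hα2 hR hd hC hc h h' hdiff hx hy)).mono ?_
  unfold primConst
  have : germConst n C R * d ≤ germConst n C R * ((1 + a) * d + e) := by
    gcongr; nlinarith
  linarith

lemma germ_zero (x y : ℝ) : germ f g 0 0 0 x y = (y - x) • f 0 := by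
  simp [germ, contract]

lemma isGerm_germ_zero : IsGerm (3 * α) 0 (germ f g 0 0 0) := by
  intro x y z _ _ _ _
  simp only [germ_zero, zero_mul]
  apply le_of_eq
  rw [norm_eq_zero]
  module

lemma sliceBound_zero (hR : 0 ≤ R) (ha : 0 ≤ a) :
    SliceBound α R a (0 : ℝ → Vec n) 0 0 where
  u_le x _ := by simpa
  u_hol x _ y _ := by simp; positivity
  path_hol x _ y _ := by simp; positivity
  area_hol x _ y _ := by simp; positivity
  v_lip x _ y _ := by simp; positivity
  chen x _ y _ z _ i j := by simp

lemma SliceBound.diff_zero (h : SliceBound α R a ψ A v) : SliceDiff α R a ψ 0 A 0 v 0 where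
  u_le x hx := by simpa using h.u_le x hx
  u_hol x hx y hy := by simpa using h.u_hol x hx y hy
  path_hol x hx y hy := by simpa using h.path_hol x hx y hy
  area_hol x hx y hy := by simpa using h.area_hol x hx y hy
  v_lip x hx y hy := by simpa using h.v_lip x hx y hy

/-- The germ is almost additive, by comparison with vanishing data, where the germ is additive. -/
lemma isGerm_germ (hα : 0 < α) (hα2 : α < 1 / 2) (hR : 1 ≤ R)
    (ha : 0 ≤ a) (hC : 1 ≤ C) (hc : CoeffBound f g R C) (h : SliceBound α R a ψ A v) :
    IsGerm (3 * α) (germConst n C R * ((1 + a) * R + a)) (germ f g ψ A v) := by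
  have h1 := isGerm_germ_sub hα hα2 hR ha (by linarith) ha hC hc h
    (sliceBound_zero (by linarith) ha) h.diff_zero
  intro x y z hx hxy hyz hz
  have e := h1 x y z hx hxy hyz hz
  have e0 := isGerm_germ_zero (f := f) (g := g) (α := α) x y z hx hxy hyz hz
  rw [zero_mul] at e0
  have e0' := norm_le_zero_iff.1 e0
  have e2 : germ f g ψ A v x z - germ f g ψ A v x y - germ f g ψ A v y z
      = (germ f g ψ A v x z - germ f g 0 0 0 x z) - (germ f g ψ A v x y - germ f g 0 0 0 x y)
        - (germ f g ψ A v y z - germ f g 0 0 0 y z)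
        + (germ f g 0 0 0 x z - germ f g 0 0 0 x y - germ f g 0 0 0 y z) := by abel
  rw [e2, e0', add_zero]
  exact e

/-- The primitive of the right hand side is `α`-Hölder, with a bound linear in the Lipschitz
constant of `v`. -/
lemma isPrimitive_sew_germ (hα3 : 1 / 3 < α) (hα2 : α < 1 / 2) (hR : 1 ≤ R)
    (ha : 0 ≤ a) (hC : 1 ≤ C) (hc : CoeffBound f g R C) (h : SliceBound α R a ψ A v) :
    IsPrimitive α (3 * R * primConst n α C R * (1 + a)) (sew (germ f g ψ A v)) := by
  have hg := germConst_nonneg (n := n) hC hR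
  have hα : 0 < α := by linarith
  have hS := sewConst_pos (p := 3 * α) (by linarith)
  have hG := isGerm_germ hα hα2 hR ha hC hc h
  have hb : ∀ x ∈ box, ∀ y ∈ box, x ≤ y →
      ‖germ f g ψ A v x y‖ ≤ (germConst n C R * R + 7 * C) * |y - x| ^ α := by
    intro x hx y hy _
    have h1 := norm_germ_sub_le hα hα2 hR (by linarith) hC hc h
      (sliceBound_zero (by linarith) ha) h.diff_zero hx hy
    have h2 : ‖germ f g 0 0 0 x y‖ ≤ 7 * |y - x| ^ α * C := by
      rw [germ_zero, norm_smul]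
      have hr : |y - x| ≤ 2 * Real.pi := abs_sub_le_of_mem_box hy hx
      have hlin : |y - x| ≤ 7 * |y - x| ^ α := by
        have := rpow_exponent_le (γ := α) (δ := 1) (r := |y - x|) (by linarith) (by linarith)
          (abs_nonneg _) hr one_pos
        simpa using this
      have : ‖f 0‖ ≤ C := by simpa using hc.bound_f.2.1 0 (by simp; linarith)
      gcongr
      exact hlin
    have e : germ f g ψ A v x y = (germ f g ψ A v x y - germ f g 0 0 0 x y) + germ f g 0 0 0 x y := by
      abel
    rw [e]
    refine (norm_add_le _ _).trans ?_
    linarith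
  refine (isPrimitive_sew (by linarith) (by linarith) (by linarith) hG hb).mono ?_
  unfold primConst
  have h1 : 7 * C ≤ germConst n C R := by
    unfold germConst
    have h1R : 1 ≤ R ^ 3 := one_le_pow₀ hR
    have hn : 0 ≤ (n:ℝ) ^ 2 := by positivity
    have : C * 1 ≤ C * R ^ 3 := by gcongr
    have : 0 ≤ (n:ℝ) ^ 2 * (C * R ^ 3) := by positivity
    nlinarith
  have h2 : (1 + a) * R + a ≤ 3 * R * (1 + a) := by nlinarith
  have h3 : germConst n C R * R + 7 * C ≤ 3 * R * (1 + a) * germConst n C R := by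
    have : germConst n C R * R + germConst n C R ≤ germConst n C R * (3 * R * (1 + a)) := by
      rw [← mul_add_one]; gcongr; nlinarith
    linarith
  have h4 : sewConst (3 * α) * (germConst n C R * ((1 + a) * R + a))
      ≤ sewConst (3 * α) * (germConst n C R * (3 * R * (1 + a))) := by gcongr
  linarith

end Primitive

/-! ### Volterra integrals with singular kernels -/

section Volterra

set_option linter.unusedSectionVars false

variable {E : Type*} [NormedAddCommGroup E] [NormedSpace ℝ E] [CompleteSpace E]

/-- Splitting at `t / 2` separates the two singularities of the Beta integrand. -/
lemma rpow_neg_mul_rpow_neg_le {e θ s t : ℝ} (he : 0 ≤ e) (hθ : 0 ≤ θ) (hs : 0 < s) (hst : s < t) :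
    (t - s) ^ (-e) * s ^ (-θ) ≤ (t / 2) ^ (-e) * s ^ (-θ) + (t / 2) ^ (-θ) * (t - s) ^ (-e) := by
  have ht : 0 < t := hs.trans hst
  have hts : 0 < t - s := by linarith
  rcases le_total s (t / 2) with h | h
  · have : (t - s) ^ (-e) ≤ (t / 2) ^ (-e) :=
      Real.rpow_le_rpow_of_nonpos (by linarith) (by linarith) (by linarith)
    have h2 : 0 ≤ (t / 2) ^ (-θ) * (t - s) ^ (-e) := by positivity
    have : (t - s) ^ (-e) * s ^ (-θ) ≤ (t / 2) ^ (-e) * s ^ (-θ) := by gcongr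
    linarith
  · have : s ^ (-θ) ≤ (t / 2) ^ (-θ) :=
      Real.rpow_le_rpow_of_nonpos (by linarith) h (by linarith)
    have h2 : 0 ≤ (t / 2) ^ (-e) * s ^ (-θ) := by positivity
    have : (t - s) ^ (-e) * s ^ (-θ) ≤ (t - s) ^ (-e) * (t / 2) ^ (-θ) := by gcongr
    linarith

lemma intervalIntegrable_rpow_sub {e t : ℝ} (he1 : e < 1) :
    IntervalIntegrable (fun s : ℝ => (t - s) ^ (-e)) volume 0 t := by
  have := (intervalIntegral.intervalIntegrable_rpow' (a := 0) (b := t) (r := -e)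
    (by linarith)).comp_sub_left t
  simpa using this.symm

lemma integral_rpow_sub {e t : ℝ} (he1 : e < 1) :
    ∫ s in (0:ℝ)..t, (t - s) ^ (-e) = t ^ (1 - e) / (1 - e) := by
  rw [intervalIntegral.integral_comp_sub_left (fun s => s ^ (-e)), sub_self, sub_zero,
    integral_rpow (Or.inl (by linarith)), Real.zero_rpow (by linarith)]
  rw [sub_zero, neg_add_eq_sub]

lemma integral_rpow_zero {θ t : ℝ} (hθ1 : θ < 1) :
    ∫ s in (0:ℝ)..t, s ^ (-θ) = t ^ (1 - θ) / (1 - θ) := by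
  rw [integral_rpow (Or.inl (by linarith)), Real.zero_rpow (by linarith)]
  rw [sub_zero, neg_add_eq_sub]

lemma ae_Ioc_of_Ioo {t : ℝ} {p : ℝ → Prop} (h : ∀ s, 0 < s → s < t → p s) :
    ∀ᵐ s : ℝ, s ∈ Ioc 0 t → p s := by
  have : ∀ᵐ s : ℝ, s ≠ t := by simp [ae_iff]
  filter_upwards [this] with s hs hs2
  exact h s hs2.1 (lt_of_le_of_ne hs2.2 hs)

lemma betaDominator_integrable {e θ t : ℝ} (he1 : e < 1) (hθ1 : θ < 1) :
    IntervalIntegrable (fun s : ℝ => (t / 2) ^ (-e) * s ^ (-θ) + (t / 2) ^ (-θ) * (t - s) ^ (-e))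
      volume 0 t :=
  ((intervalIntegral.intervalIntegrable_rpow' (by linarith)).const_mul _).add
    ((intervalIntegrable_rpow_sub he1).const_mul _)

lemma integral_betaDominator {e θ t : ℝ} (he : 0 ≤ e) (he1 : e < 1) (hθ : 0 ≤ θ) (hθ1 : θ < 1)
    (ht : 0 < t) :
    ∫ s in (0:ℝ)..t, ((t / 2) ^ (-e) * s ^ (-θ) + (t / 2) ^ (-θ) * (t - s) ^ (-e))
      ≤ (2 / (1 - θ) + 2 / (1 - e)) * t ^ (1 - e - θ) := by
  rw [intervalIntegral.integral_add
    ((intervalIntegral.intervalIntegrable_rpow' (by linarith)).const_mul _)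
    ((intervalIntegrable_rpow_sub he1).const_mul _), intervalIntegral.integral_const_mul,
    intervalIntegral.integral_const_mul, integral_rpow_sub he1, integral_rpow_zero hθ1]
  have half : ∀ q : ℝ, 0 ≤ q → q < 1 → (t / 2) ^ (-q) ≤ 2 * t ^ (-q) := by
    intro q hq hq1
    rw [Real.div_rpow ht.le (by norm_num), div_eq_mul_inv, ← Real.rpow_neg (by norm_num), neg_neg,
      mul_comm]
    gcongr
    calc (2:ℝ) ^ q ≤ 2 ^ (1:ℝ) := Real.rpow_le_rpow_of_exponent_le (by norm_num) hq1.le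
      _ = 2 := by simp
  have e1 : t ^ (-e) * t ^ (1 - θ) = t ^ (1 - e - θ) := by rw [← Real.rpow_add ht]; ring_nf
  have e2 : t ^ (-θ) * t ^ (1 - e) = t ^ (1 - e - θ) := by rw [← Real.rpow_add ht]; ring_nf
  have p1 : 0 < 1 - θ := by linarith
  have p2 : 0 < 1 - e := by linarith
  calc _ ≤ (2 * t ^ (-e)) * (t ^ (1 - θ) / (1 - θ)) + (2 * t ^ (-θ)) * (t ^ (1 - e) / (1 - e)) := by
        gcongr
        · exact half e he he1
        · exact half θ hθ hθ1
    _ = 2 / (1 - θ) * (t ^ (-e) * t ^ (1 - θ)) + 2 / (1 - e) * (t ^ (-θ) * t ^ (1 - e)) := by ring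
    _ = _ := by rw [e1, e2]; ring

lemma intervalIntegrable_beta {e θ t : ℝ} (he : 0 ≤ e) (he1 : e < 1) (hθ : 0 ≤ θ) (hθ1 : θ < 1)
    (ht : 0 < t) : IntervalIntegrable (fun s : ℝ => (t - s) ^ (-e) * s ^ (-θ)) volume 0 t := by
  rw [intervalIntegrable_iff_integrableOn_Ioo_of_le ht.le]
  have h := betaDominator_integrable (t := t) he1 hθ1
  rw [intervalIntegrable_iff_integrableOn_Ioo_of_le ht.le] at h
  refine Integrable.mono' h ?_ ?_
  · exact (((measurable_const.sub measurable_id).pow_const _).mul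
      (measurable_id.pow_const _)).aestronglyMeasurable
  · rw [ae_restrict_iff' measurableSet_Ioo]
    refine ae_of_all _ fun s hs => ?_
    have : 0 < t - s := by linarith [hs.2]
    have : 0 < s := hs.1
    rw [Real.norm_of_nonneg (by positivity)]
    exact rpow_neg_mul_rpow_neg_le he hθ hs.1 hs.2

/-- The order in `t` of the Beta integral. -/
lemma integral_beta_le {e θ t : ℝ} (he : 0 ≤ e) (he1 : e < 1) (hθ : 0 ≤ θ) (hθ1 : θ < 1)
    (ht : 0 < t) : ∫ s in (0:ℝ)..t, (t - s) ^ (-e) * s ^ (-θ)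
      ≤ (2 / (1 - θ) + 2 / (1 - e)) * t ^ (1 - e - θ) := by
  refine le_trans ?_ (integral_betaDominator he he1 hθ hθ1 ht)
  refine intervalIntegral.integral_mono_on_of_le_Ioo ht.le (intervalIntegrable_beta he he1 hθ hθ1 ht)
    (betaDominator_integrable he1 hθ1) fun s hs => ?_
  exact rpow_neg_mul_rpow_neg_le he hθ hs.1 hs.2

/-- A singular Volterra integral against a function growing at most like `s^{-θ} e^{λ s}`. The
factor `λ^{-α/4}` comes from `e^{-λ r} ≤ (λ r)^{-α/4}`. -/
lemma norm_integral_singular_le {F : ℝ → E} {c B lam α θ q t : ℝ} (hα : 0 < α) (hα1 : α ≤ 1)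
    (hθ : 0 ≤ θ) (hθ1 : θ ≤ 1 / 2) (hq : 0 ≤ q) (hq1 : q ≤ 1 - α / 2) (hlam : 0 < lam) (hc : 0 ≤ c)
    (hB : 0 ≤ B) (ht : 0 < t)
    (hF : ∀ s, 0 < s → s < t →
      ‖F s‖ ≤ c * (B * s ^ (-θ) * Real.exp (lam * s)) * (t - s) ^ (-q)) :
    ‖∫ s in (0:ℝ)..t, F s‖
      ≤ c * B * (4 + 8 / α) * lam ^ (-(α / 4)) * Real.exp (lam * t) * t ^ (1 - q - α / 4 - θ) := by
  have hi := intervalIntegrable_beta (e := q + α / 4) (θ := θ) (t := t) (by linarith) (by linarith)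
    hθ (by linarith) ht
  set D := c * B * lam ^ (-(α / 4)) * Real.exp (lam * t) with hD
  have hD0 : 0 ≤ D := by positivity
  have h1 : ‖∫ s in (0:ℝ)..t, F s‖ ≤ ∫ s in (0:ℝ)..t, D * ((t - s) ^ (-(q + α / 4)) * s ^ (-θ)) := by
    refine intervalIntegral.norm_integral_le_of_norm_le ht.le (ae_Ioc_of_Ioo fun s hs hst => ?_)
      (hi.const_mul _)
    have hts : 0 < t - s := by linarith
    refine (hF s hs hst).trans ?_
    have e1 : Real.exp (lam * s) ≤ Real.exp (lam * t) * (lam ^ (-(α / 4)) * (t - s) ^ (-(α / 4))) := by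
      have := exp_neg_le_rpow (τ := lam * (t - s)) (γ := α / 4) (by positivity) (by linarith)
        (by linarith)
      rw [Real.mul_rpow hlam.le hts.le] at this
      calc Real.exp (lam * s) = Real.exp (lam * t) * Real.exp (-(lam * (t - s))) := by
            rw [← Real.exp_add]; ring_nf
        _ ≤ _ := by gcongr
    have e2 : (t - s) ^ (-(q + α / 4)) = (t - s) ^ (-(α / 4)) * (t - s) ^ (-q) := by
      rw [← Real.rpow_add hts]; ring_nf
    rw [e2, hD]
    calc _ ≤ c * (B * s ^ (-θ) * (Real.exp (lam * t)
          * (lam ^ (-(α / 4)) * (t - s) ^ (-(α / 4))))) * (t - s) ^ (-q) := by gcongr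
      _ = _ := by ring
  refine h1.trans ?_
  rw [intervalIntegral.integral_const_mul]
  have h2 := integral_beta_le (e := q + α / 4) (θ := θ) (t := t) (by linarith) (by linarith)
    hθ (by linarith) ht
  have h3 : 2 / (1 - θ) + 2 / (1 - (q + α / 4)) ≤ 4 + 8 / α := by
    have a1 : 2 / (1 - θ) ≤ 2 / (1 / 2) := by gcongr; linarith
    have a2 : 2 / (1 - (q + α / 4)) ≤ 2 / (α / 4) := by gcongr; linarith
    have a3 : 2 / (α / 4) = 8 / α := by field_simp; norm_num
    rw [a3] at a2
    norm_num at a1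
    linarith
  calc _ ≤ D * ((4 + 8 / α) * t ^ (1 - (q + α / 4) - θ)) := by
        gcongr
        exact h2.trans (by gcongr)
    _ = _ := by rw [hD, show 1 - (q + α / 4) - θ = 1 - q - α / 4 - θ by ring]; ring

/-- The constant in the Volterra estimates on time intervals of length `T`. -/
noncomputable def volterraConst (α T : ℝ) : ℝ := 10 * gaussConst * (4 + 8 / α) * (1 + T)

lemma volterraConst_pos {α T : ℝ} (hα : 0 < α) (hT : 0 ≤ T) : 0 < volterraConst α T := by
  have := gaussConst_pos
  unfold volterraConst; positivity

lemma rpow_le_one_add {p t T : ℝ} (hp : 0 ≤ p) (hp1 : p ≤ 1) (ht : 0 < t) (htT : t ≤ T) :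
    t ^ p ≤ 1 + T := by
  rcases le_total t 1 with h | h
  · have := Real.rpow_le_one ht.le h hp
    linarith
  · have := Real.rpow_le_rpow_of_exponent_le h hp1
    rw [Real.rpow_one] at this
    linarith

/-- The solution `t ↦ ∫₀ᵗ duhamel (t - s) (H s) ds` of the inhomogeneous heat equation. -/
noncomputable def volterra (H : ℝ → ℝ → E) (t x : ℝ) : E :=
  ∫ s in (0:ℝ)..t, duhamel (t - s) (H s) x

variable {H : ℝ → ℝ → E} {α β B lam t T : ℝ}

lemma norm_volterra_le (hα : 0 < α) (hα1 : α ≤ 1) (hβ : 0 ≤ β) (hβ1 : β ≤ 1) (hlam : 0 < lam)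
    (hB : 0 ≤ B) (ht : 0 < t) (htT : t ≤ T)
    (hH : ∀ s, 0 < s → s < t →
      IsPrimitive α (B * s ^ (-((1 - β) / 2)) * Real.exp (lam * s)) (H s)) (x : ℝ) :
    ‖volterra H t x‖ ≤ volterraConst α T * B * lam ^ (-(α / 4)) * Real.exp (lam * t) := by
  have hG := gaussConst_pos
  refine (norm_integral_singular_le (c := 5 * gaussConst) (q := (1 - α) / 2) hα hα1
    (θ := (1 - β) / 2) (by linarith) (by linarith) (by linarith) (by linarith) hlam (by positivity)
    hB ht fun s hs hst => ?_).trans ?_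
  · have := norm_duhamel_le (hH s hs hst) hα hα1 (sub_pos.2 hst) x
    rwa [show (α - 1) / 2 = -((1 - α) / 2) by ring] at this
  · have := rpow_le_one_add (p := 1 - (1 - α) / 2 - α / 4 - (1 - β) / 2) (by linarith) (by linarith)
      ht htT
    have hT : 0 ≤ T := ht.le.trans htT
    unfold volterraConst
    calc _ ≤ 5 * gaussConst * B * (4 + 8 / α) * lam ^ (-(α / 4)) * Real.exp (lam * t) * (1 + T) := by
          gcongr
      _ ≤ 10 * gaussConst * B * (4 + 8 / α) * lam ^ (-(α / 4)) * Real.exp (lam * t) * (1 + T) := by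
          gcongr; norm_num
      _ = _ := by ring

lemma volterra_sub_apply (hi : ∀ x, IntervalIntegrable (fun s => duhamel (t - s) (H s) x) volume 0 t)
    (x y : ℝ) : volterra H t x - volterra H t y
      = ∫ s in (0:ℝ)..t, (duhamel (t - s) (H s) x - duhamel (t - s) (H s) y) := by
  unfold volterra
  rw [intervalIntegral.integral_sub (hi x) (hi y)]

lemma norm_volterra_sub_le_holder (hα : 0 < α) (hα1 : α ≤ 1) (hβ : 0 ≤ β) (hβ1 : β ≤ 1)
    (hαβ : α ≤ β) (hlam : 0 < lam) (hB : 0 ≤ B) (ht : 0 < t) (htT : t ≤ T)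
    (hH : ∀ s, 0 < s → s < t →
      IsPrimitive α (B * s ^ (-((1 - β) / 2)) * Real.exp (lam * s)) (H s))
    (hi : ∀ x, IntervalIntegrable (fun s => duhamel (t - s) (H s) x) volume 0 t) (x y : ℝ) :
    ‖volterra H t x - volterra H t y‖
      ≤ volterraConst α T * B * lam ^ (-(α / 4)) * Real.exp (lam * t) * |x - y| ^ β := by
  have hG := gaussConst_pos
  rw [volterra_sub_apply hi]
  refine (norm_integral_singular_le (c := 10 * gaussConst * |x - y| ^ β) (q := (1 + β - α) / 2)
    hα hα1 (θ := (1 - β) / 2) (by linarith) (by linarith) (by linarith) (by linarith) hlam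
    (by positivity) hB ht fun s hs hst => ?_).trans ?_
  · have := norm_duhamel_sub_le_holder (hH s hs hst) hα hα1 hβ hβ1 (sub_pos.2 hst) x y
    rw [show (α - 1 - β) / 2 = -((1 + β - α) / 2) by ring] at this
    refine this.trans (le_of_eq (by ring))
  · have := rpow_le_one_add (p := 1 - (1 + β - α) / 2 - α / 4 - (1 - β) / 2) (by linarith)
      (by linarith) ht htT
    have hT : 0 ≤ T := ht.le.trans htT
    unfold volterraConst
    calc _ ≤ 10 * gaussConst * |x - y| ^ β * B * (4 + 8 / α) * lam ^ (-(α / 4))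
          * Real.exp (lam * t) * (1 + T) := by gcongr
      _ = _ := by ring

/-- The Lipschitz bound for `volterra H`. The weight `t^{-(1-β)/2}` is reproduced. -/
lemma norm_volterra_sub_le (hα : 0 < α) (hα1 : α ≤ 1) (hβ : 0 ≤ β) (hβ1 : β ≤ 1) (hlam : 0 < lam)
    (hB : 0 ≤ B) (ht : 0 < t) (htT : t ≤ T)
    (hH : ∀ s, 0 < s → s < t →
      IsPrimitive α (B * s ^ (-((1 - β) / 2)) * Real.exp (lam * s)) (H s))
    (hi : ∀ x, IntervalIntegrable (fun s => duhamel (t - s) (H s) x) volume 0 t) (x y : ℝ) :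
    ‖volterra H t x - volterra H t y‖
      ≤ volterraConst α T * B * lam ^ (-(α / 4)) * Real.exp (lam * t) * t ^ (-((1 - β) / 2))
        * |x - y| := by
  have hG := gaussConst_pos
  rw [volterra_sub_apply hi]
  refine (norm_integral_singular_le (c := 4 * gaussConst * |x - y|) (q := 1 - α / 2)
    hα hα1 (θ := (1 - β) / 2) (by linarith) (by linarith) (by linarith) (by linarith) hlam
    (by positivity) hB ht fun s hs hst => ?_).trans ?_
  · have := norm_duhamel_sub_le (hH s hs hst) hα hα1 (sub_pos.2 hst) x y
    rw [show α / 2 - 1 = -(1 - α / 2) by ring] at this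
    refine this.trans (le_of_eq (by ring))
  · have h1 := rpow_le_one_add (p := α / 4) (by linarith) (by linarith) ht htT
    have e : t ^ (1 - (1 - α / 2) - α / 4 - (1 - β) / 2) = t ^ (α / 4) * t ^ (-((1 - β) / 2)) := by
      rw [← Real.rpow_add ht]; ring_nf
    have hT : 0 ≤ T := ht.le.trans htT
    rw [e]
    unfold volterraConst
    calc _ ≤ 10 * gaussConst * |x - y| * B * (4 + 8 / α) * lam ^ (-(α / 4))
          * Real.exp (lam * t) * ((1 + T) * t ^ (-((1 - β) / 2))) := by gcongr; norm_num
      _ = _ := by ring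

/-- Domination gives integrability of the Duhamel integrand. -/
lemma intervalIntegrable_duhamel (hα : 0 < α) (hα1 : α ≤ 1) (hβ : 0 ≤ β) (hβ1 : β ≤ 1)
    (hlam : 0 ≤ lam) (hB : 0 ≤ B) (ht : 0 < t) {x : ℝ}
    (hm : AEStronglyMeasurable (fun s => duhamel (t - s) (H s) x) (volume.restrict (Ioo 0 t)))
    (hH : ∀ s, 0 < s → s < t →
      IsPrimitive α (B * s ^ (-((1 - β) / 2)) * Real.exp (lam * s)) (H s)) :
    IntervalIntegrable (fun s => duhamel (t - s) (H s) x) volume 0 t := by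
  have hG := gaussConst_pos
  have hi := intervalIntegrable_beta (e := (1 - α) / 2) (θ := (1 - β) / 2) (t := t) (by linarith)
    (by linarith) (by linarith) (by linarith) ht
  have hi2 := hi.const_mul (5 * gaussConst * B * Real.exp (lam * t))
  rw [intervalIntegrable_iff_integrableOn_Ioo_of_le ht.le] at hi2 ⊢
  refine Integrable.mono' hi2 hm ?_
  rw [ae_restrict_iff' measurableSet_Ioo]
  refine ae_of_all _ fun s hs => ?_
  have := norm_duhamel_le (hH s hs.1 hs.2) hα hα1 (sub_pos.2 hs.2) x
  rw [show (α - 1) / 2 = -((1 - α) / 2) by ring] at this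
  have hs0 := hs.1
  have hts : 0 < t - s := sub_pos.2 hs.2
  refine this.trans ?_
  calc _ ≤ 5 * gaussConst * (B * s ^ (-((1 - β) / 2)) * Real.exp (lam * t)) * (t - s) ^ (-((1 - α) / 2)) := by
        gcongr
        exact hs.2.le
    _ = _ := by ring

end Volterra

/-! ### The integral equation -/

/-- A time dependent path together with its area process. -/
structure Noise (n : ℕ) where
  path : ℝ → ℝ → Vec n
  area : ℝ → ℝ → ℝ → Fin n → Fin n → ℝ

/-- The noise seen from time `r` on. -/
def Noise.shift {n : ℕ} (N : Noise n) (r : ℝ) : Noise n :=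
  ⟨fun s => N.path (r + s), fun s => N.area (r + s)⟩

/-- Measurability and Chen's relation. -/
structure Noise.Regular {n : ℕ} (N : Noise n) : Prop where
  meas_path : Measurable fun p : ℝ × ℝ => N.path p.1 p.2
  meas_area : Measurable fun p : ℝ × ℝ × ℝ => N.area p.1 p.2.1 p.2.2
  chen : ∀ s, ∀ x ∈ box, ∀ y ∈ box, ∀ z ∈ box, ∀ i j,
    N.area s x z i j - N.area s y z i j - N.area s x y i j
      = (N.path s y i - N.path s x i) * (N.path s z j - N.path s y j)

/-- The difference of two noises is bounded by `D` on `[0, T]`, in `C^β` for the paths and with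
exponent `2α` for the areas. -/
structure Noise.DiffBound {n : ℕ} (α β T D : ℝ) (N N' : Noise n) : Prop where
  sup : ∀ s ∈ Icc 0 T, ∀ x ∈ box, ‖N.path s x - N'.path s x‖ ≤ D
  hol : ∀ s ∈ Icc 0 T, ∀ x ∈ box, ∀ y ∈ box,
    ‖(N.path s y - N.path s x) - (N'.path s y - N'.path s x)‖ ≤ D * |y - x| ^ β
  area : ∀ s ∈ Icc 0 T, ∀ x ∈ box, ∀ y ∈ box,
    ‖N.area s x y - N'.area s x y‖ ≤ D * |y - x| ^ (2 * α)

/-- The vanishing noise. -/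
def Noise.zero (n : ℕ) : Noise n := ⟨0, 0⟩

/-- The noise is bounded by `R` on `[0, T]`. -/
def Noise.BoundedBy {n : ℕ} (α β T R : ℝ) (N : Noise n) : Prop :=
  N.DiffBound α β T R (Noise.zero n)

/-- `w t` is bounded in `C^β` by `m e^{λ t}`, with Lipschitz constant at most
`m t^{-(1-β)/2} e^{λ t}`, for `0 < t ≤ T`. -/
structure WBound {n : ℕ} (β T lam m : ℝ) (w : ℝ → ℝ → Vec n) : Prop where
  sup : ∀ t, 0 < t → t ≤ T → ∀ x, ‖w t x‖ ≤ m * Real.exp (lam * t)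
  hol : ∀ t, 0 < t → t ≤ T → ∀ x y, ‖w t x - w t y‖ ≤ m * Real.exp (lam * t) * |x - y| ^ β
  lip : ∀ t, 0 < t → t ≤ T → ∀ x y,
    ‖w t x - w t y‖ ≤ m * t ^ (-((1 - β) / 2)) * Real.exp (lam * t) * |x - y|

/-- The primitive in space of the right hand side of the equation at time `s`. -/
noncomputable def rhs {n : ℕ} (f : Vec n → Vec n) (g : Vec n → Vec n →L[ℝ] Vec n) (N : Noise n)
    (v : ℝ → ℝ → Vec n) (s : ℝ) : ℝ → Vec n :=
  sew (germ f g (N.path s) (N.area s) (v s))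

/-- Bounded, `β`-Hölder and periodic functions on the line. -/
structure IsDatum {n : ℕ} (β M : ℝ) (h : ℝ → Vec n) : Prop where
  periodic : Function.Periodic h (2 * Real.pi)
  sup : ∀ x, ‖h x‖ ≤ M
  hol : ∀ x y, ‖h x - h y‖ ≤ M * |x - y| ^ β

/-- `v` solves, on `(0, T]` and on the line, the integral equation with initial datum `v₀`, in which
the right hand side enters through its primitive. -/
structure IsSol {n : ℕ} (f : Vec n → Vec n) (g : Vec n → Vec n →L[ℝ] Vec n) (β : ℝ) (N : Noise n)
    (v₀ : ℝ → Vec n) (T : ℝ) (v : ℝ → ℝ → Vec n) : Prop where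
  meas : Measurable fun p : ℝ × ℝ => v p.1 p.2
  periodic : ∀ t, 0 < t → t ≤ T → Function.Periodic (v t) (2 * Real.pi)
  bound : ∃ M, WBound β T 0 M v
  eq : ∀ t, 0 < t → t ≤ T → ∀ x, v t x = heat t v₀ x + volterra (rhs f g N v) t x

section Measurability

set_option linter.unusedSectionVars false

variable {n : ℕ} {f : Vec n → Vec n} {g : Vec n → Vec n →L[ℝ] Vec n} {N : Noise n}
  {v : ℝ → ℝ → Vec n}

lemma Noise.Regular.shift (hN : N.Regular) (r : ℝ) : (N.shift r).Regular where
  meas_path := hN.meas_path.comp (by fun_prop : Measurable fun p : ℝ × ℝ => (r + p.1, p.2))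
  meas_area := hN.meas_area.comp
    (by fun_prop : Measurable fun p : ℝ × ℝ × ℝ => (r + p.1, p.2.1, p.2.2))
  chen s := hN.chen (r + s)

lemma continuous_contract : Continuous fun p : (Vec n →L[ℝ] Vec n →L[ℝ] Vec n) ×
    (Fin n → Fin n → ℝ) => contract p.1 p.2 := by
  unfold contract
  fun_prop

lemma continuous_germAt (hf : Continuous f) (hg : ContDiff ℝ ∞ g) :
    Continuous fun q : (Vec n × Vec n) × (Fin n → Fin n → ℝ) × ℝ =>
      g q.1.1 (q.1.2 - q.1.1) + contract (fderiv ℝ g q.1.1) q.2.1 + q.2.2 • (f q.1.1 + q.1.1) := by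
  have hdg : Continuous (fderiv ℝ g) := hg.continuous_fderiv (by simp)
  have hgc := hg.continuous
  have c0 : Continuous fun q : (Vec n × Vec n) × (Fin n → Fin n → ℝ) × ℝ => q.1.1 := by fun_prop
  have c1 : Continuous fun q : (Vec n × Vec n) × (Fin n → Fin n → ℝ) × ℝ =>
      g q.1.1 (q.1.2 - q.1.1) := (hgc.comp c0).clm_apply (by fun_prop)
  have c2 : Continuous fun q : (Vec n × Vec n) × (Fin n → Fin n → ℝ) × ℝ =>
      contract (fderiv ℝ g q.1.1) q.2.1 :=
    continuous_contract.comp ((hdg.comp c0).prodMk (continuous_fst.comp continuous_snd))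
  have c3 : Continuous fun q : (Vec n × Vec n) × (Fin n → Fin n → ℝ) × ℝ =>
      q.2.2 • (f q.1.1 + q.1.1) := Continuous.smul (continuous_snd.comp continuous_snd) ((hf.comp c0).add c0)
  exact (c1.add c2).add c3

lemma measurable_germ (hf : Continuous f) (hg : ContDiff ℝ ∞ g) (hN : N.Regular)
    (hv : Measurable fun p : ℝ × ℝ => v p.1 p.2) :
    Measurable fun p : ℝ × ℝ × ℝ => germ f g (N.path p.1) (N.area p.1) (v p.1) p.2.1 p.2.2 := by
  have e1 : Measurable fun p : ℝ × ℝ × ℝ => (p.1, p.2.1) := by fun_prop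
  have e2 : Measurable fun p : ℝ × ℝ × ℝ => (p.1, p.2.2) := by fun_prop
  have m1 : Measurable fun p : ℝ × ℝ × ℝ => v p.1 p.2.1 + N.path p.1 p.2.1 :=
    (hv.comp e1).add (hN.meas_path.comp e1)
  have m2 : Measurable fun p : ℝ × ℝ × ℝ => v p.1 p.2.2 + N.path p.1 p.2.2 :=
    (hv.comp e2).add (hN.meas_path.comp e2)
  have m3 : Measurable fun p : ℝ × ℝ × ℝ => p.2.2 - p.2.1 := by fun_prop
  unfold germ
  exact Measurable.comp (g := fun q : (Vec n × Vec n) × (Fin n → Fin n → ℝ) × ℝ =>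
      g q.1.1 (q.1.2 - q.1.1) + contract (fderiv ℝ g q.1.1) q.2.1 + q.2.2 • (f q.1.1 + q.1.1))
    (f := fun p : ℝ × ℝ × ℝ => ((v p.1 p.2.1 + N.path p.1 p.2.1, v p.1 p.2.2 + N.path p.1 p.2.2),
      (N.area p.1 p.2.1 p.2.2, p.2.2 - p.2.1)))
    (continuous_germAt hf hg).measurable ((m1.prodMk m2).prodMk (hN.meas_area.prodMk m3))

lemma measurable_rhs (hf : Continuous f) (hg : ContDiff ℝ ∞ g) (hN : N.Regular)
    (hv : Measurable fun p : ℝ × ℝ => v p.1 p.2) :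
    StronglyMeasurable fun p : ℝ × ℝ => rhs f g N v p.1 p.2 := by
  unfold rhs sew
  refine StronglyMeasurable.limUnder fun k => ?_
  refine Measurable.stronglyMeasurable ?_
  unfold sewSum
  refine Finset.measurable_sum _ fun i _ => ?_
  refine (measurable_germ hf hg hN hv).comp (g := fun p : ℝ × ℝ × ℝ =>
    germ f g (N.path p.1) (N.area p.1) (v p.1) p.2.1 p.2.2)
    (f := fun p : ℝ × ℝ => (p.1, trunc 0 p.2 (dyadic k i), trunc 0 p.2 (dyadic k (i + 1)))) ?_
  unfold trunc
  fun_prop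

lemma measurable_toIcoMod : Measurable fun x : ℝ => toIcoMod two_pi_pos' 0 x := by
  simp_rw [toIcoMod_eq_fract_mul]
  fun_prop

variable {E : Type*} [NormedAddCommGroup E] [NormedSpace ℝ E] [CompleteSpace E]
  {X : Type*} [MeasurableSpace X]

lemma stronglyMeasurable_perExt_bridge {H : ℝ → ℝ → E}
    (hH : StronglyMeasurable fun p : ℝ × ℝ => H p.1 p.2) :
    StronglyMeasurable fun p : ℝ × ℝ => perExt (bridge (H p.1)) p.2 := by
  have h1 : StronglyMeasurable fun p : ℝ × ℝ => bridge (H p.1) p.2 := by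
    unfold bridge
    have h2 : StronglyMeasurable fun p : ℝ × ℝ => H p.1 (2 * Real.pi) :=
      hH.comp_measurable (g := fun p : ℝ × ℝ => (p.1, 2 * Real.pi)) (by fun_prop)
    exact hH.sub ((by fun_prop : Measurable fun p : ℝ × ℝ => p.2 / (2 * Real.pi)).stronglyMeasurable.smul h2)
  exact h1.comp_measurable (g := fun p : ℝ × ℝ => (p.1, toIcoMod two_pi_pos' 0 p.2))
    (measurable_fst.prodMk (measurable_toIcoMod.comp measurable_snd))

lemma stronglyMeasurable_gaussMean {w : ℝ → ℝ} (hw : Measurable w) {h : ℝ → ℝ → E}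
    (hh : StronglyMeasurable fun p : ℝ × ℝ => h p.1 p.2) {σ s x : X → ℝ} (hσ : Measurable σ)
    (hs : Measurable s) (hx : Measurable x) :
    StronglyMeasurable fun a => gaussMean w (σ a) (h (s a)) (x a) := by
  unfold gaussMean
  have : StronglyMeasurable fun q : X × ℝ => w q.2 • h (s q.1) (x q.1 + σ q.1 * q.2) := by
    refine (hw.comp measurable_snd).stronglyMeasurable.smul ?_
    exact hh.comp_measurable (g := fun q : X × ℝ => (s q.1, x q.1 + σ q.1 * q.2)) (by fun_prop)
  exact this.integral_prod_right'

lemma stronglyMeasurable_duhamel {H : ℝ → ℝ → E}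
    (hH : StronglyMeasurable fun p : ℝ × ℝ => H p.1 p.2) {τ s x : X → ℝ} (hτ : Measurable τ)
    (hs : Measurable s) (hx : Measurable x) :
    StronglyMeasurable fun a => duhamel (τ a) (H (s a)) (x a) := by
  unfold duhamel dheat
  have h1 := stronglyMeasurable_gaussMean measurable_id
    (h := fun s => perExt (bridge (H s))) (stronglyMeasurable_perExt_bridge hH)
    (σ := fun a => Real.sqrt (2 * τ a)) (by fun_prop) hs hx
  have h2 : StronglyMeasurable fun a => H (s a) (2 * Real.pi) :=
    hH.comp_measurable (g := fun a => (s a, 2 * Real.pi)) (by fun_prop)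
  refine StronglyMeasurable.add ?_ ?_
  · exact (by fun_prop : Measurable fun a => Real.exp (-τ a)).stronglyMeasurable.smul
      ((by fun_prop : Measurable fun a => (Real.sqrt (2 * τ a))⁻¹).stronglyMeasurable.smul h1)
  · exact (by fun_prop : Measurable fun a => Real.exp (-τ a) / (2 * Real.pi)).stronglyMeasurable.smul h2

lemma stronglyMeasurable_heat {h : ℝ → E} (hh : Continuous h) :
    StronglyMeasurable fun p : ℝ × ℝ => heat p.1 h p.2 := by
  unfold heat
  have h1 := stronglyMeasurable_gaussMean (w := fun _ => 1) measurable_const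
    (h := fun _ => h) (hh.stronglyMeasurable.comp_measurable measurable_snd)
    (σ := fun p : ℝ × ℝ => Real.sqrt (2 * p.1)) (by fun_prop) measurable_fst measurable_snd
  exact (by fun_prop : Measurable fun p : ℝ × ℝ => Real.exp (-p.1)).stronglyMeasurable.smul h1

lemma stronglyMeasurable_volterra {H : ℝ → ℝ → E}
    (hH : StronglyMeasurable fun p : ℝ × ℝ => H p.1 p.2) :
    StronglyMeasurable fun p : ℝ × ℝ => if 0 < p.1 then volterra H p.1 p.2 else 0 := by
  have h1 : StronglyMeasurable fun q : (ℝ × ℝ) × ℝ =>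
      duhamel (q.1.1 - q.2) (H q.2) q.1.2 :=
    stronglyMeasurable_duhamel hH (by fun_prop) (by fun_prop) (by fun_prop)
  have hS : MeasurableSet {q : (ℝ × ℝ) × ℝ | q.2 ∈ Ioc 0 q.1.1} :=
    (measurableSet_lt measurable_const measurable_snd).inter
      (measurableSet_le measurable_snd (by fun_prop))
  have h2 := (h1.indicator hS).integral_prod_right' (ν := volume)
  have h3 : (fun p : ℝ × ℝ => if 0 < p.1 then volterra H p.1 p.2 else 0)
      = {p : ℝ × ℝ | 0 < p.1}.indicator fun p => ∫ s : ℝ, ({q : (ℝ × ℝ) × ℝ | q.2 ∈ Ioc 0 q.1.1}.indicator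
        (fun q => duhamel (q.1.1 - q.2) (H q.2) q.1.2)) (p, s) := by
    funext p
    by_cases hp : 0 < p.1
    · simp only [hp, if_true, indicator, mem_ofPred_eq]
      unfold volterra
      rw [intervalIntegral.integral_of_le hp.le, ← integral_indicator measurableSet_Ioc]
      simp only [indicator]
    · simp [hp]
  rw [h3]
  exact h2.indicator (measurableSet_lt measurable_const measurable_fst)

end Measurability

/-! ### Bounds in exponentially weighted norms -/

/-- The constraints `1/3 < α ≤ β < 1/2` on the exponents. -/
structure Exponents (α β : ℝ) : Prop where
  third_lt : 1 / 3 < α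
  le : α ≤ β
  lt_half : β < 1 / 2

/-- `v t` is bounded by `M` in `C^β`, for `0 < t ≤ T`. -/
structure CBound {n : ℕ} (β T M : ℝ) (v : ℝ → ℝ → Vec n) : Prop where
  sup : ∀ t, 0 < t → t ≤ T → ∀ x, ‖v t x‖ ≤ M
  hol : ∀ t, 0 < t → t ≤ T → ∀ x y, ‖v t x - v t y‖ ≤ M * |x - y| ^ β

section Bounds

variable {n : ℕ} {f : Vec n → Vec n} {g : Vec n → Vec n →L[ℝ] Vec n} {N N' : Noise n}
  {v v' w : ℝ → ℝ → Vec n} {α β T T' R M m D lam : ℝ}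

lemma WBound.cBound (h : WBound β T 0 M v) : CBound β T M v where
  sup t ht htT x := by simpa using h.sup t ht htT x
  hol t ht htT x y := by simpa using h.hol t ht htT x y

lemma WBound.mono {m' : ℝ} (h : WBound β T lam m w) (hm : m ≤ m') : WBound β T lam m' w where
  sup t ht htT x := (h.sup t ht htT x).trans (by gcongr)
  hol t ht htT x y := (h.hol t ht htT x y).trans (by gcongr)
  lip t ht htT x y := (h.lip t ht htT x y).trans (by gcongr)

lemma WBound.mono_time (h : WBound β T lam m w) (hT : T' ≤ T) : WBound β T' lam m w where
  sup t ht htT x := h.sup t ht (htT.trans hT) x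
  hol t ht htT x y := h.hol t ht (htT.trans hT) x y
  lip t ht htT x y := h.lip t ht (htT.trans hT) x y

lemma CBound.mono_time (h : CBound β T M w) (hT : T' ≤ T) : CBound β T' M w where
  sup t ht htT x := h.sup t ht (htT.trans hT) x
  hol t ht htT x y := h.hol t ht (htT.trans hT) x y

lemma WBound.mono_rate {lam' : ℝ} (h : WBound β T lam m w) (hm : 0 ≤ m) (hl : lam ≤ lam') :
    WBound β T lam' m w where
  sup t ht htT x := (h.sup t ht htT x).trans (by gcongr)
  hol t ht htT x y := (h.hol t ht htT x y).trans (by gcongr)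
  lip t ht htT x y := (h.lip t ht htT x y).trans (by gcongr)

/-- On a bounded time interval the exponential weight can be absorbed in the constant. -/
lemma WBound.to_zero_rate (h : WBound β T lam m w) (hm : 0 ≤ m) (hl : 0 ≤ lam) :
    WBound β T 0 (m * Real.exp (lam * T)) w where
  sup t ht htT x := (h.sup t ht htT x).trans (by rw [zero_mul, Real.exp_zero, mul_one]; gcongr)
  hol t ht htT x y := (h.hol t ht htT x y).trans (by rw [zero_mul, Real.exp_zero, mul_one]; gcongr)
  lip t ht htT x y := (h.lip t ht htT x y).trans (by
    rw [zero_mul, Real.exp_zero, mul_one, mul_right_comm m (Real.exp _)]; gcongr)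

lemma WBound.add {m' : ℝ} {w' : ℝ → ℝ → Vec n} (h : WBound β T lam m w)
    (h' : WBound β T lam m' w') : WBound β T lam (m + m') (fun t x => w t x + w' t x) where
  sup t ht htT x := (norm_add_le _ _).trans
    ((add_le_add (h.sup t ht htT x) (h'.sup t ht htT x)).trans (le_of_eq (by ring)))
  hol t ht htT x y := by
    have e : w t x + w' t x - (w t y + w' t y) = (w t x - w t y) + (w' t x - w' t y) := by abel
    rw [e]
    exact (norm_add_le _ _).trans
      ((add_le_add (h.hol t ht htT x y) (h'.hol t ht htT x y)).trans (le_of_eq (by ring)))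
  lip t ht htT x y := by
    have e : w t x + w' t x - (w t y + w' t y) = (w t x - w t y) + (w' t x - w' t y) := by abel
    rw [e]
    exact (norm_add_le _ _).trans
      ((add_le_add (h.lip t ht htT x y) (h'.lip t ht htT x y)).trans (le_of_eq (by ring)))

lemma WBound.congr (h : WBound β T lam m w) (hw : ∀ t, 0 < t → t ≤ T → ∀ x, w t x = v t x) :
    WBound β T lam m v where
  sup t ht htT x := by rw [← hw t ht htT]; exact h.sup t ht htT x
  hol t ht htT x y := by rw [← hw t ht htT, ← hw t ht htT]; exact h.hol t ht htT x y
  lip t ht htT x y := by rw [← hw t ht htT, ← hw t ht htT]; exact h.lip t ht htT x y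

lemma Noise.DiffBound.mono_time (h : N.DiffBound α β T D N') (hT : T' ≤ T) :
    N.DiffBound α β T' D N' where
  sup s hs := h.sup s ⟨hs.1, hs.2.trans hT⟩
  hol s hs := h.hol s ⟨hs.1, hs.2.trans hT⟩
  area s hs := h.area s ⟨hs.1, hs.2.trans hT⟩

lemma Noise.DiffBound.shift (h : N.DiffBound α β T D N') {r : ℝ} (hr : 0 ≤ r) :
    (N.shift r).DiffBound α β (T - r) D (N'.shift r) where
  sup s hs := h.sup (r + s) ⟨by linarith [hs.1], by linarith [hs.2]⟩
  hol s hs := h.hol (r + s) ⟨by linarith [hs.1], by linarith [hs.2]⟩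
  area s hs := h.area (r + s) ⟨by linarith [hs.1], by linarith [hs.2]⟩

lemma Exponents.rpow_le (h : Exponents α β) {x y : ℝ} (hx : x ∈ box) (hy : y ∈ box) :
    |y - x| ^ β ≤ 7 * |y - x| ^ α :=
  rpow_exponent_le h.le (by linarith [h.third_lt, h.lt_half]) (abs_nonneg _)
    (abs_sub_le_of_mem_box hy hx) (by linarith [h.third_lt, h.le])

lemma SliceBound.of_bounds (hexp : Exponents α β) (hN : N.Regular) (hNR : N.BoundedBy α β T R)
    (hv : CBound β T M v) {a s : ℝ} (hs : 0 < s) (hsT : s ≤ T) (hR : 0 ≤ R) (hM : 0 ≤ M)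
    (ha : ∀ x y, ‖v s x - v s y‖ ≤ a * |x - y|) :
    SliceBound α (7 * (M + R) + 1) a (N.path s) (N.area s) (v s) where
  u_le x hx := by
    have h1 := hNR.sup s ⟨hs.le, hsT⟩ x hx
    simp only [Noise.zero, Pi.zero_apply, sub_zero] at h1
    have h2 := hv.sup s hs hsT x
    refine (norm_add_le _ _).trans ?_
    linarith
  u_hol x hx y hy := by
    have h1 := hNR.hol s ⟨hs.le, hsT⟩ x hx y hy
    simp only [Noise.zero, Pi.zero_apply, sub_zero] at h1
    have h2 := hv.hol s hs hsT y x
    have e : (v s y + N.path s y) - (v s x + N.path s x)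
        = (v s y - v s x) + (N.path s y - N.path s x) := by abel
    rw [e]
    have h3 : 0 ≤ |y - x| ^ α := by positivity
    calc _ ≤ (M + R) * |y - x| ^ β := (norm_add_le _ _).trans (by linarith)
      _ ≤ (M + R) * (7 * |y - x| ^ α) := by gcongr; exact hexp.rpow_le hx hy
      _ ≤ _ := by nlinarith
  path_hol x hx y hy := by
    have h1 := hNR.hol s ⟨hs.le, hsT⟩ x hx y hy
    simp only [Noise.zero, Pi.zero_apply, sub_zero] at h1
    have h3 : 0 ≤ |y - x| ^ α := by positivity
    calc _ ≤ R * (7 * |y - x| ^ α) := h1.trans (by gcongr; exact hexp.rpow_le hx hy)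
      _ ≤ _ := by nlinarith [mul_nonneg hM h3]
  area_hol x hx y hy := by
    have h1 := hNR.area s ⟨hs.le, hsT⟩ x hx y hy
    simp only [Noise.zero, Pi.zero_apply, sub_zero] at h1
    refine h1.trans ?_
    gcongr
    linarith
  v_lip x _ y _ := ha y x
  chen := hN.chen s

lemma SliceDiff.of_bounds (hexp : Exponents α β) (hND : N.DiffBound α β T D N')
    {a s k : ℝ} (hs : 0 < s) (hsT : s ≤ T) (hD : 0 ≤ D) (hk : 0 ≤ k)
    (hsup : ∀ x, ‖v s x - v' s x‖ ≤ k)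
    (hhol : ∀ x y, ‖(v s x - v' s x) - (v s y - v' s y)‖ ≤ k * |x - y| ^ β)
    (ha : ∀ x y, ‖(v s x - v' s x) - (v s y - v' s y)‖ ≤ a * |x - y|) :
    SliceDiff α (7 * (k + D)) a (N.path s) (N'.path s) (N.area s) (N'.area s) (v s) (v' s) where
  u_le x hx := by
    have h1 := hND.sup s ⟨hs.le, hsT⟩ x hx
    have e : (v s x + N.path s x) - (v' s x + N'.path s x)
        = (v s x - v' s x) + (N.path s x - N'.path s x) := by abel
    rw [e]
    have := hsup x
    refine (norm_add_le _ _).trans ?_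
    linarith
  u_hol x hx y hy := by
    have h1 := hND.hol s ⟨hs.le, hsT⟩ x hx y hy
    have h2 := hhol y x
    have e : ((v s y + N.path s y) - (v s x + N.path s x))
          - ((v' s y + N'.path s y) - (v' s x + N'.path s x))
        = ((v s y - v' s y) - (v s x - v' s x))
          + ((N.path s y - N.path s x) - (N'.path s y - N'.path s x)) := by abel
    rw [e]
    calc _ ≤ (k + D) * |y - x| ^ β := (norm_add_le _ _).trans (by linarith)
      _ ≤ (k + D) * (7 * |y - x| ^ α) := by gcongr; exact hexp.rpow_le hx hy
      _ = _ := by ring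
  path_hol x hx y hy := by
    have h1 := hND.hol s ⟨hs.le, hsT⟩ x hx y hy
    have h3 : 0 ≤ |y - x| ^ α := by positivity
    calc _ ≤ D * (7 * |y - x| ^ α) := h1.trans (by gcongr; exact hexp.rpow_le hx hy)
      _ ≤ _ := by nlinarith [mul_nonneg hk h3]
  area_hol x hx y hy := by
    refine (hND.area s ⟨hs.le, hsT⟩ x hx y hy).trans ?_
    gcongr
    linarith
  v_lip x _ y _ := by
    have h2 := ha y x
    have e : (v s y - v s x) - (v' s y - v' s x) = (v s y - v' s y) - (v s x - v' s x) := by abel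
    rw [e]; exact h2

lemma IsPrimitive.congr {E : Type*} [NormedAddCommGroup E] {K : ℝ} {H H' : ℝ → E}
    (h : IsPrimitive α K H) (he : ∀ x ∈ box, H x = H' x) : IsPrimitive α K H' := by
  refine ⟨(he 0 zero_mem_box) ▸ h.1, fun x hx y hy => ?_⟩
  rw [← he x hx, ← he y hy]
  exact h.2 x hx y hy

lemma one_le_rpow_neg {s θ : ℝ} (hθ : 0 ≤ θ) (hθ1 : θ ≤ 1) (hs : 0 < s) (hsT : s ≤ T) :
    1 ≤ (1 + T) * s ^ (-θ) := by
  have h1 := rpow_le_one_add hθ hθ1 hs hsT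
  have h2 : s ^ θ * s ^ (-θ) = 1 := by rw [← Real.rpow_add hs]; simp
  have h3 : 0 < s ^ (-θ) := Real.rpow_pos_of_pos hs _
  nlinarith

/-- Growth of the right hand side: given a `C^β` bound, it is linear in the Lipschitz constant. -/
theorem exists_rhs_isPrimitive (hexp : Exponents α β) (hf : ContDiff ℝ ∞ f) (hg : ContDiff ℝ ∞ g)
    (hM : 0 ≤ M) (hR : 0 ≤ R) (hT : 0 ≤ T) :
    ∃ C, 0 < C ∧ ∀ T' ≤ T, ∀ (N : Noise n) (v : ℝ → ℝ → Vec n), N.Regular →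
      N.BoundedBy α β T' R → CBound β T' M v → ∀ m lam, 0 ≤ m → 0 ≤ lam →
      (∀ s, 0 < s → s ≤ T' → ∀ x y, ‖v s x - v s y‖
        ≤ m * s ^ (-((1 - β) / 2)) * Real.exp (lam * s) * |x - y|) →
      ∀ s, 0 < s → s ≤ T' →
        IsPrimitive α (C * (1 + m) * s ^ (-((1 - β) / 2)) * Real.exp (lam * s)) (rhs f g N v s) := by
  obtain ⟨C, hC, hc⟩ := exists_coeffBound hf hg (7 * (M + R) + 1)
  have h3 := hexp.third_lt
  have h4 := hexp.le
  have h5 := hexp.lt_half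
  have hR1 : 1 ≤ 7 * (M + R) + 1 := by linarith
  have hK := primConst_nonneg (n := n) h3 hC hR1
  set R1 := 7 * (M + R) + 1 with hR1d
  refine ⟨(3 * R1 * primConst n α C R1 + 1) * (1 + T), by positivity, ?_⟩
  intro T' hT' N v hN hNR hv m lam hm hlam hlip s hs hsT
  have hp : 0 < s ^ (-((1 - β) / 2)) := Real.rpow_pos_of_pos hs _
  have hsl := SliceBound.of_bounds hexp hN hNR hv hs hsT hR hM (hlip s hs hsT)
  refine (isPrimitive_sew_germ h3 (by linarith) hR1 (by positivity) hC hc hsl).mono ?_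
  have h6 := one_le_rpow_neg (θ := (1 - β) / 2) (by linarith) (by linarith) hs (hsT.trans hT')
  have h7 : 1 ≤ Real.exp (lam * s) := Real.one_le_exp (by positivity)
  have h8 : 1 + m * s ^ (-((1 - β) / 2)) * Real.exp (lam * s)
      ≤ (1 + T) * (1 + m) * s ^ (-((1 - β) / 2)) * Real.exp (lam * s) := by
    have : 1 ≤ (1 + T) * s ^ (-((1 - β) / 2)) * Real.exp (lam * s) := by
      calc (1:ℝ) = 1 * 1 := by ring
        _ ≤ _ := mul_le_mul h6 h7 zero_le_one (by positivity)
    have h9 : 0 ≤ T * m * s ^ (-((1 - β) / 2)) * Real.exp (lam * s) := by positivity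
    nlinarith
  calc _ ≤ (3 * R1 * primConst n α C R1 + 1) * (1 + m * s ^ (-((1 - β) / 2)) * Real.exp (lam * s)) := by
        gcongr; linarith
    _ ≤ (3 * R1 * primConst n α C R1 + 1)
        * ((1 + T) * (1 + m) * s ^ (-((1 - β) / 2)) * Real.exp (lam * s)) := by gcongr
    _ = _ := by ring

/-- Local Lipschitz continuity of the right hand side. -/
theorem exists_rhs_sub_isPrimitive (hexp : Exponents α β) (hf : ContDiff ℝ ∞ f)
    (hg : ContDiff ℝ ∞ g) (hM : 0 ≤ M) (hR : 0 ≤ R) (hT : 0 ≤ T) :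
    ∃ C, 0 < C ∧ ∀ T' ≤ T, ∀ (N N' : Noise n) (v v' : ℝ → ℝ → Vec n), N.Regular → N'.Regular →
      N.BoundedBy α β T' R → N'.BoundedBy α β T' R → WBound β T' 0 M v → WBound β T' 0 M v' →
      ∀ m D lam, 0 ≤ m → 0 ≤ D → 0 ≤ lam → N.DiffBound α β T' D N' →
      WBound β T' lam m (fun t x => v t x - v' t x) → ∀ s, 0 < s → s ≤ T' →
        IsPrimitive α (C * (m + D) * s ^ (-((1 - β) / 2)) * Real.exp (lam * s))
          (fun x => rhs f g N v s x - rhs f g N' v' s x) := by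
  obtain ⟨C, hC, hc⟩ := exists_coeffBound hf hg (7 * (M + R) + 1)
  have h3 := hexp.third_lt
  have h4 := hexp.le
  have h5 := hexp.lt_half
  have hR1 : 1 ≤ 7 * (M + R) + 1 := by linarith
  have hK := primConst_nonneg (n := n) h3 hC hR1
  set R1 := 7 * (M + R) + 1 with hR1d
  refine ⟨(primConst n α C R1 + 1) * (7 * (1 + T + M) + 1), by positivity, ?_⟩
  intro T' hT' N N' v v' hN hN' hNR hNR' hv hv' m D lam hm hD hlam hND hw s hs hsT
  have hp : 0 < s ^ (-((1 - β) / 2)) := Real.rpow_pos_of_pos hs _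
  have a1 : ∀ x y, ‖v s x - v s y‖ ≤ M * s ^ (-((1 - β) / 2)) * |x - y| := by
    simpa using hv.lip s hs hsT
  have a2 : ∀ x y, ‖v' s x - v' s y‖ ≤ M * s ^ (-((1 - β) / 2)) * |x - y| := by
    simpa using hv'.lip s hs hsT
  have hsl := SliceBound.of_bounds hexp hN hNR hv.cBound hs hsT hR hM a1
  have hsl' := SliceBound.of_bounds hexp hN' hNR' hv'.cBound hs hsT hR hM a2
  have hdf := SliceDiff.of_bounds hexp hND hs hsT hD (by positivity) (hw.sup s hs hsT)
    (hw.hol s hs hsT) (hw.lip s hs hsT)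
  have ha : 0 ≤ M * s ^ (-((1 - β) / 2)) := by positivity
  have key := isPrimitive_sew_germ_sub h3 (by linarith) hR1 ha (by positivity) (by positivity) hC hc
    hsl hsl' hdf
  have G1 := isGerm_germ (by linarith) (by linarith) hR1 ha hC hc hsl
  have G2 := isGerm_germ (by linarith) (by linarith) hR1 ha hC hc hsl'
  refine (key.congr fun x hx => sew_sub G1 G2 (by linarith) hx).mono ?_
  have h6 := one_le_rpow_neg (θ := (1 - β) / 2) (by linarith) (by linarith) hs (hsT.trans hT')
  have h7 : 1 ≤ Real.exp (lam * s) := Real.one_le_exp (by positivity)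
  set E := Real.exp (lam * s)
  set P := s ^ (-((1 - β) / 2))
  have e1 : m * E + D ≤ (m + D) * E := by nlinarith
  have e2 : 1 + M * P ≤ (1 + T + M) * P := by nlinarith
  have e3 : (1 + M * P) * (7 * (m * E + D)) + m * P * E ≤ (7 * (1 + T + M) + 1) * (m + D) * P * E := by
    have : (1 + M * P) * (7 * (m * E + D)) ≤ ((1 + T + M) * P) * (7 * ((m + D) * E)) := by gcongr
    have : 0 ≤ D * P * E := by positivity
    nlinarith
  calc _ ≤ (primConst n α C R1 + 1) * ((1 + M * P) * (7 * (m * E + D)) + m * P * E) := by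
        gcongr; linarith
    _ ≤ (primConst n α C R1 + 1) * ((7 * (1 + T + M) + 1) * (m + D) * P * E) := by gcongr
    _ = _ := by ring

/-- The linear Volterra operator maps primitives with the singularity `s^{-(1-β)/2}` to functions that
are bounded in the weighted norm, and gains the factor `λ^{-α/4}`. -/
lemma WBound.of_isPrimitive (hexp : Exponents α β) {B : ℝ} (hlam : 0 < lam) (hB : 0 ≤ B)
    (hT : T' ≤ T) {H : ℝ → ℝ → Vec n} (hm : StronglyMeasurable fun p : ℝ × ℝ => H p.1 p.2)
    (hH : ∀ s, 0 < s → s ≤ T' →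
      IsPrimitive α (B * s ^ (-((1 - β) / 2)) * Real.exp (lam * s)) (H s)) :
    WBound β T' lam (volterraConst α T * B * lam ^ (-(α / 4))) (volterra H) := by
  have h3 := hexp.third_lt
  have h4 := hexp.le
  have h5 := hexp.lt_half
  have hH' : ∀ t, t ≤ T' → ∀ s, 0 < s → s < t →
      IsPrimitive α (B * s ^ (-((1 - β) / 2)) * Real.exp (lam * s)) (H s) :=
    fun t ht s hs hst => hH s hs (hst.le.trans ht)
  have hi : ∀ t, 0 < t → t ≤ T' → ∀ x,
      IntervalIntegrable (fun s => duhamel (t - s) (H s) x) volume 0 t := by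
    intro t ht htT x
    refine intervalIntegrable_duhamel (by linarith) (by linarith) (by linarith) (by linarith)
      hlam.le hB ht ?_ (hH' t htT)
    exact (stronglyMeasurable_duhamel hm (by fun_prop) measurable_id measurable_const).aestronglyMeasurable
  constructor
  · intro t ht htT x
    exact norm_volterra_le (by linarith) (by linarith) (by linarith) (by linarith) hlam hB ht
      (htT.trans hT) (hH' t htT) x
  · intro t ht htT x y
    exact norm_volterra_sub_le_holder (by linarith) (by linarith) (by linarith) (by linarith) h4
      hlam hB ht (htT.trans hT) (hH' t htT) (hi t ht htT) x y
  · intro t ht htT x y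
    refine (norm_volterra_sub_le (by linarith) (by linarith) (by linarith) (by linarith)
      hlam hB ht (htT.trans hT) (hH' t htT) (hi t ht htT) x y).trans (le_of_eq (by ring))

/-- The heat flow of a `C^β` datum. -/
lemma IsDatum.wBound_heat (hexp : Exponents α β) {h : ℝ → Vec n} (hh : IsDatum β M h) :
    WBound β T 0 (gaussConst * M) (fun t => heat t h) := by
  have hβ : 0 < β := by linarith [hexp.third_lt, hexp.le]
  have hM : 0 ≤ M := (norm_nonneg _).trans (hh.sup 0)
  have hcont : Continuous h := continuous_of_holder hβ hh.hol
  have hG := one_le_gaussConst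
  have hMG : M ≤ gaussConst * M := by nlinarith
  constructor
  · intro t ht _ x
    simpa using (norm_heat_le hh.sup ht.le x).trans hMG
  · intro t ht _ x y
    have := norm_heat_sub_le hcont hh.sup ht.le (x := x) (y := y) (D := M * |x - y| ^ β)
      (fun z => by simpa using hh.hol (x + z) (y + z))
    refine this.trans ?_
    simp only [zero_mul, Real.exp_zero, mul_one]
    gcongr
  · intro t ht _ x y
    have := norm_sub_le_of_deriv_le (hasDerivAt_heat hcont hh.sup ht)
      (norm_dheat_le hcont hh.sup hM hβ.le (by linarith [hexp.lt_half]) hh.hol ht) x y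
    rw [show (β - 1) / 2 = -((1 - β) / 2) by ring] at this
    simpa using this

end Bounds

/-! ### A priori bounds and stability -/

section Solutions

variable {n : ℕ} {f : Vec n → Vec n} {g : Vec n → Vec n →L[ℝ] Vec n} {N N' : Noise n}
  {v v' w : ℝ → ℝ → Vec n} {v₀ v₀' : ℝ → Vec n} {α β T T' R M m D lam : ℝ}

/-- The nonlinear Volterra operator has linear growth in the weighted norm. -/
theorem exists_growth (hexp : Exponents α β) (hf : ContDiff ℝ ∞ f) (hg : ContDiff ℝ ∞ g)
    (hM : 0 ≤ M) (hR : 0 ≤ R) (hT : 0 ≤ T) :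
    ∃ C, 0 < C ∧ ∀ T' ≤ T, ∀ (N : Noise n) (v : ℝ → ℝ → Vec n), N.Regular →
      N.BoundedBy α β T' R → (Measurable fun p : ℝ × ℝ => v p.1 p.2) → CBound β T' M v →
      ∀ m lam, 0 ≤ m → 0 < lam → WBound β T' lam m v →
        WBound β T' lam (C * lam ^ (-(α / 4)) * (1 + m)) (volterra (rhs f g N v)) := by
  obtain ⟨C, hC, h⟩ := exists_rhs_isPrimitive hexp hf hg hM hR hT
  have hα : 0 < α := by linarith [hexp.third_lt]
  refine ⟨volterraConst α T * C, mul_pos (volterraConst_pos hα hT) hC, ?_⟩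
  intro T' hT' N v hN hNR hvm hv m lam hm hlam hw
  have := WBound.of_isPrimitive hexp hlam (B := C * (1 + m)) (by positivity) hT'
    (measurable_rhs hf.continuous hg hN hvm)
    (h T' hT' N v hN hNR hv m lam hm hlam.le hw.lip)
  exact this.mono (le_of_eq (by ring))

lemma intervalIntegrable_duhamel_rhs (hexp : Exponents α β) (hf : ContDiff ℝ ∞ f)
    (hg : ContDiff ℝ ∞ g) (hN : N.Regular) (hNR : N.BoundedBy α β T R)
    (hvm : Measurable fun p : ℝ × ℝ => v p.1 p.2) (hv : WBound β T 0 M v) (hM : 0 ≤ M) (hR : 0 ≤ R)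
    {a t : ℝ} (ha : 0 < a) (hat : a ≤ T) (hta : a ≤ t) (x : ℝ) :
    IntervalIntegrable (fun s => duhamel (t - s) (rhs f g N v s) x) volume 0 a := by
  obtain ⟨C, hC, h⟩ := exists_rhs_isPrimitive hexp hf hg hM hR (ha.le.trans hat)
  have h3 := hexp.third_lt
  have h4 := hexp.le
  have h5 := hexp.lt_half
  have hlip := h T le_rfl N v hN hNR hv.cBound M 0 hM le_rfl hv.lip
  have hG := gaussConst_pos
  have hi := intervalIntegrable_beta (e := (1 - α) / 2) (θ := (1 - β) / 2) (t := a) (by linarith)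
    (by linarith) (by linarith) (by linarith) ha
  have hi2 := hi.const_mul (5 * gaussConst * (C * (1 + M)))
  rw [intervalIntegrable_iff_integrableOn_Ioo_of_le ha.le] at hi2 ⊢
  refine Integrable.mono' hi2 (stronglyMeasurable_duhamel (measurable_rhs hf.continuous hg hN hvm)
    (by fun_prop) measurable_id measurable_const).aestronglyMeasurable ?_
  rw [ae_restrict_iff' measurableSet_Ioo]
  refine ae_of_all _ fun s hs => ?_
  have hs0 := hs.1
  have has : 0 < a - s := sub_pos.2 hs.2
  have hts : 0 < t - s := by linarith
  have := norm_duhamel_le (hlip s hs0 (hs.2.le.trans hat)) (by linarith) (by linarith) hts x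
  refine this.trans ?_
  rw [zero_mul, Real.exp_zero, mul_one, show (α - 1) / 2 = -((1 - α) / 2) by ring]
  have e : (t - s) ^ (-((1 - α) / 2)) ≤ (a - s) ^ (-((1 - α) / 2)) :=
    Real.rpow_le_rpow_of_nonpos has (by linarith) (by linarith)
  calc _ ≤ 5 * gaussConst * (C * (1 + M) * s ^ (-((1 - β) / 2))) * (a - s) ^ (-((1 - α) / 2)) := by
        gcongr
    _ = _ := by ring

/-- The nonlinear Volterra operator is locally Lipschitz, also in the noise; it is a contraction
for large weights `λ`. -/
theorem exists_contraction (hexp : Exponents α β) (hf : ContDiff ℝ ∞ f) (hg : ContDiff ℝ ∞ g)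
    (hM : 0 ≤ M) (hR : 0 ≤ R) (hT : 0 ≤ T) :
    ∃ C, 0 < C ∧ ∀ T' ≤ T, ∀ (N N' : Noise n) (v v' : ℝ → ℝ → Vec n), N.Regular → N'.Regular →
      N.BoundedBy α β T' R → N'.BoundedBy α β T' R →
      (Measurable fun p : ℝ × ℝ => v p.1 p.2) → (Measurable fun p : ℝ × ℝ => v' p.1 p.2) →
      WBound β T' 0 M v → WBound β T' 0 M v' →
      ∀ m D lam, 0 ≤ m → 0 ≤ D → 0 < lam → N.DiffBound α β T' D N' →
      WBound β T' lam m (fun t x => v t x - v' t x) →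
      WBound β T' lam (C * lam ^ (-(α / 4)) * (m + D))
        (fun t x => volterra (rhs f g N v) t x - volterra (rhs f g N' v') t x) := by
  obtain ⟨C, hC, h⟩ := exists_rhs_sub_isPrimitive hexp hf hg hM hR hT
  obtain ⟨C0, hC0, h0⟩ := exists_rhs_isPrimitive hexp hf hg hM hR hT
  have h3 := hexp.third_lt
  have h4 := hexp.le
  have h5 := hexp.lt_half
  have hα : 0 < α := by linarith
  refine ⟨volterraConst α T * C, mul_pos (volterraConst_pos hα hT) hC, ?_⟩
  intro T' hT' N N' v v' hN hN' hNR hNR' hvm hvm' hv hv' m D lam hm hD hlam hND hw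
  have hr := measurable_rhs hf.continuous hg hN hvm
  have hr' := measurable_rhs hf.continuous hg hN' hvm'
  have p1 := h0 T' hT' N v hN hNR hv.cBound M 0 hM le_rfl hv.lip
  have p2 := h0 T' hT' N' v' hN' hNR' hv'.cBound M 0 hM le_rfl hv'.lip
  have key := WBound.of_isPrimitive hexp hlam (B := C * (m + D)) (by positivity) hT' (hr.sub hr')
    (h T' hT' N N' v v' hN hN' hNR hNR' hv hv' m D lam hm hD hlam.le hND hw)
  refine (key.congr fun t ht htT x => ?_).mono (le_of_eq (by ring))
  have i1 := intervalIntegrable_duhamel_rhs hexp hf hg hN hNR hvm hv hM hR ht htT le_rfl x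
  have i2 := intervalIntegrable_duhamel_rhs hexp hf hg hN' hNR' hvm' hv' hM hR ht htT le_rfl x
  unfold volterra
  rw [← intervalIntegral.integral_sub i1 i2]
  refine intervalIntegral.integral_congr_ae ?_
  rw [uIoc_of_le ht.le]
  refine ae_Ioc_of_Ioo fun s hs hst => ?_
  exact duhamel_sub (p1 s hs (hst.le.trans htT)) (p2 s hs (hst.le.trans htT)) hα (by linarith) _ _

/-- A large weight beats any constant. -/
lemma exists_weight {C : ℝ} (hα : 0 < α) (hC : 0 < C) : ∃ lam, 1 ≤ lam ∧
    C * lam ^ (-(α / 4)) ≤ 1 / 2 := by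
  refine ⟨max 1 ((2 * C) ^ (4 / α)), le_max_left _ _, ?_⟩
  have h1 : (max 1 ((2 * C) ^ (4 / α))) ^ (-(α / 4)) ≤ ((2 * C) ^ (4 / α)) ^ (-(α / 4)) :=
    Real.rpow_le_rpow_of_nonpos (by positivity) (le_max_right _ _) (by linarith)
  have h2 : ((2 * C) ^ (4 / α)) ^ (-(α / 4)) = (2 * C)⁻¹ := by
    rw [← Real.rpow_mul (by positivity), ← Real.rpow_neg_one]
    congr 1; field_simp
  rw [h2] at h1
  calc _ ≤ C * (2 * C)⁻¹ := by gcongr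
    _ = 1 / 2 := by field_simp

lemma WBound.of_tendsto {w : ℕ → ℝ → ℝ → Vec n} {w' : ℝ → ℝ → Vec n} {c : ℕ → ℝ} {c' : ℝ}
    (h : ∀ k, WBound β T lam (c k) (w k)) (hc : Tendsto c atTop (𝓝 c'))
    (hw : ∀ t, 0 < t → t ≤ T → ∀ x, Tendsto (fun k => w k t x) atTop (𝓝 (w' t x))) :
    WBound β T lam c' w' where
  sup t ht htT x := le_of_tendsto_of_tendsto' (hw t ht htT x).norm (hc.mul_const _)
    fun k => (h k).sup t ht htT x
  hol t ht htT x y := le_of_tendsto_of_tendsto' ((hw t ht htT x).sub (hw t ht htT y)).norm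
    ((hc.mul_const _).mul_const _) fun k => (h k).hol t ht htT x y
  lip t ht htT x y := le_of_tendsto_of_tendsto' ((hw t ht htT x).sub (hw t ht htT y)).norm
    (((hc.mul_const _).mul_const _).mul_const _) fun k => (h k).lip t ht htT x y

/-- A self-improving bound improves to its fixed point. -/
lemma WBound.iterate {c m₀ : ℝ} (hc : 0 ≤ c) (hm : 0 ≤ m₀) (h0 : WBound β T lam m₀ w)
    (hstep : ∀ m, 0 ≤ m → WBound β T lam m w → WBound β T lam (c + m / 2) w) :
    WBound β T lam (2 * c) w := by
  have h : ∀ k : ℕ, WBound β T lam (2 * c + m₀ * (1 / 2) ^ k) w := by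
    intro k
    induction k with
    | zero => exact h0.mono (by simp; linarith)
    | succ k ih =>
      refine (hstep _ (by positivity) ih).mono (le_of_eq ?_)
      rw [pow_succ]; ring
  refine WBound.of_tendsto h ?_ (fun t _ _ x => tendsto_const_nhds)
  have := ((tendsto_pow_atTop_nhds_zero_of_lt_one (r := (1/2:ℝ)) (by norm_num)
    (by norm_num)).const_mul m₀).const_add (2 * c)
  simpa using this

lemma WBound.nonneg_of_pos (h : WBound β T lam m w) (hT : 0 < T) : 0 ≤ m := by
  have h1 := (norm_nonneg _).trans (h.sup T hT le_rfl 0)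
  exact nonneg_of_mul_nonneg_left h1 (Real.exp_pos _)

/-- A priori bound: the Lipschitz constants of a solution are controlled by its `C^β` norm. This works
globally in time because the growth in `exists_growth` is linear in the Lipschitz constant. -/
theorem exists_apriori (hexp : Exponents α β) (hf : ContDiff ℝ ∞ f) (hg : ContDiff ℝ ∞ g)
    (hM : 0 ≤ M) (hR : 0 ≤ R) (hT : 0 ≤ T) :
    ∃ C, M ≤ C ∧ ∀ T' ≤ T, ∀ (N : Noise n) (v₀ : ℝ → Vec n) (v : ℝ → ℝ → Vec n), N.Regular →
      N.BoundedBy α β T' R → IsDatum β M v₀ → IsSol f g β N v₀ T' v → CBound β T' M v →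
      WBound β T' 0 C v := by
  obtain ⟨C, hC, h⟩ := exists_growth hexp hf hg hM hR hT
  have hα : 0 < α := by linarith [hexp.third_lt]
  obtain ⟨lam, hlam, hl⟩ := exists_weight hα hC
  have hG := one_le_gaussConst
  refine ⟨2 * (gaussConst * M + 1 / 2) * Real.exp (lam * T), ?_, ?_⟩
  · have : 1 ≤ Real.exp (lam * T) := Real.one_le_exp (by positivity)
    have h1 : M ≤ 2 * (gaussConst * M + 1 / 2) := by nlinarith
    exact h1.trans (le_mul_of_one_le_right (by positivity) this)
  intro T' hT' N v₀ v hN hNR h0 hsol hv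
  rcases le_or_gt T' 0 with hT0 | hT0
  · exact ⟨fun t ht htT => absurd (ht.trans_le htT) (not_lt.2 hT0),
      fun t ht htT => absurd (ht.trans_le htT) (not_lt.2 hT0),
      fun t ht htT => absurd (ht.trans_le htT) (not_lt.2 hT0)⟩
  obtain ⟨m₀, hm₀⟩ := hsol.bound
  have hm₀0 := hm₀.nonneg_of_pos hT0
  have hstep : ∀ m, 0 ≤ m → WBound β T' lam m v →
      WBound β T' lam ((gaussConst * M + 1 / 2) + m / 2) v := by
    intro m hm hw
    have h1 := h T' hT' N v hN hNR hsol.meas hv m lam hm (by linarith) hw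
    have h2 := (h0.wBound_heat (T := T') hexp).mono_rate (lam' := lam) (by positivity) (by linarith)
    refine ((h2.add h1).congr fun t ht htT x => (hsol.eq t ht htT x).symm).mono ?_
    have : C * lam ^ (-(α / 4)) * (1 + m) ≤ 1 / 2 * (1 + m) := by gcongr
    linarith
  have h3 := WBound.iterate (c := gaussConst * M + 1 / 2) (by positivity) hm₀0
    (hm₀.mono_rate hm₀0 (by linarith : (0:ℝ) ≤ lam)) hstep
  refine (h3.to_zero_rate (by positivity) (by linarith)).mono ?_
  gcongr

/-- Stability: on the set of solutions bounded in `C^β`, the solution depends in a Lipschitz way on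
the datum and the noise. -/
theorem exists_stability (hexp : Exponents α β) (hf : ContDiff ℝ ∞ f) (hg : ContDiff ℝ ∞ g)
    (hM : 0 ≤ M) (hR : 0 ≤ R) (hT : 0 ≤ T) :
    ∃ C, 0 < C ∧ ∀ T' ≤ T, ∀ (N N' : Noise n) (v₀ v₀' : ℝ → Vec n) (v v' : ℝ → ℝ → Vec n) (D : ℝ),
      N.Regular → N'.Regular → N.BoundedBy α β T' R → N'.BoundedBy α β T' R →
      IsDatum β M v₀ → IsDatum β M v₀' → IsSol f g β N v₀ T' v → IsSol f g β N' v₀' T' v' →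
      CBound β T' M v → CBound β T' M v' → 0 ≤ D → N.DiffBound α β T' D N' →
      IsDatum β D (fun x => v₀ x - v₀' x) →
      WBound β T' 0 (C * D) (fun t x => v t x - v' t x) := by
  obtain ⟨M1, hM1, h1⟩ := exists_apriori hexp hf hg hM hR hT
  have hM10 : 0 ≤ M1 := hM.trans hM1
  obtain ⟨C, hC, h⟩ := exists_contraction hexp hf hg hM10 hR hT
  have hα : 0 < α := by linarith [hexp.third_lt]
  have hβ : 0 < β := by linarith [hexp.le]
  obtain ⟨lam, hlam, hl⟩ := exists_weight hα hC
  have hG := one_le_gaussConst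
  refine ⟨2 * (gaussConst + 1 / 2) * Real.exp (lam * T), by positivity, ?_⟩
  intro T' hT' N N' v₀ v₀' v v' D hN hN' hNR hNR' h0 h0' hs hs' hv hv' hD hND hd
  have b := h1 T' hT' N v₀ v hN hNR h0 hs hv
  have b' := h1 T' hT' N' v₀' v' hN' hNR' h0' hs' hv'
  have hstep : ∀ m, 0 ≤ m → WBound β T' lam m (fun t x => v t x - v' t x) →
      WBound β T' lam ((gaussConst + 1 / 2) * D + m / 2) (fun t x => v t x - v' t x) := by
    intro m hm hw
    have a1 := h T' hT' N N' v v' hN hN' hNR hNR' hs.meas hs'.meas b b' m D lam hm hD (by linarith)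
      hND hw
    have a2 := (hd.wBound_heat (T := T') hexp).mono_rate (lam' := lam) (by positivity) (by linarith)
    refine ((a2.add a1).congr fun t ht htT x => ?_).mono ?_
    · rw [hs.eq t ht htT x, hs'.eq t ht htT x, heat_sub_apply (continuous_of_holder hβ h0.hol) h0.sup
        (continuous_of_holder hβ h0'.hol) h0'.sup]
      abel
    · have : C * lam ^ (-(α / 4)) * (m + D) ≤ 1 / 2 * (m + D) := by gcongr
      linarith
  have b0 : WBound β T' 0 (2 * M1) (fun t x => v t x - v' t x) := by
    refine ((b.add (m' := M1) (w' := fun t x => - v' t x) ?_).congr fun t _ _ x => ?_).mono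
      (le_of_eq (by ring))
    · exact ⟨fun t ht htT x => by rw [norm_neg]; exact b'.sup t ht htT x,
        fun t ht htT x y => by rw [← neg_sub', norm_neg]; exact b'.hol t ht htT x y,
        fun t ht htT x y => by rw [← neg_sub', norm_neg]; exact b'.lip t ht htT x y⟩
    · abel
  have h3 := WBound.iterate (c := (gaussConst + 1 / 2) * D) (by positivity) (by positivity)
    (b0.mono_rate (by positivity) (by linarith : (0:ℝ) ≤ lam)) hstep
  refine (h3.to_zero_rate (by positivity) (by linarith)).mono ?_
  calc 2 * ((gaussConst + 1 / 2) * D) * Real.exp (lam * T')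
      ≤ 2 * ((gaussConst + 1 / 2) * D) * Real.exp (lam * T) := by gcongr
    _ = _ := by ring

/-- For short times the Volterra part of a bounded function is small: on `[0, h]` the weight with rate
`λ = h⁻¹` is bounded. -/
theorem exists_small_time (hexp : Exponents α β) (hf : ContDiff ℝ ∞ f) (hg : ContDiff ℝ ∞ g)
    (hM : 0 ≤ M) (hR : 0 ≤ R) (hT : 0 ≤ T) :
    ∃ C, 0 < C ∧ ∀ h, 0 < h → h ≤ T → ∀ (N : Noise n) (v : ℝ → ℝ → Vec n), N.Regular →
      N.BoundedBy α β h R → (Measurable fun p : ℝ × ℝ => v p.1 p.2) → WBound β h 0 M v →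
      WBound β h 0 (C * h ^ (α / 4)) (volterra (rhs f g N v)) := by
  obtain ⟨C, hC, hgr⟩ := exists_growth hexp hf hg hM hR hT
  refine ⟨C * (1 + M) * Real.exp 1, by positivity, ?_⟩
  intro h hh hhT N v hN hNR hvm hv
  have hl : 0 < h⁻¹ := inv_pos.2 hh
  have h1 := hgr h hhT N v hN hNR hvm hv.cBound M h⁻¹ hM hl (hv.mono_rate hM hl.le)
  have h2 := h1.to_zero_rate (by positivity) hl.le
  refine h2.mono (le_of_eq ?_)
  rw [inv_mul_cancel₀ hh.ne', Real.inv_rpow hh.le, Real.rpow_neg hh.le, inv_inv]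
  ring

end Solutions

/-! ### Local existence and uniqueness -/

section Existence

variable {n : ℕ} {f : Vec n → Vec n} {g : Vec n → Vec n →L[ℝ] Vec n} {N N' : Noise n}
  {v v' w : ℝ → ℝ → Vec n} {v₀ v₀' : ℝ → Vec n} {α β T T' R M m D lam : ℝ}

/-- The Picard iterates of the integral equation. -/
noncomputable def picard (f : Vec n → Vec n) (g : Vec n → Vec n →L[ℝ] Vec n) (N : Noise n)
    (v₀ : ℝ → Vec n) : ℕ → ℝ → ℝ → Vec n
  | 0 => fun _ _ => 0
  | k + 1 => fun t x => heat t v₀ x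
      + if 0 < t then volterra (rhs f g N (picard f g N v₀ k)) t x else 0

lemma measurable_picard (hf : ContDiff ℝ ∞ f) (hg : ContDiff ℝ ∞ g) (hN : N.Regular)
    (h0 : Continuous v₀) (k : ℕ) : Measurable fun p : ℝ × ℝ => picard f g N v₀ k p.1 p.2 := by
  induction k with
  | zero => exact measurable_const
  | succ k ih =>
    exact ((stronglyMeasurable_heat h0).add
      (stronglyMeasurable_volterra (measurable_rhs hf.continuous hg hN ih))).measurable

lemma wBound_zero (hm : 0 ≤ m) : WBound β T lam m (fun _ _ => (0 : Vec n)) where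
  sup t ht _ x := by rw [norm_zero]; positivity
  hol t ht _ x y := by rw [sub_self, norm_zero]; positivity
  lip t ht _ x y := by rw [sub_self, norm_zero]; positivity

lemma Noise.diffBound_self (N : Noise n) : N.DiffBound α β T 0 N where
  sup s _ x _ := by simp
  hol s _ x _ y _ := by simp
  area s _ x _ y _ := by simp

lemma volterra_periodic {E : Type*} [NormedAddCommGroup E] [NormedSpace ℝ E] [CompleteSpace E]
    (H : ℝ → ℝ → E) (t : ℝ) : Function.Periodic (volterra H t) (2 * Real.pi) := by
  intro x
  unfold volterra
  congr 1
  funext s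
  exact duhamel_periodic _ _ x

/-- Local existence, with an existence time that only depends on the size of the data. The Picard
iterates stay in a fixed ball on `[0, h]` and converge geometrically in the norm with weight `λ`. -/
theorem exists_local_solution (hexp : Exponents α β) (hf : ContDiff ℝ ∞ f) (hg : ContDiff ℝ ∞ g)
    (hM : 0 ≤ M) (hR : 0 ≤ R) :
    ∃ h, 0 < h ∧ h ≤ 1 ∧ ∀ (N : Noise n) (v₀ : ℝ → Vec n), N.Regular → N.BoundedBy α β h R →
      IsDatum β M v₀ → ∃ v, IsSol f g β N v₀ h v := by
  have hα : 0 < α := by linarith [hexp.third_lt]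
  have hβ : 0 < β := by linarith [hexp.le]
  have hG := one_le_gaussConst
  set M' := gaussConst * M + 1 with hM'
  have hM'0 : 0 ≤ M' := by positivity
  obtain ⟨C1, hC1, hsmall⟩ := exists_small_time hexp hf hg hM'0 hR zero_le_one
  obtain ⟨C2, hC2, hcontr⟩ := exists_contraction hexp hf hg hM'0 hR zero_le_one
  obtain ⟨lam, hlam, hl⟩ := exists_weight hα (show 0 < C1 + C2 by linarith)
  have hlam0 : 0 < lam := by linarith
  have hC1l : C1 * lam ^ (-(α / 4)) ≤ 1 := by
    have : 0 ≤ C2 * lam ^ (-(α / 4)) := by positivity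
    linarith
  have hC2l : C2 * lam ^ (-(α / 4)) ≤ 1 / 2 := by
    have : 0 ≤ C1 * lam ^ (-(α / 4)) := by positivity
    linarith
  -- with this choice `h ^ (α / 4) = λ ^ (-α / 4)`, so one `λ` serves for both requirements
  set h := lam⁻¹ with hh
  have hh0 : 0 < h := inv_pos.2 hlam0
  have hh1 : h ≤ 1 := inv_le_one_of_one_le₀ hlam
  have hhp : h ^ (α / 4) = lam ^ (-(α / 4)) := by
    rw [hh, Real.inv_rpow hlam0.le, Real.rpow_neg hlam0.le]
  refine ⟨h, hh0, hh1, ?_⟩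
  intro N v₀ hN hNR h0
  have hcont : Continuous v₀ := continuous_of_holder hβ h0.hol
  set V := picard f g N v₀ with hV
  have hVm : ∀ k, Measurable fun p : ℝ × ℝ => V k p.1 p.2 := measurable_picard hf hg hN hcont
  have hVeq : ∀ k t, 0 < t → ∀ x, V (k + 1) t x = heat t v₀ x + volterra (rhs f g N (V k)) t x := by
    intro k t ht x
    simp only [hV, picard, ht, if_true]
  -- the iterates stay in the ball of radius `M'`, where the linear part takes up all but `1`
  have hVb : ∀ k, WBound β h 0 M' (V k) := by
    intro k
    induction k with
    | zero => exact wBound_zero hM'0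
    | succ k ih =>
      have a1 := hsmall h hh0 hh1 N (V k) hN hNR (hVm k) ih
      have a2 := h0.wBound_heat (T := h) hexp
      refine ((a2.add a1).congr fun t ht _ x => (hVeq k t ht x).symm).mono ?_
      rw [hhp]; linarith
  -- successive differences contract by one half
  have hVd : ∀ k, WBound β h lam (M' * (1 / 2) ^ k) (fun t x => V (k + 1) t x - V k t x) := by
    intro k
    induction k with
    | zero =>
      refine (((hVb 1).mono_rate hM'0 hlam0.le).congr fun t _ _ x => ?_).mono (by simp)
      simp [hV, picard]
    | succ k ih =>
      have a1 := hcontr h hh1 N N (V (k + 1)) (V k) hN hN hNR hNR (hVm _) (hVm _) (hVb _) (hVb _)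
        _ 0 lam (by positivity) le_rfl hlam0 N.diffBound_self ih
      refine (a1.congr fun t ht _ x => ?_).mono ?_
      · rw [hVeq (k + 1) t ht, hVeq k t ht]; abel
      · rw [add_zero, pow_succ]
        calc C2 * lam ^ (-(α / 4)) * (M' * (1 / 2) ^ k) ≤ 1 / 2 * (M' * (1 / 2) ^ k) := by gcongr
          _ = _ := by ring
  have hVj : ∀ k j, WBound β h lam (M' * (2 * (1 / 2) ^ k - 2 * (1 / 2) ^ (k + j)))
      (fun t x => V (k + j) t x - V k t x) := by
    intro k j
    induction j with
    | zero =>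
      refine ((wBound_zero (β := β) (T := h) (lam := lam) (m := 0) le_rfl).congr
        fun t _ _ x => ?_).mono (by simp)
      simp
    | succ j ih =>
      refine ((ih.add (hVd (k + j))).congr fun t _ _ x => ?_).mono (le_of_eq ?_)
      · rw [← add_assoc]; abel
      · rw [← add_assoc, pow_succ]; ring
  set v : ℝ → ℝ → Vec n := fun t x => limUnder atTop fun k => V k t x with hv
  have hvm : Measurable fun p : ℝ × ℝ => v p.1 p.2 :=
    (StronglyMeasurable.limUnder (f := fun k (p : ℝ × ℝ) => V k p.1 p.2)
      fun k => (hVm k).stronglyMeasurable).measurable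
  have hlim : ∀ t, 0 < t → t ≤ h → ∀ x, Tendsto (fun k => V k t x) atTop (𝓝 (v t x)) := by
    intro t ht hth x
    refine (cauchySeq_of_le_geometric (1 / 2) (M' * Real.exp (lam * t)) (by norm_num)
      fun k => ?_).tendsto_limUnder
    rw [dist_comm, dist_eq_norm]
    exact ((hVd k).sup t ht hth x).trans (le_of_eq (by ring))
  have hvb : WBound β h 0 M' v := WBound.of_tendsto hVb tendsto_const_nhds hlim
  have hgeo : Tendsto (fun k : ℕ => ((1:ℝ) / 2) ^ k) atTop (𝓝 0) :=
    tendsto_pow_atTop_nhds_zero_of_lt_one (by norm_num) (by norm_num)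
  have hvd : ∀ k, WBound β h lam (M' * (2 * (1 / 2) ^ k)) (fun t x => v t x - V k t x) := by
    intro k
    refine WBound.of_tendsto (w := fun j t x => V (k + j) t x - V k t x) (fun j => hVj k j) ?_ ?_
    · have : Tendsto (fun j : ℕ => ((1:ℝ) / 2) ^ (k + j)) atTop (𝓝 0) := by
        simpa [add_comm] using (tendsto_add_atTop_iff_nat k).2 hgeo
      have h2 := ((this.const_mul 2).const_sub (2 * (1 / 2) ^ k)).const_mul M'
      rwa [mul_zero, sub_zero] at h2
    · intro t ht hth x
      have : Tendsto (fun j : ℕ => V (k + j) t x) atTop (𝓝 (v t x)) := by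
        simpa [add_comm] using (tendsto_add_atTop_iff_nat k).2 (hlim t ht hth x)
      exact this.sub_const _
  -- passage to the limit in the equation, again by the contraction estimate
  have heq : ∀ t, 0 < t → t ≤ h → ∀ x, v t x = heat t v₀ x + volterra (rhs f g N v) t x := by
    intro t ht hth x
    have l1 : Tendsto (fun k => V (k + 1) t x) atTop (𝓝 (v t x)) :=
      (tendsto_add_atTop_iff_nat 1).2 (hlim t ht hth x)
    have l2 : Tendsto (fun k => V (k + 1) t x) atTop
        (𝓝 (heat t v₀ x + volterra (rhs f g N v) t x)) := by
      rw [tendsto_iff_norm_sub_tendsto_zero]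
      have : Tendsto (fun k : ℕ => C2 * lam ^ (-(α / 4)) * (M' * (2 * (1 / 2) ^ k) + 0)
          * Real.exp (lam * t)) atTop (𝓝 0) := by
        simpa using ((((hgeo.const_mul 2).const_mul M').add_const 0).const_mul
          (C2 * lam ^ (-(α / 4)))).mul_const (Real.exp (lam * t))
      refine squeeze_zero (fun _ => norm_nonneg _) (fun k => ?_) this
      have a1 := hcontr h hh1 N N v (V k) hN hN hNR hNR hvm (hVm _) hvb (hVb _)
        _ 0 lam (by positivity) le_rfl hlam0 N.diffBound_self (hvd k)
      have a2 := a1.sup t ht hth x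
      rwa [norm_sub_rev, hVeq k t ht, add_sub_add_left_eq_sub]
    exact tendsto_nhds_unique l1 l2
  refine ⟨v, hvm, fun t ht hth x => ?_, ⟨M', hvb⟩, heq⟩
  rw [heq t ht hth, heq t ht hth, heat_periodic h0.periodic, volterra_periodic]

lemma isDatum_sub_self (v₀ : ℝ → Vec n) : IsDatum β 0 (fun x => v₀ x - v₀ x) where
  periodic x := by simp
  sup x := by simp
  hol x y := by simp

/-- Every solution is bounded on `(0, T]`, so that two of them coincide. -/
theorem IsSol.unique (hexp : Exponents α β) (hf : ContDiff ℝ ∞ f) (hg : ContDiff ℝ ∞ g)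
    (hR : 0 ≤ R) (hN : N.Regular) (hNR : N.BoundedBy α β T R) (h0 : IsDatum β M v₀)
    (hv : IsSol f g β N v₀ T v) (hv' : IsSol f g β N v₀ T v') {t : ℝ} (ht : 0 < t) (htT : t ≤ T)
    (x : ℝ) : v t x = v' t x := by
  obtain ⟨m, hm⟩ := hv.bound
  obtain ⟨m', hm'⟩ := hv'.bound
  have hT : 0 < T := ht.trans_le htT
  set K := max M (max m m')
  have hK : 0 ≤ K := ((norm_nonneg _).trans (h0.sup 0)).trans (le_max_left _ _)
  have h0K : IsDatum β K v₀ := ⟨h0.periodic, fun x => (h0.sup x).trans (le_max_left _ _),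
    fun x y => (h0.hol x y).trans (by gcongr; exact le_max_left _ _)⟩
  obtain ⟨C, hC, h⟩ := exists_stability hexp hf hg hK hR hT.le
  have := (h T le_rfl N N v₀ v₀ v v' 0 hN hN hNR hNR h0K h0K hv hv'
    (hm.mono ((le_max_left _ _).trans (le_max_right _ _))).cBound
    (hm'.mono ((le_max_right _ _).trans (le_max_right _ _))).cBound le_rfl N.diffBound_self
    (isDatum_sub_self v₀)).sup t ht htT x
  rw [mul_zero, zero_mul] at this
  exact sub_eq_zero.1 (norm_le_zero_iff.1 this)

end Existence

/-! ### Restarting and gluing -/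

section Restart

variable {n : ℕ} {f : Vec n → Vec n} {g : Vec n → Vec n →L[ℝ] Vec n} {N : Noise n}
  {v v' : ℝ → ℝ → Vec n} {v₀ : ℝ → Vec n} {α β T T' R M : ℝ}

/-- The semigroup commutes with integration in time. -/
lemma heat_intervalIntegral {E : Type*} [NormedAddCommGroup E] [NormedSpace ℝ E] [CompleteSpace E]
    {F : ℝ → ℝ → E} {b : ℝ → ℝ} {a : ℝ} (ha : 0 ≤ a)
    (hF : StronglyMeasurable fun p : ℝ × ℝ => F p.1 p.2) (hb : IntervalIntegrable b volume 0 a)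
    (hFb : ∀ s, 0 < s → s < a → ∀ x, ‖F s x‖ ≤ b s) (r x : ℝ) :
    heat r (fun y => ∫ s in (0 : ℝ)..a, F s y) x = ∫ s in (0 : ℝ)..a, heat r (F s) x := by
  unfold heat gaussMean
  rw [intervalIntegral.integral_smul]
  congr 1
  simp only [one_smul, intervalIntegral.integral_of_le ha]
  rw [intervalIntegrable_iff_integrableOn_Ioc_of_le ha] at hb
  refine integral_integral_swap ?_
  have hb2 : Integrable (fun q : ℝ × ℝ => b q.2) (stdGauss.prod (volume.restrict (Ioc 0 a))) :=
    hb.comp_snd stdGauss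
  refine hb2.mono' ?_ ?_
  · exact (hF.comp_measurable (g := fun q : ℝ × ℝ => (q.2, x + Real.sqrt (2 * r) * q.1))
      (by fun_prop)).aestronglyMeasurable
  · have h1 : ∀ᵐ s ∂volume.restrict (Ioc 0 a), ∀ x, ‖F s x‖ ≤ b s := by
      rw [ae_restrict_iff' measurableSet_Ioc]
      exact ae_Ioc_of_Ioo hFb
    exact (Measure.quasiMeasurePreserving_snd.ae h1).mono fun q hq => hq _

lemma IsSol.exists_isDatum (hv : IsSol f g β N v₀ T v) :
    ∃ M, 0 ≤ M ∧ ∀ t, 0 < t → t ≤ T → IsDatum β M (v t) := by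
  obtain ⟨M, hM⟩ := hv.bound
  rcases lt_or_ge 0 T with hT | hT
  · exact ⟨M, hM.nonneg_of_pos hT, fun t ht htT => ⟨hv.periodic t ht htT, hM.cBound.sup t ht htT,
      hM.cBound.hol t ht htT⟩⟩
  · exact ⟨0, le_rfl, fun t ht htT => by linarith⟩

lemma IsSol.exists_isPrimitive (hexp : Exponents α β) (hf : ContDiff ℝ ∞ f) (hg : ContDiff ℝ ∞ g)
    (hR : 0 ≤ R) (hN : N.Regular) (hNR : N.BoundedBy α β T R) (hv : IsSol f g β N v₀ T v) :
    ∃ B, 0 ≤ B ∧ ∀ s, 0 < s → s ≤ T →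
      IsPrimitive α (B * s ^ (-((1 - β) / 2))) (rhs f g N v s) := by
  obtain ⟨m, hm⟩ := hv.bound
  rcases lt_or_ge 0 T with hT | hT
  · have hm0 := hm.nonneg_of_pos hT
    obtain ⟨C, hC, h⟩ := exists_rhs_isPrimitive hexp hf hg hm0 hR hT.le
    refine ⟨C * (1 + m), by positivity, fun s hs hsT => ?_⟩
    simpa using h T le_rfl N v hN hNR hm.cBound m 0 hm0 le_rfl hm.lip s hs hsT
  · exact ⟨0, le_rfl, fun t ht htT => by linarith⟩

lemma IsSol.intervalIntegrable (hexp : Exponents α β) (hf : ContDiff ℝ ∞ f) (hg : ContDiff ℝ ∞ g)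
    (hR : 0 ≤ R) (hN : N.Regular) (hNR : N.BoundedBy α β T R) (hv : IsSol f g β N v₀ T v)
    {a t : ℝ} (ha : 0 < a) (haT : a ≤ T) (hat : a ≤ t) (x : ℝ) :
    IntervalIntegrable (fun s => duhamel (t - s) (rhs f g N v s) x) volume 0 a := by
  obtain ⟨m, hm⟩ := hv.bound
  exact intervalIntegrable_duhamel_rhs hexp hf hg hN hNR hv.meas hm
    (hm.nonneg_of_pos (ha.trans_le haT)) hR ha haT hat x

lemma IsDatum.continuous (hexp : Exponents α β) (h : IsDatum β M v₀) : Continuous v₀ :=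
  continuous_of_holder (by linarith [hexp.third_lt, hexp.le]) h.hol

/-- The semigroup applied to a solution: the equation with the time integral stopped at `t₀`. -/
lemma IsSol.heat_eq (hexp : Exponents α β) (hf : ContDiff ℝ ∞ f) (hg : ContDiff ℝ ∞ g)
    (hR : 0 ≤ R) (hN : N.Regular) (hNR : N.BoundedBy α β T R) (h0 : IsDatum β M v₀)
    (hv : IsSol f g β N v₀ T v) {t₀ r : ℝ} (ht : 0 < t₀) (htT : t₀ ≤ T) (hr : 0 ≤ r) (x : ℝ) :
    heat r (v t₀) x = heat (t₀ + r) v₀ x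
      + ∫ s in (0 : ℝ)..t₀, duhamel (t₀ + r - s) (rhs f g N v s) x := by
  have h3 := hexp.third_lt
  have h4 := hexp.le
  have h5 := hexp.lt_half
  have hα : 0 < α := by linarith
  have hα1 : α ≤ 1 := by linarith
  obtain ⟨K, hK, hd⟩ := hv.exists_isDatum
  obtain ⟨B, hB, hp⟩ := hv.exists_isPrimitive hexp hf hg hR hN hNR
  have hc0 := h0.continuous hexp
  have hvt := hd t₀ ht htT
  have hct := hvt.continuous hexp
  have e1 : heat r (volterra (rhs f g N v) t₀) x = heat r (v t₀) x - heat r (heat t₀ v₀) x := by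
    rw [← heat_sub_apply hct hvt.sup (continuous_heat hc0 h0.sup t₀)
      (norm_heat_le h0.sup ht.le) r x]
    congr 1
    funext y
    rw [hv.eq t₀ ht htT y]; abel
  have e2 : heat r (volterra (rhs f g N v) t₀) x
      = ∫ s in (0 : ℝ)..t₀, heat r (duhamel (t₀ - s) (rhs f g N v s)) x := by
    have hi := (intervalIntegrable_beta (e := (1 - α) / 2) (θ := (1 - β) / 2) (t := t₀)
      (by linarith) (by linarith) (by linarith) (by linarith) ht).const_mul (5 * gaussConst * B)
    refine heat_intervalIntegral ht.le ?_ hi ?_ r x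
    · exact stronglyMeasurable_duhamel (measurable_rhs hf.continuous hg hN hv.meas)
        (by fun_prop) (by fun_prop) (by fun_prop)
    · intro s hs hst x
      have := norm_duhamel_le (hp s hs (hst.le.trans htT)) hα hα1 (sub_pos.2 hst) x
      rw [show (α - 1) / 2 = -((1 - α) / 2) by ring] at this
      exact this.trans (le_of_eq (by ring))
  have e3 : ∫ s in (0 : ℝ)..t₀, heat r (duhamel (t₀ - s) (rhs f g N v s)) x
      = ∫ s in (0 : ℝ)..t₀, duhamel (t₀ + r - s) (rhs f g N v s) x := by
    refine intervalIntegral.integral_congr_ae ?_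
    rw [uIoc_of_le ht.le]
    refine ae_Ioc_of_Ioo fun s hs hst => ?_
    rw [heat_duhamel (hp s hs (hst.le.trans htT)) hα hα1 hr (sub_pos.2 hst)]
    congr 1; ring
  rw [heat_heat hc0 h0.sup ht.le hr, e2, e3] at e1
  rw [e1, add_comm r t₀]; abel

/-- A solution, seen from a positive time on, is again a solution. -/
lemma IsSol.shift (hexp : Exponents α β) (hf : ContDiff ℝ ∞ f) (hg : ContDiff ℝ ∞ g)
    (hR : 0 ≤ R) (hN : N.Regular) (hNR : N.BoundedBy α β T R) (h0 : IsDatum β M v₀)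
    (hv : IsSol f g β N v₀ T v) {t₀ : ℝ} (ht : 0 < t₀) :
    IsSol f g β (N.shift t₀) (v t₀) (T - t₀) (fun r => v (t₀ + r)) where
  meas := hv.meas.comp (f := fun p : ℝ × ℝ => (t₀ + p.1, p.2)) (by fun_prop)
  periodic t h1 h2 := hv.periodic _ (by linarith) (by linarith)
  bound := by
    obtain ⟨m, hm⟩ := hv.bound
    refine ⟨m, fun t h1 h2 x => ?_, fun t h1 h2 x y => ?_, fun t h1 h2 x y => ?_⟩
    · simpa using hm.sup (t₀ + t) (by linarith) (by linarith) x
    · simpa using hm.hol (t₀ + t) (by linarith) (by linarith) x y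
    · have := hm.lip (t₀ + t) (by linarith) (by linarith) x y
      have hm0 := hm.nonneg_of_pos (show 0 < T by linarith)
      refine this.trans ?_
      rw [zero_mul, zero_mul]
      gcongr ?_ * _ * _
      refine mul_le_mul_of_nonneg_left ?_ hm0
      exact Real.rpow_le_rpow_of_nonpos h1 (by linarith)
        (by linarith [hexp.third_lt, hexp.le, hexp.lt_half])
  eq r h1 h2 x := by
    have hr : 0 < t₀ + r := by linarith
    have e1 := hv.heat_eq hexp hf hg hR hN hNR h0 ht (by linarith) h1.le x
    have e2 := hv.eq (t₀ + r) hr (by linarith) x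
    have i1 := hv.intervalIntegrable hexp hf hg hR hN hNR hr (by linarith) le_rfl x
    have i2 := i1.mono_set (c := 0) (d := t₀) (by
      rw [uIcc_of_le hr.le, uIcc_of_le ht.le]; exact Icc_subset_Icc le_rfl (by linarith))
    have i3 := i1.mono_set (c := t₀) (d := t₀ + r) (by
      rw [uIcc_of_le hr.le, uIcc_of_le (by linarith)]; exact Icc_subset_Icc ht.le le_rfl)
    have e3 : volterra (rhs f g (N.shift t₀) (fun r => v (t₀ + r))) r x
        = ∫ s in t₀..(t₀ + r), duhamel (t₀ + r - s) (rhs f g N v s) x := by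
      unfold volterra
      have := intervalIntegral.integral_comp_add_left (a := 0) (b := r)
        (fun s => duhamel (t₀ + r - s) (rhs f g N v s) x) t₀
      rw [add_zero] at this
      rw [← this]
      congr 1
      funext s
      rw [add_sub_add_left_eq_sub]
      rfl
    simp only [e1, e2, e3]
    unfold volterra
    rw [← intervalIntegral.integral_add_adjacent_intervals i2 i3, add_assoc]

lemma IsSol.mono_time (hv : IsSol f g β N v₀ T v) (hT : T' ≤ T) : IsSol f g β N v₀ T' v where
  meas := hv.meas
  periodic t h1 h2 := hv.periodic t h1 (h2.trans hT)
  bound := hv.bound.imp fun _ h => h.mono_time hT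
  eq t h1 h2 := hv.eq t h1 (h2.trans hT)

/-- A solution can be continued by a solution restarted at an earlier time. The two agree on their
overlap `(t₀, T]` by uniqueness. The overlap is what keeps the Lipschitz bound of the continuation,
whose singularity sits at `t₀`, away from that singularity. -/
lemma IsSol.glue (hexp : Exponents α β) (hf : ContDiff ℝ ∞ f) (hg : ContDiff ℝ ∞ g)
    (hR : 0 ≤ R) (hN : N.Regular) {t₀ h : ℝ} (hNR : N.BoundedBy α β (t₀ + h) R)
    (h0 : IsDatum β M v₀) (hv : IsSol f g β N v₀ T v) (ht : 0 < t₀) (htT : t₀ < T)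
    (hTh : T ≤ t₀ + h) (hv' : IsSol f g β (N.shift t₀) (v t₀) h v') :
    IsSol f g β N v₀ (t₀ + h) (fun t => if t ≤ T then v t else v' (t - t₀)) := by
  have hNT := hNR.mono_time hTh
  have hs := hv.shift hexp hf hg hR hN hNT h0 ht
  obtain ⟨K, hK, hd⟩ := hv.exists_isDatum
  have hNs : (N.shift t₀).BoundedBy α β (T - t₀) R := hNT.shift ht.le
  have hu : ∀ t, t₀ < t → t ≤ T → v' (t - t₀) = v t := by
    intro t h1 h2
    funext x
    have := IsSol.unique hexp hf hg hR (hN.shift t₀) hNs (hd t₀ ht htT.le)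
      (hv'.mono_time (by linarith)) hs (sub_pos.2 h1) (by linarith) x
    rw [this, add_sub_cancel]
  have hw1 : ∀ t, t ≤ T → (if t ≤ T then v t else v' (t - t₀)) = v t := fun t h => if_pos h
  have hw2 : ∀ t, t₀ < t → (if t ≤ T then v t else v' (t - t₀)) = v' (t - t₀) := by
    intro t h1
    split_ifs with h2
    · exact (hu t h1 h2).symm
    · rfl
  obtain ⟨m, hm⟩ := hv.bound
  obtain ⟨m', hm'⟩ := hv'.bound
  have hm0 := hm.nonneg_of_pos (ht.trans htT)
  have hm0' := hm'.nonneg_of_pos (show 0 < h by linarith)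
  have hθ : 0 ≤ (1 - β) / 2 := by linarith [hexp.lt_half]
  refine ⟨?_, fun t h1 h2 => ?_, ?_, fun t h1 h2 x => ?_⟩
  · have : (fun p : ℝ × ℝ => (if p.1 ≤ T then v p.1 else v' (p.1 - t₀)) p.2)
        = fun p => if p.1 ≤ T then v p.1 p.2 else v' (p.1 - t₀) p.2 := by
      funext p; split_ifs <;> rfl
    rw [this]
    exact Measurable.ite (measurableSet_le measurable_fst measurable_const) hv.meas
      (hv'.meas.comp (f := fun p : ℝ × ℝ => (p.1 - t₀, p.2)) (by fun_prop))
  · split_ifs with h3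
    · exact hv.periodic t h1 h3
    · exact hv'.periodic _ (by linarith) (by linarith)
  -- on `(T, t₀ + h]` the singular factor of `v'` is at most `(T - t₀) ^ (-(1 - β) / 2)`
  · set c := (T - t₀) ^ (-((1 - β) / 2)) * (t₀ + h) ^ ((1 - β) / 2) with hc
    have hc0 : 0 ≤ c := by
      have : 0 < T - t₀ := by linarith
      have : 0 < t₀ + h := by linarith
      positivity
    refine ⟨m + m' + m' * c, fun t h1 h2 x => ?_, fun t h1 h2 x y => ?_, fun t h1 h2 x y => ?_⟩
    · split_ifs with h3
      · refine (hm.sup t h1 h3 x).trans ?_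
        gcongr ?_ * _
        nlinarith [mul_nonneg hm0' hc0]
      · refine (hm'.sup (t - t₀) (by linarith) (by linarith) x).trans ?_
        rw [zero_mul, zero_mul]
        gcongr ?_ * _
        nlinarith [mul_nonneg hm0' hc0]
    · split_ifs with h3
      · refine (hm.hol t h1 h3 x y).trans ?_
        gcongr ?_ * _ * _
        nlinarith [mul_nonneg hm0' hc0]
      · refine (hm'.hol (t - t₀) (by linarith) (by linarith) x y).trans ?_
        rw [zero_mul, zero_mul]
        gcongr ?_ * _ * _
        nlinarith [mul_nonneg hm0' hc0]
    · split_ifs with h3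
      · refine (hm.lip t h1 h3 x y).trans ?_
        gcongr ?_ * _ * _ * _
        nlinarith [mul_nonneg hm0' hc0]
      · refine (hm'.lip (t - t₀) (by linarith) (by linarith) x y).trans ?_
        rw [zero_mul, zero_mul]
        gcongr ?_ * _ * _
        have e1 : (t - t₀) ^ (-((1 - β) / 2)) ≤ (T - t₀) ^ (-((1 - β) / 2)) :=
          Real.rpow_le_rpow_of_nonpos (by linarith) (by linarith) (by linarith)
        have e2 : 1 ≤ (t₀ + h) ^ ((1 - β) / 2) * t ^ (-((1 - β) / 2)) := by
          rw [Real.rpow_neg h1.le, ← div_eq_mul_inv, one_le_div (by positivity)]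
          gcongr
        have e3 : 0 ≤ (T - t₀) ^ (-((1 - β) / 2)) := Real.rpow_nonneg (by linarith) _
        calc m' * (t - t₀) ^ (-((1 - β) / 2))
            ≤ m' * ((T - t₀) ^ (-((1 - β) / 2))
              * ((t₀ + h) ^ ((1 - β) / 2) * t ^ (-((1 - β) / 2)))) := by
              gcongr
              exact e1.trans (le_mul_of_one_le_right e3 e2)
          _ = m' * c * t ^ (-((1 - β) / 2)) := by rw [hc]; ring
          _ ≤ (m + m' + m' * c) * t ^ (-((1 - β) / 2)) := by gcongr; linarith
  · set w : ℝ → ℝ → Vec n := fun t => if t ≤ T then v t else v' (t - t₀) with hw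
    have hwv : ∀ s, s ≤ T → rhs f g N w s = rhs f g N v s := by
      intro s hs
      unfold rhs
      rw [hw]; simp only [hw1 s hs]
    change w t x = heat t v₀ x + volterra (rhs f g N w) t x
    rcases le_or_gt t T with h3 | h3
    · have : w t = v t := hw1 t h3
      rw [this, hv.eq t h1 h3]
      congr 1
      unfold volterra
      refine intervalIntegral.integral_congr_ae ?_
      rw [uIoc_of_le h1.le]
      exact ae_Ioc_of_Ioo fun s _ hst => by rw [hwv s (hst.le.trans h3)]
    · have htt : t₀ < t := htT.trans h3
      have e0 : w t = v' (t - t₀) := hw2 t htt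
      rw [e0, hv'.eq (t - t₀) (sub_pos.2 htt) (by linarith),
        hv.heat_eq hexp hf hg hR hN hNT h0 ht htT.le (sub_pos.2 htt).le, add_sub_cancel, add_assoc]
      congr 1
      have i1 := hv.intervalIntegrable hexp hf hg hR hN hNT ht htT.le (t := t) htt.le x
      have i2 := hv'.intervalIntegrable hexp hf hg hR (hN.shift t₀)
        (by have := hNR.shift ht.le; rwa [add_sub_cancel_left] at this) (sub_pos.2 htt) (by linarith) le_rfl x
      have e1 : ∫ s in (0:ℝ)..t₀, duhamel (t - s) (rhs f g N v s) x
          = ∫ s in (0:ℝ)..t₀, duhamel (t - s) (rhs f g N w s) x := by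
        refine intervalIntegral.integral_congr_ae ?_
        rw [uIoc_of_le ht.le]
        exact ae_Ioc_of_Ioo fun s _ hst => by rw [hwv s (hst.le.trans htT.le)]
      have hws : ∀ s, t₀ < s → rhs f g (N.shift t₀) v' (s - t₀) = rhs f g N w s := by
        intro s hs
        unfold rhs
        have : w s = v' (s - t₀) := hw2 s hs
        rw [this]
        simp [Noise.shift]
      have i1' : IntervalIntegrable (fun s => duhamel (t - s) (rhs f g N w s) x) volume 0 t₀ := by
        refine i1.congr_ae ?_
        rw [uIoc_of_le ht.le]
        rw [Filter.EventuallyEq, ae_restrict_iff' measurableSet_Ioc]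
        exact ae_Ioc_of_Ioo fun s _ hst => by rw [hwv s (hst.le.trans htT.le)]
      have h4 : ∀ s ∈ Ioc t₀ t, duhamel (t - t₀ - (s - t₀)) (rhs f g (N.shift t₀) v' (s - t₀)) x
          = duhamel (t - s) (rhs f g N w s) x := by
        intro s hs
        rw [hws s hs.1]; congr 1; ring
      have i2' : IntervalIntegrable (fun s => duhamel (t - s) (rhs f g N w s) x) volume t₀ t := by
        have := i2.comp_sub_right t₀
        rw [zero_add, sub_add_cancel] at this
        refine this.congr ?_
        rw [uIoc_of_le htt.le]
        exact h4
      have e2 : volterra (rhs f g (N.shift t₀) v') (t - t₀) x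
          = ∫ s in t₀..t, duhamel (t - s) (rhs f g N w s) x := by
        unfold volterra
        have := intervalIntegral.integral_comp_sub_right (a := t₀) (b := t)
          (fun s => duhamel (t - t₀ - s) (rhs f g (N.shift t₀) v' s) x) t₀
        rw [sub_self] at this
        rw [← this]
        refine intervalIntegral.integral_congr_ae (ae_of_all _ ?_)
        rw [uIoc_of_le htt.le]
        exact h4
      rw [e1, e2, intervalIntegral.integral_add_adjacent_intervals i1' i2']
      rfl

end Restart

/-! ### Regularity in time -/

section TimeRegularity

variable {n : ℕ} {f : Vec n → Vec n} {g : Vec n → Vec n →L[ℝ] Vec n} {N : Noise n}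
  {v : ℝ → ℝ → Vec n} {v₀ : ℝ → Vec n} {α β T R M : ℝ}

lemma exists_pos_of_continuous {F : ℝ → ℝ} (hF : Continuous F) (h0 : F 0 = 0) {ε T : ℝ}
    (hε : 0 < ε) (hT : 0 < T) : ∃ δ, 0 < δ ∧ δ ≤ T ∧ ∀ r, 0 ≤ r → r ≤ δ → F r ≤ ε := by
  have h1 : ∀ᶠ r in 𝓝 (0:ℝ), F r < ε := by
    have := hF.tendsto 0
    rw [h0] at this
    exact this.eventually_lt_const hε
  obtain ⟨δ, hδ, h⟩ := Metric.eventually_nhds_iff.1 h1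
  refine ⟨min (δ / 2) T, lt_min (by linarith) hT, min_le_right _ _, fun r h0 hr => (h ?_).le⟩
  rw [Real.dist_eq, sub_zero, abs_of_nonneg h0]
  linarith [min_le_left (δ / 2) T]

/-- A solution attains its initial datum uniformly. -/
theorem IsSol.tendsto_initial (hexp : Exponents α β) (hf : ContDiff ℝ ∞ f) (hg : ContDiff ℝ ∞ g)
    (hR : 0 ≤ R) (hN : N.Regular) (hNR : N.BoundedBy α β T R) (h0 : IsDatum β M v₀)
    (hv : IsSol f g β N v₀ T v) (hT : 0 < T) {ε : ℝ} (hε : 0 < ε) :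
    ∃ δ, 0 < δ ∧ δ ≤ T ∧ ∀ t, 0 < t → t ≤ δ → ∀ x, ‖v t x - v₀ x‖ ≤ ε := by
  have h3 := hexp.third_lt
  have h4 := hexp.le
  have h5 := hexp.lt_half
  have hM : 0 ≤ M := (norm_nonneg _).trans (h0.sup 0)
  obtain ⟨m, hm⟩ := hv.bound
  have hm0 := hm.nonneg_of_pos hT
  obtain ⟨C, hC, h⟩ := exists_small_time hexp hf hg hm0 hR hT.le
  have hcont : Continuous fun t : ℝ => t * M + gaussConst * M * (Real.sqrt (2 * t)) ^ β
      + C * t ^ (α / 4) := by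
    have h1 : Continuous fun t : ℝ => (Real.sqrt (2 * t)) ^ β :=
      Continuous.rpow_const (by fun_prop) fun _ => Or.inr (by linarith)
    have h2 : Continuous fun t : ℝ => t ^ (α / 4) :=
      Continuous.rpow_const (by fun_prop) fun _ => Or.inr (by linarith)
    fun_prop
  obtain ⟨δ, hδ, hδT, hd⟩ := exists_pos_of_continuous hcont
    (by simp [Real.zero_rpow (show β ≠ 0 by linarith), Real.zero_rpow (show α / 4 ≠ 0 by linarith)])
    hε hT
  refine ⟨δ, hδ, hδT, fun t ht htδ x => le_trans ?_ (hd t ht.le htδ)⟩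
  have htT := htδ.trans hδT
  have e1 := norm_heat_sub_self_le (h0.continuous hexp) h0.sup hM (by linarith) (by linarith)
    h0.hol ht.le x
  have e2 := (h t ht htT N v hN (hNR.mono_time htT) hv.meas (hm.mono_time htT)).sup t ht le_rfl x
  rw [zero_mul, Real.exp_zero, mul_one] at e2
  rw [hv.eq t ht htT, add_sub_right_comm]
  exact (norm_add_le _ _).trans (add_le_add e1 e2)

/-- A solution is uniformly continuous in `C^β` away from the initial time: restarted at time `s`,
its increments come from the semigroup acting on the Lipschitz function `v s` and from the integral
over a short time. -/
theorem IsSol.uniform_continuity (hexp : Exponents α β) (hf : ContDiff ℝ ∞ f) (hg : ContDiff ℝ ∞ g)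
    (hR : 0 ≤ R) (hN : N.Regular) (hNR : N.BoundedBy α β T R) (h0 : IsDatum β M v₀)
    (hv : IsSol f g β N v₀ T v) {t₁ ε : ℝ} (ht : 0 < t₁) (htT : t₁ ≤ T) (hε : 0 < ε) :
    ∃ δ, 0 < δ ∧ ∀ s t, t₁ ≤ s → s ≤ t → t ≤ T → t - s ≤ δ →
      IsDatum β ε (fun x => v t x - v s x) := by
  have h3 := hexp.third_lt
  have h4 := hexp.le
  have h5 := hexp.lt_half
  have hT : 0 < T := ht.trans_le htT
  obtain ⟨m, hm⟩ := hv.bound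
  have hm0 := hm.nonneg_of_pos hT
  have hG := gaussConst_pos
  obtain ⟨C, hC, h⟩ := exists_small_time hexp hf hg hm0 hR hT.le
  set L := m * t₁ ^ (-((1 - β) / 2)) with hL
  have hL0 : 0 ≤ L := by positivity
  set S : ℝ → ℝ := fun r => r * m + gaussConst * L * Real.sqrt (2 * r) with hS
  have hcS : Continuous S := by rw [hS]; fun_prop
  have hc2 : Continuous fun t : ℝ => t ^ (α / 4) :=
    Continuous.rpow_const (by fun_prop) fun _ => Or.inr (by linarith)
  have hc1 : Continuous fun r : ℝ => S r + C * r ^ (α / 4) := by fun_prop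
  have hc3 : Continuous fun r : ℝ => (2 * S r) ^ (1 - β) * (2 * L) ^ β + C * r ^ (α / 4) := by
    have : Continuous fun r : ℝ => (2 * S r) ^ (1 - β) :=
      Continuous.rpow_const (by fun_prop) fun _ => Or.inr (by linarith)
    fun_prop
  have hS0 : S 0 = 0 := by simp [hS]
  obtain ⟨δ₁, hδ₁, -, hd₁⟩ := exists_pos_of_continuous hc1
    (by simp [hS0, Real.zero_rpow (show α / 4 ≠ 0 by linarith)]) hε hT
  obtain ⟨δ₂, hδ₂, -, hd₂⟩ := exists_pos_of_continuous hc3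
    (by simp [hS0, Real.zero_rpow (show α / 4 ≠ 0 by linarith),
      Real.zero_rpow (show 1 - β ≠ 0 by linarith)]) hε hT
  refine ⟨min δ₁ δ₂, lt_min hδ₁ hδ₂, fun s t hs hst htT' hr => ?_⟩
  have hs0 : 0 < s := ht.trans_le hs
  rcases hst.eq_or_lt with rfl | hst
  · exact ⟨fun x => by simp, fun x => by simpa using hε.le,
      fun x y => by simpa using by positivity⟩
  set r := t - s with hr'
  have hr0 : 0 < r := sub_pos.2 hst
  have hsT : s ≤ T := by linarith
  have hsh := hv.shift hexp hf hg hR hN hNR h0 hs0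
  have hb := h r hr0 (by linarith) (N.shift s) (fun q => v (s + q)) (hN.shift s)
    (by have := (hNR.mono_time htT').shift hs0.le; rwa [← hr'] at this) hsh.meas
    (by
      obtain ⟨m', hm'⟩ := hsh.bound
      refine ⟨fun q h1 h2 x => ?_, fun q h1 h2 x y => ?_, fun q h1 h2 x y => ?_⟩
      · simpa using hm.sup (s + q) (by linarith) (by linarith) x
      · simpa using hm.hol (s + q) (by linarith) (by linarith) x y
      · refine (hm.lip (s + q) (by linarith) (by linarith) x y).trans ?_
        rw [zero_mul, zero_mul]
        gcongr ?_ * _ * _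
        refine mul_le_mul_of_nonneg_left ?_ hm0
        exact Real.rpow_le_rpow_of_nonpos h1 (by linarith) (by linarith))
  have heq : ∀ x, v t x - v s x = (heat r (v s) x - v s x)
      + volterra (rhs f g (N.shift s) (fun q => v (s + q))) r x := by
    intro x
    have := hsh.eq r hr0 (by linarith) x
    simp only [hr', add_sub_cancel] at this
    rw [this]; abel
  have hlip : ∀ x y, ‖v s x - v s y‖ ≤ L * |x - y| := by
    intro x y
    refine (hm.lip s hs0 hsT x y).trans ?_
    rw [zero_mul, Real.exp_zero, mul_one, hL]
    gcongr ?_ * _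
    refine mul_le_mul_of_nonneg_left ?_ hm0
    exact Real.rpow_le_rpow_of_nonpos ht hs (by linarith)
  have hsb : ∀ x, ‖v s x‖ ≤ m := fun x => hm.cBound.sup s hs0 hsT x
  have hsc : Continuous (v s) := continuous_of_holder (γ := 1) one_pos
    (fun x y => by simpa using hlip x y)
  have hsup : ∀ x, ‖heat r (v s) x - v s x‖ ≤ S r := by
    intro x
    have := norm_heat_sub_self_le hsc hsb hL0 zero_le_one le_rfl
      (fun x y => by simpa using hlip x y) hr0.le x
    simpa [hS] using this
  have hSr : 0 ≤ S r := (norm_nonneg _).trans (hsup 0)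
  refine ⟨fun x => ?_, fun x => ?_, fun x y => ?_⟩
  · rw [hv.periodic t (by linarith) htT' x, hv.periodic s hs0 hsT x]
  · refine le_trans ?_ (hd₁ r hr0.le (hr.trans (min_le_left _ _)))
    rw [heq]
    refine (norm_add_le _ _).trans (add_le_add (hsup x) ?_)
    simpa using hb.sup r hr0 le_rfl x
  · refine le_trans ?_ (mul_le_mul_of_nonneg_right (hd₂ r hr0.le (hr.trans (min_le_right _ _)))
      (by positivity))
    rw [heq, heq, add_sub_add_comm, add_mul]
    refine (norm_add_le _ _).trans (add_le_add ?_ ?_)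
    -- interpolation between the small uniform bound and the Lipschitz bound
    · have a1 : ‖heat r (v s) x - v s x - (heat r (v s) y - v s y)‖ ≤ 2 * S r := by
        refine (norm_sub_le _ _).trans ?_
        linarith [hsup x, hsup y]
      have a2 : ‖heat r (v s) x - v s x - (heat r (v s) y - v s y)‖ ≤ 2 * L * |x - y| := by
        rw [sub_sub_sub_comm]
        refine (norm_sub_le _ _).trans ?_
        have := norm_heat_sub_le hsc hsb hr0.le (x := x) (y := y) (D := L * |x - y|)
          (fun z => by simpa using hlip (x + z) (y + z))
        linarith [hlip x y]
      refine (le_interpolate (γ := β) (norm_nonneg _) a1 a2 (by linarith) (by linarith)).trans (le_of_eq ?_)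
      rw [Real.mul_rpow (x := 2 * L) (by positivity) (abs_nonneg _)]
      ring
    · simpa using hb.hol r hr0 le_rfl x y

end TimeRegularity

/-! ### The periodic heat kernel -/

section Kernel

variable {E : Type*} [NormedAddCommGroup E] [NormedSpace ℝ E] [CompleteSpace E]

/-- The summands of the periodised heat kernel, as a theta series. -/
lemma hasSum_kernel {τ : ℝ} (hτ : 0 < τ) (x : ℝ) :
    HasSum (fun k : ℤ => Real.exp (-τ) * ((Real.sqrt (4 * Real.pi * τ))⁻¹
      * Real.exp (-(x - 2 * Real.pi * k) ^ 2 / (4 * τ)))) (kernel τ x) ∧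
    kernel τ x = Real.exp (-τ) * ((Real.sqrt (4 * Real.pi * τ))⁻¹
      * HurwitzZeta.evenKernel ((-x / (2 * Real.pi) : ℝ) : UnitAddCircle) (Real.pi / τ)) := by
  have h1 := HurwitzZeta.hasSum_int_evenKernel (-x / (2 * Real.pi))
    (show 0 < Real.pi / τ by positivity)
  have h2 : ∀ k : ℤ, Real.exp (-Real.pi * (k + -x / (2 * Real.pi)) ^ 2 * (Real.pi / τ))
      = Real.exp (-(x - 2 * Real.pi * k) ^ 2 / (4 * τ)) := by
    intro k
    congr 1
    have := Real.pi_pos.ne'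
    field_simp
    ring
  simp_rw [h2] at h1
  have h3 := h1.mul_left (Real.sqrt (4 * Real.pi * τ))⁻¹
  have h4 := h3.mul_left (Real.exp (-τ))
  have e : kernel τ x = Real.exp (-τ) * ((Real.sqrt (4 * Real.pi * τ))⁻¹
      * HurwitzZeta.evenKernel ((-x / (2 * Real.pi) : ℝ) : UnitAddCircle) (Real.pi / τ)) := by
    unfold kernel heatKernel
    rw [h3.tsum_eq]
  exact ⟨e ▸ h4, e⟩

lemma contDiff_kernel {τ : ℝ} (hτ : 0 < τ) : ContDiff ℝ 1 (kernel τ) := by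
  set F : ℂ → ℂ := fun z => Complex.exp (-Real.pi * z ^ 2 * (Real.pi / τ : ℝ))
    * jacobiTheta₂ (z * Complex.I * (Real.pi / τ : ℝ)) (Complex.I * (Real.pi / τ : ℝ)) with hF
  have him : 0 < (Complex.I * ((Real.pi / τ : ℝ) : ℂ)).im := by
    simpa using (by positivity : 0 < Real.pi / τ)
  have h1 : Differentiable ℂ F := by
    intro z
    refine DifferentiableAt.mul (by fun_prop) ?_
    exact (differentiableAt_jacobiTheta₂_fst _ him).comp z (f := fun z : ℂ =>
      z * Complex.I * (Real.pi / τ : ℝ)) (by fun_prop)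
  have h2 : ContDiff ℝ 1 fun x : ℝ => (F x).re := by
    have : ContDiff ℂ 1 F := h1.contDiff
    exact this.real_of_complex
  have h3 : kernel τ = fun x => Real.exp (-τ) * ((Real.sqrt (4 * Real.pi * τ))⁻¹
      * (F ((-x / (2 * Real.pi) : ℝ) : ℂ)).re) := by
    funext x
    rw [(hasSum_kernel hτ x).2, hF]
    simp only
    rw [← HurwitzZeta.evenKernel_def, Complex.ofReal_re]
  rw [h3]
  have h4 : ContDiff ℝ 1 fun x : ℝ => -x / (2 * Real.pi) := by fun_prop
  exact contDiff_const.mul (contDiff_const.mul (h2.comp h4))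

lemma continuous_kernel {τ : ℝ} (hτ : 0 < τ) : Continuous (kernel τ) := (contDiff_kernel hτ).continuous

lemma kernel_periodic {τ : ℝ} (hτ : 0 < τ) : Function.Periodic (kernel τ) (2 * Real.pi) := by
  intro x
  rw [(hasSum_kernel hτ _).2, (hasSum_kernel hτ x).2]
  congr 3
  have : (-(x + 2 * Real.pi) / (2 * Real.pi) : ℝ) = -x / (2 * Real.pi) - 1 := by
    have := Real.pi_pos.ne'
    field_simp
    ring
  rw [this, sub_eq_add_neg]
  simp

lemma hasSum_integral_period {E : Type*} [NormedAddCommGroup E] [NormedSpace ℝ E] {φ : ℝ → E} (hφ : Integrable φ) :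
    HasSum (fun k : ℤ => ∫ y in (0 : ℝ)..(2 * Real.pi), φ (y + 2 * Real.pi * k)) (∫ y, φ y) := by
  have h1 := hasSum_integral_iUnion (μ := volume) (f := φ) (s := fun k : ℤ =>
    Ioc (0 + k • (2 * Real.pi)) (0 + (k + 1) • (2 * Real.pi))) (fun _ => measurableSet_Ioc)
    (pairwise_disjoint_Ioc_add_zsmul 0 (2 * Real.pi)) hφ.integrableOn
  rw [iUnion_Ioc_add_zsmul two_pi_pos', setIntegral_univ] at h1
  convert h1 using 2 with k
  rw [intervalIntegral.integral_comp_add_right, intervalIntegral.integral_of_le]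
  · simp only [zsmul_eq_mul, zero_add]
    push_cast
    congr 3 <;> ring
  · linarith [two_pi_pos']

/-- Unfolding: the semigroup on the circle is the semigroup on the line acting on the periodic
extension. -/
lemma integral_kernel_smul {τ B : ℝ} (hτ : 0 < τ) {h : ℝ → E}
    (hm : AEStronglyMeasurable h volume) (hp : Function.Periodic h (2 * Real.pi))
    (hB : ∀ x, ‖h x‖ ≤ B) (x : ℝ) :
    ∫ y in (0 : ℝ)..(2 * Real.pi), kernel τ (x - y) • h y = heat τ h x := by
  set G : ℝ → ℝ := fun y => Real.exp (-τ) * ((Real.sqrt (4 * Real.pi * τ))⁻¹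
    * Real.exp (-(x - y) ^ 2 / (4 * τ))) with hG
  have hσ := sqrt_two_mul_pos hτ
  have hGi : Integrable G := by
    have h1 : Integrable fun y : ℝ => Real.exp (-(4 * τ)⁻¹ * y ^ 2) :=
      integrable_exp_neg_mul_sq (by positivity)
    have h2 := h1.comp_sub_left x
    refine (h2.const_mul (Real.exp (-τ) * (Real.sqrt (4 * Real.pi * τ))⁻¹)).congr
      (ae_of_all _ fun y => ?_)
    simp only [hG]
    rw [mul_assoc]
    congr 3
    field_simp
  have e1 : heat τ h x = ∫ y, G y • h y := by
    unfold heat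
    rw [gaussMean_eq_integral _ hσ, smul_smul, ← integral_smul]
    congr 1
    funext y
    rw [smul_smul, gauss_pdf_std]
    congr 1
    simp only [hG]
    have e : Real.sqrt (4 * Real.pi * τ) = Real.sqrt (2 * τ) * Real.sqrt (2 * Real.pi) := by
      rw [← Real.sqrt_mul (by positivity)]; congr 1; ring
    rw [e, mul_inv, mul_one, div_pow, Real.sq_sqrt (by positivity)]
    have : -((y - x) ^ 2 / (2 * τ)) / 2 = -(x - y) ^ 2 / (4 * τ) := by field_simp; ring
    rw [← neg_div] at this ⊢
    rw [this]; ring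
  have hφ : Integrable fun y => G y • h y := by
    refine (hGi.mul_const B).mono' (hGi.aestronglyMeasurable.smul hm) (ae_of_all _ fun y => ?_)
    have : 0 ≤ G y := by simp only [hG]; positivity
    rw [norm_smul, Real.norm_of_nonneg this]
    gcongr
    exact hB y
  have hper : ∀ (k : ℤ) y, h (y + 2 * Real.pi * k) = h y := by
    intro k y
    have := hp.int_mul k y
    rwa [mul_comm] at this
  have s1 := hasSum_integral_period hφ
  have s2 := hasSum_integral_period hφ.norm
  have hint : ∀ k : ℤ, Integrable (fun y => G (y + 2 * Real.pi * k) • h y)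
      (volume.restrict (Ioc 0 (2 * Real.pi))) := by
    intro k
    have := (hφ.comp_add_right (2 * Real.pi * k)).restrict (s := Ioc 0 (2 * Real.pi))
    simpa only [hper] using this
  have hsum : Summable fun k : ℤ => ∫ y in Ioc 0 (2 * Real.pi), ‖G (y + 2 * Real.pi * k) • h y‖ := by
    have := s2.summable
    simpa only [hper, intervalIntegral.integral_of_le two_pi_pos'.le] using this
  have s3 := hasSum_integral_of_summable_integral_norm hint hsum
  have e2 : (fun y => ∑' k : ℤ, G (y + 2 * Real.pi * k) • h y) = fun y => kernel τ (x - y) • h y := by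
    funext y
    have h1 := ((hasSum_kernel hτ (x - y)).1).smul_const (h y)
    rw [← h1.tsum_eq]
    congr 1
    funext k
    simp only [hG, sub_sub]
  rw [e2] at s3
  simp only [hper, intervalIntegral.integral_of_le two_pi_pos'.le] at s1
  rw [intervalIntegral.integral_of_le two_pi_pos'.le, e1]
  exact s3.unique s1

lemma integral_kernel {τ : ℝ} (hτ : 0 < τ) (x : ℝ) :
    ∫ y in (0 : ℝ)..(2 * Real.pi), kernel τ (x - y) = Real.exp (-τ) := by
  have h1 := integral_kernel_smul hτ (h := fun _ => (1:ℝ)) aestronglyMeasurable_const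
    (fun _ => rfl) (B := 1) (fun _ => by simp) x
  simpa [heat_const] using h1

/-- The derivative of the semigroup, through the derivative of the kernel. -/
lemma integral_deriv_kernel_smul {τ B : ℝ} (hτ : 0 < τ) {h : ℝ → E} (hh : Continuous h)
    (hp : Function.Periodic h (2 * Real.pi)) (hB : ∀ x, ‖h x‖ ≤ B) (x : ℝ) :
    ∫ y in (0 : ℝ)..(2 * Real.pi), deriv (kernel τ) (x - y) • h y = dheat τ h x := by
  have hd : Continuous (deriv (kernel τ)) := (contDiff_kernel hτ).continuous_deriv le_rfl
  have hc := continuous_kernel hτ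
  obtain ⟨C, hC⟩ : ∃ C, ∀ y, ‖deriv (kernel τ) y‖ ≤ C := by
    have hper : Function.Periodic (deriv (kernel τ)) (2 * Real.pi) := by
      intro y
      rw [← deriv_comp_add_const]
      congr 1
      funext z
      exact kernel_periodic hτ z
    obtain ⟨C, hC⟩ := isCompact_Icc.exists_bound_of_continuousOn (s := Icc 0 (2 * Real.pi))
      hd.continuousOn
    refine ⟨C, fun y => ?_⟩
    obtain ⟨z, hz, e⟩ := hper.exists_mem_Ico₀ two_pi_pos' y
    rw [e]
    exact hC z ⟨hz.1, hz.2.le⟩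
  have h1 : HasDerivAt (fun x => ∫ y in (0 : ℝ)..(2 * Real.pi), kernel τ (x - y) • h y)
      (∫ y in (0 : ℝ)..(2 * Real.pi), deriv (kernel τ) (x - y) • h y) x := by
    refine (intervalIntegral.hasDerivAt_integral_of_dominated_loc_of_deriv_le
      (F := fun x y => kernel τ (x - y) • h y) (F' := fun x y => deriv (kernel τ) (x - y) • h y)
      (bound := fun _ => C * B) (s := univ) univ_mem (Eventually.of_forall fun x' => ?_) ?_ ?_ ?_ ?_ ?_).2
    · exact Continuous.aestronglyMeasurable (by fun_prop)
    · exact Continuous.intervalIntegrable (by fun_prop) _ _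
    · exact Continuous.aestronglyMeasurable (by fun_prop)
    · refine ae_of_all _ fun y _ x' _ => ?_
      rw [norm_smul]
      exact mul_le_mul (hC _) (hB y) (norm_nonneg _) ((norm_nonneg _).trans (hC 0))
    · simp
    · refine ae_of_all _ fun y _ x' _ => ?_
      have h2 : HasDerivAt (kernel τ) (deriv (kernel τ) (x' - y)) (x' - y) :=
        ((contDiff_kernel hτ).differentiable one_ne_zero _).hasDerivAt
      exact (h2.comp_sub_const x' y).smul_const (h y)
  have h2 : HasDerivAt (fun x => ∫ y in (0 : ℝ)..(2 * Real.pi), kernel τ (x - y) • h y)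
      (dheat τ h x) x := by
    have : (fun x => ∫ y in (0 : ℝ)..(2 * Real.pi), kernel τ (x - y) • h y) = heat τ h :=
      funext fun x => integral_kernel_smul hτ hh.aestronglyMeasurable hp hB x
    rw [this]
    exact hasDerivAt_heat hh hB hτ x
  exact h1.unique h2

/-- Integration of the kernel against a primitive, by parts. -/
lemma kernel_smul_sub_integral {τ α K : ℝ} (hτ : 0 < τ) (hα : 0 < α) (hα1 : α ≤ 1) {H : ℝ → E}
    (hH : IsPrimitive α K H) (x : ℝ) :
    kernel τ (x - 2 * Real.pi) • H (2 * Real.pi)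
      + ∫ y in (0 : ℝ)..(2 * Real.pi), deriv (kernel τ) (x - y) • H y = duhamel τ H x := by
  have hd : Continuous (deriv (kernel τ)) := (contDiff_kernel hτ).continuous_deriv le_rfl
  have hc := continuous_kernel hτ
  have hpc := hH.continuous_perExt hα hα1
  have e1 : ∀ y ∈ Icc 0 (2 * Real.pi), H y = perExt (bridge H) y
      + (y / (2 * Real.pi)) • H (2 * Real.pi) := by
    intro y hy
    rw [perExt_eq (bridge_zero hH.1) hy]
    unfold bridge
    abel
  have e2 : ∫ y in (0 : ℝ)..(2 * Real.pi), deriv (kernel τ) (x - y) • H y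
      = (∫ y in (0 : ℝ)..(2 * Real.pi), deriv (kernel τ) (x - y) • perExt (bridge H) y)
        + (∫ y in (0 : ℝ)..(2 * Real.pi), deriv (kernel τ) (x - y) * (y / (2 * Real.pi)))
          • H (2 * Real.pi) := by
    rw [← intervalIntegral.integral_smul_const, ← intervalIntegral.integral_add]
    · refine intervalIntegral.integral_congr fun y hy => ?_
      rw [uIcc_of_le two_pi_pos'.le] at hy
      rw [e1 y hy, smul_add, smul_smul]
    · exact Continuous.intervalIntegrable (by fun_prop) _ _
    · exact Continuous.intervalIntegrable (by fun_prop) _ _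
  have e3 : ∫ y in (0 : ℝ)..(2 * Real.pi), deriv (kernel τ) (x - y) * (y / (2 * Real.pi))
      = -kernel τ (x - 2 * Real.pi) + Real.exp (-τ) / (2 * Real.pi) := by
    have := intervalIntegral.integral_mul_deriv_eq_deriv_mul (a := 0) (b := 2 * Real.pi)
      (u := fun y => y / (2 * Real.pi)) (u' := fun _ => 1 / (2 * Real.pi))
      (v := fun y => -kernel τ (x - y)) (v' := fun y => deriv (kernel τ) (x - y))
      (fun y _ => (hasDerivAt_id y).div_const _) (fun y _ => ?_)
      (Continuous.intervalIntegrable (by fun_prop) _ _)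
      (Continuous.intervalIntegrable (by fun_prop) _ _)
    · simp_rw [mul_comm (deriv (kernel τ) _)]
      rw [this, div_self two_pi_pos'.ne']
      simp only [one_div, mul_neg, intervalIntegral.integral_neg,
        intervalIntegral.integral_const_mul, integral_kernel hτ]
      ring
    · have h2 : HasDerivAt (kernel τ) (deriv (kernel τ) (x - y)) (x - y) :=
        ((contDiff_kernel hτ).differentiable one_ne_zero _).hasDerivAt
      simpa only [neg_neg] using (h2.comp_const_sub x y).fun_neg
  rw [e2, integral_deriv_kernel_smul hτ hpc (perExt_periodic _) (hH.norm_perExt_le hα hα1), e3]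
  unfold duhamel
  module

end Kernel

/-! ### Rough integrals against the heat kernel -/

section RoughIntegral

variable {n : ℕ} {a : ℝ≥0} {X : RoughPath n a}

/-- The points of a partition of `[0, 2π]`. -/
lemma partition_mem_box {m : ℕ} {q : ℕ → ℝ} (h0 : q 0 = 0) (hm : q m = 2 * Real.pi)
    (hq : ∀ k < m, q k ≤ q (k + 1)) {k : ℕ} (hk : k ≤ m) : q k ∈ box := by
  have h1 : ∀ j, j ≤ m → 0 ≤ q j := by
    intro j
    induction j with
    | zero => intro _; rw [h0]
    | succ j ih => intro hj; exact (ih (by omega)).trans (hq j (by omega))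
  have h2 : ∀ j, j ≤ m → q (m - j) ≤ 2 * Real.pi := by
    intro j
    induction j with
    | zero => intro _; simp [hm]
    | succ j ih =>
      intro hj
      have := hq (m - (j + 1)) (by omega)
      rw [show m - (j + 1) + 1 = m - j by omega] at this
      exact this.trans (ih (by omega))
  have := h2 (m - k) (by omega)
  rw [show m - (m - k) = k by omega] at this
  exact ⟨h1 k hk, this⟩

/-- Sums over fine partitions determine the limit. -/
lemma HasRoughIntegral.unique {Y : ℝ → Vec n →L[ℝ] Vec n} {Y' : ℝ → Vec n →L[ℝ] Vec n →L[ℝ] Vec n}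
    {I I' : Vec n} (h : HasRoughIntegral X Y Y' I) (h' : HasRoughIntegral X Y Y' I') : I = I' := by
  by_contra hne
  have hpos : 0 < ‖I - I'‖ := norm_pos_iff.2 (sub_ne_zero.2 hne)
  obtain ⟨δ, hδ, h1⟩ := h (‖I - I'‖ / 3) (by positivity)
  obtain ⟨δ', hδ', h2⟩ := h' (‖I - I'‖ / 3) (by positivity)
  obtain ⟨m, hm⟩ := exists_nat_ge (2 * Real.pi / min δ δ')
  have hmin : 0 < min δ δ' := lt_min hδ hδ'
  have hm0 : 0 < (m : ℝ) := lt_of_lt_of_le (by positivity) hm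
  have hmesh : 2 * Real.pi / m ≤ min δ δ' := by
    rw [div_le_iff₀ hm0]
    rw [div_le_iff₀ hmin] at hm
    linarith
  have hq : ∀ k : ℕ, 2 * Real.pi / m * ((k + 1 : ℕ) : ℝ) - 2 * Real.pi / m * k = 2 * Real.pi / m := by
    intro k; push_cast; ring
  have hle : 0 ≤ 2 * Real.pi / m := by positivity
  have e1 := h1 m (fun k => 2 * Real.pi / m * k) (by simp) (by field_simp)
    (fun k _ => ⟨by linarith [hq k], by rw [hq k]; exact hmesh.trans (min_le_left _ _)⟩)
  have e2 := h2 m (fun k => 2 * Real.pi / m * k) (by simp) (by field_simp)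
    (fun k _ => ⟨by linarith [hq k], by rw [hq k]; exact hmesh.trans (min_le_right _ _)⟩)
  generalize (∑ k ∈ Finset.range m, _ : Vec n) = S at e1 e2
  have : ‖I - I'‖ ≤ ‖S - I'‖ + ‖S - I‖ := by
    have := norm_sub_le (S - I') (S - I)
    rwa [sub_sub_sub_cancel_left] at this
  linarith

/-- If the increments of `F` are close to the second order expansion of the germ, then the rough
integral against the kernel is given by integration by parts against `F`. -/
theorem hasRoughIntegral_of_increments {α K C p τ : ℝ} (hα : 0 < α) (hα1 : α ≤ 1) (hp : 1 < p)
    (hC : 0 ≤ C) (hτ : 0 < τ) {Y : ℝ → Vec n →L[ℝ] Vec n} {Y' : ℝ → Vec n →L[ℝ] Vec n →L[ℝ] Vec n}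
    {F : ℝ → Vec n} (hF : IsPrimitive α K F)
    (h : ∀ y ∈ box, ∀ z ∈ box, y ≤ z → ‖F z - F y
      - (Y y (X.path z - X.path y) + contract (Y' y) (X.area y z))‖ ≤ C * (z - y) ^ p) (x : ℝ) :
    HasRoughIntegral X (fun y => kernel τ (x - y) • Y y) (fun y => kernel τ (x - y) • Y' y)
      (duhamel τ F x) := by
  have hK := hF.nonneg
  have hd : Continuous (deriv (kernel τ)) := (contDiff_kernel hτ).continuous_deriv le_rfl
  have hc := continuous_kernel hτ
  have hd' : Continuous fun y => deriv (kernel τ) (x - y) := by fun_prop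
  have hc' : Continuous fun y => kernel τ (x - y) := by fun_prop
  obtain ⟨D, hD⟩ := isCompact_Icc.exists_bound_of_continuousOn (s := Icc 0 (2 * Real.pi))
    hd'.continuousOn
  obtain ⟨B, hB⟩ := isCompact_Icc.exists_bound_of_continuousOn (s := Icc 0 (2 * Real.pi))
    hc'.continuousOn
  have hD0 : 0 ≤ D := (norm_nonneg _).trans (hD 0 zero_mem_box)
  have hB0 : 0 ≤ B := (norm_nonneg _).trans (hB 0 zero_mem_box)
  have hFc : ContinuousOn F box := by
    have h1 : ContinuousOn (fun y => perExt (bridge F) y + (y / (2 * Real.pi)) • F (2 * Real.pi))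
        box := by
      have := hF.continuous_perExt hα hα1
      exact Continuous.continuousOn (by fun_prop)
    refine h1.congr fun y hy => ?_
    beta_reduce
    rw [perExt_eq (bridge_zero hF.1) hy]
    unfold bridge
    abel
  have hii : ∀ y ∈ box, ∀ z ∈ box, IntervalIntegrable (fun r => deriv (kernel τ) (x - r) • F r)
      volume y z := fun y hy z hz => ContinuousOn.intervalIntegrable
    ((hd'.continuousOn.smul hFc).mono (by
      intro r hr
      rw [mem_uIcc] at hr
      rcases hr with hr | hr
      · exact ⟨hy.1.trans hr.1, hr.2.trans hz.2⟩
      · exact ⟨hz.1.trans hr.1, hr.2.trans hy.2⟩))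
  -- `Φ` is the indefinite integral of the kernel against `dF`, by parts: its total increment is the
  -- claimed value, and over a short interval it is close to the kernel times the increment of `F`
  set Φ : ℝ → Vec n := fun y => kernel τ (x - y) • F y
    + ∫ z in (0 : ℝ)..y, deriv (kernel τ) (x - z) • F z with hΦ
  have hΦ0 : Φ 0 = 0 := by simp [hΦ, hF.1]
  have hΦ1 : Φ (2 * Real.pi) = duhamel τ F x := kernel_smul_sub_integral hτ hα hα1 hF x
  have hker : ∀ y z, kernel τ (x - z) - kernel τ (x - y)
      = -∫ r in y..z, deriv (kernel τ) (x - r) := by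
    intro y z
    have h2 : ∀ r, HasDerivAt (fun r => kernel τ (x - r)) (-deriv (kernel τ) (x - r)) r := by
      intro r
      have h2 : HasDerivAt (kernel τ) (deriv (kernel τ) (x - r)) (x - r) :=
        ((contDiff_kernel hτ).differentiable one_ne_zero _).hasDerivAt
      exact h2.comp_const_sub x r
    rw [← intervalIntegral.integral_neg]
    exact (intervalIntegral.integral_eq_sub_of_hasDerivAt (fun r _ => h2 r)
      (Continuous.intervalIntegrable (by fun_prop) _ _)).symm
  have hstep : ∀ y ∈ box, ∀ z ∈ box, y ≤ z → ‖Φ z - Φ y - kernel τ (x - y) • (F z - F y)‖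
      ≤ D * (K * (z - y) ^ α) * (z - y) := by
    intro y hy z hz hyz
    have e1 : Φ z - Φ y - kernel τ (x - y) • (F z - F y)
        = ∫ r in y..z, deriv (kernel τ) (x - r) • (F r - F z) := by
      have e2 : ∫ r in y..z, deriv (kernel τ) (x - r) • (F r - F z)
          = (∫ r in y..z, deriv (kernel τ) (x - r) • F r)
            - (∫ r in y..z, deriv (kernel τ) (x - r)) • F z := by
        rw [← intervalIntegral.integral_smul_const, ← intervalIntegral.integral_sub
          (hii y hy z hz) (Continuous.intervalIntegrable (by fun_prop) _ _)]
        simp_rw [smul_sub]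
      have e3 := intervalIntegral.integral_add_adjacent_intervals
        (hii 0 zero_mem_box y hy) (hii y hy z hz)
      have e4 := hker y z
      rw [e2, ← neg_eq_iff_eq_neg.2 e4]
      simp only [hΦ]
      rw [← e3]
      module
    rw [e1, ← abs_of_nonneg (sub_nonneg.2 hyz)]
    rw [abs_of_nonneg (sub_nonneg.2 hyz)]
    have := intervalIntegral.norm_integral_le_of_norm_le_const (a := y) (b := z)
      (f := fun r => deriv (kernel τ) (x - r) • (F r - F z)) (C := D * (K * (z - y) ^ α))
      (fun r hr => ?_)
    · rwa [abs_of_nonneg (sub_nonneg.2 hyz)] at this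
    · rw [uIoc_of_le hyz] at hr
      have hrb : r ∈ box := ⟨hy.1.trans hr.1.le, hr.2.trans hz.2⟩
      rw [norm_smul]
      refine mul_le_mul (hD r hrb) ?_ (norm_nonneg _) hD0
      refine (hF.2 r hrb z hz).trans ?_
      gcongr
      rw [abs_sub_comm, abs_of_nonneg (sub_nonneg.2 hr.2)]
      linarith [hr.1]
  have hcont : Continuous fun δ : ℝ => (D * K * δ ^ α + B * C * δ ^ (p - 1)) * (2 * Real.pi) := by
    have h1 : Continuous fun δ : ℝ => δ ^ α :=
      Continuous.rpow_const (by fun_prop) fun _ => Or.inr hα.le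
    have h2 : Continuous fun δ : ℝ => δ ^ (p - 1) :=
      Continuous.rpow_const (by fun_prop) fun _ => Or.inr (by linarith)
    fun_prop
  intro ε hε
  obtain ⟨δ, hδ, -, hdel⟩ := exists_pos_of_continuous hcont
    (by simp [Real.zero_rpow hα.ne', Real.zero_rpow (show p - 1 ≠ 0 by linarith)]) hε one_pos
  refine ⟨δ, hδ, fun m q h0 hm hq => ?_⟩
  have hbox : ∀ k ≤ m, q k ∈ box := fun k hk =>
    partition_mem_box h0 hm (fun k hk => (hq k hk).1) hk
  have e1 : duhamel τ F x = ∑ k ∈ Finset.range m, (Φ (q (k + 1)) - Φ (q k)) := by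
    rw [Finset.sum_range_sub (fun k => Φ (q k)), h0, hm, hΦ0, hΦ1, sub_zero]
  rw [e1, ← Finset.sum_sub_distrib]
  have e2 : (2 * Real.pi) = ∑ k ∈ Finset.range m, (q (k + 1) - q k) := by
    rw [Finset.sum_range_sub, h0, hm, sub_zero]
  refine le_trans ?_ (hdel δ hδ.le le_rfl)
  rw [e2, Finset.mul_sum]
  refine (norm_sum_le _ _).trans (Finset.sum_le_sum fun k hk => ?_)
  have hk := Finset.mem_range.1 hk
  have hy := hbox k hk.le
  have hz := hbox (k + 1) hk
  obtain ⟨hyz, hr⟩ := hq k hk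
  have s1 := hstep _ hy _ hz hyz
  have s2 := h _ hy _ hz hyz
  generalize q k = y at *
  generalize q (k + 1) = z at *
  have hzy : 0 ≤ z - y := sub_nonneg.2 hyz
  have e3 : (kernel τ (x - y) • Y y) (X.path z - X.path y)
      + contract (kernel τ (x - y) • Y' y) (X.area y z) - (Φ z - Φ y)
      = -(Φ z - Φ y - kernel τ (x - y) • (F z - F y)) - kernel τ (x - y) • (F z - F y
        - (Y y (X.path z - X.path y) + contract (Y' y) (X.area y z))) := by
    rw [contract_smul_left, _root_.smul_apply]
    module
  rw [e3]
  refine (norm_sub_le _ _).trans ?_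
  rw [norm_neg, norm_smul]
  have t1 : (z - y) ^ α ≤ δ ^ α := by gcongr
  have t2 : (z - y) ^ p ≤ δ ^ (p - 1) * (z - y) := by
    rcases hzy.eq_or_lt with h | h
    · rw [← h, Real.zero_rpow (by linarith), mul_zero]
    · calc (z - y) ^ p = (z - y) ^ (p - 1) * (z - y) := by
            rw [← Real.rpow_add_one h.ne']; congr 1; ring
        _ ≤ _ := by gcongr
  calc _ ≤ D * (K * (z - y) ^ α) * (z - y) + B * (C * (z - y) ^ p) :=
        add_le_add s1 (mul_le_mul (hB y hy) s2 (norm_nonneg _) hB0)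
    _ ≤ D * (K * δ ^ α) * (z - y) + B * (C * (δ ^ (p - 1) * (z - y))) := by gcongr
    _ = _ := by ring

/-- The rough integral against the kernel, at a time at which `u - X` is `C¹`. The sewn primitive
also contains the drift, whose primitive is subtracted. -/
theorem hasRoughIntegral_slice {α R c τ : ℝ} (hα3 : 1 / 3 < α) (hα2 : α < 1 / 2) (hR : 1 ≤ R)
    (hc : 0 ≤ c) {f : Vec n → Vec n} {g : Vec n → Vec n →L[ℝ] Vec n} (hf : ContDiff ℝ ∞ f)
    (hg : ContDiff ℝ ∞ g) {ψ v u w : ℝ → Vec n} {A : ℝ → ℝ → Fin n → Fin n → ℝ}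
    (hb : SliceBound α R c ψ A v) (hψ : ∀ x ∈ box, X.path x = ψ x)
    (hA : ∀ x ∈ box, ∀ y ∈ box, X.area x y = A x y) (hu : ∀ x ∈ box, u x = v x + ψ x)
    (hw : ContDiffOn ℝ 1 w box) (hwv : ∀ x ∈ box, w x = v x) (hτ : 0 < τ) (x : ℝ) :
    HasRoughIntegral X (fun y => kernel τ (x - y) • g (u y))
      (fun y => kernel τ (x - y) • fderiv ℝ g (u y))
      (duhamel τ (sew (germ f g ψ A v)) x - semigroup τ (drift f g u w) x) := by
  have hα : 0 < α := by linarith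
  obtain ⟨C, hC, hcb⟩ := exists_coeffBound hf hg R
  have hH := isPrimitive_sew_germ hα3 hα2 hR hc hC hcb hb
  have hG := isGerm_germ hα hα2 hR hc hC hcb hb
  set H := sew (germ f g ψ A v) with hHdef
  set dr := drift f g u w with hdr
  have hunique : UniqueDiffOn ℝ box := uniqueDiffOn_Icc two_pi_pos'
  have hw' : ContinuousOn (derivWithin w box) box := hw.continuousOn_derivWithin hunique le_rfl
  have huc : ContinuousOn u box := by
    have h1 : ContinuousOn (fun x => v x + ψ x) box := by
      intro y hy
      rw [ContinuousWithinAt, tendsto_iff_norm_sub_tendsto_zero]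
      have h2 : Tendsto (fun z => R * |z - y| ^ α) (𝓝[box] y) (𝓝 0) := by
        have h3 : Continuous fun z : ℝ => R * |z - y| ^ α :=
          continuous_const.mul (Continuous.rpow_const (by fun_prop) fun _ => Or.inr hα.le)
        have h4 := h3.tendsto y
        simp only [sub_self, abs_zero, Real.zero_rpow hα.ne', mul_zero] at h4
        exact h4.mono_left nhdsWithin_le_nhds
      refine squeeze_zero' (Eventually.of_forall fun _ => norm_nonneg _) ?_ h2
      filter_upwards [self_mem_nhdsWithin] with z hz
      exact hb.u_hol y hy z hz
    exact h1.congr hu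
  have hdrc : ContinuousOn dr box := by
    have h1 : ContinuousOn (fun x => g (u x)) box := hg.continuous.comp_continuousOn huc
    exact (h1.clm_apply hw').add ((hf.continuous.comp_continuousOn huc).add huc)
  -- a continuous extension of the drift to the line, and its primitive `D`
  set φ : ℝ → Vec n := IccExtend two_pi_pos'.le ((Icc 0 (2 * Real.pi)).domRestrict dr) with hφ
  have hφc : Continuous φ := by
    rw [hφ]
    exact Continuous.Icc_extend' (continuousOn_iff_continuous_domRestrict.1 hdrc)
  have hφe : ∀ y ∈ box, φ y = dr y := by
    intro y hy
    rw [hφ, IccExtend_of_mem _ _ (show y ∈ Icc 0 (2 * Real.pi) from hy)]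
    rfl
  set D : ℝ → Vec n := fun y => ∫ z in (0 : ℝ)..y, φ z with hD
  have hDd : ∀ y, HasDerivAt D (φ y) y := fun y => intervalIntegral.integral_hasDerivAt_right
    (hφc.intervalIntegrable _ _) (hφc.stronglyMeasurableAtFilter _ _) hφc.continuousAt
  obtain ⟨B, hB⟩ := isCompact_Icc.exists_bound_of_continuousOn (s := Icc 0 (2 * Real.pi))
    hφc.continuousOn
  have hB0 : 0 ≤ B := (norm_nonneg _).trans (hB 0 zero_mem_box)
  obtain ⟨W, hW⟩ := isCompact_Icc.exists_bound_of_continuousOn (s := Icc 0 (2 * Real.pi)) hw'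
  have hW0 : 0 ≤ W := (norm_nonneg _).trans (hW 0 zero_mem_box)
  have hDp : IsPrimitive α (7 * B) D := by
    refine ⟨by simp [hD], fun y hy z hz => ?_⟩
    have h1 : ‖D y - D z‖ ≤ B * |y - z| := by
      have := (convex_Icc 0 (2 * Real.pi)).norm_image_sub_le_of_norm_hasDerivWithin_le
        (f := D) (f' := φ) (fun r _ => (hDd r).hasDerivWithinAt) hB hz hy
      simpa using this
    have h2 := rpow_exponent_le (γ := α) (δ := 1) (by linarith) (by linarith) (abs_nonneg (y - z))
      (abs_sub_le_of_mem_box hy hz) one_pos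
    rw [Real.rpow_one] at h2
    calc _ ≤ B * |y - z| := h1
      _ ≤ B * (7 * |y - z| ^ α) := by gcongr
      _ = _ := by ring
  have hF : IsPrimitive α (3 * R * primConst n α C R * (1 + c) + 7 * B) (fun y => H y - D y) := by
    refine ⟨by beta_reduce; rw [hH.1, hDp.1, sub_zero], fun y hy z hz => ?_⟩
    rw [sub_sub_sub_comm, add_mul]
    exact (norm_sub_le _ _).trans (add_le_add (hH.2 y hy z hz) (hDp.2 y hy z hz))
  have hsg : duhamel τ D x = semigroup τ dr x := by
    rw [← kernel_smul_sub_integral hτ hα (by linarith) hDp x]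
    have hk : ∀ r, HasDerivAt (fun r => kernel τ (x - r)) (-deriv (kernel τ) (x - r)) r := by
      intro r
      have h2 : HasDerivAt (kernel τ) (deriv (kernel τ) (x - r)) (x - r) :=
        ((contDiff_kernel hτ).differentiable one_ne_zero _).hasDerivAt
      exact h2.comp_const_sub x r
    have hd : Continuous (deriv (kernel τ)) := (contDiff_kernel hτ).continuous_deriv le_rfl
    have hkc := continuous_kernel hτ
    have hDc : Continuous D := continuous_iff_continuousAt.2 fun y => (hDd y).continuousAt
    have h1 := intervalIntegral.integral_eq_sub_of_hasDerivAt (a := 0) (b := 2 * Real.pi)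
      (f := fun y => kernel τ (x - y) • D y) (fun y _ => (hk y).smul (hDd y))
      (Continuous.intervalIntegrable (by fun_prop) _ _)
    rw [hDp.1, smul_zero, sub_zero] at h1
    rw [← h1, ← intervalIntegral.integral_add (Continuous.intervalIntegrable (by fun_prop) _ _)
      (Continuous.intervalIntegrable (by fun_prop) _ _)]
    unfold semigroup
    refine intervalIntegral.integral_congr fun y hy => ?_
    rw [uIcc_of_le two_pi_pos'.le] at hy
    rw [hφe y hy]
    module
  rw [← hsg, ← duhamel_sub hH hDp hα (by linarith)]
  set K := germConst n C R * ((1 + c) * R + c)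
  have hS := sewConst_pos (p := 3 * α) (by linarith)
  have hK : 0 ≤ K := hG.nonneg
  have hfin : ∀ y ∈ box, ∀ z ∈ box, y ≤ z → ‖(H z - D z) - (H y - D y)
      - (g (u y) (X.path z - X.path y) + contract (fderiv ℝ g (u y)) (X.area y z))‖
      ≤ (sewConst (3 * α) * K + 7 * (C * R * (W + 1))) * (z - y) ^ ((1 + 3 * α) / 2) := by
    intro y hy z hz hyz
    have s1 := norm_sew_sub_le hG (by linarith) hy.1 hyz hz.2
    -- `Θ` compares the drift part of the germ, frozen at `y`, with `D`; its derivative is small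
    -- because `u` is Hölder
    set Θ : ℝ → Vec n := fun r => D r - g (u y) (w r) - r • (f (u y) + u y) with hΘ
    have hΘd : ∀ r ∈ Icc y z, HasDerivWithinAt Θ
        (φ r - g (u y) (derivWithin w box r) - (1 : ℝ) • (f (u y) + u y)) (Icc y z) r := by
      intro r hr
      have hrb : r ∈ box := ⟨hy.1.trans hr.1, hr.2.trans hz.2⟩
      have hsub : Icc y z ⊆ box := Icc_subset_Icc hy.1 hz.2
      have d1 : HasDerivWithinAt w (derivWithin w box r) (Icc y z) r :=
        ((hw.differentiableOn one_ne_zero r hrb).hasDerivWithinAt).mono hsub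
      exact ((hDd r).hasDerivWithinAt.sub ((g (u y)).hasFDerivAt.comp_hasDerivWithinAt r d1)).sub
        ((hasDerivWithinAt_id r _).smul_const _)
    have hΘb : ∀ r ∈ Ico y z, ‖φ r - g (u y) (derivWithin w box r)
        - (1 : ℝ) • (f (u y) + u y)‖ ≤ C * R * (W + 1) * (z - y) ^ α := by
      intro r hr
      have hrb : r ∈ box := ⟨hy.1.trans hr.1, hr.2.le.trans hz.2⟩
      have e1 : φ r - g (u y) (derivWithin w box r) - (1 : ℝ) • (f (u y) + u y)
          = (g (u r) - g (u y)) (derivWithin w box r) + ((f (u r) + u r) - (f (u y) + u y)) := by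
        rw [hφe r hrb, hdr, drift, _root_.sub_apply]
        module
      have hu1 : ‖u r‖ ≤ R := by rw [hu r hrb]; exact hb.u_le r hrb
      have hu2 : ‖u y‖ ≤ R := by rw [hu y hy]; exact hb.u_le y hy
      have hur : ‖u r - u y‖ ≤ R * (z - y) ^ α := by
        rw [hu r hrb, hu y hy]
        refine (hb.u_hol y hy r hrb).trans ?_
        have : 0 ≤ R := by linarith
        gcongr
        rw [abs_of_nonneg (sub_nonneg.2 hr.1)]
        linarith [hr.2]
      have q1 := hcb.bound_g.lipschitz hu2 hu1
      have q2 := hcb.bound_f.lipschitz hu2 hu1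
      have hC0 : 0 ≤ C := by linarith
      have q1' := q1.trans (mul_le_mul_of_nonneg_left hur hC0)
      have q2' := q2.trans (mul_le_mul_of_nonneg_left hur hC0)
      rw [e1]
      refine (norm_add_le _ _).trans ?_
      have q3 : ‖(g (u r) - g (u y)) (derivWithin w box r)‖ ≤ C * (R * (z - y) ^ α) * W :=
        ((g (u r) - g (u y)).le_opNorm _).trans
          (mul_le_mul q1' (hW r hrb) (norm_nonneg _) ((norm_nonneg _).trans q1'))
      linarith
    have s2 := norm_image_sub_le_of_norm_deriv_le_segment' hΘd hΘb z ⟨hyz, le_rfl⟩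
    have s3 : (z - y) ^ α * (z - y) ≤ 7 * (z - y) ^ ((1 + 3 * α) / 2) := by
      have hzy : 0 ≤ z - y := sub_nonneg.2 hyz
      have := rpow_exponent_le (γ := (1 + 3 * α) / 2) (δ := α + 1) (by linarith) (by linarith) hzy
        (by linarith [hy.1, hz.2]) (by linarith)
      rwa [Real.rpow_add_one' hzy (by linarith)] at this
    have e1 : (H z - D z) - (H y - D y)
        - (g (u y) (X.path z - X.path y) + contract (fderiv ℝ g (u y)) (X.area y z))
        = (H z - H y - germ f g ψ A v y z) - (Θ z - Θ y) := by
      simp only [hΘ, germ]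
      rw [← hu y hy, ← hu z hz, hψ z hz, hψ y hy, hA y hy z hz, hwv z hz, hwv y hy]
      have : u z - u y = (v z - v y) + (ψ z - ψ y) := by
        rw [hu y hy, hu z hz]; abel
      rw [this]
      simp only [map_add, map_sub, hu y hy]
      module
    rw [e1, add_mul]
    refine (norm_sub_le _ _).trans (add_le_add s1 (s2.trans ?_))
    have : 0 ≤ C * R * (W + 1) := by positivity
    calc _ = C * R * (W + 1) * ((z - y) ^ α * (z - y)) := by ring
      _ ≤ C * R * (W + 1) * (7 * (z - y) ^ ((1 + 3 * α) / 2)) := by gcongr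
      _ = _ := by ring
  exact hasRoughIntegral_of_increments hα (by linarith) (by linarith) (by positivity) hτ hF hfin x

end RoughIntegral

/-! ### Hölder norms and driving noises -/

section Norms

variable {F : Type*} [NormedAddCommGroup F] {γ : ℝ≥0} {h : ℝ → F} {D D' : ℝ}

lemma norm_le_of_supNorm_le (hD : 0 ≤ D) (hh : supNorm h ≤ ENNReal.ofReal D) {x : ℝ}
    (hx : x ∈ box) : ‖h x‖ ≤ D := by
  have h1 : ‖h x‖ₑ ≤ ENNReal.ofReal D := (le_iSup₂_of_le x hx le_rfl).trans hh
  rwa [← ofReal_norm, ENNReal.ofReal_le_ofReal_iff hD] at h1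

lemma supNorm_le (hh : ∀ x ∈ box, ‖h x‖ ≤ D) : supNorm h ≤ ENNReal.ofReal D := by
  refine iSup₂_le fun x hx => ?_
  rw [← ofReal_norm]
  exact ENNReal.ofReal_le_ofReal (hh x hx)

lemma norm_le_of_holderNorm_le (hD : 0 ≤ D) (hh : holderNorm γ h ≤ ENNReal.ofReal D) :
    (∀ x ∈ box, ‖h x‖ ≤ D) ∧ ∀ x ∈ box, ∀ y ∈ box, ‖h x - h y‖ ≤ D * |x - y| ^ (γ : ℝ) := by
  refine ⟨fun x hx => norm_le_of_supNorm_le hD (le_add_self.trans hh) hx, fun x hx y hy => ?_⟩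
  have h1 : eHolderNorm γ (box.domRestrict h) ≤ ENNReal.ofReal D := le_self_add.trans hh
  have h2 : MemHolder γ (box.domRestrict h) :=
    eHolderNorm_lt_top.1 (h1.trans_lt ENNReal.ofReal_lt_top)
  have h3 := h2.holderWith.dist_le ⟨x, hx⟩ ⟨y, hy⟩
  have h4 : (nnHolderNorm γ (box.domRestrict h) : ℝ) ≤ D := by
    rw [← h2.coe_nnHolderNorm_eq_eHolderNorm] at h1
    exact (NNReal.coe_le_coe.2 (ENNReal.coe_le_coe.1 h1)).trans (Real.coe_toNNReal D hD).le
  rw [dist_eq_norm] at h3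
  refine h3.trans ?_
  rw [Subtype.dist_eq, Real.dist_eq]
  gcongr

lemma holderNorm_le (hD : 0 ≤ D) (hh : ∀ x ∈ box, ‖h x‖ ≤ D')
    (hol : ∀ x ∈ box, ∀ y ∈ box, ‖h x - h y‖ ≤ D * |x - y| ^ (γ : ℝ)) :
    holderNorm γ h ≤ ENNReal.ofReal (D + D') := by
  have hD' : 0 ≤ D' := (norm_nonneg _).trans (hh 0 zero_mem_box)
  rw [ENNReal.ofReal_add hD hD']
  refine add_le_add ?_ (supNorm_le hh)
  have h1 : HolderWith D.toNNReal γ (box.domRestrict h) := by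
    rintro ⟨x, hx⟩ ⟨y, hy⟩
    have := hol x hx y hy
    change edist (h x) (h y) ≤ ENNReal.ofReal D * edist x y ^ (γ : ℝ)
    rw [edist_dist, edist_dist, dist_eq_norm, Real.dist_eq,
      ENNReal.ofReal_rpow_of_nonneg (abs_nonneg _) γ.coe_nonneg, ← ENNReal.ofReal_mul hD]
    exact ENNReal.ofReal_le_ofReal this
  exact h1.eHolderNorm_le

lemma norm_le_of_twoParamNorm_le {A : ℝ → ℝ → F} (hD : 0 ≤ D)
    (hA : twoParamNorm γ A ≤ ENNReal.ofReal D) (h0 : ∀ x ∈ box, A x x = 0) {x y : ℝ}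
    (hx : x ∈ box) (hy : y ∈ box) : ‖A x y‖ ≤ D * |y - x| ^ (γ : ℝ) := by
  rcases eq_or_ne x y with rfl | hxy
  · rw [h0 x hx, norm_zero]; positivity
  have h1 : ‖A x y‖ₑ / ENNReal.ofReal (|y - x| ^ (γ : ℝ)) ≤ ENNReal.ofReal D :=
    (le_iSup₂_of_le x hx (le_iSup₂_of_le y hy (le_iSup
      (fun _ : x ≠ y => ‖A x y‖ₑ / ENNReal.ofReal (|y - x| ^ (γ : ℝ))) hxy))).trans hA
  have hpos : 0 < |y - x| ^ (γ : ℝ) := Real.rpow_pos_of_pos (abs_pos.2 (sub_ne_zero.2 hxy.symm)) _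
  rw [ENNReal.div_le_iff (by simpa using hpos) ENNReal.ofReal_ne_top, ← ENNReal.ofReal_mul hD,
    ← ofReal_norm, ENNReal.ofReal_le_ofReal_iff (by positivity)] at h1
  exact h1

end Norms

section Driver

variable {n : ℕ} {α β : ℝ≥0} {Ψ Ψ' : ℝ → RoughPath n α}

/-- Projection of the line to `[0, 2π]`. -/
noncomputable def clamp (x : ℝ) : ℝ := projIcc 0 (2 * Real.pi) two_pi_pos'.le x

lemma clamp_mem_box (x : ℝ) : clamp x ∈ box := (projIcc 0 (2 * Real.pi) two_pi_pos'.le x).2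

lemma clamp_of_mem {x : ℝ} (hx : x ∈ box) : clamp x = x := by
  unfold clamp
  rw [projIcc_of_mem _ (show x ∈ Icc 0 (2 * Real.pi) from hx)]

lemma continuous_clamp : Continuous clamp := continuous_subtype_val.comp continuous_projIcc

/-- The noise given by a driving path, extended in a constant way outside its domain. -/
noncomputable def noiseOf (Ψ : ℝ → RoughPath n α) : Noise n :=
  ⟨fun s x => (Ψ (max s 0)).path (clamp x), fun s x y => (Ψ (max s 0)).area (clamp x) (clamp y)⟩

lemma noiseOf_path {s x : ℝ} (hs : 0 ≤ s) (hx : x ∈ box) : (noiseOf Ψ).path s x = (Ψ s).path x := by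
  simp [noiseOf, max_eq_left hs, clamp_of_mem hx]

lemma noiseOf_area {s x y : ℝ} (hs : 0 ≤ s) (hx : x ∈ box) (hy : y ∈ box) :
    (noiseOf Ψ).area s x y = (Ψ s).area x y := by
  simp [noiseOf, max_eq_left hs, clamp_of_mem hx, clamp_of_mem hy]

/-- Functions that are continuous in `y` and continuous in `s` uniformly in `y`. -/
lemma continuous_uncurry_of_uniform {Y F : Type*} [TopologicalSpace Y] [NormedAddCommGroup F]
    {G : ℝ → Y → F} (h1 : ∀ s, Continuous (G s))
    (h2 : ∀ s₀, ∀ ε > 0, ∀ᶠ s in 𝓝 s₀, ∀ y, ‖G s y - G s₀ y‖ ≤ ε) :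
    Continuous fun p : ℝ × Y => G p.1 p.2 := by
  refine continuous_iff_continuousAt.2 fun p => ?_
  rw [ContinuousAt, Metric.tendsto_nhds]
  intro ε hε
  have e1 : ∀ᶠ q : ℝ × Y in 𝓝 p, ‖G q.1 q.2 - G p.1 q.2‖ ≤ ε / 2 := by
    have := (continuous_fst.tendsto p).eventually (h2 p.1 (ε / 2) (by positivity))
    exact this.mono fun q hq => hq q.2
  have e2 : ∀ᶠ q : ℝ × Y in 𝓝 p, dist (G p.1 q.2) (G p.1 p.2) < ε / 2 :=
    Metric.tendsto_nhds.1 (((h1 p.1).comp continuous_snd).tendsto p) (ε / 2) (by positivity)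
  filter_upwards [e1, e2] with q h1 h2
  rw [← dist_eq_norm] at h1
  linarith [dist_triangle (G q.1 q.2) (G p.1 q.2) (G p.1 p.2)]

lemma RoughPath.continuousOn_path (hα : 0 < α) (X : RoughPath n α) : ContinuousOn X.path box := by
  have h0 := X.path_holder.ne
  have h1 := norm_le_of_holderNorm_le ENNReal.toReal_nonneg (ENNReal.ofReal_toReal h0).ge
  intro y hy
  rw [ContinuousWithinAt, tendsto_iff_norm_sub_tendsto_zero]
  have h2 : Tendsto (fun z => (holderNorm α X.path).toReal * |z - y| ^ (α : ℝ)) (𝓝[box] y) (𝓝 0) := by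
    have h3 : Continuous fun z : ℝ => (holderNorm α X.path).toReal * |z - y| ^ (α : ℝ) :=
      continuous_const.mul (Continuous.rpow_const (by fun_prop) fun _ => Or.inr α.2)
    have h4 := h3.tendsto y
    simp only [sub_self, abs_zero, Real.zero_rpow (show (α : ℝ) ≠ 0 from ne_of_gt hα), mul_zero] at h4
    exact h4.mono_left nhdsWithin_le_nhds
  refine squeeze_zero' (Eventually.of_forall fun _ => norm_nonneg _) ?_ h2
  filter_upwards [self_mem_nhdsWithin] with z hz
  exact h1.2 z hz y hy

lemma tendsto_max_zero (s₀ : ℝ) : Tendsto (fun s : ℝ => max s 0) (𝓝 s₀) (𝓝[Ici 0] (max s₀ 0)) :=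
  tendsto_nhdsWithin_iff.2 ⟨(by fun_prop : Continuous fun s : ℝ => max s 0).tendsto _,
    Eventually.of_forall fun s => mem_Ici.2 (le_max_right _ _)⟩

lemma IsDriver.eventually_path (hΨ : IsDriver β Ψ) {t₀ ε : ℝ} (ht : 0 ≤ t₀) (hε : 0 < ε) :
    ∀ᶠ t in 𝓝[Ici 0] t₀, holderNorm β ((Ψ t).path - (Ψ t₀).path) ≤ ENNReal.ofReal ε :=
  ((hΨ.continuous_holder t₀ ht).eventually_le_const (by simpa using hε))

lemma IsDriver.eventually_area (hΨ : IsDriver β Ψ) {t₀ ε : ℝ} (ht : 0 ≤ t₀) (hε : 0 < ε) :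
    ∀ᶠ t in 𝓝[Ici 0] t₀, ∀ x ∈ box, ∀ y ∈ box,
      ‖(Ψ t).area x y - (Ψ t₀).area x y‖ ≤ ε * |y - x| ^ (2 * (α : ℝ)) := by
  have := (hΨ.continuous_rough t₀ ht).eventually_le_const
    (show (0 : ℝ≥0∞) < ENNReal.ofReal ε by simpa using hε)
  filter_upwards [this] with t h1 x hx y hy
  have h2 : twoParamNorm (2 * α) ((Ψ t).area - (Ψ t₀).area) ≤ ENNReal.ofReal ε :=
    le_add_self.trans h1
  have h3 := norm_le_of_twoParamNorm_le hε.le h2 (fun x hx => by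
    simp [(Ψ t).area_self x hx, (Ψ t₀).area_self x hx]) hx hy
  simpa using h3

lemma noiseOf_regular (hα : 0 < α) (hΨ : IsDriver β Ψ) : (noiseOf Ψ).Regular where
  meas_path := by
    refine (continuous_uncurry_of_uniform (fun s => ?_) fun s₀ ε hε => ?_).measurable
    · exact ((Ψ (max s 0)).continuousOn_path hα).comp_continuous continuous_clamp clamp_mem_box
    · filter_upwards [(tendsto_max_zero s₀).eventually
        (hΨ.eventually_path (le_max_right s₀ 0) hε)] with s hs x
      exact (norm_le_of_holderNorm_le hε.le hs).1 _ (clamp_mem_box x)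
  meas_area := by
    refine (continuous_uncurry_of_uniform (Y := ℝ × ℝ) (G := fun s p => (noiseOf Ψ).area s p.1 p.2)
      (fun s => ?_) fun s₀ ε hε => ?_).measurable
    · exact (Ψ (max s 0)).area_continuous.comp_continuous
        (f := fun p : ℝ × ℝ => (clamp p.1, clamp p.2))
        (by have := continuous_clamp; fun_prop) fun p => ⟨clamp_mem_box _, clamp_mem_box _⟩
    · have hc : 0 < (2 * Real.pi) ^ (2 * (α : ℝ)) := Real.rpow_pos_of_pos two_pi_pos' _
      filter_upwards [(tendsto_max_zero s₀).eventually
        (hΨ.eventually_area (le_max_right s₀ 0) (div_pos hε hc))] with s hs p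
      refine (hs _ (clamp_mem_box p.1) _ (clamp_mem_box p.2)).trans ?_
      rw [div_mul_eq_mul_div, div_le_iff₀ hc]
      gcongr
      exact abs_sub_le_of_mem_box (clamp_mem_box _) (clamp_mem_box _)
  chen s x hx y hy z hz i j := by
    simp only [noiseOf, clamp_of_mem hx, clamp_of_mem hy, clamp_of_mem hz]
    exact (Ψ (max s 0)).chen x hx y hy z hz i j

lemma noiseOf_diffBound {T D : ℝ} (hD : 0 ≤ D)
    (h1 : ∀ t ∈ Icc 0 T, holderNorm β ((Ψ t).path - (Ψ' t).path) ≤ ENNReal.ofReal D)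
    (h2 : ∀ t ∈ Icc 0 T, twoParamNorm (2 * α) ((Ψ t).area - (Ψ' t).area) ≤ ENNReal.ofReal D) :
    (noiseOf Ψ).DiffBound α β T D (noiseOf Ψ') where
  sup s hs x hx := by
    rw [noiseOf_path hs.1 hx, noiseOf_path hs.1 hx]
    exact (norm_le_of_holderNorm_le hD (h1 s hs)).1 x hx
  hol s hs x hx y hy := by
    rw [noiseOf_path hs.1 hx, noiseOf_path hs.1 hx, noiseOf_path hs.1 hy, noiseOf_path hs.1 hy]
    have := (norm_le_of_holderNorm_le hD (h1 s hs)).2 y hy x hx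
    rwa [Pi.sub_apply, Pi.sub_apply, sub_sub_sub_comm] at this
  area s hs x hx y hy := by
    rw [noiseOf_area hs.1 hx hy, noiseOf_area hs.1 hx hy]
    have := norm_le_of_twoParamNorm_le hD (h2 s hs) (fun x hx => by
      simp [(Ψ s).area_self x hx, (Ψ' s).area_self x hx]) hx hy
    simpa using this

lemma Noise.DiffBound.trans {T D D' : ℝ} {a b : ℝ} {N₁ N₂ N₃ : Noise n}
    (h : N₁.DiffBound a b T D N₂) (h' : N₂.DiffBound a b T D' N₃) :
    N₁.DiffBound a b T (D + D') N₃ where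
  sup s hs x hx := by
    have := norm_add_le _ _ |>.trans (add_le_add (h.sup s hs x hx) (h'.sup s hs x hx))
    rwa [sub_add_sub_cancel] at this
  hol s hs x hx y hy := by
    have := norm_add_le _ _ |>.trans (add_le_add (h.hol s hs x hx y hy) (h'.hol s hs x hx y hy))
    rwa [sub_add_sub_cancel, ← add_mul] at this
  area s hs x hx y hy := by
    have := norm_add_le _ _ |>.trans (add_le_add (h.area s hs x hx y hy) (h'.area s hs x hx y hy))
    rwa [sub_add_sub_cancel, ← add_mul] at this

lemma Noise.DiffBound.symm {T D : ℝ} {a b : ℝ} {N₁ N₂ : Noise n}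
    (h : N₁.DiffBound a b T D N₂) : N₂.DiffBound a b T D N₁ where
  sup s hs x hx := by rw [norm_sub_rev]; exact h.sup s hs x hx
  hol s hs x hx y hy := by rw [norm_sub_rev]; exact h.hol s hs x hx y hy
  area s hs x hx y hy := by rw [norm_sub_rev]; exact h.area s hs x hx y hy

lemma Noise.DiffBound.mono {T D D' : ℝ} {a b : ℝ} {N₁ N₂ : Noise n}
    (h : N₁.DiffBound a b T D N₂) (hD : D ≤ D') : N₁.DiffBound a b T D' N₂ where
  sup s hs x hx := (h.sup s hs x hx).trans hD
  hol s hs x hx y hy := (h.hol s hs x hx y hy).trans (by gcongr)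
  area s hs x hx y hy := (h.area s hs x hx y hy).trans (by gcongr)

/-- On bounded time intervals the noise is bounded, by compactness. -/
lemma IsDriver.exists_boundedBy (hΨ : IsDriver β Ψ) (T : ℝ) :
    ∃ R, 0 ≤ R ∧ (noiseOf Ψ).BoundedBy α β T R := by
  have key : ∃ R, 0 ≤ R ∧ ∀ t ∈ Icc 0 T,
      (∀ x ∈ box, ‖(Ψ t).path x‖ ≤ R) ∧
      (∀ x ∈ box, ∀ y ∈ box, ‖(Ψ t).path y - (Ψ t).path x‖ ≤ R * |y - x| ^ (β : ℝ)) ∧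
      (∀ x ∈ box, ∀ y ∈ box, ‖(Ψ t).area x y‖ ≤ R * |y - x| ^ (2 * (α : ℝ))) := by
    refine isCompact_Icc.induction_on (p := fun S => ∃ R, 0 ≤ R ∧ ∀ t ∈ S,
      (∀ x ∈ box, ‖(Ψ t).path x‖ ≤ R) ∧
      (∀ x ∈ box, ∀ y ∈ box, ‖(Ψ t).path y - (Ψ t).path x‖ ≤ R * |y - x| ^ (β : ℝ)) ∧
      (∀ x ∈ box, ∀ y ∈ box, ‖(Ψ t).area x y‖ ≤ R * |y - x| ^ (2 * (α : ℝ)))) ?_ ?_ ?_ ?_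
    · exact ⟨0, le_rfl, by simp⟩
    · rintro S S' hS ⟨R, hR, h⟩
      exact ⟨R, hR, fun t ht => h t (hS ht)⟩
    · rintro S S' ⟨R, hR, h⟩ ⟨R', hR', h'⟩
      refine ⟨max R R', le_max_of_le_left hR, fun t ht => ?_⟩
      rcases ht with ht | ht
      · obtain ⟨a1, a2, a3⟩ := h t ht
        have := le_max_left R R'
        exact ⟨fun x hx => (a1 x hx).trans this,
          fun x hx y hy => (a2 x hx y hy).trans (by gcongr),
          fun x hx y hy => (a3 x hx y hy).trans (by gcongr)⟩
      · obtain ⟨a1, a2, a3⟩ := h' t ht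
        have := le_max_right R R'
        exact ⟨fun x hx => (a1 x hx).trans this,
          fun x hx y hy => (a2 x hx y hy).trans (by gcongr),
          fun x hx y hy => (a3 x hx y hy).trans (by gcongr)⟩
    · intro t₀ ht₀
      have e1 := hΨ.eventually_path ht₀.1 one_pos
      have e2 := hΨ.eventually_area ht₀.1 one_pos
      have b1 := norm_le_of_holderNorm_le ENNReal.toReal_nonneg
        (ENNReal.ofReal_toReal (hΨ.holder t₀ ht₀.1).ne).ge
      have b2 : ∀ x ∈ box, ∀ y ∈ box, _ := fun x hx y hy =>
        norm_le_of_twoParamNorm_le ENNReal.toReal_nonneg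
        (ENNReal.ofReal_toReal (Ψ t₀).area_holder.ne).ge (Ψ t₀).area_self hx hy
      set r1 := (holderNorm β (Ψ t₀).path).toReal
      set r2 := (twoParamNorm (2 * α) (Ψ t₀).area).toReal
      have hr1 : 0 ≤ r1 := ENNReal.toReal_nonneg
      have hr2 : 0 ≤ r2 := ENNReal.toReal_nonneg
      refine ⟨_, nhdsWithin_mono t₀ Icc_subset_Ici_self (e1.and e2),
        1 + r1 + r2, by positivity, fun t ht => ?_⟩
      obtain ⟨c1, c2⟩ := ht
      have c1 := norm_le_of_holderNorm_le zero_le_one c1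
      refine ⟨fun x hx => ?_, fun x hx y hy => ?_, fun x hx y hy => ?_⟩
      · have := norm_add_le _ _ |>.trans (add_le_add (c1.1 x hx) (b1.1 x hx))
        rw [Pi.sub_apply, sub_add_cancel] at this
        linarith
      · have := norm_add_le _ _ |>.trans (add_le_add (c1.2 y hy x hx) (b1.2 y hy x hx))
        rw [Pi.sub_apply, Pi.sub_apply, sub_sub_sub_comm, sub_add_cancel, ← add_mul] at this
        exact this.trans (mul_le_mul_of_nonneg_right (by linarith) (by positivity))
      · have := norm_add_le _ _ |>.trans (add_le_add (c2 x hx y hy) (b2 x hx y hy))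
        rw [sub_add_cancel] at this
        refine this.trans ?_
        push_cast
        rw [← add_mul]
        exact mul_le_mul_of_nonneg_right (by linarith) (by positivity)
  obtain ⟨R, hR, h⟩ := key
  refine ⟨R, hR, ⟨fun s hs x hx => ?_, fun s hs x hx y hy => ?_, fun s hs x hx y hy => ?_⟩⟩
  · rw [noiseOf_path hs.1 hx]
    simpa [Noise.zero] using (h s hs).1 x hx
  · rw [noiseOf_path hs.1 hx, noiseOf_path hs.1 hy]
    simpa [Noise.zero] using (h s hs).2.1 x hx y hy
  · rw [noiseOf_area hs.1 hx hy]
    simpa [Noise.zero] using (h s hs).2.2 x hx y hy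

/-- Periodic Hölder functions on `[0, 2π]` extend to the line. -/
lemma isDatum_perExt {M : ℝ} {h : ℝ → Vec n} (hp : h 0 = h (2 * Real.pi))
    (hs : ∀ x ∈ box, ‖h x‖ ≤ M)
    (hol : ∀ x ∈ box, ∀ y ∈ box, ‖h x - h y‖ ≤ M * |x - y| ^ (β : ℝ)) :
    IsDatum β (2 * M) (perExt h) where
  periodic := perExt_periodic h
  sup x := by
    have := norm_perExt_le hs x
    linarith [norm_nonneg (perExt h x)]
  hol := perExt_holder hp ((norm_nonneg _).trans (hs 0 zero_mem_box)) β.2 hol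

end Driver

/-! ### A singular Gronwall inequality -/

section SingularGronwall

lemma exists_lintegral_beta_le {e θ : ℝ} (he : 0 ≤ e) (he1 : e < 1) (hθ : 0 ≤ θ) (hθ1 : θ < 1) :
    ∃ B, 0 ≤ B ∧ ∀ k t, 0 ≤ k → 0 < t → ∫⁻ s in Ioo 0 t,
      ENNReal.ofReal (k * ((t - s) ^ (-e) * s ^ (-θ))) ≤ ENNReal.ofReal (k * B * t ^ (1 - e - θ)) := by
  refine ⟨2 / (1 - θ) + 2 / (1 - e), by
    have : 0 < 1 - e := by linarith
    have : 0 < 1 - θ := by linarith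
    positivity, fun k t hk ht => ?_⟩
  have h1 := intervalIntegrable_beta he he1 hθ hθ1 ht
  have h2 := integral_beta_le he he1 hθ hθ1 ht
  rw [intervalIntegrable_iff_integrableOn_Ioo_of_le ht.le] at h1
  rw [← ofReal_integral_eq_lintegral_ofReal (h1.const_mul k)]
  · apply ENNReal.ofReal_le_ofReal
    rw [integral_const_mul, mul_assoc, ← integral_Ioc_eq_integral_Ioo,
      ← intervalIntegral.integral_of_le ht.le]
    exact mul_le_mul_of_nonneg_left h2 hk
  · rw [EventuallyLE, ae_restrict_iff' measurableSet_Ioo]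
    refine ae_of_all _ fun s hs => ?_
    have : 0 < t - s := sub_pos.2 hs.2
    have := hs.1
    simp only [Pi.zero_apply]
    positivity

lemma lintegral_Ioo_sub (F : ℝ → ℝ≥0∞) (r t : ℝ) :
    ∫⁻ s in Ioo r t, F (s - r) = ∫⁻ s in Ioo 0 (t - r), F s := by
  rw [← lintegral_indicator measurableSet_Ioo, ← lintegral_indicator measurableSet_Ioo,
    ← lintegral_sub_right_eq_self ((Ioo 0 (t - r)).indicator F) r]
  congr 1
  funext s
  by_cases h : s ∈ Ioo r t
  · rw [indicator_of_mem h, indicator_of_mem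
      (show s - r ∈ Ioo 0 (t - r) from ⟨sub_pos.2 h.1, by linarith [h.2]⟩)]
  · rw [indicator_of_notMem h, indicator_of_notMem fun h' => h ⟨sub_pos.1 h'.1, by linarith [h'.2]⟩]

/-- One iteration of a singular integral inequality: the exponent of the kernel improves by `1 - q`.
The first inequality is inserted into the second one, the order of integration is exchanged, and the
inner integral is a Beta integral. The extended non-negative reals make this legitimate without
knowing that the integrals are finite. -/
lemma singular_step {p p' q θ T c c' : ℝ} (hp : 0 ≤ p) (hp1 : p < 1) (hq : 0 ≤ q) (hq1 : q < 1)
    (hθ : 0 ≤ θ) (hθ1 : θ < 1) (hc : 0 ≤ c) (hc' : 0 ≤ c') (hp' : p + q - 1 ≤ p')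
    (hp'1 : p' ≤ p + q) {a : ℝ → ℝ≥0∞} (ha : Measurable a)
    (h : ∀ t, 0 < t → t ≤ T → a t ≤ ENNReal.ofReal (c * t ^ (-θ))
      + ∫⁻ s in Ioo 0 t, ENNReal.ofReal (c * (t - s) ^ (-q)) * a s)
    (h' : ∀ t, 0 < t → t ≤ T → a t ≤ ENNReal.ofReal (c' * t ^ (-θ))
      + ∫⁻ s in Ioo 0 t, ENNReal.ofReal (c' * (t - s) ^ (-p)) * a s) :
    ∃ C, 0 ≤ C ∧ ∀ t, 0 < t → t ≤ T → a t ≤ ENNReal.ofReal (C * t ^ (-θ))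
      + ∫⁻ s in Ioo 0 t, ENNReal.ofReal (C * (t - s) ^ (-p')) * a s := by
  obtain ⟨B, hB, hbeta⟩ := exists_lintegral_beta_le hp hp1 hθ hθ1
  obtain ⟨B', hB', hbeta'⟩ := exists_lintegral_beta_le hp hp1 hq hq1
  rcases le_or_gt T 0 with hT | hT
  · exact ⟨0, le_rfl, fun t h1 h2 => by linarith⟩
  set k := c' * c with hk
  have hk0 : 0 ≤ k := by positivity
  refine ⟨c' + k * B * (1 + T) + k * B' * (1 + T), by positivity, fun t ht htT => ?_⟩
  have e1 : ∫⁻ s in Ioo 0 t, ENNReal.ofReal (c' * (t - s) ^ (-p)) * a s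
      ≤ (∫⁻ s in Ioo 0 t, ENNReal.ofReal (k * ((t - s) ^ (-p) * s ^ (-θ))))
        + ∫⁻ s in Ioo 0 t, ∫⁻ r in Ioo 0 s,
          ENNReal.ofReal (k * ((t - s) ^ (-p) * (s - r) ^ (-q))) * a r := by
    rw [← lintegral_add_left (by fun_prop)]
    refine setLIntegral_mono' measurableSet_Ioo fun s hs => ?_
    have hts : 0 < t - s := sub_pos.2 hs.2
    have hs0 := hs.1
    refine (mul_le_mul_right (h s hs.1 (hs.2.le.trans htT)) _).trans (le_of_eq ?_)
    rw [mul_add, ← ENNReal.ofReal_mul (by positivity), ← lintegral_const_mul' _ _ ENNReal.ofReal_ne_top]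
    congr 1
    · congr 1; rw [hk]; ring
    · refine setLIntegral_congr_fun measurableSet_Ioo fun r hr => ?_
      have : 0 < s - r := sub_pos.2 hr.2
      rw [← mul_assoc, ← ENNReal.ofReal_mul (by positivity)]
      congr 2; rw [hk]; ring
  -- Tonelli on the triangle `0 < r < s < t`
  have e2 : ∫⁻ s in Ioo 0 t, ∫⁻ r in Ioo 0 s,
      ENNReal.ofReal (k * ((t - s) ^ (-p) * (s - r) ^ (-q))) * a r
      = ∫⁻ r in Ioo 0 t, (∫⁻ s in Ioo r t,
        ENNReal.ofReal (k * ((t - s) ^ (-p) * (s - r) ^ (-q)))) * a r := by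
    set S : Set (ℝ × ℝ) := {x | 0 < x.2 ∧ x.2 < x.1 ∧ x.1 < t} with hSdef
    set Φ : ℝ → ℝ → ℝ≥0∞ := fun s r => S.indicator
      (fun x => ENNReal.ofReal (k * ((t - x.1) ^ (-p) * (x.1 - x.2) ^ (-q))) * a x.2) (s, r) with hΦ
    have hS : MeasurableSet S :=
      (measurableSet_lt measurable_const measurable_snd).inter
        ((measurableSet_lt measurable_snd measurable_fst).inter
          (measurableSet_lt measurable_fst measurable_const))
    have hm : Measurable (Function.uncurry Φ) := by
      have : Function.uncurry Φ = S.indicator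
        (fun x => ENNReal.ofReal (k * ((t - x.1) ^ (-p) * (x.1 - x.2) ^ (-q))) * a x.2) := rfl
      rw [this]
      exact Measurable.indicator (by fun_prop) hS
    have hin : ∀ s r, 0 < r → r < s → s < t →
        Φ s r = ENNReal.ofReal (k * ((t - s) ^ (-p) * (s - r) ^ (-q))) * a r := by
      intro s r h1 h2 h3
      have : (s, r) ∈ S := ⟨h1, h2, h3⟩
      simp only [hΦ]
      rw [indicator_of_mem this]
    have hout : ∀ s r, ¬ (0 < r ∧ r < s ∧ s < t) → Φ s r = 0 := by
      intro s r h1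
      have : (s, r) ∉ S := h1
      simp only [hΦ]
      rw [indicator_of_notMem this]
    have a1 : ∫⁻ s in Ioo 0 t, ∫⁻ r in Ioo 0 s,
        ENNReal.ofReal (k * ((t - s) ^ (-p) * (s - r) ^ (-q))) * a r = ∫⁻ s, ∫⁻ r, Φ s r := by
      rw [← lintegral_indicator measurableSet_Ioo]
      congr 1
      funext s
      by_cases hs : s ∈ Ioo 0 t
      · rw [indicator_of_mem hs, ← lintegral_indicator measurableSet_Ioo]
        congr 1
        funext r
        by_cases hr : r ∈ Ioo 0 s
        · rw [indicator_of_mem hr, hin s r hr.1 hr.2 hs.2]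
        · rw [indicator_of_notMem hr, hout s r fun h => hr ⟨h.1, h.2.1⟩]
      · rw [indicator_of_notMem hs]
        exact (lintegral_eq_zero_of_ae_eq_zero (ae_of_all _ fun r =>
          hout s r fun h => hs ⟨h.1.trans h.2.1, h.2.2⟩)).symm
    have a2 : ∫⁻ r in Ioo 0 t, (∫⁻ s in Ioo r t,
        ENNReal.ofReal (k * ((t - s) ^ (-p) * (s - r) ^ (-q)))) * a r = ∫⁻ r, ∫⁻ s, Φ s r := by
      rw [← lintegral_indicator measurableSet_Ioo]
      congr 1
      funext r
      by_cases hr : r ∈ Ioo 0 t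
      · rw [indicator_of_mem hr, ← lintegral_mul_const _ (by fun_prop),
          ← lintegral_indicator measurableSet_Ioo]
        congr 1
        funext s
        by_cases hs : s ∈ Ioo r t
        · rw [indicator_of_mem hs, hin s r hr.1 hs.1 hs.2]
        · rw [indicator_of_notMem hs, hout s r fun h => hs ⟨h.2.1, h.2.2⟩]
      · rw [indicator_of_notMem hr]
        exact (lintegral_eq_zero_of_ae_eq_zero (ae_of_all _ fun s =>
          hout s r fun h => hr ⟨h.1, h.2.1.trans h.2.2⟩)).symm
    rw [a1, a2]
    exact lintegral_lintegral_swap hm.aemeasurable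
  have e3 : ∫⁻ r in Ioo 0 t, (∫⁻ s in Ioo r t,
        ENNReal.ofReal (k * ((t - s) ^ (-p) * (s - r) ^ (-q)))) * a r
      ≤ ∫⁻ r in Ioo 0 t, ENNReal.ofReal (k * B' * (1 + T) * (t - r) ^ (-p')) * a r := by
    refine setLIntegral_mono' measurableSet_Ioo fun r hr => ?_
    gcongr
    have htr : 0 < t - r := sub_pos.2 hr.2
    have b1 := lintegral_Ioo_sub
      (fun s => ENNReal.ofReal (k * ((t - r - s) ^ (-p) * s ^ (-q)))) r t
    simp only [sub_sub, add_sub_cancel] at b1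
    rw [b1]
    have b2 := hbeta' k (t - r) hk0 htr
    simp only [sub_sub] at b2
    refine b2.trans (ENNReal.ofReal_le_ofReal ?_)
    have b3 : (t - r) ^ (1 - (p + q)) ≤ (1 + T) * (t - r) ^ (-p') := by
      have := rpow_le_one_add (p := 1 - (p + q) + p') (by linarith) (by linarith) htr
        (show t - r ≤ T by linarith [hr.1])
      calc (t - r) ^ (1 - (p + q)) = (t - r) ^ (1 - (p + q) + p') * (t - r) ^ (-p') := by
            rw [← Real.rpow_add htr]; congr 1; ring
        _ ≤ _ := by gcongr
    calc _ ≤ k * B' * ((1 + T) * (t - r) ^ (-p')) := by gcongr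
      _ = _ := by ring
  have e4 : ∫⁻ s in Ioo 0 t, ENNReal.ofReal (k * ((t - s) ^ (-p) * s ^ (-θ)))
      ≤ ENNReal.ofReal (k * B * (1 + T) * t ^ (-θ)) := by
    refine (hbeta k t hk0 ht).trans (ENNReal.ofReal_le_ofReal ?_)
    have b3 : t ^ (1 - p - θ) ≤ (1 + T) * t ^ (-θ) := by
      have := rpow_le_one_add (p := 1 - p) (by linarith) (by linarith) ht htT
      calc t ^ (1 - p - θ) = t ^ (1 - p) * t ^ (-θ) := by
            rw [← Real.rpow_add ht]; congr 1
        _ ≤ _ := by gcongr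
    calc _ ≤ k * B * ((1 + T) * t ^ (-θ)) := by gcongr
      _ = _ := by ring
  rw [e2] at e1
  refine (h' t ht htT).trans ((add_le_add_right (e1.trans (add_le_add e4 e3)) _).trans ?_)
  rw [← add_assoc, ← ENNReal.ofReal_add (by positivity) (by positivity)]
  refine add_le_add (ENNReal.ofReal_le_ofReal ?_) ?_
  · rw [← add_mul]
    have : 0 ≤ k * B' * (1 + T) := by positivity
    exact mul_le_mul_of_nonneg_right (by linarith) (by positivity)
  · refine setLIntegral_mono' measurableSet_Ioo fun r hr => ?_
    have htr : 0 < t - r := sub_pos.2 hr.2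
    gcongr
    have : 0 ≤ k * B * (1 + T) := by positivity
    linarith

/-- An integrable function satisfying an integral inequality with a weakly singular kernel is
bounded like the inhomogeneity: after finitely many iterations the kernel is bounded. -/
theorem exists_singular_bound {q θ T c : ℝ} (hq : 0 ≤ q) (hq1 : q < 1) (hθ : 0 ≤ θ) (hθ1 : θ < 1)
    (hc : 0 ≤ c) {a : ℝ → ℝ≥0∞} (ha : Measurable a) (hI : ∫⁻ s in Ioo 0 T, a s < ⊤)
    (h : ∀ t, 0 < t → t ≤ T → a t ≤ ENNReal.ofReal (c * t ^ (-θ))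
      + ∫⁻ s in Ioo 0 t, ENNReal.ofReal (c * (t - s) ^ (-q)) * a s) :
    ∃ C, 0 ≤ C ∧ ∀ t, 0 < t → t ≤ T → a t ≤ ENNReal.ofReal (C * t ^ (-θ)) := by
  have key : ∀ k : ℕ, ∃ C, 0 ≤ C ∧ ∀ t, 0 < t → t ≤ T → a t ≤ ENNReal.ofReal (C * t ^ (-θ))
      + ∫⁻ s in Ioo 0 t, ENNReal.ofReal (C * (t - s) ^ (-max (q - k * (1 - q)) 0)) * a s := by
    intro k
    induction k with
    | zero => exact ⟨c, hc, by simpa [max_eq_left hq] using h⟩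
    | succ k ih =>
      obtain ⟨C, hC, hk⟩ := ih
      have hk0 : 0 ≤ (k : ℝ) * (1 - q) := mul_nonneg (by positivity) (by linarith)
      refine singular_step (le_max_right _ _) (max_lt (by linarith) one_pos) hq hq1 hθ hθ1 hc hC
        ?_ ?_ ha h hk
      · push_cast
        rcases le_total (q - k * (1 - q)) 0 with h0 | h0
        · rw [max_eq_right h0]
          exact le_max_of_le_right (by linarith)
        · rw [max_eq_left h0]
          exact le_max_of_le_left (by linarith)
      · push_cast
        refine max_le ?_ (add_nonneg (le_max_right _ _) hq)
        have := le_max_left (q - k * (1 - q)) 0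
        linarith
  obtain ⟨k, hk⟩ := exists_nat_ge (q / (1 - q))
  rw [div_le_iff₀ (by linarith)] at hk
  obtain ⟨C, hC, hkey⟩ := key k
  rw [max_eq_right (by linarith)] at hkey
  rcases le_or_gt T 0 with hT | hT
  · exact ⟨0, le_rfl, fun t h1 h2 => by linarith⟩
  -- here the kernel is bounded, and the integrability of `a` enters
  set I := (∫⁻ s in Ioo 0 T, a s).toReal
  have hI0 : 0 ≤ I := ENNReal.toReal_nonneg
  refine ⟨C + C * I * (1 + T), by positivity, fun t ht htT => (hkey t ht htT).trans ?_⟩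
  have e1 : ∫⁻ s in Ioo 0 t, ENNReal.ofReal (C * (t - s) ^ (-(0:ℝ))) * a s
      ≤ ENNReal.ofReal (C * I) := by
    simp only [neg_zero, Real.rpow_zero, mul_one]
    rw [lintegral_const_mul _ ha, ENNReal.ofReal_mul hC]
    refine mul_le_mul_right ?_ _
    rw [ENNReal.ofReal_toReal hI.ne]
    exact lintegral_mono_set (Ioo_subset_Ioo le_rfl htT)
  refine (add_le_add_right e1 _).trans ?_
  rw [← ENNReal.ofReal_add (by positivity) (by positivity)]
  apply ENNReal.ofReal_le_ofReal
  have e2 : 1 ≤ (1 + T) * t ^ (-θ) := one_le_rpow_neg hθ hθ1.le ht htT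
  have : C * I * 1 ≤ C * I * ((1 + T) * t ^ (-θ)) := by gcongr
  linarith

end SingularGronwall

/-! ### The remainder of a mild solution -/

section MildToSol

variable {n : ℕ} {f : Vec n → Vec n} {g : Vec n → Vec n →L[ℝ] Vec n} {α β : ℝ≥0}
  {u₀ : ℝ → Vec n} {Ψ : ℝ → RoughPath n α} {T : ℝ} {u : ℝ → ℝ → Vec n}

lemma semigroup_two_pi {τ : ℝ} (hτ : 0 < τ) (h : ℝ → Vec n) :
    semigroup τ h (2 * Real.pi) = semigroup τ h 0 := by
  unfold semigroup
  congr 1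
  funext y
  rw [← kernel_periodic hτ (0 - y)]
  congr 2; ring

lemma IsMildSolution.mono_time {T' : ℝ} (hu : IsMildSolution f g β u₀ Ψ T u) (hT : T' ≤ T) :
    IsMildSolution f g β u₀ Ψ T' u where
  initial := hu.initial
  holder_bounded := lt_of_le_of_lt
    (biSup_mono fun _ ht => ⟨ht.1, ht.2.trans hT⟩) hu.holder_bounded
  holder_continuous t₀ ht₀ := (hu.holder_continuous t₀ ⟨ht₀.1, ht₀.2.trans hT⟩).mono_left
    (nhdsWithin_mono _ (Ioc_subset_Ioc_right hT))
  sup_continuous t₀ ht₀ := (hu.sup_continuous t₀ ⟨ht₀.1, ht₀.2.trans hT⟩).mono_left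
    (nhdsWithin_mono _ (Icc_subset_Icc_right hT))
  contDiff := ae_restrict_of_ae_restrict_of_subset (Icc_subset_Icc_right hT) hu.contDiff
  integrable := lt_of_le_of_lt (lintegral_mono_set (Icc_subset_Icc_right hT)) hu.integrable
  mild t ht := hu.mild t ⟨ht.1, ht.2.trans hT⟩

/-- Solutions are periodic, because the kernel is. -/
lemma IsMildSolution.periodic (hu₀ : IsInitialDatum β u₀) (hΨ : IsDriver β Ψ)
    (hu : IsMildSolution f g β u₀ Ψ T u) {t : ℝ} (ht : t ∈ Icc 0 T) :
    u t 0 = u t (2 * Real.pi) := by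
  rcases ht.1.eq_or_lt with rfl | ht0
  · rw [hu.initial _ zero_mem_box, hu.initial _ two_pi_mem_box, hu₀.2]
  obtain ⟨J, hJ, -, -, e⟩ := hu.mild t ⟨ht0, ht.2⟩ 0 zero_mem_box
  obtain ⟨J', hJ', -, -, e'⟩ := hu.mild t ⟨ht0, ht.2⟩ (2 * Real.pi) two_pi_mem_box
  have e1 : ∫ s in (0 : ℝ)..t, J s = ∫ s in (0 : ℝ)..t, J' s := by
    rw [intervalIntegral.integral_of_le ht0.le, intervalIntegral.integral_of_le ht0.le,
      integral_Ioc_eq_integral_Ioo, integral_Ioc_eq_integral_Ioo]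
    refine integral_congr_ae ?_
    filter_upwards [hJ, hJ', ae_restrict_mem measurableSet_Ioo] with s h1 h2 hs
    have hk : ∀ y, kernel (t - s) (2 * Real.pi - y) = kernel (t - s) (0 - y) := by
      intro y
      rw [← kernel_periodic (sub_pos.2 hs.2) (0 - y)]
      congr 1; ring
    simp only [hk] at h2
    exact h1.unique h2
  have e2 : ∫ s in (0 : ℝ)..t, semigroup (t - s) (drift f g (u s) (u s - (Ψ s).path)) 0
      = ∫ s in (0 : ℝ)..t, semigroup (t - s) (drift f g (u s) (u s - (Ψ s).path))
        (2 * Real.pi) := by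
    refine intervalIntegral.integral_congr_ae ?_
    rw [uIoc_of_le ht0.le]
    exact ae_Ioc_of_Ioo fun s _ hst => (semigroup_two_pi (sub_pos.2 hst) _).symm
  rw [semigroup_two_pi ht0, ← e1, ← e2, ← e, hΨ.periodic t ht.1] at e'
  exact (sub_left_injective e').symm

/-- The remainder `u - Ψ` of a mild solution, extended periodically in space and in a constant way
in time. -/
noncomputable def remainder (Ψ : ℝ → RoughPath n α) (T : ℝ) (u : ℝ → ℝ → Vec n) (t : ℝ) : ℝ → Vec n :=
  perExt (u (max 0 (min t T)) - (Ψ (max 0 (min t T))).path)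

lemma remainder_eq (hu₀ : IsInitialDatum β u₀) (hΨ : IsDriver β Ψ)
    (hu : IsMildSolution f g β u₀ Ψ T u) {t : ℝ} (ht : t ∈ Icc 0 T) {x : ℝ} (hx : x ∈ box) :
    remainder Ψ T u t x = u t x - (Ψ t).path x := by
  unfold remainder
  rw [min_eq_left ht.2, max_eq_right ht.1, perExt_eq _ hx, Pi.sub_apply]
  rw [Pi.sub_apply, Pi.sub_apply, hu.periodic hu₀ hΨ ht, hΨ.periodic t ht.1]

/-- The initial datum of the remainder. -/
noncomputable def datum (u₀ : ℝ → Vec n) (Ψ : ℝ → RoughPath n α) : ℝ → Vec n :=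
  perExt (u₀ - (Ψ 0).path)

lemma exists_isDatum_datum (hu₀ : IsInitialDatum β u₀) (hΨ : IsDriver β Ψ) :
    ∃ M, 0 ≤ M ∧ IsDatum β M (datum u₀ Ψ) := by
  have b1 := norm_le_of_holderNorm_le ENNReal.toReal_nonneg
    (ENNReal.ofReal_toReal hu₀.1.ne).ge
  have b2 := norm_le_of_holderNorm_le ENNReal.toReal_nonneg
    (ENNReal.ofReal_toReal (hΨ.holder 0 le_rfl).ne).ge
  set r1 := (holderNorm β u₀).toReal
  set r2 := (holderNorm β (Ψ 0).path).toReal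
  have h1 : 0 ≤ r1 := ENNReal.toReal_nonneg
  have h2 : 0 ≤ r2 := ENNReal.toReal_nonneg
  refine ⟨2 * (r1 + r2), by positivity, isDatum_perExt ?_ (fun x hx => ?_) fun x hx y hy => ?_⟩
  · rw [Pi.sub_apply, Pi.sub_apply, hu₀.2, hΨ.periodic 0 le_rfl]
  · exact (norm_sub_le _ _).trans (add_le_add (b1.1 x hx) (b2.1 x hx))
  · rw [Pi.sub_apply, Pi.sub_apply, sub_sub_sub_comm, add_mul]
    exact (norm_sub_le _ _).trans (add_le_add (b1.2 x hx y hy) (b2.2 x hx y hy))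

/-- On the initial datum, the semigroup on the circle agrees with the one on the line. -/
lemma semigroup_datum (hexp : Exponents α β) (hu₀ : IsInitialDatum β u₀) (hΨ : IsDriver β Ψ)
    {t : ℝ} (ht : 0 < t) (x : ℝ) :
    semigroup t (u₀ - (Ψ 0).path) x = heat t (datum u₀ Ψ) x := by
  obtain ⟨M, -, hd⟩ := exists_isDatum_datum hu₀ hΨ
  rw [← integral_kernel_smul ht (hd.continuous hexp).aestronglyMeasurable hd.periodic hd.sup]
  unfold semigroup
  refine intervalIntegral.integral_congr fun y hy => ?_
  rw [uIcc_of_le two_pi_pos'.le] at hy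
  have : datum u₀ Ψ y = (u₀ - (Ψ 0).path) y := perExt_eq (by
    rw [Pi.sub_apply, Pi.sub_apply, hu₀.2, hΨ.periodic 0 le_rfl]) hy
  beta_reduce
  rw [this]

lemma clampTime_mem (hT : 0 ≤ T) (t : ℝ) : max 0 (min t T) ∈ Icc 0 T :=
  ⟨le_max_left _ _, max_le hT (min_le_right _ _)⟩

/-- A bound for the remainder, uniform in time. -/
lemma exists_remainder_bound (hu₀ : IsInitialDatum β u₀) (hΨ : IsDriver β Ψ) (hT : 0 ≤ T)
    (hu : IsMildSolution f g β u₀ Ψ T u) :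
    ∃ M, 0 ≤ M ∧ ∀ t, IsDatum β M (remainder Ψ T u t) := by
  obtain ⟨R, hR, hNR⟩ := hΨ.exists_boundedBy T
  set K := (⨆ t ∈ Icc 0 T, holderNorm β (u t)).toReal with hK
  have hK0 : 0 ≤ K := ENNReal.toReal_nonneg
  refine ⟨2 * (K + R), by positivity, fun t => ?_⟩
  have ht := clampTime_mem hT t
  unfold remainder
  generalize max 0 (min t T) = s at *
  have b1 := norm_le_of_holderNorm_le (γ := β) (h := u s) hK0 (by
    rw [hK, ENNReal.ofReal_toReal hu.holder_bounded.ne]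
    exact le_iSup₂_of_le s ht le_rfl)
  have b2 : ∀ x ∈ box, ‖(Ψ s).path x‖ ≤ R := fun x hx => by
    have := hNR.sup s ht x hx
    rw [noiseOf_path ht.1 hx] at this
    simpa [Noise.zero] using this
  have b3 : ∀ x ∈ box, ∀ y ∈ box, ‖(Ψ s).path x - (Ψ s).path y‖ ≤ R * |x - y| ^ (β : ℝ) :=
    fun x hx y hy => by
      have := hNR.hol s ht y hy x hx
      rw [noiseOf_path ht.1 hx, noiseOf_path ht.1 hy] at this
      simpa [Noise.zero] using this
  refine isDatum_perExt ?_ (fun x hx => ?_) fun x hx y hy => ?_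
  · rw [Pi.sub_apply, Pi.sub_apply, hu.periodic hu₀ hΨ ht, hΨ.periodic s ht.1]
  · exact (norm_sub_le _ _).trans (add_le_add (b1.1 x hx) (b2 x hx))
  · rw [Pi.sub_apply, Pi.sub_apply, sub_sub_sub_comm, add_mul]
    exact (norm_sub_le _ _).trans (add_le_add (b1.2 x hx y hy) (b3 x hx y hy))

lemma continuous_remainder (hβ : 0 < β) (hu₀ : IsInitialDatum β u₀) (hΨ : IsDriver β Ψ) (hT : 0 ≤ T)
    (hu : IsMildSolution f g β u₀ Ψ T u) :
    Continuous fun p : ℝ × ℝ => remainder Ψ T u p.1 p.2 := by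
  obtain ⟨M, hM, hd⟩ := exists_remainder_bound hu₀ hΨ hT hu
  refine continuous_uncurry_of_uniform (fun s => continuous_of_holder (γ := β) hβ (hd s).hol)
    fun s₀ ε hε => ?_
  have h1 : Tendsto (fun s : ℝ => max 0 (min s T)) (𝓝 s₀) (𝓝[Icc 0 T] (max 0 (min s₀ T))) :=
    tendsto_nhdsWithin_iff.2 ⟨(by fun_prop : Continuous fun s : ℝ => max 0 (min s T)).tendsto _,
      Eventually.of_forall fun s => clampTime_mem hT s⟩
  have h2 := (hu.sup_continuous _ (clampTime_mem hT s₀)).eventually_le_const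
    (show (0 : ℝ≥0∞) < ENNReal.ofReal ε by simpa using hε)
  filter_upwards [h1.eventually h2] with s hs x
  exact norm_le_of_supNorm_le hε.le hs (toIcoMod_mem_box x)

/-- The Lipschitz constant of `h` on `[0, 2π]`. -/
noncomputable def lipConst (h : ℝ → Vec n) : ℝ≥0∞ :=
  ⨆ x ∈ box, ⨆ y ∈ box, ‖h x - h y‖ₑ / ‖x - y‖ₑ

lemma measurable_lipConst {v : ℝ → ℝ → Vec n} (hv : Continuous fun p : ℝ × ℝ => v p.1 p.2) :
    Measurable fun s => lipConst (v s) := by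
  refine LowerSemicontinuous.measurable ?_
  refine lowerSemicontinuous_biSup fun x _ => lowerSemicontinuous_biSup fun y _ => ?_
  rcases eq_or_ne x y with rfl | hxy
  · simpa using lowerSemicontinuous_const
  · have : Continuous fun s => ‖v s x - v s y‖ₑ / ‖x - y‖ₑ := by
      refine (ENNReal.continuous_div_const _ (by simpa [sub_eq_zero] using hxy)).comp ?_
      have h1 : Continuous fun s => v s x := hv.comp (by fun_prop : Continuous fun s : ℝ => (s, x))
      have h2 : Continuous fun s => v s y := hv.comp (by fun_prop : Continuous fun s : ℝ => (s, y))
      exact (h1.sub h2).enorm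
    exact this.lowerSemicontinuous

lemma lipConst_le {h : ℝ → Vec n} {C : ℝ≥0∞}
    (hh : ∀ x ∈ box, ∀ y ∈ box, ‖h x - h y‖ₑ ≤ C * ‖x - y‖ₑ) : lipConst h ≤ C :=
  iSup₂_le fun x hx => iSup₂_le fun y hy => ENNReal.div_le_of_le_mul (hh x hx y hy)

lemma le_lipConst (h : ℝ → Vec n) {x y : ℝ} (hx : x ∈ box) (hy : y ∈ box) :
    ‖h x - h y‖ₑ / ‖x - y‖ₑ ≤ lipConst h :=
  le_iSup₂_of_le (f := fun x _ => ⨆ y ∈ box, ‖h x - h y‖ₑ / ‖x - y‖ₑ) x hx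
    (le_iSup₂_of_le (f := fun y _ => ‖h x - h y‖ₑ / ‖x - y‖ₑ) y hy le_rfl)

lemma norm_sub_le_of_lipConst_le {h : ℝ → Vec n} {C : ℝ} (hC : 0 ≤ C)
    (hh : lipConst h ≤ ENNReal.ofReal C) {x y : ℝ} (hx : x ∈ box) (hy : y ∈ box) :
    ‖h x - h y‖ ≤ C * |x - y| := by
  rcases eq_or_ne x y with rfl | hxy
  · simp
  have h1 : ‖h x - h y‖ₑ / ‖x - y‖ₑ ≤ ENNReal.ofReal C :=
    (le_lipConst h hx hy).trans hh
  rw [ENNReal.div_le_iff (by simpa [sub_eq_zero] using hxy) enorm_ne_top, ← ofReal_norm,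
    ← ofReal_norm, ← ENNReal.ofReal_mul hC, ENNReal.ofReal_le_ofReal_iff (by positivity)] at h1
  exact h1

lemma perExt_of_periodic {h : ℝ → Vec n} (hp : Function.Periodic h (2 * Real.pi)) :
    perExt h = h := by
  funext x
  unfold perExt
  rw [← hp.sub_zsmul_eq (x := x) (toIcoDiv two_pi_pos' 0 x)]
  congr 1

/-- A Lipschitz bound on one period extends to the line. -/
lemma norm_sub_le_of_periodic {h : ℝ → Vec n} (hp : Function.Periodic h (2 * Real.pi)) {C : ℝ}
    (hC : 0 ≤ C) (hh : lipConst h ≤ ENNReal.ofReal C) (x y : ℝ) :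
    ‖h x - h y‖ ≤ 2 * C * |x - y| := by
  have h2 := perExt_holder (h := h) (by rw [← hp 0, zero_add]) hC zero_le_one
    (fun x hx y hy => by simpa using norm_sub_le_of_lipConst_le hC hh hx hy) x y
  rw [Real.rpow_one] at h2
  rwa [perExt_of_periodic hp] at h2

lemma lipConst_le_supNorm_deriv {h : ℝ → Vec n} (hh : ContDiffOn ℝ 1 h box) :
    lipConst h ≤ supNorm (derivWithin h box) := by
  refine lipConst_le fun x hx y hy => ?_
  rcases eq_top_or_lt_top (supNorm (derivWithin h box)) with htop | htop
  · rcases eq_or_ne x y with rfl | hxy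
    · simp
    · rw [htop, ENNReal.top_mul (by simpa [sub_eq_zero] using hxy)]
      exact le_top
  · have b := fun z hz => norm_le_of_supNorm_le (x := z) ENNReal.toReal_nonneg
      (ENNReal.ofReal_toReal htop.ne).ge hz
    have := (convex_Icc 0 (2 * Real.pi)).norm_image_sub_le_of_norm_hasDerivWithin_le
      (f := h) (f' := derivWithin h box)
      (fun r hr => (hh.differentiableOn one_ne_zero r hr).hasDerivWithinAt) b hy hx
    rw [← ofReal_norm, ← ofReal_norm, ← ENNReal.ofReal_toReal htop.ne,
      ← ENNReal.ofReal_mul ENNReal.toReal_nonneg]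
    exact ENNReal.ofReal_le_ofReal this

lemma IsMildSolution.lintegral_lipConst (hu₀ : IsInitialDatum β u₀) (hΨ : IsDriver β Ψ)
    (hu : IsMildSolution f g β u₀ Ψ T u) :
    ∫⁻ s in Ioo 0 T, lipConst (remainder Ψ T u s) < ⊤ := by
  refine lt_of_le_of_lt ?_ hu.integrable
  refine (lintegral_mono_set Ioo_subset_Icc_self).trans (lintegral_mono_ae ?_)
  filter_upwards [hu.contDiff, ae_restrict_mem measurableSet_Icc] with s h1 hs
  refine le_trans ?_ le_add_self
  refine le_trans (lipConst_le fun x hx y hy => ?_) (lipConst_le_supNorm_deriv h1)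
  rw [remainder_eq hu₀ hΨ hu hs hx, remainder_eq hu₀ hΨ hu hs hy]
  rcases eq_or_ne x y with rfl | hxy
  · simp
  have h2 : ‖(u s - (Ψ s).path) x - (u s - (Ψ s).path) y‖ₑ / ‖x - y‖ₑ
      ≤ lipConst (u s - (Ψ s).path) := le_lipConst _ hx hy
  rwa [ENNReal.div_le_iff (by simpa [sub_eq_zero] using hxy) enorm_ne_top] at h2

/-- The data of a slice at a time at which the remainder is Lipschitz. -/
lemma remainder_sliceBound (hexp : Exponents α β) (hΨ : IsDriver β Ψ)
    {R M : ℝ} (hR : 0 ≤ R) (hM : 0 ≤ M) (hNR : (noiseOf Ψ).BoundedBy α β T R)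
    (hd : ∀ t, IsDatum β M (remainder Ψ T u t)) {s : ℝ}
    (hs : 0 < s) (hsT : s ≤ T) (hfin : lipConst (remainder Ψ T u s) < ⊤) :
    SliceBound α (7 * (M + R) + 1) (2 * (lipConst (remainder Ψ T u s)).toReal) ((noiseOf Ψ).path s)
      ((noiseOf Ψ).area s) (remainder Ψ T u s) := by
  have hα : 0 < α := by
    have := hexp.third_lt
    exact_mod_cast (by linarith : (0:ℝ) < α)
  have hcb : CBound β T M (remainder Ψ T u) := ⟨fun t _ _ => (hd t).sup, fun t _ _ => (hd t).hol⟩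
  refine SliceBound.of_bounds hexp (noiseOf_regular hα hΨ) hNR hcb hs hsT hR hM fun x y => ?_
  exact norm_sub_le_of_periodic (hd s).periodic ENNReal.toReal_nonneg
    (ENNReal.ofReal_toReal hfin.ne).ge x y

/-- The equation in terms of the primitive of the right hand side. At almost every time the rough
integral is the one of `hasRoughIntegral_slice`, and the drift cancels. -/
lemma IsMildSolution.remainder_integral_eq (hexp : Exponents α β) (hf : ContDiff ℝ ∞ f)
    (hg : ContDiff ℝ ∞ g) (hu₀ : IsInitialDatum β u₀) (hΨ : IsDriver β Ψ) (hT : 0 < T)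
    (hu : IsMildSolution f g β u₀ Ψ T u) {t : ℝ} (ht : 0 < t) (htT : t ≤ T) {x : ℝ} (hx : x ∈ box) :
    IntervalIntegrable (fun s => duhamel (t - s) (rhs f g (noiseOf Ψ) (remainder Ψ T u) s) x)
      volume 0 t ∧ remainder Ψ T u t x = heat t (datum u₀ Ψ) x
        + volterra (rhs f g (noiseOf Ψ) (remainder Ψ T u)) t x := by
  have hα3 := hexp.third_lt
  have hα2 : (α : ℝ) < 1 / 2 := by linarith [hexp.le, hexp.lt_half]
  have hβ : 0 < β := by
    have := hexp.le
    exact_mod_cast (by linarith : (0:ℝ) < β)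
  obtain ⟨R, hR, hNR⟩ := hΨ.exists_boundedBy T
  obtain ⟨M, hM, hd⟩ := exists_remainder_bound hu₀ hΨ hT.le hu
  obtain ⟨J, hJ, hJi, hDi, e⟩ := hu.mild t ⟨ht, htT⟩ x hx
  have hcont := continuous_remainder hβ hu₀ hΨ hT.le hu
  have hfin : ∀ᵐ s ∂volume.restrict (Ioo 0 t), lipConst (remainder Ψ T u s) < ⊤ :=
    ae_restrict_of_ae_restrict_of_subset (Ioo_subset_Ioo le_rfl htT)
      (ae_lt_top (measurable_lipConst hcont) (hu.lintegral_lipConst hu₀ hΨ).ne)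
  have hcd : ∀ᵐ s ∂volume.restrict (Ioo 0 t), ContDiffOn ℝ 1 (u s - (Ψ s).path) box :=
    ae_restrict_of_ae_restrict_of_subset
      (Ioo_subset_Icc_self.trans (Icc_subset_Icc le_rfl htT)) hu.contDiff
  have key : ∀ᵐ s ∂volume.restrict (Ioo 0 t),
      semigroup (t - s) (drift f g (u s) (u s - (Ψ s).path)) x + J s
        = duhamel (t - s) (rhs f g (noiseOf Ψ) (remainder Ψ T u) s) x := by
    filter_upwards [hJ, hfin, hcd, ae_restrict_mem measurableSet_Ioo] with s h1 h2 h3 hs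
    have hsT : s ∈ Icc 0 T := ⟨hs.1.le, hs.2.le.trans htT⟩
    have hb := remainder_sliceBound hexp hΨ hR hM hNR hd hs.1 hsT.2 h2
    have h4 := hasRoughIntegral_slice (X := Ψ s) (u := u s) (w := u s - (Ψ s).path) hα3 hα2
      (by linarith) (by positivity) hf hg hb
      (fun x hx => (noiseOf_path hs.1.le hx).symm) (fun x hx y hy => (noiseOf_area hs.1.le hx hy).symm)
      (fun y hy => by rw [remainder_eq hu₀ hΨ hu hsT hy, noiseOf_path hs.1.le hy, sub_add_cancel])
      h3 (fun y hy => (remainder_eq hu₀ hΨ hu hsT hy).symm) (sub_pos.2 hs.2) x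
    rw [h1.unique h4]
    simp only [rhs, add_sub_cancel]
  have key' : ∀ᵐ s ∂volume.restrict (uIoc 0 t),
      semigroup (t - s) (drift f g (u s) (u s - (Ψ s).path)) x + J s
        = duhamel (t - s) (rhs f g (noiseOf Ψ) (remainder Ψ T u) s) x := by
    rwa [uIoc_of_le ht.le, ← restrict_Ioo_eq_restrict_Ioc]
  refine ⟨(hDi.add hJi).congr_ae key', ?_⟩
  rw [remainder_eq hu₀ hΨ hu ⟨ht.le, htT⟩ hx, e, semigroup_datum hexp hu₀ hΨ ht, add_assoc,
    ← intervalIntegral.integral_add hDi hJi]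
  congr 1
  unfold volterra
  exact intervalIntegral.integral_congr_ae_restrict key'

end MildToSol

/-! ### Mild solutions solve the integral equation -/

section MildIsSol

variable {n : ℕ} {f : Vec n → Vec n} {g : Vec n → Vec n →L[ℝ] Vec n} {α β : ℝ≥0}
  {u₀ : ℝ → Vec n} {Ψ : ℝ → RoughPath n α} {T : ℝ} {u : ℝ → ℝ → Vec n}

/-- The Lipschitz constant of the remainder satisfies a singular integral inequality, in which it is
only known to be integrable in time. -/
lemma IsMildSolution.lipConst_remainder_le (hexp : Exponents α β) (hf : ContDiff ℝ ∞ f)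
    (hg : ContDiff ℝ ∞ g) (hu₀ : IsInitialDatum β u₀) (hΨ : IsDriver β Ψ) (hT : 0 < T)
    (hu : IsMildSolution f g β u₀ Ψ T u) : ∃ c, 0 ≤ c ∧ ∀ t, 0 < t → t ≤ T →
      lipConst (remainder Ψ T u t) ≤ ENNReal.ofReal (c * t ^ (-((1 - (β : ℝ)) / 2)))
        + ∫⁻ s in Ioo 0 t, ENNReal.ofReal (c * (t - s) ^ (-(1 - (α : ℝ) / 2)))
          * lipConst (remainder Ψ T u s) := by
  have h3 := hexp.third_lt
  have h4 := hexp.le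
  have h5 := hexp.lt_half
  have hβ : 0 < β := by exact_mod_cast (by linarith : (0:ℝ) < β)
  have hG := gaussConst_pos
  obtain ⟨R, hR, hNR⟩ := hΨ.exists_boundedBy T
  obtain ⟨M, hM, hd⟩ := exists_remainder_bound hu₀ hΨ hT.le hu
  obtain ⟨M0, hM0, hd0⟩ := exists_isDatum_datum hu₀ hΨ
  have hcont := continuous_remainder hβ hu₀ hΨ hT.le hu
  obtain ⟨C, hC, hc⟩ := exists_coeffBound hf hg (7 * (M + R) + 1)
  have hR1 : 1 ≤ 7 * (M + R) + 1 := by linarith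
  have hK := primConst_nonneg (n := n) h3 hC hR1
  set R1 := 7 * (M + R) + 1
  set c1 := 4 * gaussConst * (3 * R1 * primConst n α C R1) with hc1
  have hc1' : 0 ≤ c1 := by positivity
  obtain ⟨B, hB, hbeta⟩ := exists_lintegral_beta_le (e := 1 - (α : ℝ) / 2) (θ := 0) (by linarith)
    (by linarith) le_rfl one_pos
  -- the datum, the constant part of the bound on the primitive, and its part linear in the
  -- Lipschitz constant
  refine ⟨gaussConst * M0 + c1 * B * ((1 + T) * (1 + T)) + 2 * c1, by positivity,
    fun t ht htT => ?_⟩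
  set a := fun s => lipConst (remainder Ψ T u s) with ha
  have hfin : ∀ᵐ s ∂volume.restrict (Ioo 0 t), a s < ⊤ :=
    ae_restrict_of_ae_restrict_of_subset (Ioo_subset_Ioo le_rfl htT)
      (ae_lt_top (measurable_lipConst hcont) (hu.lintegral_lipConst hu₀ hΨ).ne)
  have hp : 0 < t ^ (-((1 - (β : ℝ)) / 2)) := Real.rpow_pos_of_pos ht _
  have hm1 : Measurable fun s : ℝ => ENNReal.ofReal (c1 * (t - s) ^ (-(1 - (α : ℝ) / 2))) := by
    fun_prop
  -- the contribution of the Duhamel term to an increment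
  have hduh : ∀ x ∈ box, ∀ y ∈ box,
      ‖volterra (rhs f g (noiseOf Ψ) (remainder Ψ T u)) t x
        - volterra (rhs f g (noiseOf Ψ) (remainder Ψ T u)) t y‖ₑ
      ≤ (ENNReal.ofReal (c1 * B * ((1 + T) * (1 + T)) * t ^ (-((1 - (β : ℝ)) / 2)))
        + ∫⁻ s in Ioo 0 t, ENNReal.ofReal (2 * c1 * (t - s) ^ (-(1 - (α : ℝ) / 2))) * a s)
        * ‖x - y‖ₑ := by
    intro x hx y hy
    obtain ⟨i1, -⟩ := hu.remainder_integral_eq hexp hf hg hu₀ hΨ hT ht htT hx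
    obtain ⟨i2, -⟩ := hu.remainder_integral_eq hexp hf hg hu₀ hΨ hT ht htT hy
    unfold volterra
    rw [← intervalIntegral.integral_sub i1 i2, intervalIntegral.integral_of_le ht.le]
    refine (enorm_integral_le_lintegral_enorm _).trans ?_
    rw [← restrict_Ioo_eq_restrict_Ioc]
    have hpt : ∀ᵐ s ∂volume.restrict (Ioo 0 t),
        ‖duhamel (t - s) (rhs f g (noiseOf Ψ) (remainder Ψ T u) s) x
          - duhamel (t - s) (rhs f g (noiseOf Ψ) (remainder Ψ T u) s) y‖ₑ
        ≤ (ENNReal.ofReal (c1 * (t - s) ^ (-(1 - (α : ℝ) / 2)))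
          + ENNReal.ofReal (2 * c1 * (t - s) ^ (-(1 - (α : ℝ) / 2))) * a s) * ‖x - y‖ₑ := by
      filter_upwards [hfin, ae_restrict_mem measurableSet_Ioo] with s h1 hs
      have hb := remainder_sliceBound hexp hΨ hR hM hNR hd hs.1 (hs.2.le.trans htT) h1
      have hprim := isPrimitive_sew_germ h3 (by linarith) hR1 (by positivity) hC hc hb
      have hle := norm_duhamel_sub_le hprim (by linarith) (by linarith) (sub_pos.2 hs.2) x y
      have hq : 0 < (t - s) ^ (-(1 - (α : ℝ) / 2)) := Real.rpow_pos_of_pos (sub_pos.2 hs.2) _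
      rw [show (a s) = ENNReal.ofReal (a s).toReal from (ENNReal.ofReal_toReal h1.ne).symm,
        ← ofReal_norm, ← ofReal_norm, ← ENNReal.ofReal_mul (by positivity),
        ← ENNReal.ofReal_add (by positivity) (by positivity),
        ← ENNReal.ofReal_mul (by positivity)]
      refine ENNReal.ofReal_le_ofReal (hle.trans (le_of_eq ?_))
      rw [show (α : ℝ) / 2 - 1 = -(1 - (α : ℝ) / 2) by ring, Real.norm_eq_abs, hc1]
      ring
    refine (lintegral_mono_ae hpt).trans ?_
    rw [lintegral_mul_const'' _ (by
      exact (hm1.add ((by fun_prop : Measurable fun s : ℝ =>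
        ENNReal.ofReal (2 * c1 * (t - s) ^ (-(1 - (α : ℝ) / 2)))).mul
          (measurable_lipConst hcont))).aemeasurable), lintegral_add_left hm1]
    gcongr
    have := hbeta c1 t hc1' ht
    simp only [neg_zero, Real.rpow_zero, mul_one] at this
    refine this.trans (ENNReal.ofReal_le_ofReal ?_)
    have e1 := rpow_le_one_add (p := 1 - (1 - (α : ℝ) / 2) - 0) (by linarith) (by linarith) ht htT
    have e2 := one_le_rpow_neg (θ := (1 - (β : ℝ)) / 2) (by linarith) (by linarith) ht htT
    calc _ ≤ c1 * B * ((1 + T) * ((1 + T) * t ^ (-((1 - (β : ℝ)) / 2)))) := by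
          gcongr
          nlinarith
      _ = _ := by ring
  refine lipConst_le fun x hx y hy => ?_
  obtain ⟨-, e1⟩ := hu.remainder_integral_eq hexp hf hg hu₀ hΨ hT ht htT hx
  obtain ⟨-, e2⟩ := hu.remainder_integral_eq hexp hf hg hu₀ hΨ hT ht htT hy
  rw [e1, e2, add_sub_add_comm]
  refine (enorm_add_le _ _).trans ?_
  have e3 : ‖heat t (datum u₀ Ψ) x - heat t (datum u₀ Ψ) y‖ₑ
      ≤ ENNReal.ofReal (gaussConst * M0 * t ^ (-((1 - (β : ℝ)) / 2))) * ‖x - y‖ₑ := by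
    have := (hd0.wBound_heat (T := T) hexp).lip t ht htT x y
    rw [zero_mul, Real.exp_zero, mul_one] at this
    rw [← ofReal_norm, ← ofReal_norm, ← ENNReal.ofReal_mul (by positivity)]
    exact ENNReal.ofReal_le_ofReal this
  refine (add_le_add e3 (hduh x hx y hy)).trans ?_
  rw [← add_mul, ← add_assoc, ← ENNReal.ofReal_add (by positivity) (by positivity)]
  have h6 : 0 ≤ gaussConst * M0 + c1 * B * ((1 + T) * (1 + T)) := by positivity
  gcongr ?_ * _
  refine add_le_add (ENNReal.ofReal_le_ofReal ?_)
    (setLIntegral_mono' measurableSet_Ioo fun s hs => ?_)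
  · rw [← add_mul]
    exact mul_le_mul_of_nonneg_right (by linarith) hp.le
  · have hq : 0 < (t - s) ^ (-(1 - (α : ℝ) / 2)) := Real.rpow_pos_of_pos (sub_pos.2 hs.2) _
    gcongr
    linarith

/-- The remainder of a mild solution solves the integral equation on the line; in particular it is
Lipschitz in space with a constant that is an integrable power of time. -/
theorem IsMildSolution.isSol (hexp : Exponents α β) (hf : ContDiff ℝ ∞ f)
    (hg : ContDiff ℝ ∞ g) (hu₀ : IsInitialDatum β u₀) (hΨ : IsDriver β Ψ) (hT : 0 < T)
    (hu : IsMildSolution f g β u₀ Ψ T u) :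
    IsSol f g β (noiseOf Ψ) (datum u₀ Ψ) T (remainder Ψ T u) := by
  have h3 := hexp.third_lt
  have h4 := hexp.le
  have h5 := hexp.lt_half
  have hβ : 0 < β := by exact_mod_cast (by linarith : (0:ℝ) < β)
  obtain ⟨M, hM, hd⟩ := exists_remainder_bound hu₀ hΨ hT.le hu
  obtain ⟨M0, hM0, hd0⟩ := exists_isDatum_datum hu₀ hΨ
  have hcont := continuous_remainder hβ hu₀ hΨ hT.le hu
  obtain ⟨c, hc, hineq⟩ := hu.lipConst_remainder_le hexp hf hg hu₀ hΨ hT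
  obtain ⟨C, hC, hlip⟩ := exists_singular_bound (by linarith) (by linarith) (by linarith)
    (by linarith) hc (measurable_lipConst hcont) (hu.lintegral_lipConst hu₀ hΨ) hineq
  refine ⟨hcont.measurable, fun t _ _ => (hd t).periodic, ⟨M + 2 * C, ?_⟩, fun t ht htT x => ?_⟩
  · refine ⟨fun t ht htT x => ?_, fun t ht htT x y => ?_, fun t ht htT x y => ?_⟩
    · rw [zero_mul, Real.exp_zero, mul_one]
      exact ((hd t).sup x).trans (by linarith)
    · rw [zero_mul, Real.exp_zero, mul_one]
      exact ((hd t).hol x y).trans (mul_le_mul_of_nonneg_right (by linarith) (by positivity))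
    · have hp : 0 < t ^ (-((1 - (β : ℝ)) / 2)) := Real.rpow_pos_of_pos ht _
      rw [zero_mul, Real.exp_zero, mul_one]
      refine (norm_sub_le_of_periodic (hd t).periodic (by positivity) (hlip t ht htT) x y).trans ?_
      exact mul_le_mul_of_nonneg_right (by nlinarith) (abs_nonneg _)
  · obtain ⟨y, hy, e⟩ := ((hd t).periodic.sub (((heat_periodic hd0.periodic t).add
      (volterra_periodic (rhs f g (noiseOf Ψ) (remainder Ψ T u)) t)))).exists_mem_Ico₀
      two_pi_pos' x
    have := (hu.remainder_integral_eq hexp hf hg hu₀ hΨ hT ht htT ⟨hy.1, hy.2.le⟩).2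
    simp only [Pi.sub_apply, Pi.add_apply, ← this, sub_self] at e
    exact sub_eq_zero.1 e

end MildIsSol

/-! ### Regularity in space -/

section Smoothness

variable {n : ℕ} {f : Vec n → Vec n} {g : Vec n → Vec n →L[ℝ] Vec n} {N : Noise n}
  {v : ℝ → ℝ → Vec n} {v₀ : ℝ → Vec n} {α β T R M : ℝ}

lemma stronglyMeasurable_dduhamel {E X : Type*} [NormedAddCommGroup E] [NormedSpace ℝ E]
    [CompleteSpace E] [MeasurableSpace X] {H : ℝ → ℝ → E}
    (hH : StronglyMeasurable fun p : ℝ × ℝ => H p.1 p.2) {τ s x : X → ℝ} (hτ : Measurable τ)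
    (hs : Measurable s) (hx : Measurable x) :
    StronglyMeasurable fun a => dduhamel (τ a) (H (s a)) (x a) := by
  unfold dduhamel ddheat
  have h1 := stronglyMeasurable_gaussMean (w := fun ξ => ξ ^ 2 - 1) (by fun_prop)
    (h := fun s => perExt (bridge (H s))) (stronglyMeasurable_perExt_bridge hH)
    (σ := fun a => Real.sqrt (2 * τ a)) (by fun_prop) hs hx
  have h2 : StronglyMeasurable fun a => (Real.sqrt (2 * τ a))⁻¹ :=
    (by fun_prop : Measurable fun a => (Real.sqrt (2 * τ a))⁻¹).stronglyMeasurable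
  exact (by fun_prop : Measurable fun a => Real.exp (-τ a)).stronglyMeasurable.smul
    (h2.smul (h2.smul h1))

/-- A solution is continuously differentiable in space at positive times. -/
lemma IsSol.contDiff (hexp : Exponents α β) (hf : ContDiff ℝ ∞ f) (hg : ContDiff ℝ ∞ g)
    (hR : 0 ≤ R) (hN : N.Regular) (hNR : N.BoundedBy α β T R) (h0 : IsDatum β M v₀)
    (hv : IsSol f g β N v₀ T v) {t : ℝ} (ht : 0 < t) (htT : t ≤ T) : ContDiff ℝ 1 (v t) := by
  have h3 := hexp.third_lt
  have h4 := hexp.le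
  have h5 := hexp.lt_half
  have hG := gaussConst_pos
  obtain ⟨B, hB, hprim⟩ := hv.exists_isPrimitive hexp hf hg hR hN hNR
  have hm := measurable_rhs hf.continuous hg hN hv.meas
  have hm1 : ∀ x, AEStronglyMeasurable (fun s => dduhamel (t - s) (rhs f g N v s) x)
      (volume.restrict (uIoc 0 t)) := fun x =>
    (stronglyMeasurable_dduhamel hm (τ := fun s : ℝ => t - s) (s := fun s => s) (x := fun _ => x)
      (by fun_prop) measurable_id measurable_const).aestronglyMeasurable
  have hint := (intervalIntegrable_beta (e := 1 - α / 2) (θ := (1 - β) / 2) (by linarith)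
    (by linarith) (by linarith) (by linarith) ht).const_mul (4 * gaussConst * B)
  have hbd : ∀ᵐ s, s ∈ uIoc 0 t → ∀ x, ‖dduhamel (t - s) (rhs f g N v s) x‖
      ≤ 4 * gaussConst * B * ((t - s) ^ (-(1 - α / 2)) * s ^ (-((1 - β) / 2))) := by
    rw [uIoc_of_le ht.le]
    refine ae_Ioc_of_Ioo fun s hs hst x => ?_
    refine (norm_dduhamel_le (hprim s hs (hst.le.trans htT)) (by linarith) (by linarith)
      (sub_pos.2 hst) x).trans (le_of_eq ?_)
    rw [show α / 2 - 1 = -(1 - α / 2) by ring]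
    ring
  have hdu : ∀ᵐ s, s ∈ uIoc 0 t → ∀ x, HasDerivAt (duhamel (t - s) (rhs f g N v s))
      (dduhamel (t - s) (rhs f g N v s) x) x := by
    rw [uIoc_of_le ht.le]
    exact ae_Ioc_of_Ioo fun s hs hst x => hasDerivAt_duhamel (hprim s hs (hst.le.trans htT))
      (by linarith) (by linarith) (sub_pos.2 hst) x
  have hdc : ∀ᵐ s, s ∈ uIoc 0 t → Continuous fun x => dduhamel (t - s) (rhs f g N v s) x := by
    rw [uIoc_of_le ht.le]
    exact ae_Ioc_of_Ioo fun s hs hst => continuous_dduhamel (hprim s hs (hst.le.trans htT))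
      (by linarith) (by linarith) _
  have hd : ∀ x, HasDerivAt (v t) (dheat t v₀ x
      + ∫ s in (0 : ℝ)..t, dduhamel (t - s) (rhs f g N v s) x) x := by
    intro x
    have e1 : v t = fun x => heat t v₀ x + ∫ s in (0 : ℝ)..t, duhamel (t - s) (rhs f g N v s) x :=
      funext fun x => hv.eq t ht htT x
    rw [e1]
    refine (hasDerivAt_heat (h0.continuous hexp) h0.sup ht x).add ?_
    refine (intervalIntegral.hasDerivAt_integral_of_dominated_loc_of_deriv_le (s := univ)
      univ_mem (Eventually.of_forall fun y => ?_)
      (hv.intervalIntegrable hexp hf hg hR hN hNR ht htT le_rfl x) (hm1 x)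
      (hbd.mono fun s hs hm y _ => hs hm y) hint (hdu.mono fun s hs hm y _ => hs hm y)).2
    exact (hv.intervalIntegrable hexp hf hg hR hN hNR ht htT le_rfl y).def'.aestronglyMeasurable
  refine contDiff_one_iff_deriv.2 ⟨fun x => (hd x).differentiableAt, ?_⟩
  rw [show deriv (v t) = _ from funext fun x => (hd x).deriv]
  exact (continuous_dheat (h0.continuous hexp) h0.sup t).add
    (intervalIntegral.continuous_of_dominated_interval hm1
      (fun x => hbd.mono fun s hs hm => hs hm x) hint hdc)

/-- The drift along a solution, extended periodically, is measurable and bounded by an integrable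
power of time. -/
lemma IsSol.exists_drift (hexp : Exponents α β) (hf : ContDiff ℝ ∞ f) (hg : ContDiff ℝ ∞ g)
    (hR : 0 ≤ R) (hN : N.Regular) (hNR : N.BoundedBy α β T R) (h0 : IsDatum β M v₀)
    (hv : IsSol f g β N v₀ T v) (hT : 0 < T) :
    ∃ (D : ℝ → ℝ → Vec n) (C : ℝ), (StronglyMeasurable fun p : ℝ × ℝ => D p.1 p.2) ∧
      (∀ s, Function.Periodic (D s) (2 * Real.pi)) ∧
      (∀ s, 0 < s → s ≤ T → ∀ y, ‖D s y‖ ≤ C * (1 + s ^ (-((1 - β) / 2)))) ∧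
      ∀ s, 0 < s → s ≤ T → ∀ y ∈ Ioo 0 (2 * Real.pi),
        D s y = drift f g (fun y => v s y + N.path s y) (v s) y := by
  have h3 := hexp.third_lt
  have h4 := hexp.le
  have h5 := hexp.lt_half
  obtain ⟨m, hm⟩ := hv.bound
  have hm0 := hm.nonneg_of_pos hT
  obtain ⟨C, hC, hc⟩ := exists_coeffBound hf hg (7 * (m + R) + 1)
  have hcd := fun s hs hsT => hv.contDiff hexp hf hg hR hN hNR h0 (t := s) hs hsT
  have hsl : ∀ s (hs : 0 < s) (hsT : s ≤ T), SliceBound α (7 * (m + R) + 1)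
      (m * s ^ (-((1 - β) / 2))) (N.path s) (N.area s) (v s) := fun s hs hsT =>
    SliceBound.of_bounds hexp hN hNR hm.cBound hs hsT hR hm0 fun x y => by
      simpa using hm.lip s hs hsT x y
  set w : ℝ → ℝ → Vec n := fun s y => if s ∈ Ioc 0 T then v s y else 0 with hw
  have hws : ∀ s, 0 < s → s ≤ T → w s = v s := fun s h1 h2 => by
    funext y; simp [hw, h1, h2]
  have hwd : ∀ s, Differentiable ℝ (w s) := by
    intro s
    by_cases hs : s ∈ Ioc 0 T
    · rw [hws s hs.1 hs.2]
      exact (hcd s hs.1 hs.2).differentiable one_ne_zero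
    · have : w s = fun _ => 0 := by funext y; simp only [hw, if_neg hs]
      rw [this]
      exact differentiable_const _
  have hwm : Measurable fun p : ℝ × ℝ => w p.1 p.2 :=
    Measurable.ite (measurable_fst measurableSet_Ioc) hv.meas measurable_const
  have hderiv : Measurable fun p : ℝ × ℝ => deriv (w p.1) p.2 := by
    refine measurable_of_tendsto_metrizable (f := fun (k : ℕ) (p : ℝ × ℝ) =>
      ((1 : ℝ) / (k + 1))⁻¹ • (w p.1 (p.2 + 1 / ((k : ℝ) + 1)) - w p.1 p.2)) (fun k => ?_) ?_
    · have : Measurable fun p : ℝ × ℝ => w p.1 (p.2 + 1 / ((k : ℝ) + 1)) :=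
        hwm.comp (by fun_prop : Measurable fun p : ℝ × ℝ => (p.1, p.2 + 1 / ((k : ℝ) + 1)))
      exact (this.sub hwm).const_smul (((1 : ℝ) / (k + 1))⁻¹)
    · rw [tendsto_pi_nhds]
      intro p
      have h1 := ((hwd p.1) p.2).hasDerivAt.tendsto_slope_zero
      refine h1.comp (tendsto_nhdsWithin_iff.2 ⟨tendsto_one_div_add_atTop_nhds_zero_nat, ?_⟩)
      exact Eventually.of_forall fun k => by
        have : (0:ℝ) < 1 / ((k : ℝ) + 1) := by positivity
        exact this.ne'
  set D0 : ℝ → ℝ → Vec n := fun s y => g (w s y + N.path s y) (deriv (w s) y)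
    + (f (w s y + N.path s y) + (w s y + N.path s y)) with hD0
  have hu : Measurable fun p : ℝ × ℝ => w p.1 p.2 + N.path p.1 p.2 := hwm.add hN.meas_path
  have hD0m : Measurable fun p : ℝ × ℝ => D0 p.1 p.2 := by
    have hcont : Continuous fun q : Vec n × Vec n => g q.1 q.2 + (f q.1 + q.1) :=
      ((hg.continuous.comp continuous_fst).clm_apply continuous_snd).add
        ((hf.continuous.comp continuous_fst).add continuous_fst)
    exact hcont.measurable.comp (hu.prodMk hderiv)
  refine ⟨fun s => perExt (D0 s), C * (1 + m), ?_, fun s => perExt_periodic _, ?_, ?_⟩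
  · exact (hD0m.comp (measurable_fst.prodMk
      (measurable_toIcoMod.comp measurable_snd))).stronglyMeasurable
  · intro s hs hsT y
    have hp : 0 < s ^ (-((1 - β) / 2)) := Real.rpow_pos_of_pos hs _
    refine norm_perExt_le (fun x hx => ?_) y
    have hle := (hsl s hs hsT).u_le x hx
    simp only [hD0, hws s hs hsT]
    have e1 := hc.bound_g.2.1 _ hle
    have e2 := hc.bound_f.2.1 _ hle
    have e3 : ‖deriv (v s) x‖ ≤ m * s ^ (-((1 - β) / 2)) := by
      refine norm_deriv_le_of_lip' (by positivity) (Eventually.of_forall fun z => ?_)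
      simpa using hm.lip s hs hsT z x
    calc _ ≤ C * (m * s ^ (-((1 - β) / 2))) + C := by
          refine (norm_add_le _ _).trans (add_le_add ?_ e2)
          exact (ContinuousLinearMap.le_opNorm _ _).trans
            (mul_le_mul e1 e3 (norm_nonneg _) (by linarith))
      _ ≤ _ := by
          have : 0 ≤ C * s ^ (-((1 - β) / 2)) := by positivity
          have : 0 ≤ C * m := by positivity
          nlinarith
  · intro s hs hsT y hy
    have e1 : toIcoMod two_pi_pos' 0 y = y := by
      rw [toIcoMod_eq_self]
      exact ⟨hy.1.le, by simpa using hy.2⟩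
    simp only [perExt, drift, e1, hD0, hws s hs hsT]
    congr 2
    exact (((hcd s hs hsT).differentiable one_ne_zero) y).derivWithin
      (uniqueDiffOn_Icc two_pi_pos' y ⟨hy.1.le, hy.2.le⟩) |>.symm

end Smoothness

/-! ### Solutions of the integral equation are mild solutions -/

section SolToMild

variable {n : ℕ} {f : Vec n → Vec n} {g : Vec n → Vec n →L[ℝ] Vec n} {α β : ℝ≥0}
  {u₀ : ℝ → Vec n} {Ψ : ℝ → RoughPath n α} {T : ℝ} {u v : ℝ → ℝ → Vec n}

lemma tendsto_zero_of_eventually_le_ofReal {X : Type*} {F : X → ℝ≥0∞} {l : Filter X}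
    (h : ∀ ε : ℝ, 0 < ε → ∀ᶠ t in l, F t ≤ ENNReal.ofReal ε) : Tendsto F l (𝓝 0) := by
  refine ENNReal.tendsto_nhds_zero.2 fun ε hε => ?_
  rcases eq_top_or_lt_top ε with rfl | htop
  · exact Eventually.of_forall fun _ => le_top
  · exact (h ε.toReal (ENNReal.toReal_pos hε.ne' htop.ne)).mono fun t ht =>
      ht.trans (ENNReal.ofReal_toReal htop.ne).le

lemma Exponents.coe_pos (hexp : Exponents α β) : 0 < α := by
  have := hexp.third_lt
  exact_mod_cast (by linarith : (0:ℝ) < α)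

lemma Noise.BoundedBy.path_le {R : ℝ} (h : (noiseOf Ψ).BoundedBy α β T R) {t : ℝ}
    (ht : t ∈ Icc 0 T) : (∀ x ∈ box, ‖(Ψ t).path x‖ ≤ R) ∧ ∀ x ∈ box, ∀ y ∈ box,
      ‖(Ψ t).path x - (Ψ t).path y‖ ≤ R * |x - y| ^ (β : ℝ) := by
  refine ⟨fun x hx => ?_, fun x hx y hy => ?_⟩
  · have := h.sup t ht x hx
    rw [noiseOf_path ht.1 hx] at this
    simpa [Noise.zero] using this
  · have := h.hol t ht y hy x hx
    rw [noiseOf_path ht.1 hx, noiseOf_path ht.1 hy] at this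
    simpa [Noise.zero] using this

/-- Near a positive time, a solution stays close to its value in `C^β`. -/
lemma IsSol.eventually_isDatum (hexp : Exponents α β) (hf : ContDiff ℝ ∞ f) (hg : ContDiff ℝ ∞ g)
    (hu₀ : IsInitialDatum β u₀) (hΨ : IsDriver β Ψ)
    (hv : IsSol f g β (noiseOf Ψ) (datum u₀ Ψ) T v) {t₀ ε : ℝ} (ht : 0 < t₀) (htT : t₀ ≤ T)
    (hε : 0 < ε) : ∀ᶠ t in 𝓝 t₀, t ≤ T → IsDatum β ε (fun x => v t x - v t₀ x) := by
  obtain ⟨R, hR, hNR⟩ := hΨ.exists_boundedBy T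
  obtain ⟨M0, hM0, hd0⟩ := exists_isDatum_datum hu₀ hΨ
  have hN := noiseOf_regular hexp.coe_pos hΨ
  obtain ⟨δ, hδ, h⟩ := hv.uniform_continuity hexp hf hg hR hN hNR hd0 (t₁ := t₀ / 2) (by linarith)
    (by linarith) hε
  have hmem : Ioo (t₀ - min δ (t₀ / 2)) (t₀ + min δ (t₀ / 2)) ∈ 𝓝 t₀ := by
    have : 0 < min δ (t₀ / 2) := lt_min hδ (by linarith)
    exact Ioo_mem_nhds (by linarith) (by linarith)
  filter_upwards [hmem] with t hmt htT'
  have a1 := min_le_left δ (t₀ / 2)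
  have a2 := min_le_right δ (t₀ / 2)
  rcases le_total t t₀ with hle | hle
  · have := h t t₀ (by linarith [hmt.1]) hle htT (by linarith [hmt.1])
    refine ⟨fun x => ?_, fun x => ?_, fun x y => ?_⟩
    · have := this.periodic x
      beta_reduce at this ⊢
      rw [← neg_sub, this, neg_sub]
    · rw [norm_sub_rev]; exact this.sup x
    · have := this.hol x y
      rw [← norm_neg] at this
      refine le_trans (le_of_eq ?_) this
      congr 1; abel
  · exact h t₀ t (by linarith) hle htT' (by linarith [hmt.2])

lemma IsSol.tendsto_holderNorm_sub (hexp : Exponents α β) (hf : ContDiff ℝ ∞ f)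
    (hg : ContDiff ℝ ∞ g) (hu₀ : IsInitialDatum β u₀) (hΨ : IsDriver β Ψ)
    (hv : IsSol f g β (noiseOf Ψ) (datum u₀ Ψ) T v)
    (hu : ∀ t, 0 < t → t ≤ T → u t = fun x => v t x + (Ψ t).path x) {t₀ : ℝ} (ht₀ : t₀ ∈ Ioc 0 T) :
    Tendsto (fun t => holderNorm β (u t - u t₀)) (𝓝[Ioc 0 T] t₀) (𝓝 0) := by
  refine tendsto_zero_of_eventually_le_ofReal fun ε hε => ?_
  have h1 := hΨ.eventually_path ht₀.1.le (show 0 < ε / 4 by linarith)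
  have h2 := hv.eventually_isDatum hexp hf hg hu₀ hΨ ht₀.1 ht₀.2 (show 0 < ε / 4 by linarith)
  filter_upwards [nhdsWithin_mono _ (fun t (ht : t ∈ Ioc 0 T) => ht.1.le) h1,
    mem_nhdsWithin_of_mem_nhds h2, self_mem_nhdsWithin] with t a1 a2 ht
  obtain ⟨b1, b2⟩ := norm_le_of_holderNorm_le (by linarith) a1
  have a2 := a2 ht.2
  have e : u t - u t₀ = fun x => (v t x - v t₀ x) + ((Ψ t).path - (Ψ t₀).path) x := by
    funext x
    simp only [Pi.sub_apply, hu t ht.1 ht.2, hu t₀ ht₀.1 ht₀.2]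
    abel
  rw [e]
  refine (holderNorm_le (D := ε / 2) (D' := ε / 2) (by linarith) (fun x hx => ?_)
    fun x hx y hy => ?_).trans (le_of_eq (by ring_nf))
  · exact (norm_add_le _ _).trans (by linarith [a2.sup x, b1 x hx])
  · rw [add_sub_add_comm]
    refine (norm_add_le _ _).trans ?_
    linarith [a2.hol x y, b2 x hx y hy]

/-- Conversely, solutions of the integral equation on the line give mild solutions. The integrand of
the rough part is the Duhamel integrand minus the semigroup applied to the drift. -/
theorem IsSol.isMildSolution (hexp : Exponents α β) (hf : ContDiff ℝ ∞ f) (hg : ContDiff ℝ ∞ g)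
    (hu₀ : IsInitialDatum β u₀) (hΨ : IsDriver β Ψ) (hT : 0 < T)
    (hv : IsSol f g β (noiseOf Ψ) (datum u₀ Ψ) T v) (hu0 : u 0 = u₀)
    (hu : ∀ t, 0 < t → t ≤ T → u t = fun x => v t x + (Ψ t).path x) :
    IsMildSolution f g β u₀ Ψ T u := by
  have h3 := hexp.third_lt
  have h4 := hexp.le
  have h5 := hexp.lt_half
  obtain ⟨R, hR, hNR⟩ := hΨ.exists_boundedBy T
  obtain ⟨M0, hM0, hd0⟩ := exists_isDatum_datum hu₀ hΨ
  have hN := noiseOf_regular hexp.coe_pos hΨ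
  obtain ⟨m, hm⟩ := hv.bound
  have hm0 := hm.nonneg_of_pos hT
  have hcd := fun s hs hsT => hv.contDiff hexp hf hg hR hN hNR hd0 (t := s) hs hsT
  have hvu : ∀ t, 0 < t → t ≤ T → u t - (Ψ t).path = v t := fun t ht htT => by
    rw [hu t ht htT]; funext x; simp
  have hdat : ∀ x ∈ box, datum u₀ Ψ x = u₀ x - (Ψ 0).path x := fun x hx => perExt_eq (by
    rw [Pi.sub_apply, Pi.sub_apply, hu₀.2, hΨ.periodic 0 le_rfl]) hx
  have hint : IntervalIntegrable (fun s : ℝ => s ^ (-((1 - (β : ℝ)) / 2))) volume 0 T :=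
    intervalIntegral.intervalIntegrable_rpow' (by linarith)
  refine ⟨fun x _ => by rw [hu0], ?_, fun t₀ ht₀ => hv.tendsto_holderNorm_sub hexp hf hg hu₀ hΨ hu ht₀,
    fun t₀ ht₀ => ?_, ?_, ?_, fun t ht x hx => ?_⟩
  · refine lt_of_le_of_lt (b := max (holderNorm β u₀) (ENNReal.ofReal ((m + R) + (m + R))))
      (iSup₂_le fun t ht => ?_) (max_lt hu₀.1 ENNReal.ofReal_lt_top)
    rcases ht.1.eq_or_lt with rfl | ht0
    · rw [hu0]; exact le_max_left _ _
    · refine le_max_of_le_right ?_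
      obtain ⟨b1, b2⟩ := hNR.path_le ht
      rw [hu t ht0 ht.2]
      refine holderNorm_le (by positivity) (fun x hx => ?_) fun x hx y hy => ?_
      · exact (norm_add_le _ _).trans (add_le_add (hm.cBound.sup t ht0 ht.2 x) (b1 x hx))
      · rw [add_sub_add_comm, add_mul]
        exact (norm_add_le _ _).trans (add_le_add (hm.cBound.hol t ht0 ht.2 x y) (b2 x hx y hy))
  · refine tendsto_zero_of_eventually_le_ofReal fun ε hε => ?_
    rcases ht₀.1.eq_or_lt with rfl | ht0
    · obtain ⟨δ, hδ, hδT, h⟩ := hv.tendsto_initial hexp hf hg hR hN hNR hd0 hT hε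
      filter_upwards [mem_nhdsWithin_of_mem_nhds (Iio_mem_nhds hδ), self_mem_nhdsWithin] with t h1 h2
      refine supNorm_le fun x hx => ?_
      rcases h2.1.eq_or_lt with rfl | ht
      · simpa using hε.le
      · rw [Pi.sub_apply, hvu t ht h2.2, hu0, Pi.sub_apply, ← hdat x hx]
        exact h t ht (le_of_lt h1) x
    · filter_upwards [mem_nhdsWithin_of_mem_nhds
        (hv.eventually_isDatum hexp hf hg hu₀ hΨ ht0 ht₀.2 hε),
        mem_nhdsWithin_of_mem_nhds (Ioi_mem_nhds ht0), self_mem_nhdsWithin] with t h1 h2 h3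
      refine supNorm_le fun x hx => ?_
      rw [hvu t h2 h3.2, hvu t₀ ht0 ht₀.2]
      exact (h1 h3.2).sup x
  · rw [← restrict_Ioc_eq_restrict_Icc]
    filter_upwards [ae_restrict_mem measurableSet_Ioc] with s hs
    rw [hvu s hs.1 hs.2]
    exact (hcd s hs.1 hs.2).contDiffOn
  · have hi : IntegrableOn (fun s : ℝ => m + m * s ^ (-((1 - (β : ℝ)) / 2))) (Ioc 0 T) :=
      (intervalIntegrable_iff_integrableOn_Ioc_of_le hT.le).1
        (intervalIntegrable_const.add (hint.const_mul m))
    rw [← restrict_Ioc_eq_restrict_Icc]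
    refine lt_of_le_of_lt (setLIntegral_mono' measurableSet_Ioc fun s hs => ?_)
      hi.lintegral_lt_top
    have hp : 0 < s ^ (-((1 - (β : ℝ)) / 2)) := Real.rpow_pos_of_pos hs.1 _
    rw [hvu s hs.1 hs.2, ENNReal.ofReal_add hm0 (by positivity)]
    refine add_le_add (supNorm_le fun x _ => hm.cBound.sup s hs.1 hs.2 x)
      (supNorm_le fun x hx => ?_)
    have hu : UniqueDiffWithinAt ℝ box x := uniqueDiffOn_Icc two_pi_pos' x hx
    rw [(((hcd s hs.1 hs.2).differentiable one_ne_zero) x).derivWithin hu]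
    refine norm_deriv_le_of_lip' (by positivity) (Eventually.of_forall fun z => ?_)
    simpa using hm.lip s hs.1 hs.2 z x
  · obtain ⟨D, C, hDm, hDp, hDb, hDe⟩ := hv.exists_drift hexp hf hg hR hN hNR hd0 hT
    have hdr : ∀ s, 0 < s → s < t → semigroup (t - s) (drift f g (u s) (u s - (Ψ s).path)) x
        = heat (t - s) (D s) x := by
      intro s hs hst
      have hsT := hst.le.trans ht.2
      rw [← integral_kernel_smul (h := D s) (sub_pos.2 hst)
        (hDm.comp_measurable measurable_prodMk_left).aestronglyMeasurable (hDp s) (hDb s hs hsT)]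
      unfold semigroup
      rw [intervalIntegral.integral_of_le two_pi_pos'.le,
        intervalIntegral.integral_of_le two_pi_pos'.le, integral_Ioc_eq_integral_Ioo,
        integral_Ioc_eq_integral_Ioo]
      refine setIntegral_congr_fun measurableSet_Ioo fun y hy => ?_
      beta_reduce
      rw [hDe s hs hsT y hy, hvu s hs hsT]
      simp only [drift, hu s hs hsT, noiseOf_path hs.le (show y ∈ box from ⟨hy.1.le, hy.2.le⟩)]
    have hae : ∀ᵐ s ∂volume.restrict (uIoc 0 t), heat (t - s) (D s) x
        = semigroup (t - s) (drift f g (u s) (u s - (Ψ s).path)) x := by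
      rw [ae_restrict_iff' measurableSet_uIoc, uIoc_of_le ht.1.le]
      exact ae_Ioc_of_Ioo fun s hs hst => (hdr s hs hst).symm
    have hDi : IntervalIntegrable (fun s => semigroup (t - s)
        (drift f g (u s) (u s - (Ψ s).path)) x) volume 0 t := by
      refine IntervalIntegrable.congr_ae ?_ hae
      have hint' : IntervalIntegrable (fun s : ℝ => C * (1 + s ^ (-((1 - (β : ℝ)) / 2)))) volume 0 t :=
        (intervalIntegrable_const.add
          (intervalIntegral.intervalIntegrable_rpow' (by linarith))).const_mul C
      refine hint'.mono_fun' ?_ ?_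
      · have h1 := stronglyMeasurable_gaussMean (w := fun _ => 1) measurable_const hDm
          (σ := fun s : ℝ => Real.sqrt (2 * (t - s))) (s := fun s => s) (x := fun _ => x)
          (by fun_prop) measurable_id measurable_const
        exact ((by fun_prop : Measurable fun s : ℝ =>
          Real.exp (-(t - s))).stronglyMeasurable.smul h1).aestronglyMeasurable
      · rw [EventuallyLE, ae_restrict_iff' measurableSet_uIoc, uIoc_of_le ht.1.le]
        exact ae_Ioc_of_Ioo fun s hs hst =>
          norm_heat_le (hDb s hs (hst.le.trans ht.2)) (sub_nonneg.2 hst.le) x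
    have hvi := hv.intervalIntegrable hexp hf hg hR hN hNR ht.1 ht.2 le_rfl x
    refine ⟨fun s => duhamel (t - s) (rhs f g (noiseOf Ψ) v s) x
      - semigroup (t - s) (drift f g (u s) (u s - (Ψ s).path)) x, ?_, hvi.sub hDi, hDi, ?_⟩
    · filter_upwards [ae_restrict_mem measurableSet_Ioo] with s hs
      have hsT := hs.2.le.trans ht.2
      have hb : SliceBound α (7 * (m + R) + 1) (m * s ^ (-((1 - (β : ℝ)) / 2)))
          ((noiseOf Ψ).path s) ((noiseOf Ψ).area s) (v s) :=
        SliceBound.of_bounds hexp hN hNR hm.cBound hs.1 hsT hR hm0 fun x y => by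
          simpa using hm.lip s hs.1 hsT x y
      have hp : 0 < s ^ (-((1 - (β : ℝ)) / 2)) := Real.rpow_pos_of_pos hs.1 _
      have hvs := hvu s hs.1 hsT
      exact hasRoughIntegral_slice (X := Ψ s) (u := u s) (w := u s - (Ψ s).path) h3 (by linarith)
        (by linarith) (by positivity) hf hg hb
        (fun x hx => (noiseOf_path hs.1.le hx).symm)
        (fun x hx y hy => (noiseOf_area hs.1.le hx hy).symm)
        (fun y hy => by rw [hu s hs.1 hsT, noiseOf_path hs.1.le hy])
        (by rw [hvs]; exact (hcd s hs.1 hsT).contDiffOn) (fun y _ => by rw [hvs])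
        (sub_pos.2 hs.2) x
    · rw [semigroup_datum hexp hu₀ hΨ ht.1, intervalIntegral.integral_sub hvi hDi,
        add_assoc, add_sub_cancel, ← Pi.sub_apply, hvu t ht.1 ht.2]
      exact hv.eq t ht.1 ht.2 x

end SolToMild

/-! ### Maximal solutions -/

section Maximal

variable {n : ℕ} {f : Vec n → Vec n} {g : Vec n → Vec n →L[ℝ] Vec n} {α β : ℝ≥0}
  {u₀ : ℝ → Vec n} {Ψ : ℝ → RoughPath n α}

/-- A solution of the integral equation whose sum with the noise is bounded in `C^β` at a time `t`
close to the end of its interval of existence extends by a fixed amount. -/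
lemma exists_extension (hexp : Exponents α β) (hf : ContDiff ℝ ∞ f) (hg : ContDiff ℝ ∞ g)
    (hu₀ : IsInitialDatum β u₀) (hΨ : IsDriver β Ψ) (b : ℝ) (L : ℝ≥0) :
    ∃ h : ℝ, 0 < h ∧ ∀ (T t : ℝ) (v : ℝ → ℝ → Vec n),
      IsSol f g β (noiseOf Ψ) (datum u₀ Ψ) T v → 0 < t → t < T → T ≤ b → T ≤ t + h →
      holderNorm β (fun x => v t x + (Ψ t).path x) ≤ L →
      ∃ v', IsSol f g β (noiseOf Ψ) (datum u₀ Ψ) (t + h) v' := by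
  obtain ⟨R, hR, hNR⟩ := hΨ.exists_boundedBy (b + 1)
  obtain ⟨M0, hM0, hd0⟩ := exists_isDatum_datum hu₀ hΨ
  have hN := noiseOf_regular hexp.coe_pos hΨ
  obtain ⟨h, hh, hh1, hloc⟩ := exists_local_solution (n := n) hexp hf hg
    (show (0:ℝ) ≤ 2 * (L + R) by positivity) hR
  refine ⟨h, hh, fun T t v hv ht htT hTb hTh hL => ?_⟩
  obtain ⟨b1, b2⟩ := norm_le_of_holderNorm_le L.2 (hL.trans ENNReal.ofReal_coe_nnreal.ge)
  obtain ⟨c1, c2⟩ := hNR.path_le (t := t) ⟨ht.le, by linarith⟩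
  have hper := hv.periodic t ht htT.le
  have hd : IsDatum β (2 * (L + R)) (v t) := by
    rw [← perExt_of_periodic hper]
    refine isDatum_perExt (by rw [← hper 0, zero_add]) (fun x hx => ?_) fun x hx y hy => ?_
    · have e : v t x = (v t x + (Ψ t).path x) - (Ψ t).path x := by abel
      rw [e]
      exact (norm_sub_le _ _).trans (add_le_add (b1 x hx) (c1 x hx))
    · have e : v t x - v t y = ((v t x + (Ψ t).path x) - (v t y + (Ψ t).path y))
          - ((Ψ t).path x - (Ψ t).path y) := by abel
      rw [e, add_mul]
      exact (norm_sub_le _ _).trans (add_le_add (b2 x hx y hy) (c2 x hx y hy))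
  obtain ⟨v', hv'⟩ := hloc ((noiseOf Ψ).shift t) (v t) (hN.shift t)
    ((hNR.shift ht.le).mono_time (by linarith)) hd
  exact ⟨_, hv.glue hexp hf hg hR hN (hNR.mono_time (by linarith)) hd0 ht htT hTh hv'⟩

/-- Existence of a maximal solution. By uniqueness the solutions on all possible time intervals fit
together. If the supremum `b` of these times is finite, a `C^β` norm that stays below some `L` along
times approaching `b` contradicts the uniform extension in `exists_extension`. -/
theorem exists_isLocalSolution (hexp : Exponents α β) (hf : ContDiff ℝ ∞ f) (hg : ContDiff ℝ ∞ g)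
    (hu₀ : IsInitialDatum β u₀) (hΨ : IsDriver β Ψ) :
    ∃ (u : ℝ → ℝ → Vec n) (τ : EReal), IsLocalSolution f g β u₀ Ψ u τ := by
  classical
  obtain ⟨M0, hM0, hd0⟩ := exists_isDatum_datum hu₀ hΨ
  have hN := noiseOf_regular hexp.coe_pos hΨ
  set S : Set ℝ := {T | 0 < T ∧ ∃ v, IsSol f g β (noiseOf Ψ) (datum u₀ Ψ) T v} with hS
  have hne : S.Nonempty := by
    obtain ⟨R, hR, hNR⟩ := hΨ.exists_boundedBy 1
    obtain ⟨h, hh, hh1, hloc⟩ := exists_local_solution (n := n) hexp hf hg hM0 hR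
    exact ⟨h, hh, hloc _ _ hN (hNR.mono_time hh1) hd0⟩
  have hdown : ∀ T ∈ S, ∀ t, 0 < t → t ≤ T → t ∈ S := fun T hT t ht htT =>
    ⟨ht, hT.2.imp fun v hv => hv.mono_time htT⟩
  choose! V hV using fun T (hT : T ∈ S) => hT.2
  set u : ℝ → ℝ → Vec n := fun t => if t = 0 then u₀ else fun x => V t t x + (Ψ t).path x with hu
  have hu0 : u 0 = u₀ := if_pos rfl
  have huV : ∀ T ∈ S, ∀ t, 0 < t → t ≤ T → u t = fun x => V T t x + (Ψ t).path x := by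
    intro T hT t ht htT
    obtain ⟨R, hR, hNR⟩ := hΨ.exists_boundedBy t
    simp only [hu, if_neg ht.ne']
    funext x
    rw [(hV t (hdown T hT t ht htT)).unique hexp hf hg hR hN hNR hd0 ((hV T hT).mono_time htT) ht
      le_rfl x]
  have hmild : ∀ T ∈ S, IsMildSolution f g β u₀ Ψ T u := fun T hT =>
    (hV T hT).isMildSolution hexp hf hg hu₀ hΨ hT.1 hu0 (huV T hT)
  set τ : EReal := sSup ((fun T : ℝ => (T : EReal)) '' S) with hτ
  have hle : ∀ T ∈ S, (T : EReal) ≤ τ := fun T hT => le_sSup (mem_image_of_mem _ hT)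
  have hlt : ∀ t : ℝ, (t : EReal) < τ → ∃ T ∈ S, t < T := by
    intro t ht
    obtain ⟨_, ⟨T, hT, rfl⟩, h⟩ := lt_sSup_iff.1 ht
    exact ⟨T, hT, EReal.coe_lt_coe_iff.1 h⟩
  refine ⟨u, τ, ?_, fun T hT0 hT => ?_, fun b hb => ?_⟩
  · obtain ⟨T, hT⟩ := hne
    exact (EReal.coe_pos.2 hT.1).trans_le (hle T hT)
  · obtain ⟨T', hT', h⟩ := hlt T hT
    exact (hmild T' hT').mono_time h.le
  · rw [ENNReal.tendsto_nhds_top_iff_nnreal]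
    intro L
    by_contra hcon
    obtain ⟨h, hh, hext⟩ := exists_extension hexp hf hg hu₀ hΨ b L
    have hb0 : 0 < b := by
      obtain ⟨T, hT⟩ := hne
      have := hle T hT
      rw [hb, EReal.coe_le_coe_iff] at this
      exact hT.1.trans_le this
    have hnear : ∀ᶠ t in 𝓝[<] b, max 0 (b - h) < t :=
      mem_nhdsWithin_of_mem_nhds (Ioi_mem_nhds (max_lt hb0 (by linarith)))
    have hlb : ∀ᶠ t in 𝓝[<] b, t < b := self_mem_nhdsWithin
    obtain ⟨t, hL, htb, hth⟩ := ((not_eventually.1 hcon).and_eventually (hlb.and hnear)).exists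
    have ht0 : 0 < t := (le_max_left _ _).trans_lt hth
    obtain ⟨T, hT, htT⟩ := hlt t (by rw [hb]; exact EReal.coe_lt_coe_iff.2 htb)
    have hTb : T ≤ b := by
      have := hle T hT
      rwa [hb, EReal.coe_le_coe_iff] at this
    have hbt : b < t + h := by linarith [(le_max_right 0 (b - h)).trans_lt hth]
    obtain ⟨v', hv'⟩ := hext T t (V T) (hV T hT) ht0 htT hTb (by linarith) (by
      rw [← huV T hT t ht0 htT.le]; exact not_lt.1 hL)
    have := hle (t + h) ⟨by linarith, v', hv'⟩
    rw [hb, EReal.coe_le_coe_iff] at this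
    linarith

end Maximal

/-! ### Stability without a bound on the second solution -/

section Stability

variable {n : ℕ} {f : Vec n → Vec n} {g : Vec n → Vec n →L[ℝ] Vec n} {α β T R M : ℝ}

/-- Local Lipschitz dependence on the data, where only one of the two solutions is assumed to be
bounded a priori: as long as the second one stays close to the first one, it does so by a margin. -/
theorem exists_stability_of_bound (hexp : Exponents α β) (hf : ContDiff ℝ ∞ f)
    (hg : ContDiff ℝ ∞ g) (hM : 0 ≤ M) (hR : 0 ≤ R) (hT : 0 ≤ T) :
    ∃ C, 0 < C ∧ ∀ T', 0 < T' → T' ≤ T →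
      ∀ (N N' : Noise n) (v₀ v₀' : ℝ → Vec n) (v v' : ℝ → ℝ → Vec n) (D : ℝ),
      N.Regular → N'.Regular → N.BoundedBy α β T' R → N'.BoundedBy α β T' R →
      IsDatum β M v₀ → IsDatum β M v₀' → IsSol f g β N v₀ T' v → IsSol f g β N' v₀' T' v' →
      CBound β T' M v → 0 ≤ D → N.DiffBound α β T' D N' →
      IsDatum β D (fun x => v₀ x - v₀' x) → C * D ≤ 1 →
      WBound β T' 0 (C * D) (fun t x => v t x - v' t x) := by
  have h3 := hexp.third_lt
  have h4 := hexp.le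
  have h5 := hexp.lt_half
  have hG := gaussConst_pos
  obtain ⟨C, hC, hst⟩ := exists_stability (n := n) hexp hf hg (show 0 ≤ M + 1 by linarith) hR hT
  refine ⟨2 * (C + gaussConst), by positivity, ?_⟩
  intro T' hT' hT'T N N' v₀ v₀' v v' D hN hN' hNR hNR' h0 h0' hs hs' hv hD hND hd hCD
  have hCD1 : C * D ≤ 1 / 2 := by nlinarith
  have hGD1 : gaussConst * D ≤ 1 / 2 := by nlinarith
  have hup : ∀ {w : ℝ → Vec n}, IsDatum β M w → IsDatum β (M + 1) w := fun h =>
    ⟨h.periodic, fun x => (h.sup x).trans (by linarith),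
      fun x y => (h.hol x y).trans (mul_le_mul_of_nonneg_right (by linarith) (by positivity))⟩
  have hvM : CBound β T' (M + 1) v := ⟨fun t h1 h2 x => (hv.sup t h1 h2 x).trans (by linarith),
    fun t h1 h2 x y => (hv.hol t h1 h2 x y).trans
      (mul_le_mul_of_nonneg_right (by linarith) (by positivity))⟩
  -- `P t`: the solutions differ by at most `1` in `C^β` up to time `t`; then stability applies and
  -- improves `1` to `1 / 2`
  set P : ℝ → Prop := fun t => ∀ r, 0 < r → r ≤ t → (∀ x, ‖v r x - v' r x‖ ≤ 1) ∧
    ∀ x y, ‖(v r x - v' r x) - (v r y - v' r y)‖ ≤ 1 * |x - y| ^ β with hP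
  have himp : ∀ t, t ≤ T' → P t → WBound β t 0 (C * D) (fun t x => v t x - v' t x) := by
    intro t htT hPt
    refine hst t (htT.trans hT'T) N N' v₀ v₀' v v' D hN hN' (hNR.mono_time htT)
      (hNR'.mono_time htT) (hup h0) (hup h0') (hs.mono_time htT) (hs'.mono_time htT)
      (hvM.mono_time htT) ⟨fun r h1 h2 x => ?_, fun r h1 h2 x y => ?_⟩ hD (hND.mono_time htT) hd
    · have e : v' r x = v r x - (v r x - v' r x) := by abel
      rw [e]
      exact (norm_sub_le _ _).trans
        (add_le_add (hv.sup r h1 (h2.trans htT) x) ((hPt r h1 h2).1 x))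
    · have e : v' r x - v' r y = (v r x - v r y) - ((v r x - v' r x) - (v r y - v' r y)) := by abel
      rw [e, add_mul]
      exact (norm_sub_le _ _).trans
        (add_le_add (hv.hol r h1 (h2.trans htT) x y) ((hPt r h1 h2).2 x y))
  -- for short times the Duhamel terms are small
  have hstart : ∃ t₁, 0 < t₁ ∧ t₁ ≤ T' ∧ P t₁ := by
    obtain ⟨m, hm⟩ := hs.bound
    obtain ⟨m', hm'⟩ := hs'.bound
    have hm0 := hm.nonneg_of_pos hT'
    obtain ⟨B, hB, hsm⟩ := exists_small_time (n := n) hexp hf hg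
      (hm0.trans (le_max_left m m')) hR hT'.le
    have hcont : Continuous fun t : ℝ => B * t ^ (α / 4) :=
      continuous_const.mul (Continuous.rpow_const continuous_id fun _ => Or.inr (by linarith))
    obtain ⟨t₁, ht₁, ht₁T, hsmall⟩ := exists_pos_of_continuous hcont
      (by simp [Real.zero_rpow (show α / 4 ≠ 0 by linarith)]) (show (0:ℝ) < 1 / 4 by norm_num) hT'
    have e := hsmall t₁ ht₁.le le_rfl
    have w1 := hsm t₁ ht₁ ht₁T N v hN (hNR.mono_time ht₁T) hs.meas
      ((hm.mono (le_max_left _ _)).mono_time ht₁T)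
    have w2 := hsm t₁ ht₁ ht₁T N' v' hN' (hNR'.mono_time ht₁T) hs'.meas
      ((hm'.mono (le_max_right _ _)).mono_time ht₁T)
    have w3 := hd.wBound_heat (T := t₁) hexp
    have w1 := w1.cBound
    have w2 := w2.cBound
    have w3 := w3.cBound
    have heq : ∀ r, 0 < r → r ≤ t₁ → ∀ x, v r x - v' r x = heat r (fun x => v₀ x - v₀' x) x
        + (volterra (rhs f g N v) r x - volterra (rhs f g N' v') r x) := by
      intro r h1 h2 x
      rw [hs.eq r h1 (h2.trans ht₁T), hs'.eq r h1 (h2.trans ht₁T),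
        heat_sub_apply (h0.continuous hexp) h0.sup (h0'.continuous hexp) h0'.sup]
      abel
    refine ⟨t₁, ht₁, ht₁T, fun r h1 h2 => ⟨fun x => ?_, fun x y => ?_⟩⟩
    · rw [heq r h1 h2]
      have := norm_sub_le (volterra (rhs f g N v) r x) (volterra (rhs f g N' v') r x)
      refine (norm_add_le _ _).trans ?_
      linarith [w1.sup r h1 h2 x, w2.sup r h1 h2 x, w3.sup r h1 h2 x]
    · rw [heq r h1 h2, heq r h1 h2, add_sub_add_comm, sub_sub_sub_comm]
      refine (norm_add_le _ _).trans ((add_le_add (w3.hol r h1 h2 x y) ((norm_sub_le _ _).trans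
        (add_le_add (w1.hol r h1 h2 x y) (w2.hol r h1 h2 x y)))).trans ?_)
      rw [← add_mul, ← add_mul]
      exact mul_le_mul_of_nonneg_right (by linarith) (by positivity)
  obtain ⟨t₁, ht₁, ht₁T, hP1⟩ := hstart
  -- the bound extends by a fixed amount of time
  have hstep : ∃ η, 0 < η ∧ ∀ t, t₁ ≤ t → t ≤ T' → P t → P (min (t + η) T') := by
    obtain ⟨η, hη, hc⟩ := hs.uniform_continuity hexp hf hg hR hN hNR h0 ht₁ ht₁T
      (show (0:ℝ) < 1 / 4 by norm_num)
    obtain ⟨η', hη', hc'⟩ := hs'.uniform_continuity hexp hf hg hR hN' hNR' h0' ht₁ ht₁T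
      (show (0:ℝ) < 1 / 4 by norm_num)
    refine ⟨min η η', lt_min hη hη', fun t ht htT hPt r h1 h2 => ?_⟩
    rcases le_or_gt r t with hrt | hrt
    · exact hPt r h1 hrt
    have h2' := le_min_iff.1 h2
    have a1 := min_le_left η η'
    have a2 := min_le_right η η'
    have w := (himp t htT hPt).cBound
    have b1 := hc t r ht hrt.le h2'.2 (by linarith)
    have b2 := hc' t r ht hrt.le h2'.2 (by linarith)
    have e : ∀ x, v r x - v' r x = (v t x - v' t x) + ((v r x - v t x) - (v' r x - v' t x)) := by
      intro x; abel
    have ht0 := ht₁.trans_le ht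
    refine ⟨fun x => ?_, fun x y => ?_⟩
    · rw [e]
      have := norm_sub_le (v r x - v t x) (v' r x - v' t x)
      refine (norm_add_le _ _).trans ?_
      linarith [w.sup t ht0 le_rfl x, b1.sup x, b2.sup x]
    · rw [e x, e y, add_sub_add_comm, sub_sub_sub_comm (v r x - v t x)]
      refine (norm_add_le _ _).trans ((add_le_add (w.hol t ht0 le_rfl x y) ((norm_sub_le _ _).trans
        (add_le_add (b1.hol x y) (b2.hol x y)))).trans ?_)
      rw [← add_mul, ← add_mul]
      exact mul_le_mul_of_nonneg_right (by linarith) (by positivity)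
  obtain ⟨η, hη, hstep⟩ := hstep
  have hind : ∀ k : ℕ, P (min (t₁ + k * η) T') := by
    intro k
    induction k with
    | zero => simpa [min_eq_left ht₁T] using hP1
    | succ k ih =>
      have hmono : min (t₁ + (k + 1 : ℕ) * η) T' ≤ min (min (t₁ + k * η) T' + η) T' := by
        refine le_min ?_ (min_le_right _ _)
        rcases le_total (t₁ + k * η) T' with h | h
        · rw [min_eq_left h]
          exact (min_le_left _ _).trans (le_of_eq (by push_cast; ring))
        · rw [min_eq_right h]
          exact (min_le_right _ _).trans (by linarith)
      have := hstep _ (le_min (by nlinarith [show (0:ℝ) ≤ k from k.cast_nonneg]) ht₁T)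
        (min_le_right _ _) ih
      exact fun r h1 h2 => this r h1 (h2.trans hmono)
  have hfin : P T' := by
    obtain ⟨k, hk⟩ := exists_nat_ge (T' / η)
    have h1 := hind k
    rwa [min_eq_right] at h1
    rw [div_le_iff₀ hη] at hk
    linarith
  refine (himp T' le_rfl hfin).mono ?_
  nlinarith

end Stability

/-! ### Continuous dependence on the data -/

section Dependence

variable {n : ℕ} {f : Vec n → Vec n} {g : Vec n → Vec n →L[ℝ] Vec n} {α β : ℝ≥0}
  {u₀ u₀' : ℝ → Vec n} {Ψ Ψ' : ℝ → RoughPath n α} {T : ℝ} {u u' : ℝ → ℝ → Vec n}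

/-- Close data give close initial data for the remainders. -/
lemma isDatum_datum_sub (hu₀ : IsInitialDatum β u₀) (hu₀' : IsInitialDatum β u₀')
    (hΨ : IsDriver β Ψ) (hΨ' : IsDriver β Ψ') {δ : ℝ} (hδ : 0 ≤ δ)
    (h0 : holderNorm β (u₀ - u₀') ≤ ENNReal.ofReal δ)
    (hψ : holderNorm β ((Ψ 0).path - (Ψ' 0).path) ≤ ENNReal.ofReal δ) :
    IsDatum β (4 * δ) (fun x => datum u₀ Ψ x - datum u₀' Ψ' x) := by
  obtain ⟨b1, b2⟩ := norm_le_of_holderNorm_le hδ h0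
  obtain ⟨c1, c2⟩ := norm_le_of_holderNorm_le hδ hψ
  have e : ∀ x, u₀ x - (Ψ 0).path x - (u₀' x - (Ψ' 0).path x)
      = (u₀ - u₀') x - ((Ψ 0).path - (Ψ' 0).path) x := fun x => by
    simp only [Pi.sub_apply]; abel
  have := isDatum_perExt (β := β) (M := δ + δ)
    (h := fun x => u₀ x - (Ψ 0).path x - (u₀' x - (Ψ' 0).path x))
    (by rw [hu₀.2, hu₀'.2, hΨ.periodic 0 le_rfl, hΨ'.periodic 0 le_rfl])
    (fun x hx => by rw [e]; exact (norm_sub_le _ _).trans (add_le_add (b1 x hx) (c1 x hx)))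
    (fun x hx y hy => by
      rw [e, e, sub_sub_sub_comm, add_mul]
      exact (norm_sub_le _ _).trans (add_le_add (b2 x hx y hy) (c2 x hx y hy)))
  rw [show 4 * δ = 2 * (δ + δ) by ring]
  exact this

/-- Continuous dependence on the data for mild solutions on a common time interval `[0, T']`, with
constants that only involve the first solution. -/
theorem IsMildSolution.exists_dependence (hexp : Exponents α β) (hf : ContDiff ℝ ∞ f)
    (hg : ContDiff ℝ ∞ g) (hu₀ : IsInitialDatum β u₀) (hΨ : IsDriver β Ψ) (hT : 0 < T)
    (hu : IsMildSolution f g β u₀ Ψ T u) : ∃ C, 0 < C ∧ ∀ (δ : ℝ) (u₀' : ℝ → Vec n)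
      (Ψ' : ℝ → RoughPath n α), 0 ≤ δ → C * δ ≤ 1 → IsInitialDatum β u₀' → IsDriver β Ψ' →
      dataDistance β T u₀ u₀' Ψ Ψ' ≤ ENNReal.ofReal δ → ∀ T', 0 < T' → T' ≤ T →
      ∀ u', IsMildSolution f g β u₀' Ψ' T' u' → ∀ t ∈ Icc 0 T',
        holderNorm β (u t - u' t) ≤ ENNReal.ofReal (C * δ) := by
  obtain ⟨R, hR, hNR⟩ := hΨ.exists_boundedBy T
  obtain ⟨M, hM, hd⟩ := exists_remainder_bound hu₀ hΨ hT.le hu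
  obtain ⟨M0, hM0, hd0⟩ := exists_isDatum_datum hu₀ hΨ
  have hN := noiseOf_regular hexp.coe_pos hΨ
  have hv := hu.isSol hexp hf hg hu₀ hΨ hT
  obtain ⟨C, hC, hst⟩ := exists_stability_of_bound (n := n) hexp hf hg
    (show 0 ≤ M + M0 + 4 by linarith) (show 0 ≤ R + 1 by linarith) hT.le
  -- the distance of the data becomes `4 δ` on the line
  refine ⟨8 * C + 2, by linarith, ?_⟩
  intro δ u₀' Ψ' hδ hδC hu₀' hΨ' hdist T' hT' hT'T u' hu' t ht
  have hCδ : 0 ≤ C * δ := by positivity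
  have hδ1 : δ ≤ 1 / 2 := by linarith
  have d1 : holderNorm β (u₀ - u₀') ≤ ENNReal.ofReal δ :=
    (le_self_add.trans le_self_add).trans hdist
  have d2 : ∀ s ∈ Icc 0 T, holderNorm β ((Ψ s).path - (Ψ' s).path) ≤ ENNReal.ofReal δ :=
    iSup₂_le_iff.1 ((le_add_self.trans le_self_add).trans hdist)
  have d3 : ∀ s ∈ Icc 0 T, twoParamNorm (2 * α) ((Ψ s).area - (Ψ' s).area) ≤ ENNReal.ofReal δ :=
    iSup₂_le_iff.1 (le_add_self.trans hdist)
  rcases ht.1.eq_or_lt with rfl | ht0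
  · obtain ⟨b1, b2⟩ := norm_le_of_holderNorm_le hδ d1
    refine (holderNorm_le hδ (D' := δ) (fun x hx => ?_) fun x hx y hy => ?_).trans
      (ENNReal.ofReal_le_ofReal (by nlinarith))
    · rw [Pi.sub_apply, hu.initial x hx, hu'.initial x hx]
      exact b1 x hx
    · rw [Pi.sub_apply, Pi.sub_apply, hu.initial x hx, hu'.initial x hx, hu.initial y hy,
        hu'.initial y hy]
      exact b2 x hx y hy
  have hv' := hu'.isSol hexp hf hg hu₀' hΨ' hT'
  have hN' := noiseOf_regular hexp.coe_pos hΨ'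
  have hND := noiseOf_diffBound hδ d2 d3
  have hNR' : (noiseOf Ψ').BoundedBy α β T (R + 1) :=
    (hND.symm.trans hNR).mono (by linarith)
  have hdd := isDatum_datum_sub hu₀ hu₀' hΨ hΨ' hδ d1 (d2 0 ⟨le_rfl, hT.le⟩)
  have hp : ∀ x y : ℝ, 0 ≤ |x - y| ^ (β : ℝ) := fun x y => by positivity
  have hd0' : IsDatum β (M + M0 + 4) (datum u₀' Ψ') := by
    refine ⟨perExt_periodic _, fun x => ?_, fun x y => ?_⟩
    · have e : datum u₀' Ψ' x = datum u₀ Ψ x - (datum u₀ Ψ x - datum u₀' Ψ' x) := by abel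
      rw [e]
      refine (norm_sub_le _ _).trans ?_
      linarith [hd0.sup x, hdd.sup x]
    · have e : datum u₀' Ψ' x - datum u₀' Ψ' y = (datum u₀ Ψ x - datum u₀ Ψ y)
          - ((datum u₀ Ψ x - datum u₀' Ψ' x) - (datum u₀ Ψ y - datum u₀' Ψ' y)) := by abel
      rw [e]
      refine (norm_sub_le _ _).trans ((add_le_add (hd0.hol x y) (hdd.hol x y)).trans ?_)
      rw [← add_mul]
      exact mul_le_mul_of_nonneg_right (by linarith) (hp x y)
  have hd0M : IsDatum β (M + M0 + 4) (datum u₀ Ψ) :=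
    ⟨hd0.periodic, fun x => (hd0.sup x).trans (by linarith),
      fun x y => (hd0.hol x y).trans (mul_le_mul_of_nonneg_right (by linarith) (hp x y))⟩
  have hw := (hst T' hT' hT'T (noiseOf Ψ) (noiseOf Ψ') (datum u₀ Ψ) (datum u₀' Ψ')
    (remainder Ψ T u) (remainder Ψ' T' u') (4 * δ) hN hN'
    ((hNR.mono (by linarith)).mono_time hT'T) (hNR'.mono_time hT'T) hd0M hd0'
    (hv.mono_time hT'T) hv'
    ⟨fun s _ _ x => ((hd s).sup x).trans (by linarith), fun s _ _ x y => ((hd s).hol x y).trans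
      (mul_le_mul_of_nonneg_right (by linarith) (hp x y))⟩ (by linarith)
    ((hND.mono (by linarith)).mono_time hT'T) hdd (by linarith)).cBound
  obtain ⟨c1, c2⟩ := norm_le_of_holderNorm_le hδ (d2 t ⟨ht.1, ht.2.trans hT'T⟩)
  have e : ∀ x ∈ box, (u t - u' t) x = (remainder Ψ T u t x - remainder Ψ' T' u' t x)
      + ((Ψ t).path - (Ψ' t).path) x := fun x hx => by
    rw [remainder_eq hu₀ hΨ hu ⟨ht.1, ht.2.trans hT'T⟩ hx, remainder_eq hu₀' hΨ' hu' ht hx]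
    simp only [Pi.sub_apply]
    abel
  refine (holderNorm_le (D := C * (4 * δ) + δ) (D' := C * (4 * δ) + δ) (by positivity)
    (fun x hx => ?_) fun x hx y hy => ?_).trans (ENNReal.ofReal_le_ofReal (by nlinarith))
  · rw [e x hx]
    exact (norm_add_le _ _).trans (add_le_add (hw.sup t ht0 ht.2 x) (c1 x hx))
  · rw [e x hx, e y hy, add_sub_add_comm, add_mul]
    exact (norm_add_le _ _).trans (add_le_add (hw.hol t ht0 ht.2 x y) (c2 x hx y hy))

lemma holderNorm_le_of_sub {w w' : ℝ → Vec n} {K L : ℝ} (hK : 0 ≤ K) (hL : 0 ≤ L)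
    (h : holderNorm β w ≤ ENNReal.ofReal L) (h' : holderNorm β (w - w') ≤ ENNReal.ofReal K) :
    holderNorm β w' ≤ ENNReal.ofReal ((L + K) + (L + K)) := by
  obtain ⟨b1, b2⟩ := norm_le_of_holderNorm_le hL h
  obtain ⟨c1, c2⟩ := norm_le_of_holderNorm_le hK h'
  have e : ∀ x, w' x = w x - (w - w') x := fun x => by rw [Pi.sub_apply]; abel
  refine holderNorm_le (by positivity) (fun x hx => ?_) fun x hx y hy => ?_
  · rw [e]
    exact (norm_sub_le _ _).trans (add_le_add (b1 x hx) (c1 x hx))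
  · rw [e x, e y, sub_sub_sub_comm, add_mul]
    exact (norm_sub_le _ _).trans (add_le_add (b2 x hx y hy) (c2 x hx y hy))

/-- A local solution that stays close to a given bounded function before time `T` does not blow up
before or at time `T`. -/
theorem IsLocalSolution.lt_of_holderNorm_sub_le {τ' : EReal} {K : ℝ} (hK : 0 ≤ K)
    (hu' : IsLocalSolution f g β u₀' Ψ' u' τ') (hu : (⨆ t ∈ Icc 0 T, holderNorm β (u t)) < ⊤)
    (h : ∀ t, 0 < t → t ≤ T → (t : EReal) < τ' → holderNorm β (u t - u' t) ≤ ENNReal.ofReal K) :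
    (T : EReal) < τ' := by
  by_contra hcon
  have hle := not_lt.1 hcon
  have htop : τ' ≠ ⊤ := fun e => by rw [e] at hle; exact (EReal.coe_lt_top T).not_ge hle
  have hbot : τ' ≠ ⊥ := fun e => by have := hu'.pos; rw [e] at this; exact not_lt_bot this
  lift τ' to ℝ using ⟨htop, hbot⟩ with b
  have hb : 0 < b := EReal.coe_pos.1 hu'.pos
  have hbT : b ≤ T := EReal.coe_le_coe_iff.1 hle
  set L := (⨆ t ∈ Icc 0 T, holderNorm β (u t)).toReal with hL
  have h1 := (hu'.blowup b rfl).eventually_const_lt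
    (ENNReal.ofReal_lt_top (r := (L + K) + (L + K)))
  have h2 : ∀ᶠ t in 𝓝[<] b, 0 < t := mem_nhdsWithin_of_mem_nhds (Ioi_mem_nhds hb)
  have h3 : ∀ᶠ t in 𝓝[<] b, t < b := self_mem_nhdsWithin
  obtain ⟨t, a1, a2, a3⟩ := (h1.and (h2.and h3)).exists
  refine a1.not_ge (holderNorm_le_of_sub hK ENNReal.toReal_nonneg (w := u t) ?_
    (h t a2 (a3.le.trans hbT) (EReal.coe_lt_coe_iff.2 a3)))
  rw [hL, ENNReal.ofReal_toReal hu.ne]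
  exact le_iSup₂_of_le (f := fun t (_ : t ∈ Icc 0 T) => holderNorm β (u t)) t
    ⟨a2.le, a3.le.trans hbT⟩ le_rfl

end Dependence

end RoughBurgers

theorem corollary3p8 (n : ℕ) (f : RoughBurgers.Vec n → RoughBurgers.Vec n)
    (g : RoughBurgers.Vec n → RoughBurgers.Vec n →L[ℝ] RoughBurgers.Vec n)
    (hf : ContDiff ℝ ∞ f) (hg : ContDiff ℝ ∞ g)
    (α β : ℝ≥0) (hα : 1 / 3 < α) (hαβ : α < β) (hβ : β < 1 / 2)
    (u₀ : ℝ → RoughBurgers.Vec n) (hu₀ : RoughBurgers.IsInitialDatum β u₀)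
    (Ψ : ℝ → RoughBurgers.RoughPath n α) (hΨ : RoughBurgers.IsDriver β Ψ) :
    (∃ (u : ℝ → ℝ → RoughBurgers.Vec n) (τ : EReal),
      RoughBurgers.IsLocalSolution f g β u₀ Ψ u τ) ∧
    ∀ (u : ℝ → ℝ → RoughBurgers.Vec n) (τ : EReal),
      RoughBurgers.IsLocalSolution f g β u₀ Ψ u τ →
      ∀ T : ℝ, 0 ≤ T → (T : EReal) < τ → ∀ ε : ℝ, 0 < ε → ∃ δ : ℝ, 0 < δ ∧
        ∀ (u₀' : ℝ → RoughBurgers.Vec n) (Ψ' : ℝ → RoughBurgers.RoughPath n α),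
          RoughBurgers.IsInitialDatum β u₀' → RoughBurgers.IsDriver β Ψ' →
          RoughBurgers.dataDistance β T u₀ u₀' Ψ Ψ' ≤ ENNReal.ofReal δ →
          ∀ (u' : ℝ → ℝ → RoughBurgers.Vec n) (τ' : EReal),
            RoughBurgers.IsLocalSolution f g β u₀' Ψ' u' τ' →
            (T : EReal) < τ' ∧
            (⨆ t ∈ Icc 0 T, RoughBurgers.holderNorm β (u t - u' t)) ≤ ENNReal.ofReal ε := by
  have hexp : RoughBurgers.Exponents α β := by
    refine ⟨?_, ?_, ?_⟩
    · exact_mod_cast NNReal.coe_lt_coe.2 hα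
    · exact_mod_cast hαβ.le
    · exact_mod_cast NNReal.coe_lt_coe.2 hβ
  refine ⟨RoughBurgers.exists_isLocalSolution hexp hf hg hu₀ hΨ, ?_⟩
  intro u τ hu T hT hTτ ε hε
  have hmild := hu.solution T hT hTτ
  rcases hT.eq_or_lt with rfl | hT0
  · -- at time zero only the initial data matter
    refine ⟨ε / 2, by positivity, fun u₀' Ψ' _ _ hdist u' τ' hu' => ⟨hu'.pos, ?_⟩⟩
    have hmild' := hu'.solution 0 le_rfl hu'.pos
    obtain ⟨b1, b2⟩ := RoughBurgers.norm_le_of_holderNorm_le (by positivity)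
      ((le_self_add.trans le_self_add).trans hdist)
    refine iSup₂_le fun t ht => ?_
    obtain rfl : t = 0 := le_antisymm ht.2 ht.1
    refine (RoughBurgers.holderNorm_le (D := ε / 2) (D' := ε / 2) (by positivity)
      (fun x hx => ?_) fun x hx y hy => ?_).trans (le_of_eq (by rw [add_halves]))
    · rw [Pi.sub_apply, hmild.initial x hx, hmild'.initial x hx]
      exact b1 x hx
    · rw [Pi.sub_apply, Pi.sub_apply, hmild.initial x hx, hmild'.initial x hx,
        hmild.initial y hy, hmild'.initial y hy]
      exact b2 x hx y hy
  -- the bound holds as long as both solutions exist, so that the second one cannot blow up before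
  -- or at `T`
  obtain ⟨C, hC, hdep⟩ := hmild.exists_dependence hexp hf hg hu₀ hΨ hT0
  refine ⟨min 1 ε / C, by positivity, fun u₀' Ψ' hu₀' hΨ' hdist u' τ' hu' => ?_⟩
  have hCδ : C * (min 1 ε / C) = min 1 ε := mul_div_cancel₀ _ hC.ne'
  have hclose : ∀ T', 0 < T' → T' ≤ T → (T' : EReal) < τ' → ∀ t ∈ Icc 0 T',
      RoughBurgers.holderNorm β (u t - u' t) ≤ ENNReal.ofReal (min 1 ε) := by
    intro T' h1 h2 h3 t ht
    rw [← hCδ]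
    exact hdep _ u₀' Ψ' (by positivity) (hCδ.trans_le (min_le_left _ _)) hu₀' hΨ' hdist T' h1 h2
      u' (hu'.solution T' h1.le h3) t ht
  have hT' : (T : EReal) < τ' := hu'.lt_of_holderNorm_sub_le (by positivity) hmild.holder_bounded
    fun t h1 h2 h3 => hclose t h1 h2 h3 t ⟨h1.le, le_rfl⟩
  exact ⟨hT', iSup₂_le fun t ht => (hclose T hT0 le_rfl hT' t ht).trans
    (ENNReal.ofReal_le_ofReal (min_le_right _ _))⟩
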